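/- **Setting.** Let $L_x,L_y,T>0$, $\Omega=(0,L_x)\times(0,L_y)$, let $\beta,\epsilon,M,\lambda>0$ with $\epsilon<\beta^2$, and $S\ge 0$. Put $F(z)=\frac14z^4-\frac{\epsilon+\lambda}{2}z^2$ and $E_1(v)=\int_\Omega F(v)\,dx+C_0$, where $C_0\ge0$ is such that $E_1(v)>0$ for all real $v\in L^4(\Omega)$. $(\cdot,\cdot)$ and $\|\cdot\|$ are the inner product and norm of $L^2(\Omega)$; $H^s_{per}$ ($s\in\mathbb R$) is the periodic Sobolev space with norm $\|u\|_{H^s}^2=|\Omega|\sum_{k,l}(1+\xi_k^2+\eta_l^2)^s|\hat u_{k,l}|^2$, with $\xi_k=2\pi k/L_x$, $\eta_l=2\pi l/L_y$ and $\hat u_{k,l}$ the Fourier coefficients of $u$; $\|(-\Delta)^{-1/2}u\|^2=|\Omega|\sum_{(k,l)\ne(0,0)}(\xi_k^2+\eta_l^2)^{-1}|\hat u_{k,l}|^2$. **Exact solution.** Let $\phi$ be a real $\Omega$-periodic solution on $[0,T]$ of the phase field crystal equation $$\partial_t\phi=M\Delta\mu,\qquad \mu=(\Delta+\beta)^2\phi+\phi^3-\epsilon\phi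 ,$$ as an identity of periodic distributions for $0<t<T$, with $\phi(t)\in L^2(\Omega)$ for $t\in[0,T]$ and continuous Fourier coefficients on $[0,T]$, and let $\phi_0=\phi(0)$, $r(t)=\sqrt{E_1(\phi(t))}$. **Scheme.** For an integer $N\ge1$ let $S_N$ be the space of the real-valued functions in $\mathrm{span}_{\mathbb C}\{e^{i\xi_kx}e^{i\eta_ly}: -\frac N2\le k,l\le \frac N2-1\}$ and $\Pi_N$ the $L^2$-orthogonal projection onto $S_N$. For an integer $N_T\ge1$ let $\Delta t=T/N_T$ and $t^n=n\Delta t$. Let $\phi_N^0=\Pi_N\phi_0$, $R^0=r(0)$. For $0\le n<N_T$ the functions $\phi_N^{n+1},\mu_N^{n+1/2}\in S_N$ and the number $R^{n+1}$ satisfy, for all $q,\Psi\in S_N$, $$(\phi_N^{n+1}-\phi_N^n,q)+M\Delta t(\nabla\mu_N^{n+1/2},\nabla q)=0,$$ $$(\mu_N^{n+1/2},\Psi)=((\Delta+\beta)\phi_N^{n+1/2},(\Delta+\beta)\Psi)+\lambda(\phi_N^{n+1/2},\Psi)+S(\nabla(\phi_N^{n+1}-2\phi_N^n+\phi_N^{n-1}),\nabla\Psi)+\frac{R^{n+1/2}}{\sqrt{E_1(\tilde\phi_N^{n+1/2})}}(F'(\tilde\phi_N^{n+1/2}),\Psi),$$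 $$R^{n+1}-R^n=\frac{1}{2\sqrt{E_1(\tilde\phi_N^{n+1/2})}}(F'(\tilde\phi_N^{n+1/2}),\phi_N^{n+1}-\phi_N^n),$$ where $\phi_N^{n+1/2}=\frac12(\phi_N^n+\phi_N^{n+1})$, $R^{n+1/2}=\frac12(R^n+R^{n+1})$ and $\tilde\phi_N^{n+1/2}=\frac12(3\phi_N^n-\phi_N^{n-1})$. For $n=0$, $\tilde\phi_N^{1/2}$ is obtained from $(\phi_N^0,R^0)$ by one step of length $\Delta t/2$ of the first-order scheme, that is, for some $\tilde\mu\in S_N$, $\tilde R\in\mathbb R$, the function $\tilde\phi=\tilde\phi_N^{1/2}\in S_N$ satisfies for all $q,\Psi\in S_N$ $$(\tilde\phi-\phi_N^0,q)+\tfrac{M\Delta t}{2}(\nabla\tilde\mu,\nabla q)=0,$$ $$(\tilde\mu,\Psi)=((\Delta+\beta)\tilde\phi,(\Delta+\beta)\Psi)+\lambda(\tilde\phi,\Psi)+S(\nabla(\tilde\phi-\phi_N^0),\nabla\Psi)+\frac{\tilde R}{\sqrt{E_1(\phi_N^0)}}(F'(\phi_N^0),\Psi),$$ $$\tilde R-R^0=\frac{1}{2\sqrt{E_1(\phi_N^0)}}(F'(\phi_N^0),\tilde\phi-\phi_N^0),$$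 and $\phi_N^{-1}:=3\phi_N^0-2\tilde\phi_N^{1/2}$. **Theorem.** Let $m\ge0$ be an integer. Suppose that $\phi\in L^\infty(0,T;H^3_{per})\cap L^\infty(0,T;H^{m+1}_{per})$, $r\in H^3(0,T)$, $\phi_{tt}\in L^2(0,T;H^1_{per})$, $\phi_{ttt}\in L^2(0,T;H^{-1}_{per})$ (weak derivatives in time), and, if $S>0$, also $\phi_{tt}\in L^2(0,T;H^3_{per})$. Then there is a constant $C>0$, independent of $N$ and $\Delta t$ (it may depend on the exact solution and on the other data), such that for all $N,N_T\ge1$, every solution of the scheme and all $0\le k\le N_T$, $$\|\phi_N^k-\phi(t^k)\|^2+(R^k-r(t^k))^2\le C\Delta t^4\int_0^{t^k}\Big(\|(-\Delta)^{-1/2}\phi_{ttt}\|^2+\|\phi_{tt}\|_{H^1}^2+\sigma\|\phi_{tt}\|_{H^3}^2+|r'''|^2\Big)ds+C\|\phi\|^2_{L^\infty(0,T;H^{m+1}_{per})}N^{-2m},$$ where $\sigma=1$ if $S>0$ and $\sigma=0$ if $S=0$. In particular, the scheme converges with order $O(\Delta t^2+N^{-m})$: $\|\phi_N^k-\phi(t^k)\|+|R^k-r(t^k)|\le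 C(\Delta t^2+N^{-m})$. -/

import Mathlib

open MeasureTheory Set
open scoped ENNReal ContDiff

noncomputable section

/-- Data of the phase field crystal model and of its stabilized SAV reformulation: the periods
`Lx, Ly` of the domain, the constants `β, ε` of the free energy, the (constant) mobility `M`, the
SAV constants `lam` (written `λ` on paper) and `C₀`, and the stabilization parameter `S`. -/
structure PFC where
  Lx : ℝ
  Ly : ℝ
  β : ℝ
  ε : ℝ
  M : ℝ
  lam : ℝ
  C₀ : ℝ
  S : ℝ

namespace PFC

/-! ### Domain, energy density -/

/-- The domain `Ω = (0, Lx) × (0, Ly)`. -/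
def Ω (P : PFC) : Set (ℝ × ℝ) := Ioo 0 P.Lx ×ˢ Ioo 0 P.Ly

/-- The `L²(Ω)` inner product of real functions. -/
def ip (P : PFC) (u v : ℝ × ℝ → ℝ) : ℝ := ∫ p in P.Ω, u p * v p

/-- `F(z) = z⁴/4 - (ε + λ) z²/2`. -/
def F (P : PFC) (z : ℝ) : ℝ := z ^ 4 / 4 - (P.ε + P.lam) / 2 * z ^ 2

/-- `F'(z) = z³ - (ε + λ) z`. -/
def dF (P : PFC) (z : ℝ) : ℝ := z ^ 3 - (P.ε + P.lam) * z

theorem hasDerivAt_F (P : PFC) (z : ℝ) : HasDerivAt P.F (P.dF z) z := by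
  have h := ((hasDerivAt_pow 4 z).div_const 4).sub
    ((hasDerivAt_pow 2 z).const_mul ((P.ε + P.lam) / 2))
  have e : P.dF z = ((4 : ℕ) : ℝ) * z ^ (4 - 1) / 4
      - (P.ε + P.lam) / 2 * (((2 : ℕ) : ℝ) * z ^ (2 - 1)) := by
    simp only [dF]; push_cast; ring
  rw [e]
  exact h

/-- `E₁(v) = ∫_Ω F(v) dx + C₀`. -/
def E1 (P : PFC) (v : ℝ × ℝ → ℝ) : ℝ := (∫ p in P.Ω, P.F (v p)) + P.C₀

/-- Standing assumptions on the constants.  The constant `C₀` is such that `E₁` is positive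
on every function for which it is defined. -/
structure Admissible (P : PFC) : Prop where
  Lx_pos : 0 < P.Lx
  Ly_pos : 0 < P.Ly
  β_pos : 0 < P.β
  ε_pos : 0 < P.ε
  ε_lt : P.ε < P.β ^ 2
  M_pos : 0 < P.M
  lam_pos : 0 < P.lam
  C₀_nonneg : 0 ≤ P.C₀
  E1_pos : ∀ v : ℝ × ℝ → ℝ, MemLp v 4 (volume.restrict P.Ω) → 0 < P.E1 v
  S_nonneg : 0 ≤ P.S

/-! ### Fourier series and periodic Sobolev spaces

A periodic distribution is represented by the family of its Fourier coefficients. -/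

/-- The wave number `ξ_k = 2πk/Lx`. -/
def ξ (P : PFC) (k : ℤ) : ℝ := 2 * Real.pi * k / P.Lx

/-- The wave number `η_l = 2πl/Ly`. -/
def η (P : PFC) (l : ℤ) : ℝ := 2 * Real.pi * l / P.Ly

/-- The exponential `e^{i ξ_k x} e^{i η_l y}`. -/
def mode (P : PFC) (k : ℤ × ℤ) (p : ℝ × ℝ) : ℂ :=
  Complex.exp (Complex.I * ((P.ξ k.1 * p.1 + P.η k.2 * p.2 : ℝ) : ℂ))

/-- The Fourier coefficient `|Ω|⁻¹ ∫_Ω u e^{-i(ξ_k x + η_l y)}`. -/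
def coeff (P : PFC) (u : ℝ × ℝ → ℝ) (k : ℤ × ℤ) : ℂ :=
  ((P.Lx * P.Ly : ℝ) : ℂ)⁻¹ *
    ∫ p in P.Ω, (u p : ℂ) * Complex.exp (-(Complex.I * ((P.ξ k.1 * p.1 + P.η k.2 * p.2 : ℝ) : ℂ)))

/-- The symbol `ξ_k² + η_l²` of `-Δ`. -/
def negLap (P : PFC) (k : ℤ × ℤ) : ℝ := P.ξ k.1 ^ 2 + P.η k.2 ^ 2

/-- The squared norm of `H^s_per(Ω)`, `s ∈ ℝ`, of the periodic distribution with Fourier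
coefficients `c` (equal to `⊤` if it is not in this space).  For `s = 0` it is the squared
`L²(Ω)` norm; `H^{-s}_per` is the dual of `H^s_per`. -/
def hsNormSq (P : PFC) (s : ℝ) (c : ℤ × ℤ → ℂ) : ℝ≥0∞ :=
  ∑' k, ENNReal.ofReal (P.Lx * P.Ly * (1 + P.negLap k) ^ s * ‖c k‖ ^ 2)

/-- `‖(-Δ)^{-1/2} c‖²_{L²}` for a periodic distribution of mean zero; the zero mode does not
contribute because `0⁻¹ = 0`. -/
def negHalfNormSq (P : PFC) (c : ℤ × ℤ → ℂ) : ℝ≥0∞ :=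
  ∑' k, ENNReal.ofReal (P.Lx * P.Ly * (P.negLap k)⁻¹ * ‖c k‖ ^ 2)

/-- `‖u‖²` in `L^∞(0,T; H^s_per)`. -/
def linftyHsNormSq (P : PFC) (T s : ℝ) (u : ℝ → ℤ × ℤ → ℂ) : ℝ≥0∞ :=
  essSup (fun t => P.hsNormSq s (u t)) (volume.restrict (Ioo 0 T))

/-- `u ∈ L^∞(0,T; H^s_per)`. -/
def MemLinftyHs (P : PFC) (T s : ℝ) (u : ℝ → ℤ × ℤ → ℂ) : Prop :=
  (∀ k, AEStronglyMeasurable (fun t => u t k) (volume.restrict (Ioo 0 T))) ∧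
    P.linftyHsNormSq T s u < ⊤

/-- `u ∈ L²(0,T; H^s_per)`. -/
def MemL2Hs (P : PFC) (T s : ℝ) (u : ℝ → ℤ × ℤ → ℂ) : Prop :=
  (∀ k, AEStronglyMeasurable (fun t => u t k) (volume.restrict (Ioo 0 T))) ∧
    ∫⁻ t in Ioo 0 T, P.hsNormSq s (u t) < ⊤

/-- `v` is the weak derivative of order `n` of `u` on `(0,T)`. -/
def IsWeakDeriv {E : Type*} [NormedAddCommGroup E] [NormedSpace ℝ E]
    (n : ℕ) (T : ℝ) (u v : ℝ → E) : Prop :=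
  IntegrableOn u (Ioo 0 T) ∧ IntegrableOn v (Ioo 0 T) ∧
    ∀ θ : ℝ → ℝ, ContDiff ℝ ∞ θ → HasCompactSupport θ → tsupport θ ⊆ Ioo 0 T →
      ∫ t in Ioo 0 T, iteratedDeriv n θ t • u t = (-1 : ℝ) ^ n • ∫ t in Ioo 0 T, θ t • v t

/-- `∂ⁿu/∂tⁿ = v` weakly on `(0,T)`, for time-dependent periodic distributions. -/
def IsWeakTimeDeriv (n : ℕ) (T : ℝ) (u v : ℝ → ℤ × ℤ → ℂ) : Prop :=
  ∀ k, IsWeakDeriv n T (fun t => u t k) (fun t => v t k)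

/-- `r ∈ H³(0,T)`, with third weak derivative `r₃`. -/
def IsH3WithThirdDeriv (T : ℝ) (r r₃ : ℝ → ℝ) : Prop :=
  MemLp r 2 (volume.restrict (Ioo 0 T)) ∧ MemLp r₃ 2 (volume.restrict (Ioo 0 T)) ∧
    IsWeakDeriv 3 T r r₃ ∧
    ∃ r₁ r₂ : ℝ → ℝ, MemLp r₁ 2 (volume.restrict (Ioo 0 T)) ∧
      MemLp r₂ 2 (volume.restrict (Ioo 0 T)) ∧ IsWeakDeriv 1 T r r₁ ∧ IsWeakDeriv 2 T r r₂

/-! ### The exact solution -/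

/-- Fourier coefficients of the chemical potential `μ = (Δ + β)² u + u³ - ε u`. -/
def muCoeff (P : PFC) (u : ℝ × ℝ → ℝ) (k : ℤ × ℤ) : ℂ :=
  (((-P.negLap k + P.β) ^ 2 : ℝ) : ℂ) * P.coeff u k +
    P.coeff (fun p => u p ^ 3 - P.ε * u p) k

/-- `φ` solves `∂φ/∂t = M Δ μ`, `μ = (Δ + β)² φ + φ³ - ε φ`, on `(0,T)` with periodic boundary
conditions, as an identity of periodic distributions (i.e. tested with all the functions
`e^{-i(ξ_k x + η_l y)}`), and is (weakly) continuous on `[0,T]`, so that `φ(t)` has a meaning for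
every `t ∈ [0,T]`; the initial datum is `φ(0)`. -/
structure IsExactSolution (P : PFC) (T : ℝ) (φ : ℝ → ℝ × ℝ → ℝ) : Prop where
  memLp : ∀ t ∈ Icc 0 T, MemLp (φ t) 2 (volume.restrict P.Ω)
  continuousOn : ∀ k, ContinuousOn (fun t => P.coeff (φ t) k) (Icc 0 T)
  equation : ∀ k, ∀ t ∈ Ioo 0 T,
    HasDerivAt (fun s => P.coeff (φ s) k) (P.M * (-P.negLap k : ℝ) * P.muCoeff (φ t) k) t

/-- The scalar auxiliary variable `r = √E₁(φ)` as a function of time. -/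
def sav (P : PFC) (φ : ℝ → ℝ × ℝ → ℝ) (t : ℝ) : ℝ := √(P.E1 (φ t))

/-! ### The fully discrete schemes -/

/-- The real-valued elements of the Fourier space
`span {e^{iξ_k x} e^{iη_l y} : -N/2 ≤ k, l ≤ N/2 - 1}`. -/
def SN (P : PFC) (N : ℕ) : Set (ℝ × ℝ → ℝ) :=
  {u | (fun p => (u p : ℂ)) ∈ Submodule.span ℂ
    {f : ℝ × ℝ → ℂ | ∃ k l : ℤ, -(N : ℝ) / 2 ≤ k ∧ (k : ℝ) ≤ (N : ℝ) / 2 - 1 ∧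
      -(N : ℝ) / 2 ≤ l ∧ (l : ℝ) ≤ (N : ℝ) / 2 - 1 ∧ f = P.mode (k, l)}}

/-- `∂u/∂x`. -/
def dx (u : ℝ × ℝ → ℝ) : ℝ × ℝ → ℝ := fun p => deriv (fun x => u (x, p.2)) p.1

/-- `∂u/∂y`. -/
def dy (u : ℝ × ℝ → ℝ) : ℝ × ℝ → ℝ := fun p => deriv (fun y => u (p.1, y)) p.2

/-- `(Δ + β) u`. -/
def lapPlus (P : PFC) (u : ℝ × ℝ → ℝ) : ℝ × ℝ → ℝ :=
  dx (dx u) + dy (dy u) + P.β • u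

/-- `(∇u, ∇v)`. -/
def gradIp (P : PFC) (u v : ℝ × ℝ → ℝ) : ℝ := P.ip (dx u) (dx v) + P.ip (dy u) (dy v)

/-- `u` is the `L²`-orthogonal projection `Π_N v`. -/
def IsProj (P : PFC) (N : ℕ) (v u : ℝ × ℝ → ℝ) : Prop :=
  u ∈ P.SN N ∧ ∀ Ψ ∈ P.SN N, P.ip (u - v) Ψ = 0

/-- One step of length `τ` of the first-order fully discrete scheme, from `(u, R)` to `(u', R')`,
with discrete chemical potential `μ`. -/
structure FirstOrderStep (P : PFC) (N : ℕ) (τ : ℝ) (u : ℝ × ℝ → ℝ) (R : ℝ)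
    (μ u' : ℝ × ℝ → ℝ) (R' : ℝ) : Prop where
  mem : u' ∈ P.SN N
  mu_mem : μ ∈ P.SN N
  eqA : ∀ q ∈ P.SN N, P.ip (u' - u) q + P.M * τ * P.gradIp μ q = 0
  eqB : ∀ Ψ ∈ P.SN N, P.ip μ Ψ = P.ip (P.lapPlus u') (P.lapPlus Ψ) + P.lam * P.ip u' Ψ
    + P.S * P.gradIp (u' - u) Ψ + R' / √(P.E1 u) * P.ip (fun p => P.dF (u p)) Ψ
  eqC : R' - R = 1 / (2 * √(P.E1 u)) * P.ip (fun p => P.dF (u p)) (u' - u)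

/-- The extrapolation `(3u - w)/2`, where `u` is the current and `w` the previous iterate. -/
def extrap (w u : ℝ × ℝ → ℝ) : ℝ × ℝ → ℝ := fun p => (3 * u p - w p) / 2

/-- One step of length `τ` of the second-order fully discrete scheme, from `(u, R)` and the
previous iterate `w` to `(u', R')`; the half-integer values of the unknowns are the averages
`(u + u')/2` and `(R + R')/2`. -/
structure SecondOrderStep (P : PFC) (N : ℕ) (τ : ℝ) (w u : ℝ × ℝ → ℝ) (R : ℝ)
    (μ u' : ℝ × ℝ → ℝ) (R' : ℝ) : Prop where
  mem : u' ∈ P.SN N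
  mu_mem : μ ∈ P.SN N
  eqA : ∀ q ∈ P.SN N, P.ip (u' - u) q + P.M * τ * P.gradIp μ q = 0
  eqB : ∀ Ψ ∈ P.SN N, P.ip μ Ψ =
    P.ip (P.lapPlus ((1 / 2 : ℝ) • (u + u'))) (P.lapPlus Ψ)
    + P.lam * P.ip ((1 / 2 : ℝ) • (u + u')) Ψ
    + P.S * P.gradIp (u' - (2 : ℝ) • u + w) Ψ
    + ((R + R') / 2) / √(P.E1 (extrap w u)) * P.ip (fun p => P.dF (extrap w u p)) Ψ
  eqC : R' - R = 1 / (2 * √(P.E1 (extrap w u))) *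
    P.ip (fun p => P.dF (extrap w u p)) (u' - u)

/-- The iterate preceding `φN n`.  For `n = 0` it is the function `w` with `(3 φN 0 - w)/2 = h`,
where `h` is the approximation of the solution at time `τ/2`. -/
def prevIterate (h : ℝ × ℝ → ℝ) (φN : ℕ → ℝ × ℝ → ℝ) : ℕ → ℝ × ℝ → ℝ
  | 0 => (3 : ℝ) • φN 0 - (2 : ℝ) • h
  | n + 1 => φN n

/-- `(φN n, R n)`, `n ≤ NT`, is produced by the second-order fully discrete scheme with time
step `τ` from the initial datum `φ₀`: one has `φN 0 = Π_N φ₀` and `R 0 = r(0) = √E₁(φ₀)`; in the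
first step the extrapolation at time `τ/2` is computed by one step of length `τ/2` of the
first-order scheme. -/
def IsDiscreteSolution (P : PFC) (N : ℕ) (τ : ℝ) (NT : ℕ) (φ₀ : ℝ × ℝ → ℝ)
    (φN : ℕ → ℝ × ℝ → ℝ) (R : ℕ → ℝ) : Prop :=
  P.IsProj N φ₀ (φN 0) ∧ R 0 = √(P.E1 φ₀) ∧
    ∃ (h μh : ℝ × ℝ → ℝ) (Rh : ℝ) (μ : ℕ → ℝ × ℝ → ℝ),
      P.FirstOrderStep N (τ / 2) (φN 0) (R 0) μh h Rh ∧
      ∀ n < NT, P.SecondOrderStep N τ (prevIterate h φN n) (φN n) (R n)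
        (μ n) (φN (n + 1)) (R (n + 1))

end PFC

end

/-! Everything is done on Fourier coefficients; `sob s` is the squared H^s norm of a family of
coefficients up to the factor |Ω|. In two dimensions the weights (1 + ξ² + η²)⁻² are summable, so
H^p with p ≥ 2 multiplies H^s for s ≤ p (`sob_le_of_convolution`). Hence F' and E₁ are locally
Lipschitz in the norms that occur, and the positivity of E₁ at one constant function already bounds
E₁ below uniformly (`e1Low_pos`), so that √E₁ is Lipschitz as well.

Stability. When the potential equation is tested with the increment of the solution, the scalar
equation turns the work of the nonlinear term into an increment of R². This gives `energy_step_le`,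
and without defects a bound of all iterates in H² that depends neither on N nor on the time step
(`exists_stability_bound`). The nonlinearities may then be treated as Lipschitz.

Error recursion. The errors solve the same linear scheme with three defects, and `energy_step_le`
applies again (`Regular.exists_step_bound`). The exact solution is inserted through averages of its
values at the two end points of a step. The mass equation then has the error of the trapezoidal
rule, controlled by φ_ttt in the dual norm; the potential equation has the extrapolation error and,
if S > 0, the second difference in the stabilization, controlled by φ_tt in H¹ and H³; the remaining
nonlinear defects are quadratic in φ(b) - φ(a). The index j is 0 if S = 0 and 1 if S > 0, and
H^{2j+1} is the norm of φ_tt that is used. The quadratic terms require φ to be Lipschitz in time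
with values in H²; this, even in H^{2j+5}, follows from the equation itself by interpolation in time
and elliptic regularity in space (`exists_regular`).

Small times. The quadratic terms sum to τ⁴ Λ t, where Λ is the squared Lipschitz constant, whereas
the claim allows only τ⁴ times an integral over (0,t), which could conceivably be much smaller than
t. It cannot, unless φ is constant in time (`Regular.exists_lip_le_defect`). Suppose the integral is
o(t) along a sequence. Then the equation can be expanded to second order at t = 0, and the
coefficient of t² says that Δ(φ(0) φ_t(0)²) = 0. So φ(0) φ_t(0)² is constant, and the constant is 0
because φ_t(0) has mean zero on a connected cell. On the open set where φ_t(0) ≠ 0 the function φ(0)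
vanishes; the right-hand side of the equation is local, hence φ_t(0) vanishes there too. Thus φ_t(0)
= 0, and by uniqueness φ is stationary, so that Λ may be taken to be 0.

First step. The value at τ/2 comes from one step of a first-order scheme, whose local error is still
of second order. The scalar error is estimated first by the energy inequality, and it enters the
error of each mode with a further factor τ (`Regular.exists_first_step_sav_bound`,
`Regular.exists_first_step_bound`).

Conclusion. The discrete Gronwall inequality `le_of_discrete_recursion` bounds the retained modes of
the error, starting from an initial error equal to 0; the discarded modes are bounded by the spatial
regularity of φ. -/

noncomputable section

open scoped ComplexConjugate

namespace PFC

variable {P : PFC}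

/-! ### Fourier coefficients on the period cell and Parseval's identity. -/

section Torus

local instance : MeasureSpace UnitAddCircle := ⟨AddCircle.haarAddCircle⟩

/-- The standard parametrization of the period cell by the unit torus. -/
def torusMap (P : PFC) (x : UnitAddTorus (Fin 2)) : ℝ × ℝ :=
  (P.Lx * (AddCircle.equivIoc 1 0 (x 0) : ℝ), P.Ly * (AddCircle.equivIoc 1 0 (x 1) : ℝ))

theorem map_mul_left_restrict_Ioc {L : ℝ} (hL : 0 < L) :
    Measure.map (fun x => L * x) (volume.restrict (Ioc (0 : ℝ) (0 + 1)))
      = ENNReal.ofReal L⁻¹ • volume.restrict (Ioc 0 L) := by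
  have h : (fun x => L * x) ⁻¹' Ioc 0 L = Ioc (0 : ℝ) (0 + 1) := by
    ext x
    simp only [mem_preimage, mem_Ioc, zero_add]
    constructor
    · rintro ⟨h1, h2⟩
      exact ⟨(mul_pos_iff_of_pos_left hL).1 h1, by nlinarith⟩
    · rintro ⟨h1, h2⟩
      exact ⟨mul_pos hL h1, by nlinarith⟩
  rw [← h, ← Measure.restrict_map (measurable_const_mul L) measurableSet_Ioc,
    Real.map_volume_mul_left hL.ne', Measure.restrict_smul, abs_of_pos (inv_pos.2 hL)]

theorem restrict_Ω_eq (P : PFC) :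
    (volume : Measure (ℝ × ℝ)).restrict P.Ω
      = (volume.restrict (Ioc 0 P.Lx)).prod (volume.restrict (Ioc 0 P.Ly)) := by
  rw [Ω, Measure.volume_eq_prod, ← Measure.prod_restrict, Measure.restrict_congr_set Ioo_ae_eq_Ioc,
    Measure.restrict_congr_set Ioo_ae_eq_Ioc]

/-- The Haar probability measure of the unit torus becomes Lebesgue measure on the cell divided by
its area, so the Fourier theory of `UnitAddTorus` can be transported to the rectangle. Half-open
intervals are exchanged for open ones up to null sets. -/
theorem map_torusMap (P : PFC) (hP : P.Admissible) :
    Measurable P.torusMap ∧ Measure.map P.torusMap volume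
      = ENNReal.ofReal (P.Lx * P.Ly)⁻¹ • volume.restrict P.Ω := by
  have hx := hP.Lx_pos
  have hy := hP.Ly_pos
  have h1 := UnitAddTorus.measurePreserving_equivPiIoc (d := Fin 2) 0
  have hS : MeasurableSet {x : Fin 2 → ℝ | ∀ i, x i ∈ Ioc ((0 : Fin 2 → ℝ) i)
      ((0 : Fin 2 → ℝ) i + 1)} := MeasurableSet.univ_pi' (fun i => measurableSet_Ioc)
  have h2 := measurePreserving_subtype_coe (μa := (volume : Measure (Fin 2 → ℝ))) hS
  have hB : MeasurableSet (Ioc (0 : ℝ) (0 + 1) ×ˢ Ioc (0 : ℝ) (0 + 1)) :=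
    measurableSet_Ioc.prod measurableSet_Ioc
  have h3 := (volume_preserving_finTwoArrow ℝ).restrict_preimage hB
  have hpre : (MeasurableEquiv.finTwoArrow : (Fin 2 → ℝ) ≃ᵐ ℝ × ℝ) ⁻¹'
      (Ioc (0 : ℝ) (0 + 1) ×ˢ Ioc (0 : ℝ) (0 + 1)) = {x : Fin 2 → ℝ | ∀ i, x i ∈
        Ioc ((0 : Fin 2 → ℝ) i) ((0 : Fin 2 → ℝ) i + 1)} := by
    ext x
    simp [Fin.forall_fin_two, MeasurableEquiv.finTwoArrow]
  rw [hpre] at h3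
  have h4 : MeasurePreserving (Prod.map (fun x => P.Lx * x) (fun y => P.Ly * y))
      (volume.restrict (Ioc (0 : ℝ) (0 + 1) ×ˢ Ioc (0 : ℝ) (0 + 1)))
      (ENNReal.ofReal (P.Lx * P.Ly)⁻¹ • volume.restrict P.Ω) := by
    refine ⟨(measurable_const_mul _).prodMap (measurable_const_mul _), ?_⟩
    rw [Measure.volume_eq_prod, ← Measure.prod_restrict, ← Measure.map_prod_map _ _
      (measurable_const_mul _) (measurable_const_mul _), map_mul_left_restrict_Ioc hx,
      map_mul_left_restrict_Ioc hy, ← Measure.volume_eq_prod, restrict_Ω_eq,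
      Measure.prod_smul_left, Measure.prod_smul_right, smul_smul, mul_inv,
      ENNReal.ofReal_mul (inv_pos.2 hx).le]
  have h : MeasurePreserving P.torusMap volume _ := (h4.comp h3).comp (h2.comp h1)
  exact ⟨h.measurable, h.map_eq⟩

end Torus

/-- The Fourier coefficient of a complex function on the period cell. -/
def cf (P : PFC) (u : ℝ × ℝ → ℂ) (k : ℤ × ℤ) : ℂ :=
  ((P.Lx * P.Ly : ℝ) : ℂ)⁻¹ *
    ∫ p in P.Ω, u p * Complex.exp (-(Complex.I * ((P.ξ k.1 * p.1 + P.η k.2 * p.2 : ℝ) : ℂ)))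

theorem coeff_eq_cf (P : PFC) (u : ℝ × ℝ → ℝ) : P.coeff u = P.cf (fun p => (u p : ℂ)) := rfl

theorem exp_neg_eq_conj_mode (P : PFC) (k : ℤ × ℤ) (p : ℝ × ℝ) :
    Complex.exp (-(Complex.I * ((P.ξ k.1 * p.1 + P.η k.2 * p.2 : ℝ) : ℂ)))
      = conj (P.mode k p) := by
  rw [mode, ← Complex.exp_conj, map_mul, Complex.conj_I, Complex.conj_ofReal, neg_mul]

theorem continuous_mode (P : PFC) (k : ℤ × ℤ) : Continuous (P.mode k) := by
  unfold mode; fun_prop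

theorem norm_mode (P : PFC) (k : ℤ × ℤ) (p : ℝ × ℝ) : ‖P.mode k p‖ = 1 := by
  rw [mode, mul_comm, Complex.norm_exp_ofReal_mul_I]

theorem mode_add (P : PFC) (k j : ℤ × ℤ) (p : ℝ × ℝ) :
    P.mode (k + j) p = P.mode k p * P.mode j p := by
  simp only [mode, ← Complex.exp_add, ξ, η, Prod.fst_add, Prod.snd_add]
  congr 1
  push_cast
  ring

theorem mode_neg (P : PFC) (k : ℤ × ℤ) (p : ℝ × ℝ) : P.mode (-k) p = conj (P.mode k p) := by
  rw [← exp_neg_eq_conj_mode, mode]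
  congr 1
  simp only [ξ, η, Prod.fst_neg, Prod.snd_neg]
  push_cast
  ring

theorem mode_zero (P : PFC) (p : ℝ × ℝ) : P.mode 0 p = 1 := by
  simp [mode, ξ, η]

theorem isFiniteMeasure_Ω (P : PFC) : IsFiniteMeasure ((volume : Measure (ℝ × ℝ)).restrict P.Ω) := by
  rw [restrict_Ω_eq]
  infer_instance

section Torus

local instance : MeasureSpace UnitAddCircle := ⟨AddCircle.haarAddCircle⟩

theorem mFourier_eq_mode (P : PFC) (hP : P.Admissible) (n : Fin 2 → ℤ)
    (x : UnitAddTorus (Fin 2)) :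
    UnitAddTorus.mFourier n x = P.mode (n 0, n 1) (P.torusMap x) := by
  have hx := hP.Lx_pos.ne'
  have hy := hP.Ly_pos.ne'
  have h : ∀ i, x i = ((AddCircle.equivIoc 1 0 (x i) : ℝ) : UnitAddCircle) := fun i =>
    ((AddCircle.equivIoc (1 : ℝ) 0).symm_apply_apply (x i)).symm
  simp only [UnitAddTorus.mFourier, ContinuousMap.coe_mk, Fin.prod_univ_two]
  rw [h 0, h 1, fourier_coe_apply, fourier_coe_apply, ← Complex.exp_add, mode, torusMap]
  congr 1
  simp only [ξ, η]
  have hx' : (P.Lx : ℂ) ≠ 0 := by exact_mod_cast hx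
  have hy' : (P.Ly : ℂ) ≠ 0 := by exact_mod_cast hy
  push_cast
  field_simp

theorem integral_comp_torusMap (P : PFC) (hP : P.Admissible) {f : ℝ × ℝ → ℂ}
    (hf : AEStronglyMeasurable f (volume.restrict P.Ω)) :
    ∫ x, f (P.torusMap x) = ((P.Lx * P.Ly : ℝ) : ℂ)⁻¹ * ∫ p in P.Ω, f p := by
  obtain ⟨hm, he⟩ := P.map_torusMap hP
  have := integral_map (μ := volume) hm.aemeasurable (f := f) (by rw [he]; exact hf.smul_measure _)
  rw [← this, he, integral_smul_measure, ENNReal.toReal_ofReal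
    (inv_nonneg.2 (mul_pos hP.Lx_pos hP.Ly_pos).le), Complex.real_smul]
  push_cast
  rfl

theorem memLp_comp_torusMap (P : PFC) (hP : P.Admissible) {f : ℝ × ℝ → ℂ}
    (hf : MemLp f 2 (volume.restrict P.Ω)) : MemLp (fun x => f (P.torusMap x)) 2 volume := by
  obtain ⟨hm, he⟩ := P.map_torusMap hP
  have h2 : MemLp f 2 (Measure.map P.torusMap volume) := by
    rw [he]; exact hf.smul_measure ENNReal.ofReal_ne_top
  exact (memLp_map_measure_iff h2.1 hm.aemeasurable).1 h2

/-- Parseval's identity on the period cell. -/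
theorem hasSum_conj_cf_mul_cf (P : PFC) (hP : P.Admissible) {f g : ℝ × ℝ → ℂ}
    (hf : MemLp f 2 (volume.restrict P.Ω)) (hg : MemLp g 2 (volume.restrict P.Ω)) :
    HasSum (fun k => conj (P.cf f k) * P.cf g k)
      (((P.Lx * P.Ly : ℝ) : ℂ)⁻¹ * ∫ p in P.Ω, conj (f p) * g p) := by
  have key : ∀ {h : ℝ × ℝ → ℂ} (hh : MemLp h 2 (volume.restrict P.Ω)) (n : Fin 2 → ℤ),
      UnitAddTorus.mFourierCoeff ((P.memLp_comp_torusMap hP hh).toLp) n = P.cf h (n 0, n 1) := by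
    intro h hh n
    rw [UnitAddTorus.mFourierCoeff]
    have e1 : ∫ t, UnitAddTorus.mFourier (-n) t • ((P.memLp_comp_torusMap hP hh).toLp) t
        = ∫ t, (fun p => h p * Complex.exp
          (-(Complex.I * ((P.ξ (n 0) * p.1 + P.η (n 1) * p.2 : ℝ) : ℂ)))) (P.torusMap t) := by
      apply integral_congr_ae
      filter_upwards [(P.memLp_comp_torusMap hP hh).coeFn_toLp] with t ht
      have := P.exp_neg_eq_conj_mode (n 0, n 1) (P.torusMap t)
      simp only at this
      rw [ht, this, UnitAddTorus.mFourier_neg, mFourier_eq_mode P hP, smul_eq_mul, mul_comm]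
    rw [e1, P.integral_comp_torusMap hP (f := fun p => h p * Complex.exp
          (-(Complex.I * ((P.ξ (n 0) * p.1 + P.η (n 1) * p.2 : ℝ) : ℂ)))), cf]
    exact hh.1.mul (Continuous.aestronglyMeasurable (by fun_prop))
  have h := UnitAddTorus.hasSum_prod_mFourierCoeff (P.memLp_comp_torusMap hP hf).toLp
    (P.memLp_comp_torusMap hP hg).toLp
  have h : HasSum (fun n : Fin 2 → ℤ => conj (P.cf f (n 0, n 1)) * P.cf g (n 0, n 1)) _ :=
    h.congr_fun fun n => (congrArg₂ (fun a b => conj a * b) (key hf n) (key hg n)).symm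
  have e2 : ∫ t, conj (((P.memLp_comp_torusMap hP hf).toLp : UnitAddTorus (Fin 2) → ℂ) t)
      * ((P.memLp_comp_torusMap hP hg).toLp : UnitAddTorus (Fin 2) → ℂ) t
      = ∫ t, (fun p => conj (f p) * g p) (P.torusMap t) := by
    apply integral_congr_ae
    filter_upwards [(P.memLp_comp_torusMap hP hf).coeFn_toLp,
      (P.memLp_comp_torusMap hP hg).coeFn_toLp] with t h1 h2
    rw [h1, h2]
  rw [e2, P.integral_comp_torusMap hP (f := fun p => conj (f p) * g p)
    ((Complex.continuous_conj.comp_aestronglyMeasurable hf.1).mul hg.1)] at h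
  exact (finTwoArrowEquiv ℤ).hasSum_iff.1 h

end Torus

/-! ### Weighted sums over the frequencies and the multiplication inequality. -/

/-- The Cauchy–Schwarz inequality for series of extended nonnegative reals. -/
theorem ENNReal.tsum_mul_sq_le {ι : Type*} (f g : ι → ℝ≥0∞) :
    (∑' i, f i * g i) ^ 2 ≤ (∑' i, f i ^ 2) * ∑' i, g i ^ 2 := by
  let _ : MeasurableSpace ι := ⊤
  have h := ENNReal.lintegral_mul_le_Lp_mul_Lq (Measure.count : Measure ι)
    (p := 2) (q := 2) ⟨by norm_num, by norm_num, by norm_num⟩ (f := f) (g := g)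
    measurable_from_top.aemeasurable measurable_from_top.aemeasurable
  simp only [lintegral_count, Pi.mul_apply] at h
  have h2 := pow_le_pow_left' h 2
  rw [mul_pow] at h2
  have e : ∀ x : ℝ≥0∞, (x ^ (1 / 2 : ℝ)) ^ 2 = x := fun x => by
    rw [← ENNReal.rpow_natCast, ← ENNReal.rpow_mul]; norm_num
  rw [e, e] at h2
  simpa using h2

/-- The weight `1 + ξ_k² + η_l²`. -/
def wt (P : PFC) (k : ℤ × ℤ) : ℝ := 1 + P.negLap k

theorem negLap_nonneg (P : PFC) (k : ℤ × ℤ) : 0 ≤ P.negLap k := by unfold negLap; positivity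

theorem one_le_wt (P : PFC) (k : ℤ × ℤ) : 1 ≤ P.wt k := by
  have := P.negLap_nonneg k; unfold wt; linarith

theorem wt_pos (P : PFC) (k : ℤ × ℤ) : 0 < P.wt k := zero_lt_one.trans_le (P.one_le_wt k)

theorem negLap_le_wt (P : PFC) (k : ℤ × ℤ) : P.negLap k ≤ P.wt k := by unfold wt; linarith

theorem negLap_neg (P : PFC) (k : ℤ × ℤ) : P.negLap (-k) = P.negLap k := by
  simp only [negLap, ξ, η, Prod.fst_neg, Prod.snd_neg]; push_cast; ring

theorem negLap_zero (P : PFC) : P.negLap 0 = 0 := by simp [negLap, ξ, η]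

/-- A Peetre-type inequality, from k = (k + j) - j. It distributes the weight of a product over its
two factors. -/
theorem wt_le_add (P : PFC) (j k : ℤ × ℤ) : P.wt k ≤ 2 * (P.wt j + P.wt (k + j)) := by
  simp only [wt, negLap, ξ, η, Prod.fst_add, Prod.snd_add, Int.cast_add]
  have h1 : 2 * Real.pi * (k.1 + j.1 : ℝ) / P.Lx
    = 2 * Real.pi * k.1 / P.Lx + 2 * Real.pi * j.1 / P.Lx := by ring
  have h2 : 2 * Real.pi * (k.2 + j.2 : ℝ) / P.Ly
    = 2 * Real.pi * k.2 / P.Ly + 2 * Real.pi * j.2 / P.Ly := by ring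
  rw [h1, h2]
  generalize 2 * Real.pi * k.1 / P.Lx = a
  generalize 2 * Real.pi * j.1 / P.Lx = b
  generalize 2 * Real.pi * k.2 / P.Ly = c
  generalize 2 * Real.pi * j.2 / P.Ly = d
  nlinarith [sq_nonneg (a + 2 * b), sq_nonneg (c + 2 * d)]

theorem tsum_inv_one_add_sq_lt_top {c : ℝ} (hc : c ≠ 0) :
    ∑' k : ℤ, ENNReal.ofReal (1 + (c * k) ^ 2)⁻¹ < ⊤ := by
  have h : Summable (fun k : ℤ => (1 + (c * k) ^ 2)⁻¹) := by
    have h2 := (Real.summable_one_div_int_pow.2 one_lt_two).mul_left ((c ^ 2)⁻¹)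
    refine Summable.of_norm_bounded_eventually h2 ?_
    filter_upwards [(Set.finite_singleton (0 : ℤ)).compl_mem_cofinite] with k hk
    have hk' : (k : ℝ) ≠ 0 := by exact_mod_cast hk
    rw [Real.norm_of_nonneg (by positivity), one_div, ← mul_inv, mul_pow]
    exact inv_anti₀ (by positivity) (by linarith)
  rw [← ENNReal.ofReal_tsum_of_nonneg (fun k => by positivity) h]
  exact ENNReal.ofReal_lt_top

/-- The sum of `(1 + ξ_k² + η_l²)⁻²`. -/
def zetaTwo (P : PFC) : ℝ≥0∞ := ∑' k, ENNReal.ofReal (P.wt k ^ 2)⁻¹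

/-- Since (1 + ξ² + η²)² ≥ (1 + ξ²)(1 + η²), the double sum is dominated by a product of two
convergent one-dimensional sums. This is where the space dimension two enters. -/
theorem zetaTwo_lt_top (P : PFC) (hP : P.Admissible) : P.zetaTwo < ⊤ := by
  have hpi := Real.pi_pos
  have hx := hP.Lx_pos
  have hy := hP.Ly_pos
  have h1 := tsum_inv_one_add_sq_lt_top (c := 2 * Real.pi / P.Lx) (by positivity)
  have h2 := tsum_inv_one_add_sq_lt_top (c := 2 * Real.pi / P.Ly) (by positivity)
  refine lt_of_le_of_lt ?_ (ENNReal.mul_lt_top h1 h2)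
  rw [zetaTwo, ENNReal.tsum_prod', ← ENNReal.tsum_mul_right]
  refine ENNReal.tsum_le_tsum fun a => ?_
  rw [← ENNReal.tsum_mul_left]
  refine ENNReal.tsum_le_tsum fun b => ?_
  rw [← ENNReal.ofReal_mul (by positivity), ← mul_inv]
  refine ENNReal.ofReal_le_ofReal (inv_anti₀ (by positivity) ?_)
  have e1 : P.ξ a = 2 * Real.pi / P.Lx * a := by unfold ξ; ring
  have e2 : P.η b = 2 * Real.pi / P.Ly * b := by unfold η; ring
  rw [wt, negLap, e1, e2]
  nlinarith [sq_nonneg (2 * Real.pi / P.Lx * a), sq_nonneg (2 * Real.pi / P.Ly * b),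
    mul_nonneg (sq_nonneg (2 * Real.pi / P.Lx * a)) (sq_nonneg (2 * Real.pi / P.Ly * b))]

/-- The squared `H^s` norm of a sequence of Fourier coefficients, for a natural number `s`, without
the factor `|Ω|`. -/
def sob (P : PFC) (s : ℕ) (c : ℤ × ℤ → ℂ) : ℝ≥0∞ :=
  ∑' k, ENNReal.ofReal (P.wt k ^ s) * ‖c k‖ₑ ^ 2

theorem hsNormSq_natCast (P : PFC) (hP : P.Admissible) (s : ℕ) (c : ℤ × ℤ → ℂ) :
    P.hsNormSq s c = ENNReal.ofReal (P.Lx * P.Ly) * P.sob s c := by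
  have hx := hP.Lx_pos
  have hy := hP.Ly_pos
  rw [hsNormSq, sob, ← ENNReal.tsum_mul_left]
  refine tsum_congr fun k => ?_
  rw [Real.rpow_natCast, ENNReal.ofReal_mul, ENNReal.ofReal_mul (by positivity), mul_assoc,
    ENNReal.ofReal_pow (norm_nonneg _), ofReal_norm]
  · rfl
  · have := P.negLap_nonneg k; positivity

/-- The larger of x and y absorbs z^s, and at least a second power of the smaller one is left over.
If x is the larger one, the surplus x^(p-s) is traded for y^(p-s), which is possible because s ≤ p.
-/
theorem kernel_bound {x y z : ℝ} (hx : 1 ≤ x) (hy : 1 ≤ y) (hz : 0 ≤ z) (h : z ≤ 2 * (x + y)) (s p : ℕ)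
    (hp : 2 ≤ p) (hps : s ≤ p) :
    z ^ s * (x ^ p * y ^ s)⁻¹ ≤ 4 ^ s * ((x ^ 2)⁻¹ + (y ^ 2)⁻¹) := by
  have hx0 : 0 < x := by linarith
  have hy0 : 0 < y := by linarith
  rw [← div_eq_mul_inv, div_le_iff₀ (by positivity)]
  rcases le_total x y with hxy | hxy
  · have h1 : z ^ s ≤ (4 * y) ^ s := pow_le_pow_left₀ hz (by linarith) s
    have h2 : x ^ 2 ≤ x ^ p := pow_le_pow_right₀ hx hp
    calc z ^ s ≤ 4 ^ s * y ^ s := by rwa [mul_pow] at h1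
      _ = 4 ^ s * (x ^ 2)⁻¹ * (x ^ 2 * y ^ s) := by field_simp
      _ ≤ 4 ^ s * ((x ^ 2)⁻¹ + (y ^ 2)⁻¹) * (x ^ p * y ^ s) := by
          gcongr
          linarith [inv_pos.2 (pow_pos hy0 2)]
  · have h1 : z ^ s ≤ (4 * x) ^ s := pow_le_pow_left₀ hz (by linarith) s
    have h2 : x ^ s * y ^ 2 ≤ x ^ p * y ^ s := by
      obtain ⟨q, rfl⟩ := Nat.exists_eq_add_of_le hps
      rw [pow_add, mul_assoc]
      gcongr
      calc y ^ 2 ≤ y ^ (s + q) := pow_le_pow_right₀ hy hp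
        _ = y ^ q * y ^ s := by rw [pow_add, mul_comm]
        _ ≤ x ^ q * y ^ s := by gcongr
    calc z ^ s ≤ 4 ^ s * x ^ s := by rwa [mul_pow] at h1
      _ = 4 ^ s * (y ^ 2)⁻¹ * (x ^ s * y ^ 2) := by field_simp
      _ ≤ 4 ^ s * ((x ^ 2)⁻¹ + (y ^ 2)⁻¹) * (x ^ p * y ^ s) := by
          gcongr
          linarith [inv_pos.2 (pow_pos hx0 2)]

/-- The constant in the multiplication inequality `sob_le_of_convolution`. -/
def mulConst (P : PFC) (s : ℕ) : ℝ≥0∞ := ENNReal.ofReal (4 ^ s) * (P.zetaTwo + P.zetaTwo)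

theorem mulConst_lt_top (P : PFC) (hP : P.Admissible) (s : ℕ) : P.mulConst s < ⊤ :=
  ENNReal.mul_lt_top ENNReal.ofReal_lt_top
    (ENNReal.add_lt_top.2 ⟨P.zetaTwo_lt_top hP, P.zetaTwo_lt_top hP⟩)

/-- Cauchy–Schwarz in the convolution against the weight wt(j)^p wt(k+j)^s leaves a kernel whose sum
over j is bounded uniformly in k by `kernel_bound`; the remaining double sum factors after
exchanging the summations. The asymmetry matters: the second factor is needed only in the norm in
which the product is measured. -/
theorem sob_le_of_convolution (P : PFC) (s p : ℕ) (hp : 2 ≤ p) (hps : s ≤ p)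
    (a b c : ℤ × ℤ → ℂ) (h : ∀ k, ‖c k‖ₑ ≤ ∑' j, ‖a j‖ₑ * ‖b (k + j)‖ₑ) :
    P.sob s c ≤ P.mulConst s * (P.sob p a * P.sob s b) := by
  have shift : ∀ (k : ℤ × ℤ) (f : ℤ × ℤ → ℝ≥0∞), ∑' j, f (k + j) = ∑' j, f j := fun k f =>
    (Equiv.addLeft k).tsum_eq f
  have shift' : ∀ (k : ℤ × ℤ) (f : ℤ × ℤ → ℝ≥0∞), ∑' j, f (j + k) = ∑' j, f j := fun k f =>
    (Equiv.addRight k).tsum_eq f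
  have key : ∀ k, ENNReal.ofReal (P.wt k ^ s) * ‖c k‖ₑ ^ 2 ≤ P.mulConst s *
      ∑' j, (ENNReal.ofReal (P.wt j ^ p) * ‖a j‖ₑ ^ 2) *
        (ENNReal.ofReal (P.wt (k + j) ^ s) * ‖b (k + j)‖ₑ ^ 2) := by
    intro k
    have hw : ∀ j, 0 < P.wt j ^ p * P.wt (k + j) ^ s := fun j =>
      mul_pos (pow_pos (P.wt_pos _) _) (pow_pos (P.wt_pos _) _)
    have h1 : ∀ j, ‖a j‖ₑ * ‖b (k + j)‖ₑ
        = ENNReal.ofReal (√(P.wt j ^ p * P.wt (k + j) ^ s)⁻¹) *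
          (ENNReal.ofReal (√(P.wt j ^ p * P.wt (k + j) ^ s)) * (‖a j‖ₑ * ‖b (k + j)‖ₑ)) := by
      intro j
      rw [← mul_assoc, ← ENNReal.ofReal_mul (Real.sqrt_nonneg _),
        ← Real.sqrt_mul (inv_nonneg.2 (hw j).le), inv_mul_cancel₀ (hw j).ne', Real.sqrt_one,
        ENNReal.ofReal_one, one_mul]
    have h2 : ‖c k‖ₑ ^ 2 ≤ (∑' j, ENNReal.ofReal (P.wt j ^ p * P.wt (k + j) ^ s)⁻¹) *
        ∑' j, (ENNReal.ofReal (P.wt j ^ p) * ‖a j‖ₑ ^ 2) *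
          (ENNReal.ofReal (P.wt (k + j) ^ s) * ‖b (k + j)‖ₑ ^ 2) := by
      refine (pow_le_pow_left' (h k) 2).trans ?_
      rw [tsum_congr h1]
      refine (ENNReal.tsum_mul_sq_le _ _).trans (le_of_eq ?_)
      congr 1
      · refine tsum_congr fun j => ?_
        rw [← ENNReal.ofReal_pow (Real.sqrt_nonneg _), Real.sq_sqrt (inv_nonneg.2 (hw j).le)]
      · refine tsum_congr fun j => ?_
        rw [mul_pow, ← ENNReal.ofReal_pow (Real.sqrt_nonneg _), Real.sq_sqrt (hw j).le,
          ENNReal.ofReal_mul (pow_pos (P.wt_pos _) _).le]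
        ring
    refine (mul_le_mul_right h2 _).trans ?_
    rw [← mul_assoc]
    refine mul_le_mul_left ?_ _
    rw [← ENNReal.tsum_mul_left, mulConst]
    have h3 : P.zetaTwo + P.zetaTwo = ∑' j, (ENNReal.ofReal (P.wt j ^ 2)⁻¹ +
        ENNReal.ofReal (P.wt (k + j) ^ 2)⁻¹) := by
      rw [ENNReal.tsum_add, shift k (fun j => ENNReal.ofReal (P.wt j ^ 2)⁻¹), zetaTwo]
    rw [h3, ← ENNReal.tsum_mul_left]
    refine ENNReal.tsum_le_tsum fun j => ?_
    rw [← ENNReal.ofReal_add (by have := P.wt_pos j; positivity)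
      (by have := P.wt_pos (k + j); positivity), ← ENNReal.ofReal_mul (by have := P.wt_pos k; positivity),
      ← ENNReal.ofReal_mul (by positivity)]
    exact ENNReal.ofReal_le_ofReal (kernel_bound (P.one_le_wt _) (P.one_le_wt _) (P.wt_pos k).le
      (P.wt_le_add j k) s p hp hps)
  refine (ENNReal.tsum_le_tsum key).trans ?_
  rw [ENNReal.tsum_mul_left]
  refine mul_le_mul_right (le_of_eq ?_) _
  rw [ENNReal.tsum_comm]
  simp_rw [ENNReal.tsum_mul_left]
  simp_rw [shift' _ (fun j => ENNReal.ofReal (P.wt j ^ s) * ‖b j‖ₑ ^ 2)]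
  rw [ENNReal.tsum_mul_right, sob, sob]

/-! ### Real functions -/

theorem memLp_ofReal {P : PFC} {u : ℝ × ℝ → ℝ} {q : ℝ≥0∞} (hu : MemLp u q (volume.restrict P.Ω)) :
    MemLp (fun p => (u p : ℂ)) q (volume.restrict P.Ω) := hu.ofReal

theorem integrable_of_memLp {P : PFC} {u : ℝ × ℝ → ℝ} (hu : MemLp u 2 (volume.restrict P.Ω)) :
    Integrable u (volume.restrict P.Ω) :=
  have := P.isFiniteMeasure_Ω
  hu.integrable (by norm_num)

theorem area_pos {P : PFC} (hP : P.Admissible) : 0 < P.Lx * P.Ly := mul_pos hP.Lx_pos hP.Ly_pos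

theorem integrable_mul_conj_mode {P : PFC} {f : ℝ × ℝ → ℂ} (hf : Integrable f (volume.restrict P.Ω))
    (k : ℤ × ℤ) : Integrable (fun p => f p * Complex.exp
      (-(Complex.I * ((P.ξ k.1 * p.1 + P.η k.2 * p.2 : ℝ) : ℂ)))) (volume.restrict P.Ω) := by
  refine hf.mul_bdd (c := 1) (Continuous.aestronglyMeasurable (by fun_prop)) ?_
  refine Filter.Eventually.of_forall fun p => ?_
  rw [exp_neg_eq_conj_mode, RCLike.norm_conj, norm_mode]

theorem cf_add (P : PFC) {f g : ℝ × ℝ → ℂ} (hf : Integrable f (volume.restrict P.Ω))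
    (hg : Integrable g (volume.restrict P.Ω)) :
    P.cf (fun p => f p + g p) = P.cf f + P.cf g := by
  ext k
  simp only [cf, Pi.add_apply, add_mul]
  rw [integral_add (integrable_mul_conj_mode hf k) (integrable_mul_conj_mode hg k), mul_add]

theorem cf_const_mul (P : PFC) (c : ℂ) (f : ℝ × ℝ → ℂ) :
    P.cf (fun p => c * f p) = c • P.cf f := by
  ext k
  simp only [cf, Pi.smul_apply, smul_eq_mul, mul_assoc]
  rw [integral_const_mul]
  ring

theorem coeff_add {P : PFC} {u v : ℝ × ℝ → ℝ} (hu : Integrable u (volume.restrict P.Ω))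
    (hv : Integrable v (volume.restrict P.Ω)) :
    P.coeff (fun p => u p + v p) = P.coeff u + P.coeff v := by
  simp only [coeff_eq_cf, Complex.ofReal_add]
  exact P.cf_add hu.ofReal hv.ofReal

theorem coeff_const_mul (P : PFC) (c : ℝ) (u : ℝ × ℝ → ℝ) :
    P.coeff (fun p => c * u p) = (c : ℂ) • P.coeff u := by
  simp only [coeff_eq_cf, Complex.ofReal_mul]
  exact P.cf_const_mul _ _

theorem coeff_sub {P : PFC} {u v : ℝ × ℝ → ℝ} (hu : Integrable u (volume.restrict P.Ω))
    (hv : Integrable v (volume.restrict P.Ω)) :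
    P.coeff (fun p => u p - v p) = P.coeff u - P.coeff v := by
  have h := coeff_add hu (hv.const_mul (-1))
  rw [coeff_const_mul] at h
  simpa [sub_eq_add_neg] using h

theorem coeff_congr_ae {P : PFC} {u v : ℝ × ℝ → ℝ} (h : u =ᵐ[volume.restrict P.Ω] v) :
    P.coeff u = P.coeff v := by
  ext k
  simp only [coeff]
  congr 1
  refine integral_congr_ae ?_
  filter_upwards [h] with p hp
  rw [hp]

theorem coeff_neg (P : PFC) (u : ℝ × ℝ → ℝ) (k : ℤ × ℤ) :
    P.coeff u (-k) = conj (P.coeff u k) := by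
  simp only [coeff, map_mul, map_inv₀, Complex.conj_ofReal]
  congr 1
  rw [← integral_conj]
  refine integral_congr_ae (Filter.Eventually.of_forall fun p => ?_)
  beta_reduce
  simp only [map_mul, Complex.conj_ofReal]
  rw [P.exp_neg_eq_conj_mode (-k), P.exp_neg_eq_conj_mode k, mode_neg]

/-- Parseval's identity for real functions. -/
theorem hasSum_re_conj_coeff_mul_coeff {P : PFC} (hP : P.Admissible) {u v : ℝ × ℝ → ℝ}
    (hu : MemLp u 2 (volume.restrict P.Ω)) (hv : MemLp v 2 (volume.restrict P.Ω)) :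
    HasSum (fun k => P.Lx * P.Ly * (conj (P.coeff u k) * P.coeff v k).re) (P.ip u v) := by
  have h := P.hasSum_conj_cf_mul_cf hP (memLp_ofReal hu) (memLp_ofReal hv)
  have h2 := (RCLike.hasSum_re ℂ h).mul_left (P.Lx * P.Ly)
  have hA := (area_pos hP).ne'
  have e : P.Lx * P.Ly * RCLike.re (((P.Lx * P.Ly : ℝ) : ℂ)⁻¹ *
      ∫ p in P.Ω, conj (u p : ℂ) * (v p : ℂ)) = P.ip u v := by
    simp_rw [Complex.conj_ofReal, ← Complex.ofReal_mul]
    rw [integral_complex_ofReal, ← Complex.ofReal_inv, ← Complex.ofReal_mul]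
    rw [RCLike.re_to_complex, Complex.ofReal_re, mul_inv_cancel_left₀ hA, ip]
  rw [e] at h2
  exact h2

theorem ip_eq_tsum {P : PFC} (hP : P.Admissible) {u v : ℝ × ℝ → ℝ}
    (hu : MemLp u 2 (volume.restrict P.Ω)) (hv : MemLp v 2 (volume.restrict P.Ω)) :
    P.ip u v = P.Lx * P.Ly * ∑' k, (conj (P.coeff u k) * P.coeff v k).re := by
  rw [← (hasSum_re_conj_coeff_mul_coeff hP hu hv).tsum_eq, tsum_mul_left]

theorem sob_zero_eq {P : PFC} (c : ℤ × ℤ → ℂ) : P.sob 0 c = ∑' k, ‖c k‖ₑ ^ 2 := by simp [sob]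

/-- Parseval's identity for the norm. -/
theorem ofReal_ip_self {P : PFC} (hP : P.Admissible) {u : ℝ × ℝ → ℝ}
    (hu : MemLp u 2 (volume.restrict P.Ω)) :
    ENNReal.ofReal (P.ip u u) = ENNReal.ofReal (P.Lx * P.Ly) * P.sob 0 (P.coeff u) := by
  have h := hasSum_re_conj_coeff_mul_coeff hP hu hu
  have e : ∀ k, P.Lx * P.Ly * (conj (P.coeff u k) * P.coeff u k).re
      = P.Lx * P.Ly * ‖P.coeff u k‖ ^ 2 := fun k => by
    rw [mul_comm (conj _), Complex.mul_conj, Complex.ofReal_re, Complex.normSq_eq_norm_sq]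
  simp only [e] at h
  have hA := area_pos hP
  rw [← h.tsum_eq, ENNReal.ofReal_tsum_of_nonneg (fun k => by positivity) h.summable, sob_zero_eq,
    ← ENNReal.tsum_mul_left]
  refine tsum_congr fun k => ?_
  rw [ENNReal.ofReal_mul hA.le, ENNReal.ofReal_pow (norm_nonneg _), ofReal_norm]

theorem cf_mul_conj_mode (P : PFC) (f : ℝ × ℝ → ℂ) (k j : ℤ × ℤ) :
    P.cf (fun p => f p * conj (P.mode k p)) j = P.cf f (k + j) := by
  simp only [cf]
  congr 1
  refine integral_congr_ae (Filter.Eventually.of_forall fun p => ?_)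
  simp only
  rw [P.exp_neg_eq_conj_mode j, P.exp_neg_eq_conj_mode (k + j), mode_add, map_mul, mul_assoc]

/-- Parseval for u and v times a conjugate exponential: modulation shifts the coefficients of v by
k, so the inner product is the k-th coefficient of the product, written as a convolution. -/
theorem enorm_coeff_mul_le {P : PFC} (hP : P.Admissible) {u v : ℝ × ℝ → ℝ}
    (hu : MemLp u 2 (volume.restrict P.Ω)) (hv : MemLp v 2 (volume.restrict P.Ω)) (k : ℤ × ℤ) :
    ‖P.coeff (fun p => u p * v p) k‖ₑ ≤ ∑' j, ‖P.coeff u j‖ₑ * ‖P.coeff v (k + j)‖ₑ := by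
  have hv' : MemLp (fun p => (v p : ℂ) * conj (P.mode k p)) 2 (volume.restrict P.Ω) := by
    refine MemLp.of_le_mul (c := 1) hv (hv.ofReal.1.mul ?_) ?_
    · exact (Complex.continuous_conj.comp (P.continuous_mode k)).aestronglyMeasurable
    · refine Filter.Eventually.of_forall fun p => ?_
      rw [norm_mul, RCLike.norm_conj, norm_mode, Complex.norm_real, mul_one, one_mul]
  have h := P.hasSum_conj_cf_mul_cf hP (memLp_ofReal hu) hv'
  have e : P.coeff (fun p => u p * v p) k = ((P.Lx * P.Ly : ℝ) : ℂ)⁻¹ *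
      ∫ p in P.Ω, conj (u p : ℂ) * ((v p : ℂ) * conj (P.mode k p)) := by
    rw [coeff]
    congr 1
    refine integral_congr_ae (Filter.Eventually.of_forall fun p => ?_)
    simp only [Complex.conj_ofReal, Complex.ofReal_mul]
    rw [P.exp_neg_eq_conj_mode k, mul_assoc]
  rw [e, ← h.tsum_eq]
  refine enorm_tsum_le_tsum_enorm.trans (le_of_eq (tsum_congr fun j => ?_))
  rw [enorm_mul, cf_mul_conj_mode, RCLike.enorm_conj]
  rfl

theorem sob_coeff_mul_le {P : PFC} (hP : P.Admissible) {u v : ℝ × ℝ → ℝ}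
    (hu : MemLp u 2 (volume.restrict P.Ω)) (hv : MemLp v 2 (volume.restrict P.Ω)) (s p : ℕ)
    (hp : 2 ≤ p) (hps : s ≤ p) :
    P.sob s (P.coeff (fun x => u x * v x))
      ≤ P.mulConst s * (P.sob p (P.coeff u) * P.sob s (P.coeff v)) :=
  P.sob_le_of_convolution s p hp hps _ _ _ (enorm_coeff_mul_le hP hu hv)

/-! ### Absolutely convergent Fourier series -/

/-- The sum of the Fourier series with coefficients `c`. -/
def synth (P : PFC) (c : ℤ × ℤ → ℂ) (p : ℝ × ℝ) : ℂ := ∑' k, c k * P.mode k p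

theorem continuous_synth {P : PFC} {c : ℤ × ℤ → ℂ} (hc : Summable fun k => ‖c k‖) :
    Continuous (P.synth c) :=
  continuous_tsum (fun k => continuous_const.mul (P.continuous_mode k)) hc fun k p => by
    rw [norm_mul, norm_mode, mul_one]

theorem norm_synth_le {P : PFC} {c : ℤ × ℤ → ℂ} (hc : Summable fun k => ‖c k‖) (p : ℝ × ℝ) :
    ‖P.synth c p‖ ≤ ∑' k, ‖c k‖ := by
  have e : ∀ k, ‖c k * P.mode k p‖ = ‖c k‖ := fun k => by rw [norm_mul, norm_mode, mul_one]
  refine (norm_tsum_le_tsum_norm (by simpa only [e] using hc)).trans_eq (tsum_congr e)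

theorem memLp_synth {P : PFC} {c : ℤ × ℤ → ℂ} (hc : Summable fun k => ‖c k‖) (q : ℝ≥0∞) :
    MemLp (P.synth c) q (volume.restrict P.Ω) :=
  have := P.isFiniteMeasure_Ω
  MemLp.of_bound (continuous_synth hc).aestronglyMeasurable _
    (Filter.Eventually.of_forall (norm_synth_le hc))

section Torus

local instance : MeasureSpace UnitAddCircle := ⟨AddCircle.haarAddCircle⟩

theorem cf_mode {P : PFC} (hP : P.Admissible) (j k : ℤ × ℤ) :
    P.cf (P.mode j) k = if k = j then 1 else 0 := by
  have h := orthonormal_iff_ite.1 (UnitAddTorus.orthonormal_mFourier (d := Fin 2)) ![k.1, k.2]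
    ![j.1, j.2]
  rw [ContinuousMap.inner_toLp] at h
  have e := P.integral_comp_torusMap hP (f := fun p => P.mode j p * conj (P.mode k p))
    (Continuous.aestronglyMeasurable ((P.continuous_mode j).mul
      (Complex.continuous_conj.comp (P.continuous_mode k))))
  have e2 : P.cf (P.mode j) k = ((P.Lx * P.Ly : ℝ) : ℂ)⁻¹ *
      ∫ p in P.Ω, P.mode j p * conj (P.mode k p) := by
    simp only [cf]
    congr 1
    refine integral_congr_ae (Filter.Eventually.of_forall fun p => ?_)
    simp only
    rw [P.exp_neg_eq_conj_mode k]
  rw [e2, ← e]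
  have e3 : (![k.1, k.2] = ![j.1, j.2]) ↔ k = j := by
    rw [Prod.ext_iff]
    simp [funext_iff, Fin.forall_fin_two]
  rw [if_congr e3 rfl rfl] at h
  rw [← h]
  refine integral_congr_ae (Filter.Eventually.of_forall fun x => ?_)
  simp only [mFourier_eq_mode P hP]
  rfl

end Torus

theorem cf_synth {P : PFC} (hP : P.Admissible) {c : ℤ × ℤ → ℂ} (hc : Summable fun k => ‖c k‖) :
    P.cf (P.synth c) = c := by
  have := P.isFiniteMeasure_Ω
  ext k
  have hint : ∀ j, Integrable (fun p => c j * P.mode j p * conj (P.mode k p))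
      (volume.restrict P.Ω) := fun j => by
    refine Integrable.of_bound (C := ‖c j‖) (Continuous.aestronglyMeasurable
      ((continuous_const.mul (P.continuous_mode j)).mul
      (Complex.continuous_conj.comp (P.continuous_mode k)))) ?_
    refine Filter.Eventually.of_forall fun p => ?_
    rw [norm_mul, norm_mul, RCLike.norm_conj, norm_mode, norm_mode, mul_one, mul_one]
  have h := hasSum_integral_of_summable_integral_norm hint (by
    simp only [norm_mul, RCLike.norm_conj, norm_mode, mul_one, integral_const]
    exact hc.const_smul _)
  have e : ∀ j, ∫ p in P.Ω, c j * P.mode j p * conj (P.mode k p)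
      = ((P.Lx * P.Ly : ℝ) : ℂ) * (c j * if k = j then 1 else 0) := fun j => by
    have hA : ((P.Lx * P.Ly : ℝ) : ℂ) ≠ 0 := by exact_mod_cast (area_pos hP).ne'
    rw [← cf_mode hP, cf, mul_left_comm, mul_inv_cancel_left₀ hA, ← integral_const_mul]
    refine integral_congr_ae (Filter.Eventually.of_forall fun p => ?_)
    simp only
    rw [P.exp_neg_eq_conj_mode k, mul_assoc]
  simp only [e] at h
  have h2 := h.unique ((hasSum_ite_eq k (((P.Lx * P.Ly : ℝ) : ℂ) * c k)).congr_fun fun j => by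
    by_cases hj : k = j
    · subst hj; simp
    · rw [if_neg hj, if_neg (Ne.symm hj), mul_zero, mul_zero])
  have hA : ((P.Lx * P.Ly : ℝ) : ℂ) ≠ 0 := by exact_mod_cast (area_pos hP).ne'
  rw [cf]
  rw [inv_mul_eq_iff_eq_mul₀ hA, ← h2]
  refine integral_congr_ae (Filter.Eventually.of_forall fun p => ?_)
  simp only
  rw [synth, tsum_mul_right, P.exp_neg_eq_conj_mode k]

/-- Completeness of the exponentials, read off from Parseval's identity for the difference. -/
theorem ae_eq_of_cf_eq {P : PFC} (hP : P.Admissible) {f g : ℝ × ℝ → ℂ}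
    (hf : MemLp f 2 (volume.restrict P.Ω)) (hg : MemLp g 2 (volume.restrict P.Ω))
    (h : P.cf f = P.cf g) : f =ᵐ[volume.restrict P.Ω] g := by
  have := P.isFiniteMeasure_Ω
  have hd : MemLp (fun p => f p - g p) 2 (volume.restrict P.Ω) := hf.sub hg
  have h0 : P.cf (fun p => f p - g p) = 0 := by
    have h1 : P.cf (fun p => f p + (-1 : ℂ) * g p) = 0 := by
      rw [P.cf_add (hf.integrable (by norm_num)) ((hg.integrable (by norm_num)).const_mul _),
        cf_const_mul, h, neg_one_smul, add_neg_cancel]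
    simpa [sub_eq_add_neg] using h1
  have hs := P.hasSum_conj_cf_mul_cf hP hd hd
  rw [h0] at hs
  simp only [Pi.zero_apply, mul_zero] at hs
  have h2 := hs.unique hasSum_zero
  have hA : ((P.Lx * P.Ly : ℝ) : ℂ)⁻¹ ≠ 0 := by
    simpa using ⟨hP.Ly_pos.ne', hP.Lx_pos.ne'⟩
  have h3 := (mul_eq_zero.1 h2).resolve_left hA
  have e : ∀ p, conj (f p - g p) * (f p - g p) = ((‖f p - g p‖ ^ 2 : ℝ) : ℂ) := fun p => by
    rw [mul_comm, Complex.mul_conj, Complex.normSq_eq_norm_sq]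
  simp only [e] at h3
  rw [integral_complex_ofReal, Complex.ofReal_eq_zero, integral_eq_zero_iff_of_nonneg
    (fun p => by positivity) hd.norm.integrable_sq] at h3
  filter_upwards [h3] with p hp
  simpa [sub_eq_zero] using hp

/-! ### Calculus of the squared Sobolev norms -/

theorem sob_mono_exp (s t : ℕ) (h : s ≤ t) (c : ℤ × ℤ → ℂ) : P.sob s c ≤ P.sob t c :=
  ENNReal.tsum_le_tsum fun k => mul_le_mul_left
    (ENNReal.ofReal_le_ofReal (pow_le_pow_right₀ (P.one_le_wt k) h)) _

theorem sob_le_mul_of_norm_le (s : ℕ) {C : ℝ} (a b : ℤ × ℤ → ℂ)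
    (h : ∀ k, ‖a k‖ ≤ C * ‖b k‖) : P.sob s a ≤ ENNReal.ofReal (C ^ 2) * P.sob s b := by
  rw [sob, sob, ← ENNReal.tsum_mul_left]
  refine ENNReal.tsum_le_tsum fun k => ?_
  rw [mul_left_comm]
  refine mul_le_mul_right ?_ _
  rw [← ofReal_norm, ← ofReal_norm, ← ENNReal.ofReal_pow (norm_nonneg _),
    ← ENNReal.ofReal_pow (norm_nonneg _), ← ENNReal.ofReal_mul (sq_nonneg C), ← mul_pow]
  exact ENNReal.ofReal_le_ofReal (pow_le_pow_left₀ (norm_nonneg _) (h k) 2)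

theorem sob_le_of_norm_le (s : ℕ) (a b : ℤ × ℤ → ℂ) (h : ∀ k, ‖a k‖ ≤ ‖b k‖) :
    P.sob s a ≤ P.sob s b := by
  simpa using sob_le_mul_of_norm_le (P := P) s (C := 1) a b (by simpa using h)

theorem enorm_add_sq_le (a b : ℂ) : ‖a + b‖ₑ ^ 2 ≤ 2 * (‖a‖ₑ ^ 2 + ‖b‖ₑ ^ 2) := by
  simp only [← ofReal_norm]
  rw [← ENNReal.ofReal_pow (norm_nonneg _), ← ENNReal.ofReal_pow (norm_nonneg _),
    ← ENNReal.ofReal_pow (norm_nonneg _), ← ENNReal.ofReal_add (by positivity) (by positivity),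
    ← ENNReal.ofReal_ofNat 2, ← ENNReal.ofReal_mul (by norm_num)]
  refine ENNReal.ofReal_le_ofReal ?_
  nlinarith [norm_add_le a b, norm_nonneg (a + b), norm_nonneg a, norm_nonneg b,
    sq_nonneg (‖a‖ - ‖b‖)]

theorem sob_add_le (s : ℕ) (a b : ℤ × ℤ → ℂ) :
    P.sob s (a + b) ≤ 2 * (P.sob s a + P.sob s b) := by
  rw [sob, sob, sob, ← ENNReal.tsum_add, ← ENNReal.tsum_mul_left]
  refine ENNReal.tsum_le_tsum fun k => ?_
  rw [← mul_add, mul_left_comm]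
  exact mul_le_mul_right (enorm_add_sq_le _ _) _

theorem sob_smul (s : ℕ) (c : ℂ) (a : ℤ × ℤ → ℂ) : P.sob s (c • a) = ‖c‖ₑ ^ 2 * P.sob s a := by
  rw [sob, sob, ← ENNReal.tsum_mul_left]
  refine tsum_congr fun k => ?_
  rw [Pi.smul_apply, smul_eq_mul, enorm_mul, mul_pow, mul_left_comm]

theorem sob_neg (s : ℕ) (a : ℤ × ℤ → ℂ) : P.sob s (-a) = P.sob s a := by
  simp [sob]

theorem sob_sub_le (s : ℕ) (a b : ℤ × ℤ → ℂ) :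
    P.sob s (a - b) ≤ 2 * (P.sob s a + P.sob s b) := by
  rw [sub_eq_add_neg, ← sob_neg s b]
  exact sob_add_le s a (-b)

theorem sob_sub_comm (s : ℕ) (a b : ℤ × ℤ → ℂ) : P.sob s (a - b) = P.sob s (b - a) := by
  rw [← sob_neg, neg_sub]

theorem sob_zero (s : ℕ) : P.sob s 0 = 0 := by simp [sob]

/-- The embedding of H² into the absolutely convergent Fourier series, by Cauchy–Schwarz. It
supplies pointwise bounds and continuous representatives. -/
theorem tsum_enorm_sq_le (c : ℤ × ℤ → ℂ) : (∑' k, ‖c k‖ₑ) ^ 2 ≤ P.zetaTwo * P.sob 2 c := by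
  have h1 : ∀ k, ‖c k‖ₑ = ENNReal.ofReal (P.wt k)⁻¹ * (ENNReal.ofReal (P.wt k) * ‖c k‖ₑ) := by
    intro k
    have := P.wt_pos k
    rw [← mul_assoc, ← ENNReal.ofReal_mul (by positivity), inv_mul_cancel₀ this.ne',
      ENNReal.ofReal_one, one_mul]
  rw [tsum_congr h1]
  refine (ENNReal.tsum_mul_sq_le _ _).trans (le_of_eq ?_)
  congr 1
  · refine tsum_congr fun k => ?_
    have := P.wt_pos k
    rw [← ENNReal.ofReal_pow (by positivity), inv_pow]
  · refine tsum_congr fun k => ?_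
    rw [mul_pow, ← ENNReal.ofReal_pow (P.wt_pos k).le]

theorem summable_norm_of_tsum_enorm_lt_top {c : ℤ × ℤ → ℂ} (h : ∑' k, ‖c k‖ₑ < ⊤) :
    Summable fun k => ‖c k‖ := by
  have := ENNReal.summable_toReal h.ne
  simpa using this

theorem summable_norm_of_sob_two (hP : P.Admissible) {c : ℤ × ℤ → ℂ} (h : P.sob 2 c < ⊤) :
    Summable fun k => ‖c k‖ := by
  refine summable_norm_of_tsum_enorm_lt_top ?_
  have h1 := (tsum_enorm_sq_le (P := P) c).trans_lt (ENNReal.mul_lt_top (P.zetaTwo_lt_top hP) h)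
  by_contra hc
  rw [not_lt, top_le_iff] at hc
  rw [hc] at h1
  simp at h1

/-! ### The algebra of functions with coefficients in `H²` -/

/-- The square integrable functions on the period cell whose coefficients lie in `H²_per`. -/
structure Good (P : PFC) (u : ℝ × ℝ → ℝ) : Prop where
  memLp : MemLp u 2 (volume.restrict P.Ω)
  sob_lt_top : P.sob 2 (P.coeff u) < ⊤

theorem Good.integrable {u : ℝ × ℝ → ℝ} (hu : P.Good u) : Integrable u (volume.restrict P.Ω) :=
  integrable_of_memLp hu.memLp

theorem Good.ae_eq_synth (hP : P.Admissible) {u : ℝ × ℝ → ℝ} (hu : P.Good u) :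
    (fun p => (u p : ℂ)) =ᵐ[volume.restrict P.Ω] P.synth (P.coeff u) := by
  have hs := summable_norm_of_sob_two hP hu.sob_lt_top
  exact ae_eq_of_cf_eq hP (memLp_ofReal hu.memLp) (memLp_synth hs 2) (by rw [cf_synth hP hs]; rfl)

theorem Good.ae_bound (hP : P.Admissible) {u : ℝ × ℝ → ℝ} (hu : P.Good u) :
    ∃ B : ℝ, ∀ᵐ p ∂(volume.restrict P.Ω), ‖u p‖ ≤ B := by
  refine ⟨∑' k, ‖P.coeff u k‖, ?_⟩
  filter_upwards [hu.ae_eq_synth hP] with p hp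
  rw [← Complex.norm_real, hp]
  exact norm_synth_le (summable_norm_of_sob_two hP hu.sob_lt_top) p

theorem Good.memLp_mul (hP : P.Admissible) {u v : ℝ × ℝ → ℝ} (hu : P.Good u)
    (hv : MemLp v 2 (volume.restrict P.Ω)) :
    MemLp (fun p => u p * v p) 2 (volume.restrict P.Ω) := by
  obtain ⟨B, hB⟩ := hu.ae_bound hP
  refine MemLp.of_le_mul (c := B) hv (hu.memLp.1.mul hv.1) ?_
  filter_upwards [hB] with p hp
  rw [norm_mul]
  exact mul_le_mul_of_nonneg_right hp (norm_nonneg _)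

theorem Good.mul (hP : P.Admissible) {u v : ℝ × ℝ → ℝ} (hu : P.Good u) (hv : P.Good v) :
    P.Good (fun p => u p * v p) :=
  ⟨hu.memLp_mul hP hv.memLp, (sob_coeff_mul_le hP hu.memLp hv.memLp 2 2 le_rfl le_rfl).trans_lt
    (ENNReal.mul_lt_top (P.mulConst_lt_top hP 2) (ENNReal.mul_lt_top hu.sob_lt_top hv.sob_lt_top))⟩

theorem Good.add {u v : ℝ × ℝ → ℝ} (hu : P.Good u) (hv : P.Good v) :
    P.Good (fun p => u p + v p) := by
  refine ⟨hu.memLp.add hv.memLp, ?_⟩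
  rw [coeff_add hu.integrable hv.integrable]
  refine (sob_add_le 2 _ _).trans_lt (ENNReal.mul_lt_top (by simp) ?_)
  exact ENNReal.add_lt_top.2 ⟨hu.sob_lt_top, hv.sob_lt_top⟩

theorem Good.sub {u v : ℝ × ℝ → ℝ} (hu : P.Good u) (hv : P.Good v) :
    P.Good (fun p => u p - v p) := by
  refine ⟨hu.memLp.sub hv.memLp, ?_⟩
  rw [coeff_sub hu.integrable hv.integrable]
  refine (sob_sub_le 2 _ _).trans_lt (ENNReal.mul_lt_top (by simp) ?_)
  exact ENNReal.add_lt_top.2 ⟨hu.sob_lt_top, hv.sob_lt_top⟩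

theorem Good.const_mul {u : ℝ × ℝ → ℝ} (hu : P.Good u) (c : ℝ) : P.Good (fun p => c * u p) := by
  refine ⟨hu.memLp.const_mul c, ?_⟩
  rw [coeff_const_mul, sob_smul]
  exact ENNReal.mul_lt_top (by simp) hu.sob_lt_top

theorem sob_coeff_add_le (s : ℕ) {u v : ℝ × ℝ → ℝ} (hu : P.Good u) (hv : P.Good v) :
    P.sob s (P.coeff fun p => u p + v p) ≤ 2 * (P.sob s (P.coeff u) + P.sob s (P.coeff v)) := by
  rw [coeff_add hu.integrable hv.integrable]
  exact sob_add_le s _ _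

theorem sob_coeff_sub_le (s : ℕ) {u v : ℝ × ℝ → ℝ} (hu : P.Good u) (hv : P.Good v) :
    P.sob s (P.coeff fun p => u p - v p) ≤ 2 * (P.sob s (P.coeff u) + P.sob s (P.coeff v)) := by
  rw [coeff_sub hu.integrable hv.integrable]
  exact sob_sub_le s _ _

theorem sob_coeff_const_mul (s : ℕ) (c : ℝ) (u : ℝ × ℝ → ℝ) :
    P.sob s (P.coeff fun p => c * u p) = ENNReal.ofReal (c ^ 2) * P.sob s (P.coeff u) := by
  rw [coeff_const_mul, sob_smul, ← ofReal_norm, Complex.norm_real, Real.norm_eq_abs,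
    ← ENNReal.ofReal_pow (abs_nonneg c), sq_abs]

theorem Good.dF (hP : P.Admissible) {u : ℝ × ℝ → ℝ} (hu : P.Good u) :
    P.Good (fun p => P.dF (u p)) := by
  have h := (((hu.mul hP hu).mul hP hu).sub (hu.const_mul (P.ε + P.lam)))
  convert h using 2 with p
  simp only [PFC.dF]; ring

/-- Boundedness of the triple product. -/
theorem sob_coeff_mul_mul_le (hP : P.Admissible) {u v w : ℝ × ℝ → ℝ} (hu : P.Good u)
    (hv : P.Good v) (hw : MemLp w 2 (volume.restrict P.Ω)) (s p : ℕ) (hp : 2 ≤ p) (hps : s ≤ p) :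
    P.sob s (P.coeff fun x => u x * (v x * w x)) ≤ P.mulConst s * P.mulConst s *
      (P.sob p (P.coeff u) * P.sob p (P.coeff v) * P.sob s (P.coeff w)) := by
  refine (sob_coeff_mul_le hP hu.memLp (hv.memLp_mul hP hw) s p hp hps).trans ?_
  refine (mul_le_mul_right (mul_le_mul_right (sob_coeff_mul_le hP hv.memLp hw s p hp hps) _)
    _).trans (le_of_eq (by ring))

/-- Local Lipschitz continuity of `u ↦ F'(u)` in Sobolev spaces. -/
theorem exists_sob_dF_sub_le (hP : P.Admissible) (s p : ℕ) (hp : 2 ≤ p) (hps : s ≤ p)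
    {B : ℝ≥0∞} (hB : B ≠ ⊤) : ∃ C : ℝ≥0∞, C ≠ ⊤ ∧ ∀ u v : ℝ × ℝ → ℝ, P.Good u → P.Good v →
      P.sob p (P.coeff u) ≤ B → P.sob p (P.coeff v) ≤ B →
      P.sob s (P.coeff fun x => P.dF (u x) - P.dF (v x))
        ≤ C * P.sob s (P.coeff fun x => u x - v x) := by
  have hm := (P.mulConst_lt_top hP s).ne
  refine ⟨2 * (2 * (2 * (P.mulConst s * P.mulConst s * (B * B) +
    P.mulConst s * P.mulConst s * (B * B)) + P.mulConst s * P.mulConst s * (B * B)) +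
    ENNReal.ofReal ((P.ε + P.lam) ^ 2)), by finiteness, fun u v hu hv hBu hBv => ?_⟩
  have hd := hu.sub hv
  -- The factorization u³ - v³ = (u² + uv + v²)(u - v); in each product the difference is placed
  -- last, so that only this factor is measured in the weak norm.
  have e : (fun x => P.dF (u x) - P.dF (v x)) = fun x => ((u x * (u x * (u x - v x)) +
      u x * (v x * (u x - v x))) + v x * (v x * (u x - v x))) - (P.ε + P.lam) * (u x - v x) := by
    ext x; simp only [PFC.dF]; ring
  have g1 := hu.mul hP (hu.mul hP hd)
  have g2 := hu.mul hP (hv.mul hP hd)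
  have g3 := hv.mul hP (hv.mul hP hd)
  rw [e]
  refine (sob_coeff_sub_le s ((g1.add g2).add g3) (hd.const_mul _)).trans ?_
  rw [sob_coeff_const_mul, mul_assoc, add_mul]
  gcongr
  refine (sob_coeff_add_le s (g1.add g2) g3).trans ?_
  rw [mul_assoc, add_mul]
  gcongr
  · refine (sob_coeff_add_le s g1 g2).trans ?_
    rw [mul_assoc, add_mul]
    gcongr
    · refine (sob_coeff_mul_mul_le hP hu hu hd.memLp s p hp hps).trans ?_
      rw [mul_assoc _ (B * B)]
      gcongr
    · refine (sob_coeff_mul_mul_le hP hu hv hd.memLp s p hp hps).trans ?_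
      rw [mul_assoc _ (B * B)]
      gcongr
  · refine (sob_coeff_mul_mul_le hP hv hv hd.memLp s p hp hps).trans ?_
    rw [mul_assoc _ (B * B)]
    gcongr

theorem coeff_zero_fun (P : PFC) : P.coeff (fun _ => 0) = 0 := by
  ext k; simp [coeff]

theorem good_zero (P : PFC) : P.Good (fun _ => 0) := ⟨MemLp.zero, by simp [coeff_zero_fun, sob_zero]⟩

theorem exists_sob_dF_le (hP : P.Admissible) (s p : ℕ) (hp : 2 ≤ p) (hps : s ≤ p)
    {B : ℝ≥0∞} (hB : B ≠ ⊤) : ∃ C : ℝ≥0∞, C ≠ ⊤ ∧ ∀ u : ℝ × ℝ → ℝ, P.Good u →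
      P.sob p (P.coeff u) ≤ B → P.sob s (P.coeff fun x => P.dF (u x)) ≤ C * P.sob s (P.coeff u) := by
  obtain ⟨C, hC, h⟩ := exists_sob_dF_sub_le hP s p hp hps hB
  refine ⟨C, hC, fun u hu hBu => ?_⟩
  have := h u (fun _ => 0) hu P.good_zero hBu (by simp [coeff_zero_fun, sob_zero])
  simpa [PFC.dF] using this

/-! ### Scalar products -/

theorem ofReal_ip_sq_le (hP : P.Admissible) {u v : ℝ × ℝ → ℝ}
    (hu : MemLp u 2 (volume.restrict P.Ω)) (hv : MemLp v 2 (volume.restrict P.Ω)) :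
    ENNReal.ofReal (P.ip u v ^ 2) ≤ ENNReal.ofReal ((P.Lx * P.Ly) ^ 2) *
      (P.sob 0 (P.coeff u) * P.sob 0 (P.coeff v)) := by
  have h := hasSum_re_conj_coeff_mul_coeff hP hu hv
  have hA := area_pos hP
  have h1 : ‖P.ip u v‖ₑ ≤ ENNReal.ofReal (P.Lx * P.Ly) *
      ∑' k, ‖P.coeff u k‖ₑ * ‖P.coeff v k‖ₑ := by
    rw [← h.tsum_eq, ← ENNReal.tsum_mul_left]
    refine enorm_tsum_le_tsum_enorm.trans (ENNReal.tsum_le_tsum fun k => ?_)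
    rw [enorm_mul, Real.enorm_of_nonneg hA.le]
    refine mul_le_mul_right ?_ _
    rw [← enorm_mul, ← ofReal_norm, ← ofReal_norm]
    refine ENNReal.ofReal_le_ofReal ((Complex.abs_re_le_norm _).trans (le_of_eq ?_))
    rw [norm_mul, norm_mul, RCLike.norm_conj]
  have h2 : ENNReal.ofReal (P.ip u v ^ 2) = ‖P.ip u v‖ₑ ^ 2 := by
    rw [← ofReal_norm, ← ENNReal.ofReal_pow (norm_nonneg _), Real.norm_eq_abs, sq_abs]
  rw [h2]
  refine (pow_le_pow_left' h1 2).trans ?_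
  rw [mul_pow, ← ENNReal.ofReal_pow hA.le, sob_zero_eq, sob_zero_eq]
  exact mul_le_mul_right (ENNReal.tsum_mul_sq_le _ _) _

theorem ofReal_add_sq_le (x y : ℝ) : ENNReal.ofReal ((x + y) ^ 2)
    ≤ 2 * (ENNReal.ofReal (x ^ 2) + ENNReal.ofReal (y ^ 2)) := by
  rw [← ENNReal.ofReal_add (by positivity) (by positivity), ← ENNReal.ofReal_ofNat 2,
    ← ENNReal.ofReal_mul (by norm_num)]
  exact ENNReal.ofReal_le_ofReal (by nlinarith [sq_nonneg (x - y)])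

theorem ofReal_mul_sq (x y : ℝ) : ENNReal.ofReal ((x * y) ^ 2)
    = ENNReal.ofReal (x ^ 2) * ENNReal.ofReal (y ^ 2) := by
  rw [mul_pow, ENNReal.ofReal_mul (by positivity)]

theorem ofReal_sq_le_of_abs_le {x y : ℝ} (h : |x| ≤ |y|) :
    ENNReal.ofReal (x ^ 2) ≤ ENNReal.ofReal (y ^ 2) :=
  ENNReal.ofReal_le_ofReal (sq_le_sq.2 h)

/-! ### The energy `E₁` -/

theorem volume_Ω (hP : P.Admissible) : (volume : Measure (ℝ × ℝ)).real P.Ω = P.Lx * P.Ly := by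
  rw [Measure.real, Ω, Measure.volume_eq_prod, Measure.prod_prod, Real.volume_Ioo, Real.volume_Ioo,
    ENNReal.toReal_mul, ENNReal.toReal_ofReal (by linarith [hP.Lx_pos]),
    ENNReal.toReal_ofReal (by linarith [hP.Ly_pos])]
  ring

/-- The minimum of `E₁`. -/
def e1Low (P : PFC) : ℝ := P.C₀ - P.Lx * P.Ly * ((P.ε + P.lam) ^ 2 / 4)

/-- The constant √(ε + λ) minimizes F pointwise, and its energy is exactly `e1Low`. Positivity of E₁
on this one function thus gives a positive lower bound of E₁ on all functions, which makes every
division by √E₁ uniform. -/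
theorem e1Low_pos (hP : P.Admissible) : 0 < P.e1Low := by
  have := P.isFiniteMeasure_Ω
  have h := hP.E1_pos (fun _ => √(P.ε + P.lam)) (memLp_const _)
  have ha : 0 ≤ P.ε + P.lam := by linarith [hP.ε_pos, hP.lam_pos]
  have e : P.F (√(P.ε + P.lam)) = - ((P.ε + P.lam) ^ 2 / 4) := by
    have h4 : √(P.ε + P.lam) ^ 4 = (P.ε + P.lam) ^ 2 := by
      rw [show 4 = 2 * 2 from rfl, pow_mul, Real.sq_sqrt ha]
    rw [F, h4, Real.sq_sqrt ha]; ring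
  rw [E1, e, integral_const, measureReal_restrict_apply_univ, volume_Ω hP, smul_eq_mul] at h
  unfold e1Low
  linarith

theorem e1Low_le (hP : P.Admissible) (v : ℝ × ℝ → ℝ) : P.e1Low ≤ P.E1 v := by
  have := P.isFiniteMeasure_Ω
  have hA := area_pos hP
  unfold e1Low E1
  by_cases hi : Integrable (fun p => P.F (v p)) (volume.restrict P.Ω)
  · have h := integral_mono (integrable_const (-((P.ε + P.lam) ^ 2 / 4))) hi (fun p => by
      simp only [F]
      nlinarith [sq_nonneg (v p ^ 2 - (P.ε + P.lam))])
    rw [integral_const, measureReal_restrict_apply_univ, volume_Ω hP, smul_eq_mul] at h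
    linarith
  -- If F(v) is not integrable its integral is 0 by convention, so E₁ v = C₀, and the bound still
  -- holds.
  · rw [integral_undef hi]
    nlinarith [mul_nonneg hA.le (sq_nonneg (P.ε + P.lam))]

theorem E1_pos (hP : P.Admissible) (v : ℝ × ℝ → ℝ) : 0 < P.E1 v :=
  (e1Low_pos hP).trans_le (e1Low_le hP v)

theorem sqrt_e1Low_le (hP : P.Admissible) (v : ℝ × ℝ → ℝ) : √P.e1Low ≤ √(P.E1 v) :=
  Real.sqrt_le_sqrt (e1Low_le hP v)

theorem sqrt_E1_pos (hP : P.Admissible) (v : ℝ × ℝ → ℝ) : 0 < √(P.E1 v) :=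
  Real.sqrt_pos.2 (E1_pos hP v)

theorem Good.integrable_F (hP : P.Admissible) {u : ℝ × ℝ → ℝ} (hu : P.Good u) :
    Integrable (fun p => P.F (u p)) (volume.restrict P.Ω) := by
  have h := ((((hu.mul hP hu).mul hP (hu.mul hP hu)).const_mul (1 / 4)).sub
    ((hu.mul hP hu).const_mul ((P.ε + P.lam) / 2))).integrable
  convert h using 2 with p
  simp only [F]; ring

/-- F(u) - F(v) is u - v times a polynomial that stays bounded in H², so the energy is Lipschitz
already with respect to the L² norm. -/
theorem exists_E1_sub_le (hP : P.Admissible) {B : ℝ≥0∞} (hB : B ≠ ⊤) :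
    ∃ C : ℝ≥0∞, C ≠ ⊤ ∧ ∀ u v : ℝ × ℝ → ℝ, P.Good u → P.Good v →
      P.sob 2 (P.coeff u) ≤ B → P.sob 2 (P.coeff v) ≤ B →
      ENNReal.ofReal ((P.E1 u - P.E1 v) ^ 2) ≤ C * P.sob 0 (P.coeff fun x => u x - v x) := by
  have hm := (P.mulConst_lt_top hP 2).ne
  refine ⟨ENNReal.ofReal ((P.Lx * P.Ly) ^ 2) * (2 *
    (ENNReal.ofReal ((1 / 4) ^ 2) * (P.mulConst 2 * ((2 * (B + B)) *
      (2 * (P.mulConst 2 * (B * B) + P.mulConst 2 * (B * B))))) +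
    ENNReal.ofReal (((P.ε + P.lam) / 2) ^ 2) * (2 * (B + B)))), by finiteness,
    fun u v hu hv hBu hBv => ?_⟩
  have hd := hu.sub hv
  have h1 := hu.add hv
  have h2 := (hu.mul hP hu).add (hv.mul hP hv)
  have hq := ((h1.mul hP h2).const_mul (1 / 4)).sub (h1.const_mul ((P.ε + P.lam) / 2))
  have e : P.E1 u - P.E1 v = P.ip (fun x => 1 / 4 * ((u x + v x) * (u x * u x + v x * v x)) -
      (P.ε + P.lam) / 2 * (u x + v x)) (fun x => u x - v x) := by
    rw [E1, E1, add_sub_add_right_eq_sub, ← integral_sub (hu.integrable_F hP) (hv.integrable_F hP),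
      ip]
    congr 1; ext x; simp only [F]; ring
  rw [e]
  refine (ofReal_ip_sq_le hP hq.memLp hd.memLp).trans ?_
  rw [mul_assoc]
  gcongr
  refine (sob_mono_exp 0 2 (by norm_num) _).trans ?_
  have hb1 : P.sob 2 (P.coeff fun x => u x + v x) ≤ 2 * (B + B) :=
    (sob_coeff_add_le 2 hu hv).trans (by gcongr)
  refine (sob_coeff_sub_le 2 ((h1.mul hP h2).const_mul _) (h1.const_mul _)).trans ?_
  rw [sob_coeff_const_mul, sob_coeff_const_mul]
  gcongr
  refine (sob_coeff_mul_le hP h1.memLp h2.memLp 2 2 le_rfl le_rfl).trans ?_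
  gcongr
  refine (sob_coeff_add_le 2 (hu.mul hP hu) (hv.mul hP hv)).trans ?_
  gcongr
  · refine (sob_coeff_mul_le hP hu.memLp hu.memLp 2 2 le_rfl le_rfl).trans ?_
    gcongr
  · refine (sob_coeff_mul_le hP hv.memLp hv.memLp 2 2 le_rfl le_rfl).trans ?_
    gcongr

/-- In the symmetric second difference the terms of odd order in d cancel, and every remaining term
contains d twice. The squared quantity is therefore of fourth order in d. -/
theorem exists_E1_second_difference_le (hP : P.Admissible) {B : ℝ≥0∞} (hB : B ≠ ⊤) :
    ∃ C : ℝ≥0∞, C ≠ ⊤ ∧ ∀ m d : ℝ × ℝ → ℝ, P.Good m → P.Good d →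
      P.sob 2 (P.coeff m) ≤ B → P.sob 2 (P.coeff d) ≤ B →
      ENNReal.ofReal ((P.E1 (fun x => m x + d x) + P.E1 (fun x => m x - d x) - 2 * P.E1 m) ^ 2)
        ≤ C * P.sob 0 (P.coeff d) ^ 2 := by
  have hm := (P.mulConst_lt_top hP 0).ne
  refine ⟨ENNReal.ofReal ((P.Lx * P.Ly) ^ 2) * (2 * (2 * (ENNReal.ofReal (3 ^ 2) *
    (P.mulConst 0 * P.mulConst 0 * (B * B)) + ENNReal.ofReal ((1 / 2) ^ 2) *
    (P.mulConst 0 * P.mulConst 0 * (B * B))) + ENNReal.ofReal ((P.ε + P.lam) ^ 2))),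
    by finiteness, fun m d hm hd hBm hBd => ?_⟩
  have g1 := (hm.mul hP (hm.mul hP hd)).const_mul 3
  have g2 := (hd.mul hP (hd.mul hP hd)).const_mul (1 / 2)
  have g3 := hd.const_mul (P.ε + P.lam)
  have e : P.E1 (fun x => m x + d x) + P.E1 (fun x => m x - d x) - 2 * P.E1 m
      = P.ip d (fun x => (3 * (m x * (m x * d x)) + 1 / 2 * (d x * (d x * d x)))
        - (P.ε + P.lam) * d x) := by
    have e1 : P.E1 (fun x => m x + d x) + P.E1 (fun x => m x - d x) - 2 * P.E1 m
      = ((∫ p in P.Ω, P.F (m p + d p)) + ∫ p in P.Ω, P.F (m p - d p)) -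
        ∫ p in P.Ω, 2 * P.F (m p) := by
      rw [integral_const_mul]; simp only [E1]; ring
    have i1 : Integrable (fun p => P.F (m p + d p) + P.F (m p - d p)) (volume.restrict P.Ω) :=
      ((hm.add hd).integrable_F hP).add ((hm.sub hd).integrable_F hP)
    rw [e1, ← integral_add ((hm.add hd).integrable_F hP) ((hm.sub hd).integrable_F hP),
      ← integral_sub i1 ((hm.integrable_F hP).const_mul 2), ip]
    congr 1; ext x; simp only [F]; ring
  rw [e]
  refine (ofReal_ip_sq_le hP hd.memLp ((g1.add g2).sub g3).memLp).trans ?_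
  rw [mul_assoc, sq (P.sob 0 _), mul_left_comm (2 * _)]
  gcongr
  refine (sob_coeff_sub_le 0 (g1.add g2) g3).trans ?_
  rw [mul_assoc, add_mul, sob_coeff_const_mul]
  gcongr
  refine (sob_coeff_add_le 0 g1 g2).trans ?_
  rw [mul_assoc, add_mul, sob_coeff_const_mul, sob_coeff_const_mul,
    mul_assoc (ENNReal.ofReal (3 ^ 2)), mul_assoc (ENNReal.ofReal ((1 / 2) ^ 2))]
  gcongr
  · refine (sob_coeff_mul_mul_le hP hm hm hd.memLp 0 2 le_rfl (by norm_num)).trans ?_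
    rw [mul_assoc _ (B * B)]
    gcongr
  · refine (sob_coeff_mul_mul_le hP hd hd hd.memLp 0 2 le_rfl (by norm_num)).trans ?_
    rw [mul_assoc _ (B * B)]
    gcongr

/-- An exact central Taylor formula: F has degree four, so only the terms linear and cubic in d
survive. -/
theorem E1_first_difference (hP : P.Admissible) {m d : ℝ × ℝ → ℝ} (hm : P.Good m)
    (hd : P.Good d) : P.E1 (fun x => m x + d x) - P.E1 (fun x => m x - d x)
      = 2 * (P.ip (fun x => P.dF (m x)) d + P.ip (fun x => m x * d x) fun x => d x * d x) := by
  have i1 : Integrable (fun x => P.dF (m x) * d x) (volume.restrict P.Ω) :=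
    ((hm.dF hP).mul hP hd).integrable
  have i2 : Integrable (fun x => m x * d x * (d x * d x)) (volume.restrict P.Ω) :=
    ((hm.mul hP hd).mul hP (hd.mul hP hd)).integrable
  rw [E1, E1, add_sub_add_right_eq_sub, ← integral_sub ((hm.add hd).integrable_F hP)
    ((hm.sub hd).integrable_F hP), ip, ip, ← integral_add i1 i2, ← integral_const_mul]
  congr 1; ext x; simp only [F, PFC.dF]; ring

/-- Lipschitz bound for the square root on `[ρ², ∞)`. -/
theorem abs_sqrt_sub_sqrt_le {ρ x y : ℝ} (hρ : 0 < ρ) (hx : ρ ≤ √x) (hy : ρ ≤ √y) :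
    |√x - √y| ≤ |(2 * ρ)⁻¹ * (x - y)| := by
  have hx0 : 0 ≤ x := by
    by_contra h; rw [Real.sqrt_eq_zero_of_nonpos (by linarith)] at hx; linarith
  have hy0 : 0 ≤ y := by
    by_contra h; rw [Real.sqrt_eq_zero_of_nonpos (by linarith)] at hy; linarith
  have e : x - y = (√x - √y) * (√x + √y) := by
    nlinarith [Real.sq_sqrt hx0, Real.sq_sqrt hy0]
  rw [e, mul_left_comm, abs_mul]
  refine le_mul_of_one_le_right (abs_nonneg _) ?_
  rw [abs_of_nonneg (by positivity), ← div_eq_inv_mul, le_div_iff₀ (by positivity)]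
  linarith

theorem exists_sqrt_E1_sub_le (hP : P.Admissible) {B : ℝ≥0∞} (hB : B ≠ ⊤) :
    ∃ C : ℝ≥0∞, C ≠ ⊤ ∧ ∀ u v : ℝ × ℝ → ℝ, P.Good u → P.Good v →
      P.sob 2 (P.coeff u) ≤ B → P.sob 2 (P.coeff v) ≤ B →
      ENNReal.ofReal ((√(P.E1 u) - √(P.E1 v)) ^ 2) ≤ C * P.sob 0 (P.coeff fun x => u x - v x) := by
  obtain ⟨C, hC, h⟩ := exists_E1_sub_le hP hB
  have hρ := Real.sqrt_pos.2 (e1Low_pos hP)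
  refine ⟨ENNReal.ofReal ((2 * √P.e1Low)⁻¹ ^ 2) * C, by finiteness, fun u v hu hv hBu hBv => ?_⟩
  refine (ofReal_sq_le_of_abs_le (abs_sqrt_sub_sqrt_le hρ (sqrt_e1Low_le hP u)
    (sqrt_e1Low_le hP v))).trans ?_
  rw [ofReal_mul_sq, mul_assoc]
  gcongr
  exact h u v hu hv hBu hBv

/-- The average of two square roots against the square root of a third number. -/
theorem abs_average_sqrt_sub_le {ρ p q z : ℝ} (hρ : 0 < ρ) (hp : ρ ≤ √p) (hq : ρ ≤ √q)
    (hz : ρ ≤ √z) : |(√q + √p) / 2 - √z| ≤ (4 * ρ)⁻¹ * |p + q - 2 * z|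
      + (16 * ρ ^ 3)⁻¹ * |(q - z) * (p - q)| := by
  have hp0 : 0 ≤ p := by
    by_contra h; rw [Real.sqrt_eq_zero_of_nonpos (by linarith)] at hp; linarith
  have hq0 : 0 ≤ q := by
    by_contra h; rw [Real.sqrt_eq_zero_of_nonpos (by linarith)] at hq; linarith
  have hz0 : 0 ≤ z := by
    by_contra h; rw [Real.sqrt_eq_zero_of_nonpos (by linarith)] at hz; linarith
  obtain ⟨a, ha⟩ : ∃ a, a = √p := ⟨_, rfl⟩
  obtain ⟨b, hb⟩ : ∃ b, b = √q := ⟨_, rfl⟩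
  obtain ⟨c, hc⟩ : ∃ c, c = √z := ⟨_, rfl⟩
  have ep : p = a ^ 2 := by rw [ha, Real.sq_sqrt hp0]
  have eq : q = b ^ 2 := by rw [hb, Real.sq_sqrt hq0]
  have ez : z = c ^ 2 := by rw [hc, Real.sq_sqrt hz0]
  rw [← ha] at hp ⊢; rw [← hb] at hq ⊢; rw [← hc] at hz ⊢
  -- Both summands are quadratically small when p and q are the energies at m ± d and z is the
  -- energy at m: the first contains a second difference, the second a product of two first
  -- differences.
  have h1 : (b + a) / 2 - c = (2 * (a + c))⁻¹ * (p + q - 2 * z) +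
      (2 * ((a + c) * (b + c) * (a + b)))⁻¹ * ((q - z) * (p - q)) := by
    have := (show 0 < a + c by linarith).ne'
    have := (show 0 < b + c by linarith).ne'
    have := (show 0 < a + b by linarith).ne'
    rw [ep, eq, ez]
    field_simp
    ring
  rw [h1]
  refine (abs_add_le _ _).trans (add_le_add ?_ ?_)
  · rw [abs_mul, abs_of_nonneg (inv_nonneg.2 (by linarith))]
    exact mul_le_mul_of_nonneg_right (inv_anti₀ (by positivity) (by linarith)) (abs_nonneg _)
  · have h4 : (2 * ρ) * (2 * ρ) ≤ (a + c) * (b + c) :=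
      mul_le_mul (by linarith) (by linarith) (by linarith) (by linarith)
    have h3 : (2 * ρ) * (2 * ρ) * (2 * ρ) ≤ (a + c) * (b + c) * (a + b) :=
      mul_le_mul h4 (by linarith) (by linarith) ((by positivity : 0 ≤ 2 * ρ * (2 * ρ)).trans h4)
    have h5 : 0 < ρ ^ 3 := by positivity
    have h6 : 2 * ρ * (2 * ρ) * (2 * ρ) = 8 * ρ ^ 3 := by ring
    rw [abs_mul, abs_of_nonneg (inv_nonneg.2 (by linarith))]
    exact mul_le_mul_of_nonneg_right (inv_anti₀ (by positivity) (by linarith)) (abs_nonneg _)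

/-! ### Consistency of the extrapolated nonlinear terms -/

/-- `½(√E₁(m-d) + √E₁(m+d))` against `√E₁(w)`. -/
theorem exists_average_sav_sub_le (hP : P.Admissible) {B : ℝ≥0∞} (hB : B ≠ ⊤) :
    ∃ C : ℝ≥0∞, C ≠ ⊤ ∧ ∀ m d w : ℝ × ℝ → ℝ, P.Good m → P.Good d → P.Good w →
      P.sob 2 (P.coeff m) ≤ B → P.sob 2 (P.coeff d) ≤ B → P.sob 2 (P.coeff w) ≤ B →
      ENNReal.ofReal (((√(P.E1 fun x => m x - d x) + √(P.E1 fun x => m x + d x)) / 2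
        - √(P.E1 w)) ^ 2) ≤
      C * (P.sob 0 (P.coeff fun x => w x - m x) + P.sob 0 (P.coeff d) ^ 2) := by
  have hB2 : 2 * (B + B) ≠ ⊤ := by finiteness
  obtain ⟨C1, hC1, h1⟩ := exists_sqrt_E1_sub_le hP hB
  obtain ⟨C2, hC2, h2⟩ := exists_E1_second_difference_le hP hB
  obtain ⟨C3, hC3, h3⟩ := exists_E1_sub_le hP hB2
  have hρ := Real.sqrt_pos.2 (e1Low_pos hP)
  obtain ⟨ρ, hρe⟩ : ∃ ρ, ρ = √P.e1Low := ⟨_, rfl⟩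
  refine ⟨2 * (C1 + 2 * (ENNReal.ofReal ((4 * ρ)⁻¹ ^ 2) * C2 + ENNReal.ofReal ((16 * ρ ^ 3)⁻¹ ^ 2)
    * (C3 * (C3 * 4)))), by finiteness, fun m d w hm hd hw hBm hBd hBw => ?_⟩
  obtain ⟨p, hp⟩ : ∃ p, p = P.E1 fun x => m x + d x := ⟨_, rfl⟩
  obtain ⟨q, hq⟩ : ∃ q, q = P.E1 fun x => m x - d x := ⟨_, rfl⟩
  have hBp : P.sob 2 (P.coeff fun x => m x + d x) ≤ 2 * (B + B) :=
    (sob_coeff_add_le 2 hm hd).trans (by gcongr)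
  have hBq : P.sob 2 (P.coeff fun x => m x - d x) ≤ 2 * (B + B) :=
    (sob_coeff_sub_le 2 hm hd).trans (by gcongr)
  have hBm' : P.sob 2 (P.coeff m) ≤ 2 * (B + B) := by
    refine hBm.trans ?_
    rw [two_mul, add_assoc]
    exact le_self_add
  have key := abs_average_sqrt_sub_le (ρ := ρ) (p := p) (q := q) (z := P.E1 m) (hρe ▸ hρ)
    (by rw [hρe, hp]; exact sqrt_e1Low_le hP _) (by rw [hρe, hq]; exact sqrt_e1Low_le hP _)
    (by rw [hρe]; exact sqrt_e1Low_le hP _)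
  rw [← hp, ← hq]
  -- The distance of w from the midpoint m is paid for by Lipschitz continuity; the averaging error
  -- at m is quadratic in d.
  have e : (√q + √p) / 2 - √(P.E1 w) = (√(P.E1 m) - √(P.E1 w)) + ((√q + √p) / 2 - √(P.E1 m)) := by
    ring
  rw [e]
  refine (ofReal_add_sq_le _ _).trans ?_
  have b1 : ENNReal.ofReal ((√(P.E1 m) - √(P.E1 w)) ^ 2) ≤
      C1 * P.sob 0 (P.coeff fun x => w x - m x) := by
    rw [← neg_sub, neg_sq]
    exact h1 w m hw hm hBw hBm
  have b3 : ENNReal.ofReal ((q - P.E1 m) ^ 2) ≤ C3 * P.sob 0 (P.coeff d) := by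
    have := h3 _ m (hm.sub hd) hm hBq hBm'
    rw [← hq] at this
    refine this.trans (le_of_eq ?_)
    have e2 : (fun x => m x - d x - m x) = fun x => (-1) * d x := by ext x; ring
    rw [e2, sob_coeff_const_mul]; norm_num
  have b4 : ENNReal.ofReal ((p - q) ^ 2) ≤ C3 * (4 * P.sob 0 (P.coeff d)) := by
    have := h3 _ _ (hm.add hd) (hm.sub hd) hBp hBq
    rw [← hq, ← hp] at this
    refine this.trans (le_of_eq ?_)
    have e2 : (fun x => m x + d x - (m x - d x)) = fun x => 2 * d x := by ext x; ring
    rw [e2, sob_coeff_const_mul]; norm_num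
  have b2 : ENNReal.ofReal (((√q + √p) / 2 - √(P.E1 m)) ^ 2) ≤ 2 * (ENNReal.ofReal ((4 * ρ)⁻¹ ^ 2)
      * C2 + ENNReal.ofReal ((16 * ρ ^ 3)⁻¹ ^ 2) * (C3 * (C3 * 4))) * P.sob 0 (P.coeff d) ^ 2 := by
    refine (ofReal_sq_le_of_abs_le (key.trans (le_abs_self _))).trans ?_
    refine (ofReal_add_sq_le _ _).trans ?_
    rw [ofReal_mul_sq, ofReal_mul_sq, sq_abs, sq_abs, ofReal_mul_sq]
    have b5 := h2 m d hm hd hBm hBd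
    rw [← hp, ← hq] at b5
    calc _ ≤ 2 * (ENNReal.ofReal ((4 * ρ)⁻¹ ^ 2) * (C2 * P.sob 0 (P.coeff d) ^ 2) +
          ENNReal.ofReal ((16 * ρ ^ 3)⁻¹ ^ 2) * ((C3 * P.sob 0 (P.coeff d)) *
          (C3 * (4 * P.sob 0 (P.coeff d))))) := by gcongr
      _ = _ := by ring
  rw [mul_assoc]
  gcongr
  refine (add_le_add b1 b2).trans ?_
  rw [add_mul]
  gcongr
  · exact le_self_add
  · exact le_add_self

/-- The discrete nonlinear term in the chemical potential. -/
theorem exists_sob_potential_sub_le (hP : P.Admissible) {B : ℝ≥0∞} (hB : B ≠ ⊤) :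
    ∃ C : ℝ≥0∞, C ≠ ⊤ ∧ ∀ m d w : ℝ × ℝ → ℝ, P.Good m → P.Good d → P.Good w →
      P.sob 2 (P.coeff m) ≤ B → P.sob 2 (P.coeff d) ≤ B → P.sob 2 (P.coeff w) ≤ B →
      P.sob 1 (P.coeff fun x => (√(P.E1 fun x => m x - d x) + √(P.E1 fun x => m x + d x)) / 2
          / √(P.E1 w) * P.dF (w x) - (P.dF (m x - d x) + P.dF (m x + d x)) / 2) ≤
      C * (P.sob 1 (P.coeff fun x => w x - m x) + P.sob 2 (P.coeff d) ^ 2) := by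
  obtain ⟨C1, hC1, h1⟩ := exists_average_sav_sub_le hP hB
  obtain ⟨C2, hC2, h2⟩ := exists_sob_dF_sub_le hP 1 2 le_rfl (by norm_num) hB
  obtain ⟨C3, hC3, h3⟩ := exists_sob_dF_le hP 1 2 le_rfl (by norm_num) hB
  have hm1 := (P.mulConst_lt_top hP 1).ne
  obtain ⟨ρ, hρe⟩ : ∃ ρ, ρ = √P.e1Low := ⟨_, rfl⟩
  have hρ : 0 < ρ := by rw [hρe]; exact Real.sqrt_pos.2 (e1Low_pos hP)
  refine ⟨2 * (2 * (C2 + ENNReal.ofReal (ρ⁻¹ ^ 2) * C1 * (C3 * B)) + ENNReal.ofReal (3 ^ 2) *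
    (P.mulConst 1 * P.mulConst 1 * B)), by finiteness, fun m d w hm hd hw hBm hBd hBw => ?_⟩
  obtain ⟨r, hr⟩ : ∃ r, r = (√(P.E1 fun x => m x - d x) + √(P.E1 fun x => m x + d x)) / 2 :=
    ⟨_, rfl⟩
  obtain ⟨E, hE⟩ : ∃ E, E = √(P.E1 w) := ⟨_, rfl⟩
  have hEρ : ρ ≤ E := by rw [hρe, hE]; exact sqrt_e1Low_le hP w
  have hE0 : 0 < E := hρ.trans_le hEρ
  have key := h1 m d w hm hd hw hBm hBd hBw
  rw [← hr, ← hE] at key ⊢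
  -- Three sources of error: replacing m by w inside F', the ratio r/E not being 1, and the
  -- averaging of the cubic, since the mean of F'(m ± d) is F'(m) + 3md².
  have e : (fun x => r / E * P.dF (w x) - (P.dF (m x - d x) + P.dF (m x + d x)) / 2)
      = fun x => ((P.dF (w x) - P.dF (m x)) + E⁻¹ * (r - E) * P.dF (w x)) -
        3 * (d x * (m x * d x)) := by
    ext x
    simp only [PFC.dF]
    field_simp
    ring
  rw [e]
  have g1 := (hw.dF hP).sub (hm.dF hP)
  have g2 := (hw.dF hP).const_mul (E⁻¹ * (r - E))
  have g3 := (hd.mul hP (hm.mul hP hd)).const_mul 3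
  refine (sob_coeff_sub_le 1 (g1.add g2) g3).trans ?_
  rw [mul_assoc, add_mul]
  gcongr
  · refine (sob_coeff_add_le 1 g1 g2).trans ?_
    rw [mul_assoc, add_mul]
    gcongr
    · refine (h2 w m hw hm hBw hBm).trans ?_
      gcongr
      exact le_self_add
    · rw [sob_coeff_const_mul, ofReal_mul_sq]
      have hi : ENNReal.ofReal (E⁻¹ ^ 2) ≤ ENNReal.ofReal (ρ⁻¹ ^ 2) :=
        ENNReal.ofReal_le_ofReal (by gcongr)
      have hs : P.sob 0 (P.coeff fun x => w x - m x) + P.sob 0 (P.coeff d) ^ 2 ≤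
          P.sob 1 (P.coeff fun x => w x - m x) + P.sob 2 (P.coeff d) ^ 2 := by
        gcongr
        · exact sob_mono_exp 0 1 (by norm_num) _
        · exact sob_mono_exp 0 2 (by norm_num) _
      calc _ ≤ ENNReal.ofReal (ρ⁻¹ ^ 2) * (C1 * (P.sob 1 (P.coeff fun x => w x - m x) +
            P.sob 2 (P.coeff d) ^ 2)) * (C3 * B) := by
            refine mul_le_mul' (mul_le_mul' hi (key.trans (by gcongr))) ((h3 w hw hBw).trans ?_)
            gcongr
            exact (sob_mono_exp 1 2 (by norm_num) _).trans hBw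
        _ = _ := by ring
  · rw [sob_coeff_const_mul, mul_assoc]
    gcongr
    refine (sob_coeff_mul_mul_le hP hd hm hd.memLp 1 2 le_rfl (by norm_num)).trans ?_
    rw [mul_assoc _ B]
    refine mul_le_mul_right ?_ _
    calc P.sob 2 (P.coeff d) * P.sob 2 (P.coeff m) * P.sob 1 (P.coeff d)
        ≤ P.sob 2 (P.coeff d) * B * P.sob 2 (P.coeff d) :=
          mul_le_mul' (mul_le_mul_right hBm _) (sob_mono_exp 1 2 (by norm_num) _)
      _ = B * P.sob 2 (P.coeff d) ^ 2 := by ring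
      _ ≤ _ := mul_le_mul_right le_add_self _

/-- The discrete increment of the auxiliary variable. -/
theorem exists_sav_increment_sub_le (hP : P.Admissible) {B : ℝ≥0∞} (hB : B ≠ ⊤) :
    ∃ C : ℝ≥0∞, C ≠ ⊤ ∧ ∀ m d w : ℝ × ℝ → ℝ, P.Good m → P.Good d → P.Good w →
      P.sob 2 (P.coeff m) ≤ B → P.sob 2 (P.coeff d) ≤ B → P.sob 2 (P.coeff w) ≤ B →
      ENNReal.ofReal ((P.ip (fun x => P.dF (w x)) d / √(P.E1 w) -
        (√(P.E1 fun x => m x + d x) - √(P.E1 fun x => m x - d x))) ^ 2) ≤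
      C * (P.sob 0 (P.coeff d) *
        (P.sob 0 (P.coeff fun x => w x - m x) + P.sob 2 (P.coeff d) ^ 2)) := by
  obtain ⟨C1, hC1, h1⟩ := exists_average_sav_sub_le hP hB
  obtain ⟨C2, hC2, h2⟩ := exists_sob_dF_sub_le hP 0 2 le_rfl (by norm_num) hB
  obtain ⟨C3, hC3, h3⟩ := exists_sob_dF_le hP 0 2 le_rfl (by norm_num) hB
  have hm0 := (P.mulConst_lt_top hP 0).ne
  obtain ⟨ρ, hρe⟩ : ∃ ρ, ρ = √P.e1Low := ⟨_, rfl⟩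
  have hρ : 0 < ρ := by rw [hρe]; exact Real.sqrt_pos.2 (e1Low_pos hP)
  obtain ⟨A, hA⟩ : ∃ A, A = ENNReal.ofReal ((P.Lx * P.Ly) ^ 2) := ⟨_, rfl⟩
  have hAt : A ≠ ⊤ := by rw [hA]; finiteness
  obtain ⟨I, hI⟩ : ∃ I, I = ENNReal.ofReal (ρ⁻¹ ^ 2) := ⟨_, rfl⟩
  have hIt : I ≠ ⊤ := by rw [hI]; finiteness
  refine ⟨2 * (2 * (I * (A * C2) + I * I * C1 * (A * (C3 * B))) +
    I * (A * (P.mulConst 0 * B * P.mulConst 0))), by finiteness,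
    fun m d w hm hd hw hBm hBd hBw => ?_⟩
  have hdm := hw.sub hm
  obtain ⟨a, ha⟩ : ∃ a, a = √(P.E1 fun x => m x - d x) := ⟨_, rfl⟩
  obtain ⟨c, hc⟩ : ∃ c, c = √(P.E1 fun x => m x + d x) := ⟨_, rfl⟩
  obtain ⟨E, hE⟩ : ∃ E, E = √(P.E1 w) := ⟨_, rfl⟩
  have hEρ : ρ ≤ E := by rw [hρe, hE]; exact sqrt_e1Low_le hP w
  have haρ : ρ ≤ a := by rw [hρe, ha]; exact sqrt_e1Low_le hP _
  have hcρ : ρ ≤ c := by rw [hρe, hc]; exact sqrt_e1Low_le hP _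
  have hE0 : 0 < E := hρ.trans_le hEρ
  have hr0 : 0 < (a + c) / 2 := by linarith
  have key := h1 m d w hm hd hw hBm hBd hBw
  have hdiff := E1_first_difference hP hm hd
  have hcc : c ^ 2 = P.E1 fun x => m x + d x := by
    rw [hc, Real.sq_sqrt (E1_pos hP _).le]
  have haa : a ^ 2 = P.E1 fun x => m x - d x := by
    rw [ha, Real.sq_sqrt (E1_pos hP _).le]
  rw [← ha, ← hc, ← hE] at key
  rw [← hcc, ← haa] at hdiff
  rw [← ha, ← hc, ← hE]
  have hipsub : P.ip (fun x => P.dF (w x) - P.dF (m x)) d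
      = P.ip (fun x => P.dF (w x)) d - P.ip (fun x => P.dF (m x)) d := by
    have i1 : Integrable (fun x => P.dF (w x) * d x) (volume.restrict P.Ω) :=
      ((hw.dF hP).mul hP hd).integrable
    have i2 : Integrable (fun x => P.dF (m x) * d x) (volume.restrict P.Ω) :=
      ((hm.dF hP).mul hP hd).integrable
    rw [ip, ip, ip, ← integral_sub i1 i2]
    congr 1; ext x; ring
  obtain ⟨X, hX⟩ : ∃ X, X = P.ip (fun x => P.dF (m x)) d := ⟨_, rfl⟩
  obtain ⟨Y, hY⟩ : ∃ Y, Y = P.ip (fun x => m x * d x) fun x => d x * d x := ⟨_, rfl⟩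
  obtain ⟨Z, hZ⟩ : ∃ Z, Z = P.ip (fun x => P.dF (w x) - P.dF (m x)) d := ⟨_, rfl⟩
  have hW : P.ip (fun x => P.dF (w x)) d = Z + X := by rw [hZ, hX, hipsub]; ring
  rw [hW]
  rw [← hX, ← hY] at hdiff
  -- Since c² - a² = 2(X + Y), the exact increment c - a is X + Y divided by the mean (a + c)/2.
  -- What remains is the change of F' (in Z), the change of denominator from the mean to E, and the
  -- cubic remainder Y.
  have e : (Z + X) / E - (c - a) = (E⁻¹ * Z + (E⁻¹ * ((a + c) / 2)⁻¹) * ((a + c) / 2 - E) * X) +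
      -(((a + c) / 2)⁻¹ * Y) := by
    have : c - a = ((a + c) / 2)⁻¹ * (X + Y) := by
      rw [eq_inv_mul_iff_mul_eq₀ hr0.ne']
      linarith
    rw [this]
    generalize (a + c) / 2 = r at hr0
    field_simp
    ring
  rw [e]
  have hS0 : P.sob 0 (P.coeff d) ≤ P.sob 2 (P.coeff d) := sob_mono_exp 0 2 (by norm_num) _
  have hiE : ENNReal.ofReal (E⁻¹ ^ 2) ≤ I := by
    rw [hI]; exact ENNReal.ofReal_le_ofReal (by gcongr)
  have hir : ENNReal.ofReal (((a + c) / 2)⁻¹ ^ 2) ≤ I := by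
    rw [hI]; exact ENNReal.ofReal_le_ofReal (by gcongr; linarith)
  obtain ⟨D, hD⟩ : ∃ D, D = P.sob 0 (P.coeff d) := ⟨_, rfl⟩
  obtain ⟨Q, hQ⟩ : ∃ Q, Q = P.sob 0 (P.coeff fun x => w x - m x) + P.sob 2 (P.coeff d) ^ 2 :=
    ⟨_, rfl⟩
  have bZ : ENNReal.ofReal (Z ^ 2) ≤ A * C2 * (D * Q) := by
    rw [hZ, hA, hD, hQ]
    refine (ofReal_ip_sq_le hP ((hw.dF hP).sub (hm.dF hP)).memLp hd.memLp).trans ?_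
    calc _ ≤ ENNReal.ofReal ((P.Lx * P.Ly) ^ 2) *
          (C2 * P.sob 0 (P.coeff fun x => w x - m x) * P.sob 0 (P.coeff d)) := by
          gcongr; exact h2 w m hw hm hBw hBm
      _ = ENNReal.ofReal ((P.Lx * P.Ly) ^ 2) * C2 * (P.sob 0 (P.coeff d) *
          P.sob 0 (P.coeff fun x => w x - m x)) := by ring
      _ ≤ _ := by gcongr; exact le_self_add
  have bX : ENNReal.ofReal (X ^ 2) ≤ A * (C3 * B) * D := by
    rw [hX, hA, hD]
    refine (ofReal_ip_sq_le hP (hm.dF hP).memLp hd.memLp).trans ?_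
    rw [mul_assoc]
    gcongr
    refine (h3 m hm hBm).trans ?_
    gcongr
    exact (sob_mono_exp 0 2 (by norm_num) _).trans hBm
  have bY : ENNReal.ofReal (Y ^ 2) ≤ A * (P.mulConst 0 * B * P.mulConst 0) * (D * Q) := by
    rw [hY, hA, hD, hQ]
    refine (ofReal_ip_sq_le hP (hm.mul hP hd).memLp (hd.mul hP hd).memLp).trans ?_
    calc _ ≤ ENNReal.ofReal ((P.Lx * P.Ly) ^ 2) * ((P.mulConst 0 * (B * P.sob 2 (P.coeff d))) *
          (P.mulConst 0 * (P.sob 2 (P.coeff d) * P.sob 0 (P.coeff d)))) := by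
          gcongr
          · refine (sob_coeff_mul_le hP hm.memLp hd.memLp 0 2 le_rfl (by norm_num)).trans ?_
            gcongr
          · exact sob_coeff_mul_le hP hd.memLp hd.memLp 0 2 le_rfl (by norm_num)
      _ = ENNReal.ofReal ((P.Lx * P.Ly) ^ 2) * (P.mulConst 0 * B * P.mulConst 0) *
          (P.sob 0 (P.coeff d) * P.sob 2 (P.coeff d) ^ 2) := by ring
      _ ≤ _ := by gcongr; exact le_add_self
  have bK : ENNReal.ofReal (((a + c) / 2 - E) ^ 2) ≤ C1 * Q := by
    refine key.trans ?_
    rw [hQ]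
    gcongr
  rw [← hD, ← hQ]
  calc _ ≤ 2 * (2 * (I * (A * C2 * (D * Q)) + I * I * (C1 * Q) * (A * (C3 * B) * D)) +
        I * (A * (P.mulConst 0 * B * P.mulConst 0) * (D * Q))) := by
        refine (ofReal_add_sq_le _ _).trans ?_
        rw [neg_sq, ofReal_mul_sq]
        gcongr
        refine (ofReal_add_sq_le _ _).trans ?_
        rw [ofReal_mul_sq, ofReal_mul_sq, ofReal_mul_sq, ofReal_mul_sq]
        gcongr
    _ = _ := by ring

/-! ### Trigonometric polynomials -/

/-- `u` is the real trigonometric polynomial with coefficients `c` and frequencies in `s`. -/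
def IsTrig (P : PFC) (s : Finset (ℤ × ℤ)) (c : ℤ × ℤ → ℂ) (u : ℝ × ℝ → ℝ) : Prop :=
  ∀ p, (u p : ℂ) = ∑ k ∈ s, c k * P.mode k p

theorem summable_norm_ite (s : Finset (ℤ × ℤ)) (c : ℤ × ℤ → ℂ) :
    Summable fun k => ‖if k ∈ s then c k else 0‖ :=
  summable_of_ne_finset_zero (s := s) fun k hk => by simp [hk]

theorem synth_ite (s : Finset (ℤ × ℤ)) (c : ℤ × ℤ → ℂ) (p : ℝ × ℝ) :
    P.synth (fun k => if k ∈ s then c k else 0) p = ∑ k ∈ s, c k * P.mode k p := by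
  rw [synth, tsum_eq_sum (s := s) fun k hk => by simp [hk]]
  exact Finset.sum_congr rfl fun k hk => by simp [hk]

theorem IsTrig.coeff (hP : P.Admissible) {s : Finset (ℤ × ℤ)} {c : ℤ × ℤ → ℂ} {u : ℝ × ℝ → ℝ}
    (h : P.IsTrig s c u) (k : ℤ × ℤ) : P.coeff u k = if k ∈ s then c k else 0 := by
  have e : (fun p => (u p : ℂ)) = P.synth (fun k => if k ∈ s then c k else 0) := by
    ext p; rw [synth_ite, h p]
  rw [coeff_eq_cf, e, cf_synth hP (summable_norm_ite s c)]

theorem IsTrig.memLp {s : Finset (ℤ × ℤ)} {c : ℤ × ℤ → ℂ} {u : ℝ × ℝ → ℝ}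
    (h : P.IsTrig s c u) : MemLp u 2 (volume.restrict P.Ω) := by
  have e : (fun p => (u p : ℂ)) = P.synth (fun k => if k ∈ s then c k else 0) := by
    ext p; rw [synth_ite, h p]
  have h2 := memLp_synth (P := P) (summable_norm_ite s c) 2
  rw [← e] at h2
  exact h2.re

theorem sob_lt_top_of_finite (s : ℕ) (S : Finset (ℤ × ℤ)) (c : ℤ × ℤ → ℂ)
    (h : ∀ k, k ∉ S → c k = 0) : P.sob s c < ⊤ := by
  rw [sob, tsum_eq_sum (s := S) fun k hk => by simp [h k hk]]
  exact ENNReal.sum_lt_top.2 fun k _ => by finiteness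

theorem IsTrig.good (hP : P.Admissible) {s : Finset (ℤ × ℤ)} {c : ℤ × ℤ → ℂ} {u : ℝ × ℝ → ℝ}
    (h : P.IsTrig s c u) : P.Good u :=
  ⟨h.memLp, sob_lt_top_of_finite 2 s _ fun k hk => by rw [h.coeff hP, if_neg hk]⟩

theorem hasDerivAt_mode_fst (k : ℤ × ℤ) (x y : ℝ) :
    HasDerivAt (fun x : ℝ => P.mode k (x, y)) (Complex.I * P.ξ k.1 * P.mode k (x, y)) x := by
  have h1 : HasDerivAt (fun x : ℝ => P.ξ k.1 * x + P.η k.2 * y) (P.ξ k.1) x := by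
    simpa using ((hasDerivAt_id x).const_mul (P.ξ k.1)).add_const (P.η k.2 * y)
  have h := ((h1.ofReal_comp).const_mul Complex.I).cexp
  rw [mul_comm]
  exact h

theorem hasDerivAt_mode_snd (k : ℤ × ℤ) (x y : ℝ) :
    HasDerivAt (fun y : ℝ => P.mode k (x, y)) (Complex.I * P.η k.2 * P.mode k (x, y)) y := by
  have h1 : HasDerivAt (fun y : ℝ => P.ξ k.1 * x + P.η k.2 * y) (P.η k.2) y := by
    simpa using ((hasDerivAt_id y).const_mul (P.η k.2)).const_add (P.ξ k.1 * x)
  have h := ((h1.ofReal_comp).const_mul Complex.I).cexp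
  rw [mul_comm]
  exact h

theorem ofReal_deriv_eq {f : ℝ → ℝ} {z : ℂ} {x : ℝ} (h : HasDerivAt (fun x => (f x : ℂ)) z x) :
    ((deriv f x : ℝ) : ℂ) = z := by
  have h1 : HasDerivAt f z.re x := by
    have := Complex.reCLM.hasFDerivAt.comp_hasDerivAt x h
    simpa [Function.comp_def] using this
  rw [h1.deriv]
  exact h1.ofReal_comp.unique h

theorem IsTrig.dx {s : Finset (ℤ × ℤ)} {c : ℤ × ℤ → ℂ} {u : ℝ × ℝ → ℝ}
    (h : P.IsTrig s c u) : P.IsTrig s (fun k => Complex.I * P.ξ k.1 * c k) (PFC.dx u) := by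
  intro p
  refine ofReal_deriv_eq ?_
  have e : (fun x : ℝ => (u (x, p.2) : ℂ)) = fun x => ∑ k ∈ s, c k * P.mode k (x, p.2) := by
    ext x; exact h _
  rw [e]
  refine HasDerivAt.congr_deriv (HasDerivAt.fun_sum fun k _ =>
    (hasDerivAt_mode_fst k p.1 p.2).const_mul (c k)) (Finset.sum_congr rfl fun k _ => by ring)

theorem IsTrig.dy {s : Finset (ℤ × ℤ)} {c : ℤ × ℤ → ℂ} {u : ℝ × ℝ → ℝ}
    (h : P.IsTrig s c u) : P.IsTrig s (fun k => Complex.I * P.η k.2 * c k) (PFC.dy u) := by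
  intro p
  refine ofReal_deriv_eq ?_
  have e : (fun y : ℝ => (u (p.1, y) : ℂ)) = fun y => ∑ k ∈ s, c k * P.mode k (p.1, y) := by
    ext x; exact h _
  rw [e]
  refine HasDerivAt.congr_deriv (HasDerivAt.fun_sum fun k _ =>
    (hasDerivAt_mode_snd k p.1 p.2).const_mul (c k)) (Finset.sum_congr rfl fun k _ => by ring)

theorem IsTrig.lapPlus {s : Finset (ℤ × ℤ)} {c : ℤ × ℤ → ℂ} {u : ℝ × ℝ → ℝ}
    (h : P.IsTrig s c u) :
    P.IsTrig s (fun k => ((P.β - P.negLap k : ℝ) : ℂ) * c k) (P.lapPlus u) := by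
  intro p
  simp only [PFC.lapPlus, Pi.add_apply, Pi.smul_apply, smul_eq_mul, Complex.ofReal_add,
    Complex.ofReal_mul]
  rw [h.dx.dx p, h.dy.dy p, h p, Finset.mul_sum, ← Finset.sum_add_distrib,
    ← Finset.sum_add_distrib]
  refine Finset.sum_congr rfl fun k _ => ?_
  simp only [negLap]
  push_cast
  linear_combination (P.ξ k.1 ^ 2 + P.η k.2 ^ 2) * c k * P.mode k p * Complex.I_sq

theorem IsTrig.ip_eq (hP : P.Admissible) {s : Finset (ℤ × ℤ)} {c : ℤ × ℤ → ℂ} {u v : ℝ × ℝ → ℝ}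
    (hu : MemLp u 2 (volume.restrict P.Ω)) (h : P.IsTrig s c v) :
    P.ip u v = P.Lx * P.Ly * ∑ k ∈ s, (conj (P.coeff u k) * c k).re := by
  rw [ip_eq_tsum hP hu h.memLp, tsum_eq_sum (s := s)]
  · congr 1
    refine Finset.sum_congr rfl fun k hk => ?_
    rw [h.coeff hP, if_pos hk]
  · intro k hk
    rw [h.coeff hP, if_neg hk, mul_zero, Complex.zero_re]

theorem IsTrig.add {s : Finset (ℤ × ℤ)} {c d : ℤ × ℤ → ℂ} {u v : ℝ × ℝ → ℝ}
    (hu : P.IsTrig s c u) (hv : P.IsTrig s d v) : P.IsTrig s (c + d) (u + v) := by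
  intro p
  rw [Pi.add_apply, Complex.ofReal_add, hu p, hv p, ← Finset.sum_add_distrib]
  exact Finset.sum_congr rfl fun k _ => by rw [Pi.add_apply, add_mul]

theorem IsTrig.smul {s : Finset (ℤ × ℤ)} {c : ℤ × ℤ → ℂ} {u : ℝ × ℝ → ℝ}
    (hu : P.IsTrig s c u) (a : ℝ) : P.IsTrig s ((a : ℂ) • c) (a • u) := by
  intro p
  rw [Pi.smul_apply, smul_eq_mul, Complex.ofReal_mul, hu p, Finset.mul_sum]
  exact Finset.sum_congr rfl fun k _ => by rw [Pi.smul_apply, smul_eq_mul, mul_assoc]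

/-! ### The space `S_N` -/

/-- The frequencies allowed in the definition of `S_N`. -/
def IsMode (N : ℕ) (k : ℤ × ℤ) : Prop :=
  -(N : ℝ) / 2 ≤ k.1 ∧ (k.1 : ℝ) ≤ (N : ℝ) / 2 - 1 ∧ -(N : ℝ) / 2 ≤ k.2 ∧ (k.2 : ℝ) ≤ (N : ℝ) / 2 - 1

theorem finite_isMode (N : ℕ) : {k | IsMode N k}.Finite := by
  refine (Finset.finite_toSet (Finset.Icc (-(N : ℤ)) N ×ˢ Finset.Icc (-(N : ℤ)) N)).subset ?_
  rintro ⟨a, b⟩ ⟨h1, h2, h3, h4⟩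
  have hN : (0 : ℝ) ≤ N := Nat.cast_nonneg N
  simp only [Finset.coe_product, Finset.coe_Icc, mem_prod, mem_Icc]
  simp only at h1 h2 h3 h4
  refine ⟨⟨?_, ?_⟩, ?_, ?_⟩ <;> · rify; linarith

theorem finite_isMode_symm (N : ℕ) : {k | IsMode N k ∧ IsMode N (-k)}.Finite :=
  (finite_isMode N).subset fun _ h => h.1

/-- The frequencies of the real elements of `S_N`. -/
def modes (N : ℕ) : Finset (ℤ × ℤ) := (finite_isMode_symm N).toFinset

theorem mem_modes {N : ℕ} {k : ℤ × ℤ} : k ∈ modes N ↔ IsMode N k ∧ IsMode N (-k) := by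
  simp [modes]

theorem neg_mem_modes {N : ℕ} {k : ℤ × ℤ} : -k ∈ modes N ↔ k ∈ modes N := by
  rw [mem_modes, mem_modes, neg_neg, and_comm]

/-- The range of frequencies in the definition of `SN` is not symmetric about 0. A real function has
hermitian coefficients, so a coefficient whose mirror frequency is not allowed must vanish; only the
symmetric set `modes N` remains. -/
theorem isTrig_of_mem_SN (hP : P.Admissible) {N : ℕ} {u : ℝ × ℝ → ℝ} (hu : u ∈ P.SN N) :
    P.IsTrig (modes N) (P.coeff u) u := by
  have key : ∀ f ∈ Submodule.span ℂ
      {f : ℝ × ℝ → ℂ | ∃ k l : ℤ, -(N : ℝ) / 2 ≤ k ∧ (k : ℝ) ≤ (N : ℝ) / 2 - 1 ∧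
        -(N : ℝ) / 2 ≤ l ∧ (l : ℝ) ≤ (N : ℝ) / 2 - 1 ∧ f = P.mode (k, l)},
      ∃ c : ℤ × ℤ → ℂ, ∀ p, f p = ∑ k ∈ (finite_isMode N).toFinset, c k * P.mode k p := by
    intro f hf
    induction hf using Submodule.span_induction with
    | mem f hf =>
      obtain ⟨k, l, h1, h2, h3, h4, rfl⟩ := hf
      refine ⟨Pi.single (k, l) 1, fun p => ?_⟩
      rw [Finset.sum_eq_single (k, l)]
      · simp
      · intro j _ hj; rw [Pi.single_eq_of_ne hj, zero_mul]
      · intro h; exact absurd ((finite_isMode N).mem_toFinset.2 ⟨h1, h2, h3, h4⟩) h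
    | zero => exact ⟨0, fun p => by simp⟩
    | add f g _ _ hf hg =>
      obtain ⟨c, hc⟩ := hf
      obtain ⟨d, hd⟩ := hg
      exact ⟨c + d, fun p => by simp [hc p, hd p, add_mul, Finset.sum_add_distrib]⟩
    | smul a f _ hf =>
      obtain ⟨c, hc⟩ := hf
      exact ⟨a • c, fun p => by simp [hc p, mul_assoc, Finset.mul_sum]⟩
  obtain ⟨c, hc⟩ := key _ hu
  have hT : P.IsTrig _ c u := hc
  have h0 : ∀ k, k ∉ modes N → P.coeff u k = 0 := by
    intro k hk
    by_cases h1 : IsMode N k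
    · have h2 : ¬ IsMode N (-k) := fun h => hk (mem_modes.2 ⟨h1, h⟩)
      have h3 : P.coeff u (-k) = 0 := by
        rw [hT.coeff hP, if_neg (by simpa using h2)]
      have h4 := P.coeff_neg u (-k)
      rwa [neg_neg, h3, map_zero] at h4
    · rw [hT.coeff hP, if_neg (by simpa using h1)]
  intro p
  rw [hT p]
  symm
  have hsub : modes N ⊆ (finite_isMode N).toFinset := fun k hk => by
    rw [Set.Finite.mem_toFinset]; exact (mem_modes.1 hk).1
  rw [Finset.sum_subset hsub fun k _ hk => by rw [h0 k hk, zero_mul]]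
  refine Finset.sum_congr rfl fun k hk => ?_
  rw [hT.coeff hP, if_pos hk]

theorem coeff_eq_zero_of_mem_SN (hP : P.Admissible) {N : ℕ} {u : ℝ × ℝ → ℝ} (hu : u ∈ P.SN N)
    {k : ℤ × ℤ} (hk : k ∉ modes N) : P.coeff u k = 0 := by
  rw [(isTrig_of_mem_SN hP hu).coeff hP, if_neg hk]

theorem good_of_mem_SN (hP : P.Admissible) {N : ℕ} {u : ℝ × ℝ → ℝ} (hu : u ∈ P.SN N) : P.Good u :=
  (isTrig_of_mem_SN hP hu).good hP

theorem mem_SN_of_isTrig {N : ℕ} {c : ℤ × ℤ → ℂ} {u : ℝ × ℝ → ℝ} (h : P.IsTrig (modes N) c u) :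
    u ∈ P.SN N := by
  have e : (fun p => (u p : ℂ)) = ∑ k ∈ modes N, c k • P.mode k := by
    ext p; rw [h p, Finset.sum_apply]; rfl
  rw [SN, Set.mem_ofPred_eq, e]
  refine Submodule.sum_mem _ fun k hk => Submodule.smul_mem _ _ (Submodule.subset_span ?_)
  obtain ⟨h1, h2, h3, h4⟩ := (mem_modes.1 hk).1
  exact ⟨k.1, k.2, h1, h2, h3, h4, rfl⟩

theorem add_mem_SN (hP : P.Admissible) {N : ℕ} {u v : ℝ × ℝ → ℝ} (hu : u ∈ P.SN N)
    (hv : v ∈ P.SN N) : u + v ∈ P.SN N :=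
  mem_SN_of_isTrig ((isTrig_of_mem_SN hP hu).add (isTrig_of_mem_SN hP hv))

theorem smul_mem_SN (hP : P.Admissible) {N : ℕ} {u : ℝ × ℝ → ℝ} (hu : u ∈ P.SN N) (a : ℝ) :
    a • u ∈ P.SN N :=
  mem_SN_of_isTrig ((isTrig_of_mem_SN hP hu).smul a)

theorem sub_mem_SN (hP : P.Admissible) {N : ℕ} {u v : ℝ × ℝ → ℝ} (hu : u ∈ P.SN N)
    (hv : v ∈ P.SN N) : u - v ∈ P.SN N := by
  rw [sub_eq_add_neg, ← neg_one_smul ℝ v]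
  exact add_mem_SN hP hu (smul_mem_SN hP hv _)

theorem exists_mem_SN_of_hermitian (hP : P.Admissible) (N : ℕ) {c : ℤ × ℤ → ℂ}
    (hc : ∀ k, c (-k) = conj (c k)) :
    ∃ u ∈ P.SN N, ∀ k ∈ modes N, P.coeff u k = c k := by
  have hreal : ∀ p, conj (∑ k ∈ modes N, c k * P.mode k p) = ∑ k ∈ modes N, c k * P.mode k p := by
    intro p
    rw [map_sum]
    refine Finset.sum_bij (fun k _ => -k) (fun k hk => neg_mem_modes.2 hk)
      (fun a _ b _ h => neg_injective h) (fun k hk => ⟨-k, neg_mem_modes.2 hk, neg_neg k⟩) ?_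
    intro k _
    rw [map_mul, hc, mode_neg]
  have hT : P.IsTrig (modes N) c (fun p => (∑ k ∈ modes N, c k * P.mode k p).re) := fun p =>
    Complex.conj_eq_iff_re.1 (hreal p)
  exact ⟨_, mem_SN_of_isTrig hT, fun k hk => by rw [hT.coeff hP, if_pos hk]⟩

/-- The function with coefficients c is itself an admissible real test function, because c is
hermitian. This turns the weak equations of the scheme into equations for the individual modes. -/
theorem eq_zero_of_forall_mem_SN (hP : P.Admissible) (N : ℕ) {c : ℤ × ℤ → ℂ}
    (hc : ∀ k, c (-k) = conj (c k))
    (h : ∀ v ∈ P.SN N, ∑ k ∈ modes N, (conj (c k) * P.coeff v k).re = 0) :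
    ∀ k ∈ modes N, c k = 0 := by
  obtain ⟨u, hu, hk⟩ := exists_mem_SN_of_hermitian hP N hc
  have h1 := h u hu
  have h2 : ∀ k ∈ modes N, (conj (c k) * P.coeff u k).re = ‖c k‖ ^ 2 := fun k hkm => by
    rw [hk k hkm, mul_comm, Complex.mul_conj, Complex.ofReal_re, Complex.normSq_eq_norm_sq]
  rw [Finset.sum_congr rfl h2, Finset.sum_eq_zero_iff_of_nonneg fun k _ => by positivity] at h1
  intro k hkm
  simpa using h1 k hkm

theorem ip_eq_sum_modes (hP : P.Admissible) {N : ℕ} {u v : ℝ × ℝ → ℝ}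
    (hu : MemLp u 2 (volume.restrict P.Ω)) (hv : v ∈ P.SN N) :
    P.ip u v = P.Lx * P.Ly * ∑ k ∈ modes N, (conj (P.coeff u k) * P.coeff v k).re :=
  (isTrig_of_mem_SN hP hv).ip_eq hP hu

theorem gradIp_eq_sum_modes (hP : P.Admissible) {N : ℕ} {u v : ℝ × ℝ → ℝ}
    (hu : u ∈ P.SN N) (hv : v ∈ P.SN N) :
    P.gradIp u v = P.Lx * P.Ly *
      ∑ k ∈ modes N, (conj ((P.negLap k : ℂ) * P.coeff u k) * P.coeff v k).re := by
  have tu := isTrig_of_mem_SN hP hu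
  have tv := isTrig_of_mem_SN hP hv
  rw [gradIp, tv.dx.ip_eq hP tu.dx.memLp, tv.dy.ip_eq hP tu.dy.memLp, ← mul_add,
    ← Finset.sum_add_distrib]
  congr 1
  refine Finset.sum_congr rfl fun k hk => ?_
  rw [tu.dx.coeff hP, tu.dy.coeff hP, if_pos hk, if_pos hk, ← Complex.add_re]
  congr 1
  simp only [map_mul, Complex.conj_I, Complex.conj_ofReal, negLap]
  push_cast
  linear_combination -(P.ξ k.1 ^ 2 + P.η k.2 ^ 2) * conj (P.coeff u k) * P.coeff v k * Complex.I_sq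

theorem ip_lapPlus_eq_sum_modes (hP : P.Admissible) {N : ℕ} {u v : ℝ × ℝ → ℝ}
    (hu : u ∈ P.SN N) (hv : v ∈ P.SN N) :
    P.ip (P.lapPlus u) (P.lapPlus v) = P.Lx * P.Ly *
      ∑ k ∈ modes N, (conj ((((P.β - P.negLap k) ^ 2 : ℝ) : ℂ) * P.coeff u k) * P.coeff v k).re := by
  have tu := isTrig_of_mem_SN hP hu
  have tv := isTrig_of_mem_SN hP hv
  rw [tv.lapPlus.ip_eq hP tu.lapPlus.memLp]
  congr 1
  refine Finset.sum_congr rfl fun k hk => ?_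
  rw [tu.lapPlus.coeff hP, if_pos hk]
  congr 1
  simp only [map_mul, Complex.conj_ofReal]
  push_cast
  ring

/-! ### The schemes in Fourier space -/

/-- The symbol of `(Δ + β)² + λ`. -/
def sym (P : PFC) (k : ℤ × ℤ) : ℝ := (P.β - P.negLap k) ^ 2 + P.lam

theorem mass_eq_of_weak (hP : P.Admissible) {N : ℕ} {a : ℝ} {u u' μ : ℝ × ℝ → ℝ} (hu : u ∈ P.SN N)
    (hu' : u' ∈ P.SN N) (hμ : μ ∈ P.SN N)
    (h : ∀ q ∈ P.SN N, P.ip (u' - u) q + a * P.gradIp μ q = 0) :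
    ∀ k ∈ modes N, P.coeff u' k - P.coeff u k = -((a * P.negLap k : ℝ) : ℂ) * P.coeff μ k := by
  have hA := (area_pos hP).ne'
  have gu := good_of_mem_SN hP hu
  have gu' := good_of_mem_SN hP hu'
  have key := eq_zero_of_forall_mem_SN hP N
    (c := fun k => P.coeff u' k - P.coeff u k + (a : ℂ) * ((P.negLap k : ℂ) * P.coeff μ k))
    (fun k => by
      simp only [coeff_neg, negLap_neg, map_add, map_sub, map_mul, Complex.conj_ofReal])
    (fun v hv => by
      have h1 := h v hv
      rw [ip_eq_sum_modes hP (gu'.memLp.sub gu.memLp) hv, gradIp_eq_sum_modes hP hμ hv,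
        show P.coeff (u' - u) = P.coeff u' - P.coeff u from coeff_sub gu'.integrable gu.integrable,
        mul_left_comm, ← mul_add] at h1
      rw [← (mul_eq_zero.1 h1).resolve_left hA, Finset.mul_sum, ← Finset.sum_add_distrib]
      refine Finset.sum_congr rfl fun k _ => ?_
      rw [map_add, add_mul, Complex.add_re]
      congr 1
      rw [map_mul, Complex.conj_ofReal, mul_assoc, Complex.re_ofReal_mul])
  intro k hk
  have := key k hk
  push_cast
  linear_combination this

theorem potential_eq_of_weak (hP : P.Admissible) {N : ℕ} {a : ℝ} {v z μ f : ℝ × ℝ → ℝ}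
    (hv : v ∈ P.SN N) (hz : z ∈ P.SN N) (hμ : μ ∈ P.SN N) (hf : P.Good f)
    (h : ∀ Ψ ∈ P.SN N, P.ip μ Ψ = P.ip (P.lapPlus v) (P.lapPlus Ψ) + P.lam * P.ip v Ψ
      + P.S * P.gradIp z Ψ + a * P.ip f Ψ) :
    ∀ k ∈ modes N, P.coeff μ k = (P.sym k : ℂ) * P.coeff v k +
      ((P.S * P.negLap k : ℝ) : ℂ) * P.coeff z k + (a : ℂ) * P.coeff f k := by
  have hA := (area_pos hP).ne'
  have gv := good_of_mem_SN hP hv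
  have gμ := good_of_mem_SN hP hμ
  have key := eq_zero_of_forall_mem_SN hP N
    (c := fun k => P.coeff μ k - (((((P.β - P.negLap k) ^ 2 : ℝ) : ℂ) * P.coeff v k +
      (P.lam : ℂ) * P.coeff v k) + (P.S : ℂ) * ((P.negLap k : ℂ) * P.coeff z k) +
      (a : ℂ) * P.coeff f k))
    (fun k => by
      simp only [coeff_neg, negLap_neg, map_add, map_sub, map_mul, Complex.conj_ofReal])
    (fun w hw => by
      have h1 := h w hw
      rw [ip_eq_sum_modes hP gμ.memLp hw, ip_eq_sum_modes hP gv.memLp hw,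
        ip_eq_sum_modes hP hf.memLp hw, gradIp_eq_sum_modes hP hz hw,
        ip_lapPlus_eq_sum_modes hP hv hw, mul_left_comm, mul_left_comm P.S, mul_left_comm a,
        ← mul_add, ← mul_add, ← mul_add] at h1
      have h2 := mul_left_cancel₀ hA h1
      rw [← sub_eq_zero, Finset.mul_sum, Finset.mul_sum, Finset.mul_sum, ← Finset.sum_add_distrib,
        ← Finset.sum_add_distrib, ← Finset.sum_add_distrib, ← Finset.sum_sub_distrib] at h2
      rw [← h2]
      refine Finset.sum_congr rfl fun k _ => ?_
      simp only [map_add, map_sub, map_mul, Complex.conj_ofReal]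
      rw [sub_mul, Complex.sub_re, add_mul, Complex.add_re, add_mul, Complex.add_re, add_mul,
        Complex.add_re, mul_assoc (P.lam : ℂ), Complex.re_ofReal_mul, mul_assoc (P.S : ℂ),
        Complex.re_ofReal_mul, mul_assoc (a : ℂ), Complex.re_ofReal_mul])
  intro k hk
  have := key k hk
  simp only [sym]
  push_cast at this ⊢
  linear_combination this

theorem extrap_mem_SN (hP : P.Admissible) {N : ℕ} {w u : ℝ × ℝ → ℝ} (hw : w ∈ P.SN N)
    (hu : u ∈ P.SN N) : extrap w u ∈ P.SN N := by
  have e : extrap w u = (3 / 2 : ℝ) • u + (-(1 / 2) : ℝ) • w := by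
    ext p; simp [extrap]; ring
  rw [e]
  exact add_mem_SN hP (smul_mem_SN hP hu _) (smul_mem_SN hP hw _)

theorem SecondOrderStep.modes_eq (hP : P.Admissible) {N : ℕ} {τ : ℝ} {w u μ u' : ℝ × ℝ → ℝ}
    {R R' : ℝ} (hw : w ∈ P.SN N) (hu : u ∈ P.SN N) (h : P.SecondOrderStep N τ w u R μ u' R') :
    (∀ k ∈ modes N, P.coeff u' k - P.coeff u k = -((P.M * τ * P.negLap k : ℝ) : ℂ) * P.coeff μ k) ∧
    (∀ k ∈ modes N, P.coeff μ k = (P.sym k : ℂ) * ((P.coeff u k + P.coeff u' k) / 2) +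
      ((P.S * P.negLap k : ℝ) : ℂ) * (P.coeff u' k - 2 * P.coeff u k + P.coeff w k) +
      (((R + R') / 2 / √(P.E1 (extrap w u)) : ℝ) : ℂ) *
        P.coeff (fun p => P.dF (extrap w u p)) k) ∧
    R' - R = 1 / (2 * √(P.E1 (extrap w u))) * (P.Lx * P.Ly * ∑ k ∈ modes N,
      (conj (P.coeff (fun p => P.dF (extrap w u p)) k) * (P.coeff u' k - P.coeff u k)).re) := by
  have gw := good_of_mem_SN hP hw
  have gu := good_of_mem_SN hP hu
  have gu' := good_of_mem_SN hP h.mem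
  have gf := (good_of_mem_SN hP (extrap_mem_SN hP hw hu)).dF hP
  have hsub : P.coeff (u' - u) = P.coeff u' - P.coeff u := coeff_sub gu'.integrable gu.integrable
  have hadd : P.coeff (u + u') = P.coeff u + P.coeff u' := coeff_add gu.integrable gu'.integrable
  have hav : P.coeff ((1 / 2 : ℝ) • (u + u')) = ((1 / 2 : ℝ) : ℂ) • P.coeff (u + u') :=
    P.coeff_const_mul (1 / 2) (u + u')
  have h2 : P.coeff (u' - (2 : ℝ) • u + w) = P.coeff (u' - (2 : ℝ) • u) + P.coeff w :=
    coeff_add (gu'.sub (gu.const_mul 2)).integrable gw.integrable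
  have h3 : P.coeff (u' - (2 : ℝ) • u) = P.coeff u' - P.coeff ((2 : ℝ) • u) :=
    coeff_sub gu'.integrable (gu.const_mul 2).integrable
  have h4 : P.coeff ((2 : ℝ) • u) = ((2 : ℝ) : ℂ) • P.coeff u := P.coeff_const_mul 2 u
  refine ⟨mass_eq_of_weak hP hu h.mem h.mu_mem h.eqA, fun k hk => ?_, ?_⟩
  · rw [potential_eq_of_weak hP (smul_mem_SN hP (add_mem_SN hP hu h.mem) _)
      (add_mem_SN hP (sub_mem_SN hP h.mem (smul_mem_SN hP hu _)) hw) h.mu_mem gf h.eqB k hk,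
      hav, hadd, h2, h3, h4]
    simp only [Pi.add_apply, Pi.sub_apply, Pi.smul_apply, smul_eq_mul]
    push_cast
    ring
  · rw [h.eqC, ip_eq_sum_modes hP gf.memLp (sub_mem_SN hP h.mem hu), hsub]
    rfl

theorem FirstOrderStep.modes_eq (hP : P.Admissible) {N : ℕ} {τ : ℝ} {u μ u' : ℝ × ℝ → ℝ}
    {R R' : ℝ} (hu : u ∈ P.SN N) (h : P.FirstOrderStep N τ u R μ u' R') :
    (∀ k ∈ modes N, P.coeff u' k - P.coeff u k = -((P.M * τ * P.negLap k : ℝ) : ℂ) * P.coeff μ k) ∧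
    (∀ k ∈ modes N, P.coeff μ k = (P.sym k : ℂ) * P.coeff u' k +
      ((P.S * P.negLap k : ℝ) : ℂ) * (P.coeff u' k - P.coeff u k) +
      ((R' / √(P.E1 u) : ℝ) : ℂ) * P.coeff (fun p => P.dF (u p)) k) ∧
    R' - R = 1 / (2 * √(P.E1 u)) * (P.Lx * P.Ly * ∑ k ∈ modes N,
      (conj (P.coeff (fun p => P.dF (u p)) k) * (P.coeff u' k - P.coeff u k)).re) := by
  have gu := good_of_mem_SN hP hu
  have gu' := good_of_mem_SN hP h.mem
  have gf := gu.dF hP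
  have hsub : P.coeff (u' - u) = P.coeff u' - P.coeff u := coeff_sub gu'.integrable gu.integrable
  refine ⟨mass_eq_of_weak hP hu h.mem h.mu_mem h.eqA, fun k hk => ?_, ?_⟩
  · rw [potential_eq_of_weak hP h.mem (sub_mem_SN hP h.mem hu) h.mu_mem gf h.eqB k hk, hsub]
    rfl
  · rw [h.eqC, ip_eq_sum_modes hP gf.memLp (sub_mem_SN hP h.mem hu), hsub]
    rfl

theorem IsProj.coeff_eq (hP : P.Admissible) {N : ℕ} {v u : ℝ × ℝ → ℝ}
    (hv : MemLp v 2 (volume.restrict P.Ω)) (h : P.IsProj N v u) :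
    ∀ k ∈ modes N, P.coeff u k = P.coeff v k := by
  have gu := good_of_mem_SN hP h.1
  have hA := (area_pos hP).ne'
  have hsub : P.coeff (u - v) = P.coeff u - P.coeff v :=
    coeff_sub gu.integrable (integrable_of_memLp hv)
  have key := eq_zero_of_forall_mem_SN hP N (c := fun k => P.coeff u k - P.coeff v k)
    (fun k => by simp only [coeff_neg, map_sub])
    (fun w hw => by
      have h1 := h.2 w hw
      rw [ip_eq_sum_modes hP (gu.memLp.sub hv) hw, hsub] at h1
      exact (mul_eq_zero.1 h1).resolve_left hA)
  exact fun k hk => sub_eq_zero.1 (key k hk)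

/-! ### Energy estimates for one step -/

/-- The potential w is multiplied by the increment e' - e. From `h2` this product yields differences
of squares and the work of b; from `h1` it yields the dissipation -Mτκ|w|², which absorbs every
product of w with a defect. The defect t is thereby measured with the weight κ⁻¹ and g with κ; at κ
= 0 this requires t = 0. -/
theorem energy_mode_le {M τ κ ℓ s σ : ℝ} (hM : 0 < M) (hτ : 0 ≤ τ) (hκ : 0 ≤ κ) (hs : 0 ≤ s)
    {e e' v w b g t : ℂ} (ht : κ = 0 → t = 0)
    (h1 : e' - e = -((M * τ * κ : ℝ) : ℂ) * w + (τ : ℂ) * t)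
    (h2 : w = (ℓ : ℂ) * ((e + e') / 2) + (s : ℂ) * (e' - 2 * e + v) + (σ : ℂ) * b + g) :
    ℓ / 2 * (‖e'‖ ^ 2 - ‖e‖ ^ 2) + s / 2 * (‖e' - e‖ ^ 2 - ‖e - v‖ ^ 2)
      + σ * (conj b * (e' - e)).re ≤ τ * ((2 / M + 1) * (κ⁻¹ * ‖t‖ ^ 2) + (M + 1) * (κ * ‖g‖ ^ 2)) := by
  have hns : ∀ z : ℂ, ‖z‖ ^ 2 = z.re ^ 2 + z.im ^ 2 := fun z => by
    rw [← Complex.normSq_eq_norm_sq, Complex.normSq_apply]; ring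
  have r1 := congrArg Complex.re h1
  have i1 := congrArg Complex.im h1
  have r2 := congrArg Complex.re h2
  have i2 := congrArg Complex.im h2
  simp only [hns]
  simp only [Complex.add_re, Complex.add_im, Complex.sub_re, Complex.sub_im, Complex.mul_re,
    Complex.mul_im, Complex.neg_re, Complex.neg_im, Complex.ofReal_re, Complex.ofReal_im,
    Complex.conj_re, Complex.conj_im, Complex.div_ofNat_re, Complex.div_ofNat_im, Complex.re_ofNat,
    Complex.im_ofNat, neg_zero, zero_mul, sub_zero, add_zero] at *
  obtain ⟨er, ei⟩ := e
  obtain ⟨fr, fi⟩ := e'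
  obtain ⟨or, oi⟩ := v
  obtain ⟨wr, wi⟩ := w
  obtain ⟨br, bi⟩ := b
  obtain ⟨gr, gi⟩ := g
  obtain ⟨tr, ti⟩ := t
  simp only at *
  -- Real and imaginary parts obey the same scalar inequality. The products wt and Mκgw take half of
  -- the dissipation Mκw² each.
  have key : ∀ {x y w g t : ℝ}, (κ = 0 → t = 0) → y - x = -(M * τ * κ * w) + τ * t →
      w * (y - x) - g * (y - x) ≤ τ * ((2 / M + 1) * (κ⁻¹ * t ^ 2) + (M + 1) * (κ * g ^ 2)) := by
    intro x y w g t ht h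
    rw [h]
    rcases hκ.eq_or_lt with h0 | h0
    · rw [ht h0.symm, ← h0]; simp
    · have e1 : w * (-(M * τ * κ * w) + τ * t) - g * (-(M * τ * κ * w) + τ * t)
          = τ * (-(M * κ) * w ^ 2 + w * t + M * κ * (g * w) - g * t) := by ring
      rw [e1]
      refine mul_le_mul_of_nonneg_left ?_ hτ
      have a1 : w * t ≤ M * κ / 2 * w ^ 2 + 1 / (2 * M) * (κ⁻¹ * t ^ 2) := by
        have : 0 ≤ (M * κ * w - t) ^ 2 / (2 * (M * κ)) := by positivity
        have e2 : (M * κ * w - t) ^ 2 / (2 * (M * κ)) = M * κ / 2 * w ^ 2 - w * t +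
            1 / (2 * M) * (κ⁻¹ * t ^ 2) := by field_simp; ring
        linarith
      have a2 : M * κ * (g * w) ≤ M * κ / 2 * w ^ 2 + M * κ / 2 * g ^ 2 := by
        nlinarith [mul_nonneg (mul_nonneg hM.le hκ) (sq_nonneg (g - w))]
      have a3 : -(g * t) ≤ κ / 2 * g ^ 2 + 1 / 2 * (κ⁻¹ * t ^ 2) := by
        have : 0 ≤ (κ * g + t) ^ 2 / (2 * κ) := by positivity
        have e2 : (κ * g + t) ^ 2 / (2 * κ) = κ / 2 * g ^ 2 + g * t +
            1 / 2 * (κ⁻¹ * t ^ 2) := by field_simp; ring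
        linarith
      have a4 : 1 / (2 * M) * (κ⁻¹ * t ^ 2) ≤ 2 / M * (κ⁻¹ * t ^ 2) := by
        refine mul_le_mul_of_nonneg_right ?_ (by positivity)
        rw [div_le_div_iff₀ (by positivity) hM]; linarith
      have a5 : 0 ≤ κ * g ^ 2 := by positivity
      have a6 : 0 ≤ κ⁻¹ * t ^ 2 := by positivity
      nlinarith [mul_nonneg hM.le a5]
  have k1 := key (x := er) (y := fr) (w := wr) (g := gr) (t := tr)
    (fun h => congrArg Complex.re (ht h)) (by linarith)
  have k2 := key (x := ei) (y := fi) (w := wi) (g := gi) (t := ti)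
    (fun h => congrArg Complex.im (ht h)) (by linarith)
  -- The stabilization telescopes through 2(y - 2x + o)(y - x) = (y - x)² - (x - o)² + (y - 2x +
  -- o)².
  have k3 : ∀ {x y o w b g : ℝ}, w = ℓ * ((x + y) / 2) + s * (y - 2 * x + o) + σ * b + g →
      ℓ / 2 * (y ^ 2 - x ^ 2) + s / 2 * ((y - x) ^ 2 - (x - o) ^ 2) + σ * (b * (y - x))
      ≤ w * (y - x) - g * (y - x) := by
    intro x y o w b g h
    rw [h]
    nlinarith [mul_nonneg hs (sq_nonneg (y - 2 * x + o))]
  have k4 := k3 (x := er) (y := fr) (o := or) (w := wr) (b := br) (g := gr) (by linarith)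
  have k5 := k3 (x := ei) (y := fi) (o := oi) (w := wi) (b := bi) (g := gi) (by linarith)
  linarith

/-- The energy inequality for one step of the second-order scheme with defects. -/
theorem energy_step_le (hP : P.Admissible) (K : Finset (ℤ × ℤ)) {τ : ℝ} (hτ : 0 ≤ τ)
    {s : ℤ × ℤ → ℝ} (hs : ∀ k, 0 ≤ s k) {e e' v w b g t : ℤ × ℤ → ℂ} {r r' σ t₂ : ℝ}
    (ht : ∀ k, P.negLap k = 0 → t k = 0)
    (h1 : ∀ k ∈ K, e' k - e k = -((P.M * τ * P.negLap k : ℝ) : ℂ) * w k + (τ : ℂ) * t k)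
    (h2 : ∀ k ∈ K, w k = (P.sym k : ℂ) * ((e k + e' k) / 2) + (s k : ℂ) * (e' k - 2 * e k + v k)
      + (σ : ℂ) * b k + g k)
    (h3 : r' - r = 1 / 2 * (P.Lx * P.Ly * ∑ k ∈ K, (conj (b k) * (e' k - e k)).re) + t₂) :
    P.Lx * P.Ly * (∑ k ∈ K, P.sym k / 2 * ‖e' k‖ ^ 2) +
      P.Lx * P.Ly * (∑ k ∈ K, s k / 2 * ‖e' k - e k‖ ^ 2) + 2 * σ * (r' - r - t₂)
    ≤ P.Lx * P.Ly * (∑ k ∈ K, P.sym k / 2 * ‖e k‖ ^ 2) +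
      P.Lx * P.Ly * (∑ k ∈ K, s k / 2 * ‖e k - v k‖ ^ 2) +
      τ * ((2 / P.M + 1) * (P.Lx * P.Ly * ∑ k ∈ K, (P.negLap k)⁻¹ * ‖t k‖ ^ 2) +
        (P.M + 1) * (P.Lx * P.Ly * ∑ k ∈ K, P.negLap k * ‖g k‖ ^ 2)) := by
  have hA := area_pos hP
  have key := Finset.sum_le_sum fun k hk => energy_mode_le hP.M_pos hτ (P.negLap_nonneg k) (hs k)
    (ht k) (h1 k hk) (h2 k hk)
  have key2 := mul_le_mul_of_nonneg_left key hA.le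
  simp only [Finset.sum_add_distrib, mul_sub, Finset.sum_sub_distrib, ← Finset.mul_sum, mul_add]
    at key2
  -- The scalar equation replaces the nonlinear work by the increment of the auxiliary variable; no
  -- bound on b is needed.
  have h4 : P.Lx * P.Ly * ∑ k ∈ K, (conj (b k) * (e' k - e k)).re = 2 * (r' - r - t₂) := by
    linarith
  simp only [mul_sub] at h4
  have h5 : 2 * σ * (r' - r - t₂) = P.Lx * P.Ly * (σ * ∑ k ∈ K, (conj (b k) * e' k
      - conj (b k) * e k).re) := by
    rw [mul_left_comm, h4]; ring
  rw [h5]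
  nlinarith

theorem sym_pos (hP : P.Admissible) (k : ℤ × ℤ) : 0 < P.sym k := by
  have := hP.lam_pos; unfold sym; positivity

/-- The constant in `wt_sq_le_sym`. -/
def symLow (P : PFC) : ℝ := 2 + 2 * (1 + P.β) ^ 2 / P.lam

theorem symLow_pos (hP : P.Admissible) : 0 < P.symLow := by
  have := hP.lam_pos; unfold symLow; positivity

/-- Coercivity in H²: the square (β - κ)² controls high frequencies and degenerates near κ = β,
where λ > 0 takes over. -/
theorem wt_sq_le_sym (hP : P.Admissible) (k : ℤ × ℤ) : P.wt k ^ 2 ≤ P.symLow * P.sym k := by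
  have hl := hP.lam_pos
  have h1 : P.wt k ^ 2 ≤ 2 * (P.β - P.negLap k) ^ 2 + 2 * (1 + P.β) ^ 2 := by
    unfold wt; nlinarith [sq_nonneg (1 + P.negLap k - 2 * (1 + P.β)), sq_nonneg (P.negLap k - P.β -
      (1 + P.β))]
  have h2 : P.symLow * P.sym k = 2 * (P.β - P.negLap k) ^ 2 + 2 * (1 + P.β) ^ 2 + (2 * P.lam +
      2 * (1 + P.β) ^ 2 / P.lam * (P.β - P.negLap k) ^ 2) := by
    unfold symLow sym; field_simp; ring
  have : 0 ≤ 2 * P.lam + 2 * (1 + P.β) ^ 2 / P.lam * (P.β - P.negLap k) ^ 2 := by positivity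
  linarith

theorem sym_le (hP : P.Admissible) (k : ℤ × ℤ) :
    P.sym k ≤ ((P.β + 1) ^ 2 + P.lam) * P.wt k ^ 2 := by
  have hκ := P.negLap_nonneg k
  have hb := hP.β_pos
  have hl := hP.lam_pos
  have h1 : 1 ≤ P.wt k ^ 2 := one_le_pow₀ (P.one_le_wt k)
  have h2 : (P.β - P.negLap k) ^ 2 ≤ (P.β + 1) ^ 2 * P.wt k ^ 2 := by
    rw [← mul_pow]
    refine sq_le_sq' ?_ ?_ <;> unfold wt <;> nlinarith [mul_nonneg hb.le hκ]
  unfold sym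
  nlinarith

theorem sob_eq_ofReal_sum (s : ℕ) (K : Finset (ℤ × ℤ)) (c : ℤ × ℤ → ℂ)
    (h : ∀ k, k ∉ K → c k = 0) : P.sob s c = ENNReal.ofReal (∑ k ∈ K, P.wt k ^ s * ‖c k‖ ^ 2) := by
  rw [sob, tsum_eq_sum (s := K) fun k hk => by simp [h k hk],
    ENNReal.ofReal_sum_of_nonneg fun k _ => by have := P.wt_pos k; positivity]
  refine Finset.sum_congr rfl fun k _ => ?_
  rw [ENNReal.ofReal_mul (pow_pos (P.wt_pos k) s).le, ENNReal.ofReal_pow (norm_nonneg _),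
    ofReal_norm]

theorem ofReal_sum_le_sob (s : ℕ) (K : Finset (ℤ × ℤ)) (c : ℤ × ℤ → ℂ) :
    ENNReal.ofReal (∑ k ∈ K, P.wt k ^ s * ‖c k‖ ^ 2) ≤ P.sob s c := by
  rw [ENNReal.ofReal_sum_of_nonneg fun k _ => by have := P.wt_pos k; positivity]
  refine le_trans (le_of_eq (Finset.sum_congr rfl fun k _ => ?_)) (ENNReal.sum_le_tsum K)
  rw [ENNReal.ofReal_mul (pow_pos (P.wt_pos k) s).le, ENNReal.ofReal_pow (norm_nonneg _),
    ofReal_norm]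

theorem ofReal_sum_negLap_le_sob (K : Finset (ℤ × ℤ)) (c : ℤ × ℤ → ℂ) :
    ENNReal.ofReal (∑ k ∈ K, P.negLap k * ‖c k‖ ^ 2) ≤ P.sob 1 c := by
  refine le_trans (ENNReal.ofReal_le_ofReal (Finset.sum_le_sum fun k _ => ?_))
    (ofReal_sum_le_sob 1 K c)
  rw [pow_one]
  exact mul_le_mul_of_nonneg_right (P.negLap_le_wt k) (by positivity)

theorem sob_two_le_energy (hP : P.Admissible) (K : Finset (ℤ × ℤ)) (c : ℤ × ℤ → ℂ)
    (h : ∀ k, k ∉ K → c k = 0) : P.sob 2 c ≤ ENNReal.ofReal (2 * P.symLow / (P.Lx * P.Ly) *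
      (P.Lx * P.Ly * ∑ k ∈ K, P.sym k / 2 * ‖c k‖ ^ 2)) := by
  have hA := (area_pos hP).ne'
  rw [sob_eq_ofReal_sum 2 K c h, ← mul_assoc, div_mul_cancel₀ _ hA, Finset.mul_sum]
  refine ENNReal.ofReal_le_ofReal (Finset.sum_le_sum fun k _ => ?_)
  have h1 := mul_le_mul_of_nonneg_right (wt_sq_le_sym hP k) (sq_nonneg ‖c k‖)
  linarith

/-! ### Unconditional stability -/

theorem prevIterate_mem_SN (hP : P.Admissible) {N NT : ℕ} {h : ℝ × ℝ → ℝ}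
    {φN : ℕ → ℝ × ℝ → ℝ} (h0 : φN 0 ∈ P.SN N) (hh : h ∈ P.SN N)
    (hn : ∀ n < NT, φN (n + 1) ∈ P.SN N) : ∀ n ≤ NT, φN n ∈ P.SN N ∧ prevIterate h φN n ∈ P.SN N := by
  have h1 : ∀ n ≤ NT, φN n ∈ P.SN N := by
    intro n hle
    cases n with
    | zero => exact h0
    | succ n => exact hn n hle
  intro n hle
  refine ⟨h1 n hle, ?_⟩
  cases n with
  | zero => exact sub_mem_SN hP (smul_mem_SN hP h0 _) (smul_mem_SN hP hh _)
  | succ n => exact h1 n (by omega)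

theorem coeff_prevIterate_zero (hP : P.Admissible) {N : ℕ} {h : ℝ × ℝ → ℝ}
    {φN : ℕ → ℝ × ℝ → ℝ} (h0 : φN 0 ∈ P.SN N) (hh : h ∈ P.SN N) (k : ℤ × ℤ) :
    P.coeff (prevIterate h φN 0) k = 3 * P.coeff (φN 0) k - 2 * P.coeff h k := by
  have g0 := good_of_mem_SN hP h0
  have gh := good_of_mem_SN hP hh
  have e : P.coeff (prevIterate h φN 0) = P.coeff (fun p => 3 * φN 0 p) - P.coeff (fun p => 2 * h p) :=
    coeff_sub (g0.const_mul 3).integrable (gh.const_mul 2).integrable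
  rw [e, coeff_const_mul, coeff_const_mul]
  simp

/-- Uniform bounds in `H²` for the discrete solutions. -/
theorem exists_stability_bound (hP : P.Admissible) {φ₀ : ℝ × ℝ → ℝ} (hφ₀ : P.Good φ₀) :
    ∃ B : ℝ≥0∞, B ≠ ⊤ ∧ ∀ (N : ℕ) (τ : ℝ) (NT : ℕ) (φN : ℕ → ℝ × ℝ → ℝ) (R : ℕ → ℝ)
      (h μh : ℝ × ℝ → ℝ) (Rh : ℝ) (μ : ℕ → ℝ × ℝ → ℝ), 0 ≤ τ →
      P.IsProj N φ₀ (φN 0) → R 0 = √(P.E1 φ₀) →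
      P.FirstOrderStep N (τ / 2) (φN 0) (R 0) μh h Rh →
      (∀ n < NT, P.SecondOrderStep N τ (prevIterate h φN n) (φN n) (R n)
        (μ n) (φN (n + 1)) (R (n + 1))) →
      P.sob 2 (P.coeff h) ≤ B ∧ ∀ n ≤ NT, P.sob 2 (P.coeff (φN n)) ≤ B := by
  have hA := area_pos hP
  have hS := hP.S_nonneg
  obtain ⟨b, hb⟩ : ∃ b, b = P.Lx * P.Ly * ((((P.β + 1) ^ 2 + P.lam) / 2) *
    (P.sob 2 (P.coeff φ₀)).toReal) + P.E1 φ₀ := ⟨_, rfl⟩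
  -- Here b bounds the initial energy for every N. The factor 5 is 1 + 4: the fictitious previous
  -- iterate satisfies φ⁰ - φ⁻¹ = 2(h - φ⁰), so the stabilization energy at n = 0 is four times that
  -- of the first-order step, which is at most b.
  refine ⟨ENNReal.ofReal (2 * P.symLow / (P.Lx * P.Ly) * (5 * b)), by finiteness, ?_⟩
  intro N τ NT φN R h μh Rh μ hτ hproj hR0 hfirst hstep
  have hmem := prevIterate_mem_SN hP hproj.1 hfirst.mem
    (fun n hn => (hstep n hn).mem)
  obtain ⟨K, hK⟩ : ∃ K, K = modes N := ⟨_, rfl⟩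
  obtain ⟨L, hL⟩ : ∃ L : (ℤ × ℤ → ℂ) → ℝ, L = fun c => P.Lx * P.Ly * ∑ k ∈ K, P.sym k / 2 * ‖c k‖ ^ 2 :=
    ⟨_, rfl⟩
  have hL0 : ∀ c, 0 ≤ L c := fun c => by
    rw [hL]
    exact mul_nonneg hA.le (Finset.sum_nonneg fun k _ => by have := sym_pos hP k; positivity)
  have hLs : ∀ u ∈ P.SN N, L (P.coeff u) ≤ 5 * b →
      P.sob 2 (P.coeff u) ≤ ENNReal.ofReal (2 * P.symLow / (P.Lx * P.Ly) * (5 * b)) := by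
    intro u hu hle
    refine (sob_two_le_energy hP K _ fun k hk =>
      coeff_eq_zero_of_mem_SN hP hu (hK ▸ hk)).trans (ENNReal.ofReal_le_ofReal ?_)
    rw [hL] at hle
    have := symLow_pos hP
    gcongr
  -- the initial energy
  have hinit : L (P.coeff (φN 0)) + R 0 ^ 2 ≤ b := by
    rw [hb, hR0, Real.sq_sqrt (E1_pos hP _).le, hL]
    beta_reduce
    refine add_le_add (mul_le_mul_of_nonneg_left ?_ hA.le) le_rfl
    have h1 : ∑ k ∈ K, P.wt k ^ 2 * ‖P.coeff φ₀ k‖ ^ 2 ≤ (P.sob 2 (P.coeff φ₀)).toReal :=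
      (ENNReal.ofReal_le_iff_le_toReal hφ₀.sob_lt_top.ne).1 (ofReal_sum_le_sob 2 K _)
    refine le_trans ?_ (mul_le_mul_of_nonneg_left h1 (by have := hP.lam_pos; positivity))
    rw [Finset.mul_sum]
    refine Finset.sum_le_sum fun k hk => ?_
    rw [hproj.coeff_eq hP hφ₀.memLp k (hK ▸ hk)]
    have := mul_le_mul_of_nonneg_right (sym_le hP k) (sq_nonneg ‖P.coeff φ₀ k‖)
    linarith
  -- the first-order step
  obtain ⟨f1, f2, f3⟩ := hfirst.modes_eq hP hproj.1
  have hs1 : ∀ k, 0 ≤ P.sym k / 2 + P.S * P.negLap k := fun k => by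
    have := sym_pos hP k; have := P.negLap_nonneg k; positivity
  -- The implicit first-order step is an instance of the second-order inequality: take v = e and
  -- move half of the symbol into the stabilization, since ℓe' = ℓ(e + e')/2 + (ℓ/2)(e' - e).
  have s1 := energy_step_le hP K (τ := τ / 2) (by linarith)
    (s := fun k => P.sym k / 2 + P.S * P.negLap k) hs1 (e := P.coeff (φN 0)) (e' := P.coeff h)
    (v := P.coeff (φN 0)) (w := P.coeff μh) (b := fun k => ((√(P.E1 (φN 0)))⁻¹ : ℝ) *
      P.coeff (fun p => P.dF (φN 0 p)) k) (g := 0) (t := 0) (r := R 0) (r' := Rh) (σ := Rh) (t₂ := 0)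
    (fun _ _ => rfl) (fun k hk => by rw [f1 k (hK ▸ hk)]; simp)
    (fun k hk => by
      rw [f2 k (hK ▸ hk)]; push_cast; simp only [Pi.zero_apply]; ring)
    (by
      rw [f3, hK]
      simp only [map_mul, Complex.conj_ofReal, mul_assoc, Complex.re_ofReal_mul, ← Finset.mul_sum]
      field_simp
      ring)
  simp only [sub_self, norm_zero, Pi.zero_apply, ne_eq, OfNat.ofNat_ne_zero, not_false_eq_true,
    zero_pow, mul_zero, Finset.sum_const_zero, add_zero, sub_zero] at s1
  have hd0 : ∀ k, P.coeff (φN 0) k - P.coeff (prevIterate h φN 0) k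
      = 2 * (P.coeff h k - P.coeff (φN 0) k) := fun k => by
    rw [coeff_prevIterate_zero hP hproj.1 hfirst.mem]; ring
  obtain ⟨D, hD⟩ : ∃ D : ℝ, D = P.Lx * P.Ly * ∑ k ∈ K, P.S * P.negLap k / 2 *
    ‖P.coeff h k - P.coeff (φN 0) k‖ ^ 2 := ⟨_, rfl⟩
  have hD1 : D ≤ P.Lx * P.Ly * ∑ k ∈ K, (P.sym k / 2 + P.S * P.negLap k) / 2 *
      ‖P.coeff h k - P.coeff (φN 0) k‖ ^ 2 := by
    rw [hD]
    gcongr with k hk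
    linarith [sym_pos hP k]
  have hD0 : 0 ≤ D := by
    rw [hD]
    exact mul_nonneg hA.le (Finset.sum_nonneg fun k _ => by have := P.negLap_nonneg k; positivity)
  have hs2 : L (P.coeff h) + D ≤ b := by
    have e1 : L (P.coeff h) = P.Lx * P.Ly * ∑ k ∈ K, P.sym k / 2 * ‖P.coeff h k‖ ^ 2 := by rw [hL]
    have e2 : L (P.coeff (φN 0)) = P.Lx * P.Ly * ∑ k ∈ K, P.sym k / 2 * ‖P.coeff (φN 0) k‖ ^ 2 := by
      rw [hL]
    nlinarith [sq_nonneg Rh, sq_nonneg (Rh - R 0)]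
  have hb0 : 0 ≤ b := (add_nonneg (hL0 _) hD0).trans hs2
  refine ⟨hLs h hfirst.mem (by linarith), fun n hn => hLs _ (hmem n hn).1 ?_⟩
  -- decay of the modified energy
  have main : ∀ n ≤ NT, L (P.coeff (φN n)) + P.Lx * P.Ly * (∑ k ∈ K, P.S * P.negLap k / 2 *
      ‖P.coeff (φN n) k - P.coeff (prevIterate h φN n) k‖ ^ 2) + R n ^ 2 ≤ 5 * b := by
    intro n
    induction n with
    | zero =>
      intro _
      have e : P.Lx * P.Ly * (∑ k ∈ K, P.S * P.negLap k / 2 *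
          ‖P.coeff (φN 0) k - P.coeff (prevIterate h φN 0) k‖ ^ 2) = 4 * D := by
        rw [hD, mul_left_comm 4, Finset.mul_sum _ _ (4 : ℝ)]
        congr 1
        refine Finset.sum_congr rfl fun k _ => ?_
        rw [hd0, norm_mul, mul_pow]
        norm_num
        ring
      rw [e]
      linarith [hL0 (P.coeff h)]
    | succ n ih =>
      intro hn
      have ih' := ih (by omega)
      obtain ⟨f1, f2, f3⟩ := (hstep n hn).modes_eq hP (hmem n (by omega)).2 (hmem n (by omega)).1
      -- With σ the average of R n and R (n + 1), the term 2σ(r' - r) is exactly the difference of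
      -- their squares.
      have s2 := energy_step_le hP K hτ (s := fun k => P.S * P.negLap k)
        (fun k => mul_nonneg hS (P.negLap_nonneg k)) (e := P.coeff (φN n))
        (e' := P.coeff (φN (n + 1)))
        (v := P.coeff (prevIterate h φN n)) (w := P.coeff (μ n))
        (b := fun k => ((√(P.E1 (extrap (prevIterate h φN n) (φN n))))⁻¹ : ℝ) *
          P.coeff (fun p => P.dF (extrap (prevIterate h φN n) (φN n) p)) k)
        (g := 0) (t := 0) (r := R n) (r' := R (n + 1)) (σ := (R n + R (n + 1)) / 2) (t₂ := 0)
        (fun _ _ => rfl) (fun k hk => by rw [f1 k (hK ▸ hk)]; simp)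
        (fun k hk => by
          rw [f2 k (hK ▸ hk)]; push_cast; simp only [Pi.zero_apply]; ring)
        (by
          rw [f3, hK]
          simp only [map_mul, Complex.conj_ofReal, mul_assoc, Complex.re_ofReal_mul,
            ← Finset.mul_sum]
          field_simp
          ring)
      simp only [norm_zero, Pi.zero_apply, ne_eq, OfNat.ofNat_ne_zero, not_false_eq_true,
        zero_pow, mul_zero, Finset.sum_const_zero, add_zero, sub_zero] at s2
      rw [hL] at ih' ⊢
      simp only [prevIterate]
      linarith
  have h1 := main n hn
  have h2 : 0 ≤ P.Lx * P.Ly * (∑ k ∈ K, P.S * P.negLap k / 2 *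
      ‖P.coeff (φN n) k - P.coeff (prevIterate h φN n) k‖ ^ 2) :=
    mul_nonneg hA.le (Finset.sum_nonneg fun k _ => by have := P.negLap_nonneg k; positivity)
  linarith [sq_nonneg (R n)]

/-! ### Weak derivatives in one variable -/

section WeakDerivatives

variable {T : ℝ}

/-- Test functions on `(0,T)`. -/
structure IsTest (T : ℝ) (θ : ℝ → ℝ) : Prop where
  contDiff : ContDiff ℝ ∞ θ
  compact : HasCompactSupport θ
  subset : tsupport θ ⊆ Ioo 0 T

theorem IsTest.exists_Icc (hT : 0 < T) {θ : ℝ → ℝ} (h : IsTest T θ) :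
    ∃ a b, 0 < a ∧ a ≤ b ∧ b < T ∧ ∀ t, t ∉ Icc a b → θ t = 0 := by
  rcases (tsupport θ).eq_empty_or_nonempty with he | hne
  · refine ⟨T / 2, T / 2, by linarith, le_rfl, by linarith, fun t _ => ?_⟩
    exact image_eq_zero_of_notMem_tsupport (by simp [he])
  · obtain ⟨a, ha⟩ := h.compact.isCompact.exists_isLeast hne
    obtain ⟨b, hb⟩ := h.compact.isCompact.exists_isGreatest hne
    refine ⟨a, b, (h.subset ha.1).1, ha.2 hb.1, (h.subset hb.1).2, fun t ht => ?_⟩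
    refine image_eq_zero_of_notMem_tsupport fun hm => ht ⟨ha.2 hm, hb.2 hm⟩

theorem isTest_of_Icc {θ : ℝ → ℝ} (h : ContDiff ℝ ∞ θ) {a b : ℝ} (ha : 0 < a) (hb : b < T)
    (h0 : ∀ t, t ∉ Icc a b → θ t = 0) : IsTest T θ := by
  have hs : tsupport θ ⊆ Icc a b :=
    closure_minimal (fun t ht => by_contra fun hm => ht (h0 t hm)) isClosed_Icc
  exact ⟨h, isCompact_Icc.of_isClosed_subset (isClosed_tsupport θ) hs,
    fun t ht => ⟨ha.trans_le (hs ht).1, (hs ht).2.trans_lt hb⟩⟩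

theorem IsTest.add {θ χ : ℝ → ℝ} (h : IsTest T θ) (h' : IsTest T χ) :
    IsTest T (fun t => θ t + χ t) :=
  ⟨h.contDiff.add h'.contDiff, h.compact.add h'.compact,
    (tsupport_add θ χ).trans (union_subset h.subset h'.subset)⟩

theorem IsTest.const_mul {θ : ℝ → ℝ} (h : IsTest T θ) (c : ℝ) : IsTest T (fun t => c * θ t) :=
  ⟨contDiff_const.mul h.contDiff, h.compact.mul_left,
    (tsupport_mul_subset_right (f := fun _ => c) (g := θ)).trans h.subset⟩

/-- The primitive vanishes to the left of the support, and the vanishing mean makes it vanish to the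
right as well; hence it is again a test function. -/
theorem IsTest.primitive (hT : 0 < T) {θ : ℝ → ℝ} (h : IsTest T θ)
    (h0 : ∫ t in (0 : ℝ)..T, θ t = 0) :
    ∃ χ, IsTest T χ ∧ ∀ t, HasDerivAt χ (θ t) t := by
  obtain ⟨a, b, ha, hab, hb, hθ⟩ := h.exists_Icc hT
  have hc := h.contDiff.continuous
  have hd : ∀ t, HasDerivAt (fun t => ∫ s in (0 : ℝ)..t, θ s) (θ t) t := fun t =>
    intervalIntegral.integral_hasDerivAt_right (hc.intervalIntegrable _ _)
      hc.stronglyMeasurable.stronglyMeasurableAtFilter hc.continuousAt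
  refine ⟨fun t => ∫ s in (0 : ℝ)..t, θ s, isTest_of_Icc ?_ ha hb fun t ht => ?_, hd⟩
  · rw [contDiff_infty_iff_deriv]
    refine ⟨fun t => (hd t).differentiableAt, ?_⟩
    have : deriv (fun t => ∫ s in (0 : ℝ)..t, θ s) = θ := funext fun t => (hd t).deriv
    rw [this]
    exact h.contDiff
  · rw [mem_Icc, not_and_or, not_le, not_le] at ht
    rcases ht with ht | ht
    · refine (intervalIntegral.integral_congr (g := fun _ => 0) fun s hs => ?_).trans (by simp)
      refine hθ s fun hm => ?_
      rcases mem_uIcc.1 hs with h1 | h1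
      · linarith [hm.1, h1.2]
      · linarith [hm.1, h1.2]
    · have h1 := intervalIntegral.integral_add_adjacent_intervals
        (hc.intervalIntegrable (μ := volume) 0 t) (hc.intervalIntegrable (μ := volume) t T)
      rw [h0] at h1
      have h2 : ∫ s in t..T, θ s = 0 := by
        refine (intervalIntegral.integral_congr (g := fun _ => 0) fun s hs => ?_).trans (by simp)
        refine hθ s fun hm => ?_
        rcases mem_uIcc.1 hs with h3 | h3
        · linarith [hm.2, h3.1]
        · linarith [hm.2, h3.1]
      linarith

theorem exists_isTest_integral_eq_one (hT : 0 < T) :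
    ∃ θ, IsTest T θ ∧ ∫ t in (0 : ℝ)..T, θ t = 1 := by
  obtain ⟨f, h1, h2, h3, h4, h5⟩ := exists_contDiff_tsupport_subset (E := ℝ) (n := ⊤)
    (s := Ioo 0 T) (x := T / 2) (Ioo_mem_nhds (by linarith) (by linarith))
  have hf : IsTest T f := ⟨h3, h2, h1⟩
  have hpos : 0 < ∫ t in (0 : ℝ)..T, f t := by
    refine intervalIntegral.integral_pos hT h3.continuous.continuousOn
      (fun t _ => (h4 ⟨t, rfl⟩).1) ⟨T / 2, ⟨by linarith, by linarith⟩, by rw [h5]; norm_num⟩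
  refine ⟨_, hf.const_mul (∫ t in (0 : ℝ)..T, f t)⁻¹, ?_⟩
  rw [intervalIntegral.integral_const_mul, inv_mul_cancel₀ hpos.ne']

theorem intervalIntegrable_of_Ioo {E : Type*} [NormedAddCommGroup E] {v : ℝ → E} (hv : IntegrableOn v (Ioo 0 T)) {a b : ℝ}
    (ha : a ∈ Icc 0 T) (hb : b ∈ Icc 0 T) : IntervalIntegrable v volume a b := by
  rw [← integrableOn_Icc_iff_integrableOn_Ioo] at hv
  exact (hv.mono_set (uIcc_subset_Icc ha hb)).intervalIntegrable

theorem eqOn_Icc_of_ae_eq {E : Type*} [NormedAddCommGroup E] (hT : 0 < T) {u v : ℝ → E} (hu : ContinuousOn u (Icc 0 T))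
    (hv : ContinuousOn v (Icc 0 T)) (h : ∀ᵐ t ∂volume.restrict (Ioo 0 T), u t = v t) :
    EqOn u v (Icc 0 T) := by
  have h' : u =ᵐ[volume.restrict (Icc 0 T)] v := by
    rwa [← restrict_Ioo_eq_restrict_Icc]
  exact Measure.eqOn_Icc_of_ae_eq volume hT.ne h' hu hv

variable {E : Type*} [NormedAddCommGroup E] [NormedSpace ℝ E]

theorem integrableOn_smul_of_continuous {θ : ℝ → ℝ} (hθ : Continuous θ) {u : ℝ → E}
    (hu : IntegrableOn u (Ioo 0 T)) : IntegrableOn (fun t => θ t • u t) (Ioo 0 T) := by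
  rw [← integrableOn_Icc_iff_integrableOn_Ioo] at hu ⊢
  exact hu.continuousOn_smul hθ.continuousOn isCompact_Icc

/-- Integration by parts for a merely integrable v: Fubini on the triangle s < t, with the inner
integral of the derivative equal to -χ(s) because χ vanishes at T. -/
theorem integral_smul_primitive (hT : 0 < T) [CompleteSpace E] {χ : ℝ → ℝ} (h : IsTest T χ)
    {v : ℝ → E} (hv : IntegrableOn v (Ioo 0 T)) :
    ∫ t in Ioo 0 T, deriv χ t • ∫ s in (0 : ℝ)..t, v s = -∫ t in Ioo 0 T, χ t • v t := by
  obtain ⟨a, b, ha, hab, hb, hχ⟩ := h.exists_Icc hT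
  have hd : Continuous (deriv χ) := (contDiff_infty_iff_deriv.1 h.contDiff).2.continuous
  have hχT : χ T = 0 := hχ T fun hm => by linarith [hm.2]
  have hdi : IntegrableOn (deriv χ) (Ioo 0 T) :=
    (hd.integrableOn_Icc).mono_set Ioo_subset_Icc_self
  have hI : Integrable (fun p : ℝ × ℝ => deriv χ p.1 • v p.2)
      ((volume.restrict (Ioo 0 T)).prod (volume.restrict (Ioo 0 T))) := hdi.smul_prod hv
  have hI2 := hI.indicator (measurableSet_lt measurable_snd measurable_fst)
  have hsw := integral_integral_swap (f := fun t s => {p : ℝ × ℝ | p.2 < p.1}.indicator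
    (fun p : ℝ × ℝ => deriv χ p.1 • v p.2) (t, s)) hI2
  have e1 : ∀ t ∈ Ioo 0 T, ∫ s in Ioo 0 T, {p : ℝ × ℝ | p.2 < p.1}.indicator
      (fun p : ℝ × ℝ => deriv χ p.1 • v p.2) (t, s) = deriv χ t • ∫ s in (0 : ℝ)..t, v s := by
    intro t ht
    rw [intervalIntegral.integral_of_le ht.1.le, ← integral_Ioc_eq_integral_Ioo.symm.symm,
      ← integral_smul]
    have : (fun s => {p : ℝ × ℝ | p.2 < p.1}.indicator
        (fun p : ℝ × ℝ => deriv χ p.1 • v p.2) (t, s)) =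
        (Iio t).indicator fun s => deriv χ t • v s := by
      ext s; simp [indicator]
    rw [this, integral_indicator measurableSet_Iio, Measure.restrict_restrict measurableSet_Iio]
    have h2 : Iio t ∩ Ioc 0 T = Ioo 0 t := by
      ext s
      constructor
      · rintro ⟨h1, h2⟩; exact ⟨h2.1, h1⟩
      · rintro h1; exact ⟨h1.2, h1.1, (h1.2.trans ht.2).le⟩
    rw [h2, integral_Ioc_eq_integral_Ioo]
  have e2 : ∀ s ∈ Ioo 0 T, ∫ t in Ioo 0 T, {p : ℝ × ℝ | p.2 < p.1}.indicator
      (fun p : ℝ × ℝ => deriv χ p.1 • v p.2) (t, s) = -(χ s • v s) := by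
    intro s hs
    have : (fun t => {p : ℝ × ℝ | p.2 < p.1}.indicator
        (fun p : ℝ × ℝ => deriv χ p.1 • v p.2) (t, s)) =
        (Ioi s).indicator fun t => deriv χ t • v s := by
      ext t; simp [indicator]
    rw [this, integral_indicator measurableSet_Ioi, Measure.restrict_restrict measurableSet_Ioi]
    have h2 : Ioi s ∩ Ioo 0 T = Ioo s T := by
      ext t
      constructor
      · rintro ⟨h1, h2⟩; exact ⟨h1, h2.2⟩
      · rintro h1; exact ⟨h1.1, hs.1.trans h1.1, h1.2⟩
    rw [h2, integral_smul_const, ← integral_Ioc_eq_integral_Ioo,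
      ← intervalIntegral.integral_of_le hs.2.le, intervalIntegral.integral_deriv_eq_sub
        (fun t _ => (h.contDiff.differentiable (by simp)).differentiableAt)
        (hd.intervalIntegrable _ _), hχT, zero_sub, neg_smul]
  rw [setIntegral_congr_fun measurableSet_Ioo e1, setIntegral_congr_fun measurableSet_Ioo e2,
    integral_neg] at hsw
  exact hsw

theorem continuousOn_primitive_Icc (hT : 0 < T) {v : ℝ → E} (hv : IntegrableOn v (Ioo 0 T)) :
    ContinuousOn (fun t => ∫ s in (0 : ℝ)..t, v s) (Icc 0 T) := by
  have h := intervalIntegral.continuousOn_primitive_interval' (intervalIntegrable_of_Ioo hv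
    (left_mem_Icc.2 hT.le) (right_mem_Icc.2 hT.le)) left_mem_uIcc
  rwa [uIcc_of_le hT.le] at h

theorem integrableOn_const_add_primitive (hT : 0 < T) {v : ℝ → E}
    (hv : IntegrableOn v (Ioo 0 T)) (c : E) :
    IntegrableOn (fun t => c + ∫ s in (0 : ℝ)..t, v s) (Ioo 0 T) :=
  (ContinuousOn.integrableOn_Icc (continuousOn_const.add
    (continuousOn_primitive_Icc hT hv))).mono_set Ioo_subset_Icc_self

/-- A weak derivative of order `n + 1` is integrated to a weak derivative of order `n`. -/
theorem IsWeakDeriv.exists_primitive (hT : 0 < T) [CompleteSpace E] {n : ℕ} {u v : ℝ → E}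
    (h : IsWeakDeriv (n + 1) T u v) :
    ∃ c : E, IsWeakDeriv n T u (fun t => c + ∫ s in (0 : ℝ)..t, v s) := by
  obtain ⟨hu, hv, h⟩ := h
  obtain ⟨θ₀, hθ₀, h1⟩ := exists_isTest_integral_eq_one hT
  obtain ⟨V, hV⟩ : ∃ V : ℝ → E, V = fun t => ∫ s in (0 : ℝ)..t, v s := ⟨_, rfl⟩
  have hVi : IntegrableOn V (Ioo 0 T) := by
    simpa [hV] using integrableOn_const_add_primitive hT hv (0 : E)
  obtain ⟨a, ha⟩ : ∃ a, a = ∫ t in Ioo 0 T, iteratedDeriv n θ₀ t • u t := ⟨_, rfl⟩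
  obtain ⟨b, hb⟩ : ∃ b, b = ∫ t in Ioo 0 T, θ₀ t • V t := ⟨_, rfl⟩
  -- The constant is forced by testing with the reference function θ₀ of integral 1. A general θ
  -- with integral i is iθ₀ plus a test function of mean zero, which is the derivative χ' of a test
  -- function, and χ is used in the hypothesis of order n + 1.
  refine ⟨(-1 : ℝ) ^ n • a - b, hu, integrableOn_const_add_primitive hT hv _, fun θ c1 c2 c3 => ?_⟩
  have hθ : IsTest T θ := ⟨c1, c2, c3⟩
  obtain ⟨i, hi⟩ : ∃ i, i = ∫ t in (0 : ℝ)..T, θ t := ⟨_, rfl⟩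
  have hz : ∫ t in (0 : ℝ)..T, (θ t + (-i) * θ₀ t) = 0 := by
    rw [intervalIntegral.integral_add (c1.continuous.intervalIntegrable _ _)
      ((hθ₀.contDiff.continuous.intervalIntegrable _ _).const_mul _),
      intervalIntegral.integral_const_mul, h1, ← hi]
    ring
  obtain ⟨χ, hχ, hd⟩ := (hθ.add (hθ₀.const_mul (-i))).primitive hT hz
  have hdχ : deriv χ = fun t => θ t + (-i) * θ₀ t := funext fun t => (hd t).deriv
  have key := h χ hχ.contDiff hχ.compact hχ.subset
  have hsm := integral_smul_primitive hT hχ hv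
  have hit : ∀ t, iteratedDeriv (n + 1) χ t = iteratedDeriv n θ t + (-i) * iteratedDeriv n θ₀ t := by
    intro t
    rw [iteratedDeriv_succ', hdχ, iteratedDeriv_fun_add
      (c1.contDiffAt.of_le (by exact_mod_cast le_top))
      ((contDiff_const.mul hθ₀.contDiff).contDiffAt.of_le (by exact_mod_cast le_top)),
      iteratedDeriv_const_mul_field]
  have hci : ∀ θ : ℝ → ℝ, ContDiff ℝ ∞ θ → Continuous (iteratedDeriv n θ) := fun θ hθ =>
    hθ.continuous_iteratedDeriv n (by exact_mod_cast le_top)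
  have e1 : ∫ t in Ioo 0 T, iteratedDeriv (n + 1) χ t • u t =
      (∫ t in Ioo 0 T, iteratedDeriv n θ t • u t) - i • a := by
    simp only [hit, add_smul, mul_smul]
    refine (integral_add (integrableOn_smul_of_continuous (hci θ c1) hu)
      ((integrableOn_smul_of_continuous (hci θ₀ hθ₀.contDiff) hu).smul (-i))).trans ?_
    simp only [Pi.smul_apply]
    rw [integral_smul, ← ha, neg_smul, sub_eq_add_neg]
  have e2 : ∫ t in Ioo 0 T, deriv χ t • V t = (∫ t in Ioo 0 T, θ t • V t) - i • b := by
    simp only [hdχ, add_smul, mul_smul]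
    refine (integral_add (integrableOn_smul_of_continuous c1.continuous hVi)
      ((integrableOn_smul_of_continuous hθ₀.contDiff.continuous hVi).smul (-i))).trans ?_
    simp only [Pi.smul_apply]
    rw [integral_smul, ← hb, neg_smul, sub_eq_add_neg]
  have e3 : ∫ t in Ioo 0 T, θ t • ((-1 : ℝ) ^ n • a - b + V t) =
      i • ((-1 : ℝ) ^ n • a - b) + ∫ t in Ioo 0 T, θ t • V t := by
    simp only [smul_add]
    have hθi : IntegrableOn θ (Ioo 0 T) := c1.continuous.integrableOn_Icc.mono_set Ioo_subset_Icc_self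
    rw [integral_add (hθi.smul_const _) (integrableOn_smul_of_continuous c1.continuous hVi),
      integral_smul_const, hi, intervalIntegral.integral_of_le hT.le, integral_Ioc_eq_integral_Ioo]
  have hV' : ∀ t, (∫ s in (0 : ℝ)..t, v s) = V t := fun t => by rw [hV]
  simp only [hV'] at hsm ⊢
  rw [e2] at hsm
  rw [e1] at key
  rw [e3]
  have h4 : ∫ t in Ioo 0 T, χ t • v t = i • b - ∫ t in Ioo 0 T, θ t • V t := by
    rw [← neg_eq_iff_eq_neg.2 (hsm.symm.symm)]; abel
  rw [h4] at key
  rw [eq_add_of_sub_eq key]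
  rcases neg_one_pow_eq_or ℝ n with hn | hn <;> rw [pow_succ, hn] <;> module

theorem ae_eq_of_forall_integral_smul_eq [CompleteSpace E] {u v : ℝ → E}
    (hu : IntegrableOn u (Ioo 0 T)) (hv : IntegrableOn v (Ioo 0 T))
    (h : ∀ θ, IsTest T θ → ∫ t in Ioo 0 T, θ t • u t = ∫ t in Ioo 0 T, θ t • v t) :
    ∀ᵐ t ∂volume.restrict (Ioo 0 T), u t = v t := by
  have key := isOpen_Ioo.ae_eq_zero_of_integral_contDiff_smul_eq_zero (μ := volume)
    (U := Ioo 0 T) (f := fun t => u t - v t) (hu.sub hv).locallyIntegrableOn fun θ h1 h2 h3 => by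
      have hz : ∀ t, t ∉ Ioo 0 T → θ t • (u t - v t) = 0 := fun t ht => by
        rw [image_eq_zero_of_notMem_tsupport fun hm => ht (h3 hm), zero_smul]
      rw [← setIntegral_eq_integral_of_forall_compl_eq_zero hz]
      simp only [smul_sub]
      rw [integral_sub (integrableOn_smul_of_continuous h1.continuous hu)
        (integrableOn_smul_of_continuous h1.continuous hv), h θ ⟨h1, h2, h3⟩, sub_self]
  rw [ae_restrict_iff' measurableSet_Ioo]
  filter_upwards [key] with t ht hm using sub_eq_zero.1 (ht hm)

theorem IsWeakDeriv.unique [CompleteSpace E] {n : ℕ} {u v w : ℝ → E} (h : IsWeakDeriv n T u v)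
    (h' : IsWeakDeriv n T u w) : ∀ᵐ t ∂volume.restrict (Ioo 0 T), v t = w t := by
  refine ae_eq_of_forall_integral_smul_eq h.2.1 h'.2.1 fun θ hθ => ?_
  have h1 := (h.2.2 θ hθ.contDiff hθ.compact hθ.subset).symm.trans
    (h'.2.2 θ hθ.contDiff hθ.compact hθ.subset)
  exact smul_right_injective E (pow_ne_zero n (by norm_num : (-1 : ℝ) ≠ 0)) h1

theorem IsWeakDeriv.ae_eq [CompleteSpace E] {u v : ℝ → E} (h : IsWeakDeriv 0 T u v) :
    ∀ᵐ t ∂volume.restrict (Ioo 0 T), u t = v t := by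
  refine ae_eq_of_forall_integral_smul_eq h.1 h.2.1 fun θ hθ => ?_
  simpa using h.2.2 θ hθ.contDiff hθ.compact hθ.subset

end WeakDerivatives

/-! ### Consecutive time derivatives of a scalar function -/

/-- `f' = g`, `g' = v` and `v' = w` on `[0,T]`, in integrated form. -/
structure TimeRep (T : ℝ) (f g v w : ℝ → ℂ) : Prop where
  cont_g : ContinuousOn g (Icc 0 T)
  cont_v : ContinuousOn v (Icc 0 T)
  int_w : IntegrableOn w (Ioo 0 T)
  f_sub : ∀ a ∈ Icc 0 T, ∀ b ∈ Icc 0 T, f b - f a = ∫ s in a..b, g s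
  g_sub : ∀ a ∈ Icc 0 T, ∀ b ∈ Icc 0 T, g b - g a = ∫ s in a..b, v s
  v_sub : ∀ a ∈ Icc 0 T, ∀ b ∈ Icc 0 T, v b - v a = ∫ s in a..b, w s

theorem sub_eq_integral_of_eqOn {T : ℝ} {E : Type*} [NormedAddCommGroup E] [NormedSpace ℝ E]
    (hT : 0 < T) {f g : ℝ → E} (hg : IntegrableOn g (Ioo 0 T)) {c : E}
    (h : EqOn f (fun t => c + ∫ s in (0 : ℝ)..t, g s) (Icc 0 T)) {a b : ℝ} (ha : a ∈ Icc 0 T)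
    (hb : b ∈ Icc 0 T) : f b - f a = ∫ s in a..b, g s := by
  have h0 := left_mem_Icc.2 hT.le
  rw [h ha, h hb, add_sub_add_left_eq_sub, intervalIntegral.integral_interval_sub_left
    (intervalIntegrable_of_Ioo hg h0 hb) (intervalIntegrable_of_Ioo hg h0 ha)]

/-- The third weak derivative is integrated three times. Continuity of f upgrades the resulting
almost everywhere identity to one on the closed interval, and uniqueness of weak derivatives
identifies the given second derivative with the continuous v. -/
theorem exists_timeRep {T : ℝ} (hT : 0 < T) {f v₂ w : ℝ → ℂ} (hf : ContinuousOn f (Icc 0 T))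
    (h2 : IsWeakDeriv 2 T f v₂) (h3 : IsWeakDeriv 3 T f w) :
    ∃ g v : ℝ → ℂ, TimeRep T f g v w ∧ ∀ᵐ t ∂volume.restrict (Ioo 0 T), v₂ t = v t := by
  obtain ⟨c, hc⟩ := h3.exists_primitive hT
  obtain ⟨d, hd⟩ := hc.exists_primitive hT
  obtain ⟨e, he⟩ := hd.exists_primitive hT
  refine ⟨fun t => d + ∫ s in (0 : ℝ)..t, (c + ∫ x in (0 : ℝ)..s, w x),
    fun t => c + ∫ s in (0 : ℝ)..t, w s, ⟨continuousOn_const.add (continuousOn_primitive_Icc hT hc.2.1),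
    continuousOn_const.add (continuousOn_primitive_Icc hT h3.2.1), h3.2.1,
    fun a ha b hb => ?_, fun a ha b hb => ?_, fun a ha b hb => ?_⟩, h2.unique hc⟩
  · exact sub_eq_integral_of_eqOn hT hd.2.1 (eqOn_Icc_of_ae_eq hT hf
      (continuousOn_const.add (continuousOn_primitive_Icc hT hd.2.1)) he.ae_eq) ha hb
  · exact sub_eq_integral_of_eqOn hT hc.2.1 (fun _ _ => rfl) ha hb
  · exact sub_eq_integral_of_eqOn hT h3.2.1 (fun _ _ => rfl) ha hb

theorem norm_sub_le_integral_norm {T : ℝ} {g v : ℝ → ℂ} (hv : IntegrableOn v (Ioo 0 T))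
    (h : ∀ a ∈ Icc 0 T, ∀ b ∈ Icc 0 T, g b - g a = ∫ s in a..b, v s) {a b x y : ℝ} (ha : 0 ≤ a)
    (hb : b ≤ T) (hx : x ∈ Icc a b) (hy : y ∈ Icc a b) :
    ‖g y - g x‖ ≤ ∫ s in Ioo a b, ‖v s‖ := by
  have hab : Ioo a b ⊆ Ioo 0 T := fun s hs => ⟨ha.trans_lt hs.1, hs.2.trans_le hb⟩
  rw [h x ⟨ha.trans hx.1, hx.2.trans hb⟩ y ⟨ha.trans hy.1, hy.2.trans hb⟩]
  refine (intervalIntegral.norm_integral_le_integral_norm_uIoc).trans ?_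
  rw [← integral_Ioc_eq_integral_Ioo]
  refine setIntegral_mono_set ?_ (Filter.Eventually.of_forall fun _ => norm_nonneg _) ?_
  · rw [integrableOn_Ioc_iff_integrableOn_Ioo]
    exact (hv.mono_set hab).norm
  · exact (Ioc_subset_Ioc (le_min hx.1 hy.1) (max_le hx.2 hy.2)).eventuallyLE

/-- The constant g(z) is subtracted under the integral. The reference time z may differ from x and
y, which serves the forward, backward and global uses below. -/
theorem norm_remainder_le {T : ℝ} {f g : ℝ → ℂ} (hg : ContinuousOn g (Icc 0 T))
    (h : ∀ a ∈ Icc 0 T, ∀ b ∈ Icc 0 T, f b - f a = ∫ s in a..b, g s) {a b x y z W : ℝ} (ha : 0 ≤ a)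
    (hb : b ≤ T) (hx : x ∈ Icc a b) (hy : y ∈ Icc a b) 
    (hW : ∀ s ∈ Icc a b, ‖g s - g z‖ ≤ W) :
    ‖f y - f x - (y - x : ℝ) * g z‖ ≤ W * |y - x| := by
  have hsub : uIcc x y ⊆ Icc a b := uIcc_subset_Icc hx hy
  have hgi : IntervalIntegrable g volume x y := (hg.mono (hsub.trans
    (Icc_subset_Icc ha hb))).intervalIntegrable
  rw [h x ⟨ha.trans hx.1, hx.2.trans hb⟩ y ⟨ha.trans hy.1, hy.2.trans hb⟩]
  have e : ((y - x : ℝ) : ℂ) * g z = ∫ _ in x..y, g z := by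
    rw [intervalIntegral.integral_const, Complex.real_smul]
  rw [e, ← intervalIntegral.integral_sub hgi (by simp)]
  exact intervalIntegral.norm_integral_le_of_norm_le_const fun s hs =>
    hW s (hsub (uIoc_subset_uIcc hs))

theorem integrableOn_Ioo_of_continuousOn {T : ℝ} {g : ℝ → ℂ} (hg : ContinuousOn g (Icc 0 T)) :
    IntegrableOn g (Ioo 0 T) := hg.integrableOn_Icc.mono_set Ioo_subset_Icc_self

/-- Cauchy's inequality on an interval. -/
theorem ofReal_integral_norm_sq_le {T : ℝ} {v : ℝ → ℂ} (hv : IntegrableOn v (Ioo 0 T)) {a b : ℝ}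
    (ha : 0 ≤ a) (hb : b ≤ T) : ENNReal.ofReal ((∫ s in Ioo a b, ‖v s‖) ^ 2) ≤
      ENNReal.ofReal (b - a) * ∫⁻ s in Ioo a b, ‖v s‖ₑ ^ 2 := by
  have hab : Ioo a b ⊆ Ioo 0 T := fun s hs => ⟨ha.trans_lt hs.1, hs.2.trans_le hb⟩
  have hv' := hv.mono_set hab
  rw [ENNReal.ofReal_pow (integral_nonneg fun _ => norm_nonneg _),
    ofReal_integral_norm_eq_lintegral_enorm hv']
  have h := ENNReal.lintegral_mul_le_Lp_mul_Lq (volume.restrict (Ioo a b))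
    Real.HolderConjugate.two_two (f := fun s => ‖v s‖ₑ) (g := 1)
    hv'.aestronglyMeasurable.enorm aemeasurable_const
  simp only [Pi.mul_apply, Pi.one_apply, mul_one, ENNReal.one_rpow, lintegral_one,
    Measure.restrict_apply_univ, Real.volume_Ioo] at h
  calc _ ≤ _ := pow_le_pow_left₀ (by positivity) h 2
    _ = _ := by
      rw [mul_pow, ← ENNReal.rpow_natCast, ← ENNReal.rpow_natCast, ← ENNReal.rpow_mul,
        ← ENNReal.rpow_mul]
      norm_num
      rw [mul_comm]

theorem enorm_sq_le_of_norm_le {z : ℂ} {c W : ℝ} (h : ‖z‖ ≤ c * W) :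
    ‖z‖ₑ ^ 2 ≤ ENNReal.ofReal (c ^ 2) * ENNReal.ofReal (W ^ 2) := by
  rw [← ENNReal.ofReal_mul (sq_nonneg c), ← mul_pow, ← ofReal_norm,
    ← ENNReal.ofReal_pow (norm_nonneg z)]
  exact ENNReal.ofReal_le_ofReal (pow_le_pow_left₀ (norm_nonneg z) h 2)

section Truncation

variable {T : ℝ} {f g v w : ℝ → ℂ}

theorem TimeRep.hasDerivAt (h : TimeRep T f g v w) {t : ℝ} (ht : t ∈ Ioo 0 T) :
    HasDerivAt f (g t) t := by
  have hmem := Icc_mem_nhds ht.1 ht.2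
  have h0 : (0 : ℝ) ∈ Icc 0 T := ⟨le_rfl, ht.1.le.trans ht.2.le⟩
  have hd : HasDerivAt (fun x => f 0 + ∫ s in (0 : ℝ)..x, g s) (g t) t := by
    refine (intervalIntegral.integral_hasDerivAt_right ?_ ?_ ?_).const_add _
    · exact intervalIntegrable_of_Ioo (integrableOn_Ioo_of_continuousOn h.cont_g) h0 (Ioo_subset_Icc_self ht)
    · exact (h.cont_g.mono Ioo_subset_Icc_self).stronglyMeasurableAtFilter isOpen_Ioo t ht
    · exact h.cont_g.continuousAt hmem
  refine hd.congr_of_eventuallyEq ?_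
  filter_upwards [hmem] with x hx
  rw [← h.f_sub 0 h0 x hx]; ring

/-- Error of the trapezoidal rule. -/
theorem TimeRep.trapezoid (h : TimeRep T f g v w) {a b : ℝ} (ha : 0 ≤ a) (hab : a < b)
    (hb : b ≤ T) : ‖(g a + g b) / 2 - (f b - f a) / ((b - a : ℝ) : ℂ)‖ₑ ^ 2 ≤
      ENNReal.ofReal (4 * (b - a) ^ 3) * ∫⁻ s in Ioo a b, ‖w s‖ₑ ^ 2 := by
  obtain ⟨W, hW⟩ : ∃ W, W = ∫ s in Ioo a b, ‖w s‖ := ⟨_, rfl⟩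
  have hW0 : 0 ≤ W := by rw [hW]; exact integral_nonneg fun _ => norm_nonneg _
  have haI : a ∈ Icc a b := ⟨le_rfl, hab.le⟩
  have hbI : b ∈ Icc a b := ⟨hab.le, le_rfl⟩
  have hv : ∀ s ∈ Icc a b, ‖v s - v a‖ ≤ W := fun s hs => by
    rw [hW]; exact norm_sub_le_integral_norm h.int_w h.v_sub ha hb haI hs
  have hg : ∀ s ∈ Icc a b, ‖g s - g a - (s - a : ℝ) * v a‖ ≤ W * |s - a| := fun s hs =>
    norm_remainder_le h.cont_v h.g_sub ha hb haI hs hv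
  have hba : 0 < b - a := sub_pos.2 hab
  have hsub : uIcc a b ⊆ Icc 0 T := by rw [uIcc_of_le hab.le]; exact Icc_subset_Icc ha hb
  have hgi : IntervalIntegrable g volume a b := (h.cont_g.mono hsub).intervalIntegrable
  have e1 : f b - f a - (b - a : ℝ) * g a - ((b - a) ^ 2 / 2 : ℝ) * v a =
      ∫ s in a..b, (g s - g a - (s - a : ℝ) * v a) := by
    have i2 : IntervalIntegrable (fun s : ℝ => ((s - a : ℝ) : ℂ) * v a) volume a b :=
      Continuous.intervalIntegrable (by fun_prop) _ _
    rw [intervalIntegral.integral_sub (hgi.sub (by simp)) i2, intervalIntegral.integral_sub hgi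
      (by simp), ← h.f_sub a ⟨ha, hab.le.trans hb⟩ b ⟨ha.trans hab.le, hb⟩,
      intervalIntegral.integral_const, Complex.real_smul, intervalIntegral.integral_mul_const,
      intervalIntegral.integral_ofReal]
    congr 3
    rw [intervalIntegral.integral_sub (by simp) (by simp), integral_id]
    simp; ring
  have n1 : ‖f b - f a - (b - a : ℝ) * g a - ((b - a) ^ 2 / 2 : ℝ) * v a‖ ≤
      W * (b - a) * |b - a| := by
    rw [e1]
    refine intervalIntegral.norm_integral_le_of_norm_le_const fun s hs => ?_
    rw [uIoc_of_le hab.le] at hs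
    refine (hg s ⟨hs.1.le, hs.2⟩).trans ?_
    rw [abs_of_pos (sub_pos.2 hs.1)]
    gcongr
    exact hs.2
  have n2 := hg b hbI
  rw [abs_of_pos hba] at n1 n2
  have hne : ((b - a : ℝ) : ℂ) ≠ 0 := by exact_mod_cast hba.ne'
  -- Average and difference quotient have the same expansion g(a) + (b - a)v(a)/2 at a; only the two
  -- remainders survive, and both are controlled by the integral of w.
  have e2 : (g a + g b) / 2 - (f b - f a) / ((b - a : ℝ) : ℂ) =
      (1 / 2 : ℝ) * (g b - g a - (b - a : ℝ) * v a) - (b - a : ℝ)⁻¹ *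
      (f b - f a - (b - a : ℝ) * g a - ((b - a) ^ 2 / 2 : ℝ) * v a) := by
    push_cast at hne ⊢
    field_simp
    ring
  have n3 : ‖(g a + g b) / 2 - (f b - f a) / ((b - a : ℝ) : ℂ)‖ ≤ 2 * (b - a) * W := by
    rw [e2]
    refine (norm_sub_le _ _).trans ?_
    rw [norm_mul, norm_mul, Complex.norm_real, Complex.norm_real,
      Real.norm_of_nonneg (by norm_num : (0 : ℝ) ≤ 1 / 2), Real.norm_of_nonneg (inv_nonneg.2 hba.le)]
    calc _ ≤ 1 / 2 * (W * (b - a)) + (b - a)⁻¹ * (W * (b - a) * (b - a)) := by gcongr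
      _ = 3 / 2 * (W * (b - a)) := by field_simp; ring
      _ ≤ _ := by nlinarith [mul_nonneg hW0 hba.le]
  refine (enorm_sq_le_of_norm_le n3).trans ?_
  have := ofReal_integral_norm_sq_le h.int_w ha hb
  rw [← hW] at this
  calc _ ≤ ENNReal.ofReal ((2 * (b - a)) ^ 2) * (ENNReal.ofReal (b - a) *
        ∫⁻ s in Ioo a b, ‖w s‖ₑ ^ 2) := by gcongr
    _ = _ := by rw [← mul_assoc, ← ENNReal.ofReal_mul (by positivity)]; congr 2; ring

/-- Error of the backward difference quotient. -/
theorem TimeRep.backward (h : TimeRep T f g v w) {a b : ℝ} (ha : 0 ≤ a) (hab : a < b)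
    (hb : b ≤ T) : ‖g b - (f b - f a) / ((b - a : ℝ) : ℂ)‖ₑ ^ 2 ≤
      ENNReal.ofReal (b - a) * ∫⁻ s in Ioo a b, ‖v s‖ₑ ^ 2 := by
  have hba : 0 < b - a := sub_pos.2 hab
  have hbI : b ∈ Icc a b := ⟨hab.le, le_rfl⟩
  have n1 := norm_remainder_le h.cont_g h.f_sub ha hb (⟨le_rfl, hab.le⟩ : a ∈ Icc a b) hbI
    (z := b) fun s hs => norm_sub_le_integral_norm (integrableOn_Ioo_of_continuousOn h.cont_v) h.g_sub ha hb hbI hs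
  rw [abs_of_pos hba] at n1
  have hne : ((b - a : ℝ) : ℂ) ≠ 0 := by exact_mod_cast hba.ne'
  have e : g b - (f b - f a) / ((b - a : ℝ) : ℂ) =
      -((b - a : ℝ) : ℂ)⁻¹ * (f b - f a - (b - a : ℝ) * g b) := by
    field_simp; ring
  have n2 : ‖g b - (f b - f a) / ((b - a : ℝ) : ℂ)‖ ≤ 1 * ∫ s in Ioo a b, ‖v s‖ := by
    rw [e, norm_mul, norm_neg, norm_inv, Complex.norm_real, Real.norm_of_nonneg hba.le, one_mul]
    calc _ ≤ (b - a)⁻¹ * ((∫ s in Ioo a b, ‖v s‖) * (b - a)) := by gcongr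
      _ = _ := by field_simp
  refine (enorm_sq_le_of_norm_le n2).trans ?_
  simpa using ofReal_integral_norm_sq_le (integrableOn_Ioo_of_continuousOn h.cont_v) ha hb

/-- Second differences. -/
theorem TimeRep.second_difference (h : TimeRep T f g v w) {t δ : ℝ} (hδ : 0 ≤ δ) (h0 : 0 ≤ t - δ)
    (hT : t + δ ≤ T) : ‖f (t + δ) - 2 * f t + f (t - δ)‖ₑ ^ 2 ≤
      ENNReal.ofReal (8 * δ ^ 3) * ∫⁻ s in Ioo (t - δ) (t + δ), ‖v s‖ₑ ^ 2 := by
  obtain ⟨W, hW⟩ : ∃ W, W = ∫ s in Ioo (t - δ) (t + δ), ‖v s‖ := ⟨_, rfl⟩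
  have ht : t ∈ Icc (t - δ) (t + δ) := ⟨by linarith, by linarith⟩
  have hg : ∀ s ∈ Icc (t - δ) (t + δ), ‖g s - g t‖ ≤ W := fun s hs => by
    rw [hW]; exact norm_sub_le_integral_norm (integrableOn_Ioo_of_continuousOn h.cont_v) h.g_sub h0 hT ht hs
  have n1 := norm_remainder_le h.cont_g h.f_sub h0 hT ht
    (⟨by linarith, by linarith⟩ : t + δ ∈ Icc (t - δ) (t + δ)) hg
  have n2 := norm_remainder_le h.cont_g h.f_sub h0 hT ht
    (⟨by linarith, by linarith⟩ : t - δ ∈ Icc (t - δ) (t + δ)) hg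
  have e1 : t + δ - t = δ := by ring
  have e2 : t - δ - t = -δ := by ring
  rw [e1, abs_of_nonneg hδ] at n1
  rw [e2, abs_neg, abs_of_nonneg hδ] at n2
  have n3 : ‖f (t + δ) - 2 * f t + f (t - δ)‖ ≤ 2 * δ * W := by
    have e : f (t + δ) - 2 * f t + f (t - δ) = (f (t + δ) - f t - (δ : ℝ) * g t) +
      (f (t - δ) - f t - ((-δ : ℝ) : ℂ) * g t) := by push_cast; ring
    rw [e]
    refine (norm_add_le _ _).trans ?_
    linarith
  refine (enorm_sq_le_of_norm_le n3).trans ?_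
  have := ofReal_integral_norm_sq_le (integrableOn_Ioo_of_continuousOn h.cont_v) h0 hT
  rw [← hW] at this
  calc _ ≤ ENNReal.ofReal ((2 * δ) ^ 2) * (ENNReal.ofReal (t + δ - (t - δ)) *
        ∫⁻ s in Ioo (t - δ) (t + δ), ‖v s‖ₑ ^ 2) := by gcongr
    _ = _ := by rw [← mul_assoc, ← ENNReal.ofReal_mul (by positivity)]; congr 2; ring

/-- Bound of the first derivative by the increment and the second derivative. -/
theorem TimeRep.enorm_g_le (h : TimeRep T f g v w) (hT : 0 < T) {t : ℝ} (ht : t ∈ Icc 0 T) :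
    ENNReal.ofReal (T ^ 2) * ‖g t‖ₑ ^ 2 ≤ 2 * (‖f T - f 0‖ₑ ^ 2 +
      ENNReal.ofReal (T ^ 3) * ∫⁻ s in Ioo 0 T, ‖v s‖ₑ ^ 2) := by
  have n1 := norm_remainder_le h.cont_g h.f_sub le_rfl le_rfl (left_mem_Icc.2 hT.le)
    (right_mem_Icc.2 hT.le) (z := t) fun s hs =>
      norm_sub_le_integral_norm (integrableOn_Ioo_of_continuousOn h.cont_v) h.g_sub le_rfl le_rfl ht hs
  rw [sub_zero, abs_of_pos hT, mul_comm (∫ s in Ioo 0 T, ‖v s‖)] at n1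
  have e : ENNReal.ofReal (T ^ 2) * ‖g t‖ₑ ^ 2 = ‖(f T - f 0) + -(f T - f 0 - T * g t)‖ₑ ^ 2 := by
    rw [neg_sub, add_sub_cancel, enorm_mul, mul_pow, ENNReal.ofReal_pow hT.le, ← ofReal_norm (T : ℂ),
      Complex.norm_real, Real.norm_of_nonneg hT.le]
  rw [e]
  refine (enorm_add_sq_le _ _).trans ?_
  gcongr
  rw [enorm_neg]
  refine (enorm_sq_le_of_norm_le n1).trans ?_
  calc _ ≤ ENNReal.ofReal (T ^ 2) * (ENNReal.ofReal (T - 0) * ∫⁻ s in Ioo 0 T, ‖v s‖ₑ ^ 2) := by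
        gcongr; exact ofReal_integral_norm_sq_le (integrableOn_Ioo_of_continuousOn h.cont_v) le_rfl le_rfl
    _ = _ := by
      rw [← mul_assoc, ← ENNReal.ofReal_mul (by positivity)]; congr 2; ring

/-- Bound of a function by averages of itself and of its derivative over a window. -/
theorem TimeRep.enorm_v_le (h : TimeRep T f g v w) {t δ : ℝ} (ht : t ∈ Icc 0 T) (hδ : 0 < δ)
    (hδT : δ ≤ T) : ENNReal.ofReal δ * ‖v t‖ₑ ^ 2 ≤ 2 * (∫⁻ s in Ioo 0 T, ‖v s‖ₑ ^ 2) +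
      2 * ENNReal.ofReal (δ ^ 2) * ∫⁻ s in Ioo 0 T, ‖w s‖ₑ ^ 2 := by
  -- A window of length δ that contains t and stays inside [0,T].
  obtain ⟨a, ha⟩ : ∃ a, a = min t (T - δ) := ⟨_, rfl⟩
  have ha0 : 0 ≤ a := by rw [ha]; exact le_min ht.1 (by linarith)
  have haT : a + δ ≤ T := by have := min_le_right t (T - δ); rw [ha]; linarith
  have hta : t ∈ Icc a (a + δ) := by
    refine ⟨by rw [ha]; exact min_le_left _ _, ?_⟩
    rcases min_choice t (T - δ) with h1 | h1 <;> rw [ha, h1]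
    · linarith
    · linarith [ht.2]
  have hsub : Ioo a (a + δ) ⊆ Ioo 0 T := fun s hs => ⟨ha0.trans_lt hs.1, hs.2.trans_le haT⟩
  obtain ⟨I, hI⟩ : ∃ I, I = ∫⁻ s in Ioo 0 T, ‖w s‖ₑ ^ 2 := ⟨_, rfl⟩
  have hp : ∀ s ∈ Ioo a (a + δ), ‖v t‖ₑ ^ 2 ≤ 2 * ‖v s‖ₑ ^ 2 + 2 * (ENNReal.ofReal δ * I) := by
    intro s hs
    have n1 := norm_sub_le_integral_norm h.int_w h.v_sub ha0 haT (Ioo_subset_Icc_self hs) hta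
    have e : v t = v s + (v t - v s) := by ring
    rw [e, ← mul_add]
    refine (enorm_add_sq_le _ _).trans ?_
    gcongr
    rw [← one_mul (∫ s in Ioo a (a + δ), ‖w s‖)] at n1
    refine (enorm_sq_le_of_norm_le n1).trans ?_
    rw [one_pow, ENNReal.ofReal_one, one_mul]
    refine (ofReal_integral_norm_sq_le h.int_w ha0 haT).trans ?_
    rw [add_sub_cancel_left, hI]
    exact mul_le_mul_right (lintegral_mono_set hsub) _
  have hm : AEMeasurable (fun s => 2 * ‖v s‖ₑ ^ 2) (volume.restrict (Ioo a (a + δ))) :=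
    (((integrableOn_Ioo_of_continuousOn h.cont_v).mono_set hsub).aestronglyMeasurable.enorm.pow_const 2).const_mul 2
  have key := setLIntegral_mono' (μ := volume) measurableSet_Ioo hp
  rw [lintegral_add_left' hm, lintegral_const_mul' _ _ (by simp), setLIntegral_const,
    setLIntegral_const, Real.volume_Ioo, add_sub_cancel_left, mul_comm] at key
  refine key.trans (add_le_add (mul_le_mul_right (lintegral_mono_set hsub) _) (le_of_eq ?_))
  rw [← hI, ENNReal.ofReal_pow hδ.le]
  ring

end Truncation

/-! ### Spatial regularity -/

/-- The product κ·sym is comparable to wt³ except at low frequencies, where it degenerates; there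
wt³ ≤ 2κwt² + 8 leaves the last term. -/
theorem wt_cube_mul_norm_le (hP : P.Admissible) (k : ℤ × ℤ) {c f D : ℂ}
    (hD : D = -((P.M * P.negLap k : ℝ) : ℂ) * ((P.sym k : ℂ) * c + f)) :
    P.wt k ^ 3 * ‖c‖ ≤ 2 * P.symLow / P.M * ‖D‖ + 2 * P.symLow * (P.wt k * ‖f‖) + 8 * ‖c‖ := by
  have hM := hP.M_pos
  have hκ := P.negLap_nonneg k
  have hs := sym_pos hP k
  have hL := symLow_pos hP
  have h1 : P.M * P.negLap k * (P.sym k * ‖c‖) ≤ ‖D‖ + P.M * P.negLap k * ‖f‖ := by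
    have e : ((P.M * P.negLap k : ℝ) : ℂ) * ((P.sym k : ℂ) * c) =
        -D - ((P.M * P.negLap k : ℝ) : ℂ) * f := by rw [hD]; ring
    have h := congrArg norm e
    rw [norm_mul, norm_mul, Complex.norm_real, Complex.norm_real, Real.norm_of_nonneg (by positivity),
      Real.norm_of_nonneg hs.le] at h
    rw [h]
    refine (norm_sub_le _ _).trans ?_
    rw [norm_neg, norm_mul, Complex.norm_real, Real.norm_of_nonneg (by positivity)]
  have h2 : P.wt k ^ 3 ≤ 2 * P.negLap k * P.wt k ^ 2 + 8 := by
    unfold wt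
    nlinarith [mul_nonneg hκ hκ, mul_nonneg hκ (sq_nonneg (P.negLap k - 1)),
      mul_nonneg (add_nonneg hκ zero_le_one) (sq_nonneg (P.negLap k - 1))]
  have h3 : P.wt k ^ 3 * ‖c‖ ≤ 2 * P.negLap k * (P.symLow * P.sym k) * ‖c‖ + 8 * ‖c‖ := by
    have := wt_sq_le_sym hP k
    calc _ ≤ (2 * P.negLap k * P.wt k ^ 2 + 8) * ‖c‖ := by gcongr
      _ ≤ (2 * P.negLap k * (P.symLow * P.sym k) + 8) * ‖c‖ := by gcongr
      _ = _ := by ring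
  have h4 : 2 * P.negLap k * (P.symLow * P.sym k) * ‖c‖ =
      2 * P.symLow / P.M * (P.M * P.negLap k * (P.sym k * ‖c‖)) := by field_simp
  have h5 : 2 * P.symLow / P.M * (P.M * P.negLap k * (P.sym k * ‖c‖)) ≤
      2 * P.symLow / P.M * (‖D‖ + P.M * P.negLap k * ‖f‖) := by gcongr
  have h6 : 2 * P.symLow / P.M * (‖D‖ + P.M * P.negLap k * ‖f‖) =
      2 * P.symLow / P.M * ‖D‖ + 2 * P.symLow * (P.negLap k * ‖f‖) := by field_simp
  have h7 : 2 * P.symLow * (P.negLap k * ‖f‖) ≤ 2 * P.symLow * (P.wt k * ‖f‖) := by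
    have := P.negLap_le_wt k; gcongr
  linarith

/-- Elliptic regularity for `D = M Δ (L c + f)`, `L = (Δ + β)² + λ`. -/
theorem exists_sob_le_of_elliptic (hP : P.Admissible) : ∃ C : ℝ≥0∞, C ≠ ⊤ ∧
    ∀ (p a b : ℕ), p ≤ a + 6 → p ≤ b + 4 → ∀ c f D : ℤ × ℤ → ℂ,
      (∀ k, D k = -((P.M * P.negLap k : ℝ) : ℂ) * ((P.sym k : ℂ) * c k + f k)) →
      P.sob p c ≤ C * (P.sob a D + P.sob b f + P.sob a c) := by
  have hM := hP.M_pos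
  have hL := symLow_pos hP
  obtain ⟨A, hA⟩ : ∃ A, A = 2 * P.symLow / P.M + 2 * P.symLow + 8 := ⟨_, rfl⟩
  have hA0 : 0 ≤ A := by rw [hA]; positivity
  have hA1 : 2 * P.symLow / P.M ≤ A := by rw [hA]; linarith
  have hA2 : 2 * P.symLow ≤ A := by rw [hA]; have : 0 < 2 * P.symLow / P.M := by positivity
                                    linarith
  have hA3 : 8 ≤ A := by rw [hA]; have : 0 < 2 * P.symLow / P.M := by positivity
                         linarith
  refine ⟨ENNReal.ofReal (3 * A ^ 2), by finiteness, fun p a b hpa hpb c f D hD => ?_⟩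
  -- After squaring, the factor wt³ is a gain of six orders over D; f stands under a Laplacian and
  -- carries wt itself, so the gain over f is four.
  have hk : ∀ k, P.wt k ^ p * ‖c k‖ ^ 2 ≤ 3 * A ^ 2 * (P.wt k ^ a * ‖D k‖ ^ 2 +
      P.wt k ^ b * ‖f k‖ ^ 2 + P.wt k ^ a * ‖c k‖ ^ 2) := by
    intro k
    have h1 := P.one_le_wt k
    have h0 := P.wt_pos k
    have h2 := wt_cube_mul_norm_le hP k (hD k)
    have h3 : P.wt k ^ 3 * ‖c k‖ ≤ A * (‖D k‖ + P.wt k * ‖f k‖ + ‖c k‖) := by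
      refine h2.trans ?_
      rw [mul_add, mul_add]
      gcongr
    have h4 : P.wt k ^ 6 * ‖c k‖ ^ 2 ≤ 3 * A ^ 2 * (‖D k‖ ^ 2 + P.wt k ^ 2 * ‖f k‖ ^ 2 +
        ‖c k‖ ^ 2) := by
      have h5 := pow_le_pow_left₀ (by positivity) h3 2
      have h6 : (‖D k‖ + P.wt k * ‖f k‖ + ‖c k‖) ^ 2 ≤ 3 * (‖D k‖ ^ 2 + (P.wt k * ‖f k‖) ^ 2 +
          ‖c k‖ ^ 2) := by
        nlinarith [sq_nonneg (‖D k‖ - P.wt k * ‖f k‖), sq_nonneg (‖D k‖ - ‖c k‖),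
          sq_nonneg (P.wt k * ‖f k‖ - ‖c k‖)]
      calc P.wt k ^ 6 * ‖c k‖ ^ 2 = (P.wt k ^ 3 * ‖c k‖) ^ 2 := by ring
        _ ≤ (A * (‖D k‖ + P.wt k * ‖f k‖ + ‖c k‖)) ^ 2 := h5
        _ = A ^ 2 * (‖D k‖ + P.wt k * ‖f k‖ + ‖c k‖) ^ 2 := by ring
        _ ≤ A ^ 2 * (3 * (‖D k‖ ^ 2 + (P.wt k * ‖f k‖) ^ 2 + ‖c k‖ ^ 2)) := by gcongr
        _ = _ := by ring
    have h7 : P.wt k ^ p ≤ P.wt k ^ 6 * P.wt k ^ a := by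
      rw [← pow_add, add_comm 6 a]; exact pow_le_pow_right₀ h1 hpa
    have h8 : P.wt k ^ p * P.wt k ^ 2 ≤ P.wt k ^ 6 * P.wt k ^ b := by
      rw [← pow_add, ← pow_add]; exact pow_le_pow_right₀ h1 (by omega)
    refine le_of_mul_le_mul_left ?_ (pow_pos h0 6)
    calc P.wt k ^ 6 * (P.wt k ^ p * ‖c k‖ ^ 2) = P.wt k ^ p * (P.wt k ^ 6 * ‖c k‖ ^ 2) := by ring
      _ ≤ P.wt k ^ p * (3 * A ^ 2 * (‖D k‖ ^ 2 + P.wt k ^ 2 * ‖f k‖ ^ 2 + ‖c k‖ ^ 2)) := by gcongr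
      _ = 3 * A ^ 2 * (P.wt k ^ p * ‖D k‖ ^ 2 + P.wt k ^ p * P.wt k ^ 2 * ‖f k‖ ^ 2 +
          P.wt k ^ p * ‖c k‖ ^ 2) := by ring
      _ ≤ 3 * A ^ 2 * (P.wt k ^ 6 * P.wt k ^ a * ‖D k‖ ^ 2 + P.wt k ^ 6 * P.wt k ^ b * ‖f k‖ ^ 2 +
          P.wt k ^ 6 * P.wt k ^ a * ‖c k‖ ^ 2) := by gcongr
      _ = _ := by ring
  have hof : ∀ (s : ℕ) k (z : ℂ), ENNReal.ofReal (P.wt k ^ s) * ‖z‖ₑ ^ 2 =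
      ENNReal.ofReal (P.wt k ^ s * ‖z‖ ^ 2) := fun s k z => by
    rw [ENNReal.ofReal_mul (pow_pos (P.wt_pos k) s).le, ENNReal.ofReal_pow (norm_nonneg _),
      ofReal_norm]
  simp only [sob, hof]
  rw [← ENNReal.tsum_add, ← ENNReal.tsum_add, ← ENNReal.tsum_mul_left]
  refine ENNReal.tsum_le_tsum fun k => ?_
  have := P.wt_pos k
  rw [← ENNReal.ofReal_add (by positivity) (by positivity), ← ENNReal.ofReal_add (by positivity)
    (by positivity), ← ENNReal.ofReal_mul (by positivity)]
  exact ENNReal.ofReal_le_ofReal (hk k)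

/-! ### Time-dependent norms -/

/-- For weakly continuous functions the essential supremum is a supremum. -/
theorem hsNormSq_le_linfty {T s : ℝ} (hT : 0 < T) (hP : P.Admissible) {u : ℝ → ℤ × ℤ → ℂ}
    (hu : ∀ k, ContinuousOn (fun t => u t k) (Icc 0 T)) (h : P.linftyHsNormSq T s u < ⊤) :
    ∀ t ∈ Icc 0 T, P.hsNormSq s (u t) ≤ P.linftyHsNormSq T s u := by
  intro t ht
  have hA := area_pos hP
  obtain ⟨L, hL⟩ : ∃ L, L = P.linftyHsNormSq T s u := ⟨_, rfl⟩
  rw [← hL] at h ⊢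
  have hae : ∀ᵐ t ∂volume.restrict (Ioo 0 T), P.hsNormSq s (u t) ≤ L := by
    rw [hL]; exact ENNReal.ae_le_essSup _
  -- Finite partial sums are continuous in time, so for them a bound at almost every time is a bound
  -- at every time; the full norm is the supremum of these sums.
  rw [hsNormSq, ENNReal.tsum_eq_iSup_sum]
  refine iSup_le fun K => ?_
  have hnn : ∀ t k, 0 ≤ P.Lx * P.Ly * (1 + P.negLap k) ^ s * ‖u t k‖ ^ 2 := fun t k => by
    have := P.negLap_nonneg k; positivity
  rw [← ENNReal.ofReal_sum_of_nonneg fun k _ => hnn t k]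
  obtain ⟨S, hS⟩ : ∃ S : ℝ → ℝ, S = fun t => ∑ k ∈ K, P.Lx * P.Ly * (1 + P.negLap k) ^ s *
    ‖u t k‖ ^ 2 := ⟨_, rfl⟩
  have hc : ContinuousOn S (Icc 0 T) := by
    rw [hS]
    exact continuousOn_finsetSum _ fun k _ => continuousOn_const.mul ((hu k).norm.pow 2)
  -- The inequality S ≤ L is written as an equality of continuous functions, so that the principle
  -- for almost everywhere equal functions applies.
  have hle : ∀ᵐ t ∂volume.restrict (Ioo 0 T), S t = min (S t) L.toReal := by
    filter_upwards [hae] with t ht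
    refine (min_eq_left ?_).symm
    refine (ENNReal.ofReal_le_iff_le_toReal h.ne).1 (le_trans ?_ ht)
    rw [hS, ENNReal.ofReal_sum_of_nonneg fun k _ => hnn t k]
    exact ENNReal.sum_le_tsum K
  have := eqOn_Icc_of_ae_eq hT hc (hc.inf continuousOn_const) hle ht
  refine ENNReal.ofReal_le_of_le_toReal ?_
  have h2 : S t ≤ L.toReal := by rw [this]; exact min_le_right _ _
  rwa [hS] at h2

theorem aemeasurable_of_continuousOn {T : ℝ} {f : ℝ → ℂ} (hf : ContinuousOn f (Icc 0 T)) {a b : ℝ}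
    (hab : Ioo a b ⊆ Ioo 0 T) : AEMeasurable (fun t => ‖f t‖ₑ ^ 2) (volume.restrict (Ioo a b)) :=
  ((integrableOn_Ioo_of_continuousOn hf).mono_set hab).aestronglyMeasurable.enorm.pow_const 2

theorem lintegral_sob {T : ℝ} (s : ℕ) {v : ℝ → ℤ × ℤ → ℂ}
    (hv : ∀ k, ContinuousOn (fun t => v t k) (Icc 0 T)) {a b : ℝ} (hab : Ioo a b ⊆ Ioo 0 T) :
    ∫⁻ t in Ioo a b, P.sob s (v t) =
      ∑' k, ENNReal.ofReal (P.wt k ^ s) * ∫⁻ t in Ioo a b, ‖v t k‖ₑ ^ 2 := by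
  simp only [sob]
  rw [lintegral_tsum fun k => (aemeasurable_of_continuousOn (hv k) hab).const_mul _]
  exact tsum_congr fun k => lintegral_const_mul' _ _ (by finiteness)

theorem lintegral_hsNormSq_of_ae_eq (hP : P.Admissible) {T : ℝ} (s : ℕ) {v u : ℝ → ℤ × ℤ → ℂ}
    (h : ∀ k, ∀ᵐ t ∂volume.restrict (Ioo 0 T), u t k = v t k) {a b : ℝ}
    (hab : Ioo a b ⊆ Ioo 0 T) :
    ∫⁻ t in Ioo a b, P.hsNormSq s (u t) =
      ENNReal.ofReal (P.Lx * P.Ly) * ∫⁻ t in Ioo a b, P.sob s (v t) := by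
  rw [← lintegral_const_mul' _ _ (by finiteness)]
  refine lintegral_congr_ae ?_
  filter_upwards [ae_mono (Measure.restrict_mono hab le_rfl) (ae_all_iff.2 h)] with t ht
  have : u t = v t := funext ht
  rw [hsNormSq_natCast P hP, this]

theorem tsum_inv_wt_lintegral_lt_top (hP : P.Admissible) {T : ℝ} {w : ℝ → ℤ × ℤ → ℂ}
    (hw : P.MemL2Hs T (-1) w) :
    ∑' k, ENNReal.ofReal (P.wt k)⁻¹ * ∫⁻ t in Ioo 0 T, ‖w t k‖ₑ ^ 2 < ⊤ := by
  have hA := area_pos hP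
  have h : ENNReal.ofReal (P.Lx * P.Ly) * (∑' k, ENNReal.ofReal (P.wt k)⁻¹ *
      ∫⁻ t in Ioo 0 T, ‖w t k‖ₑ ^ 2) = ∫⁻ t in Ioo 0 T, P.hsNormSq (-1) (w t) := by
    simp only [hsNormSq]
    have e : ∀ t k, ENNReal.ofReal (P.Lx * P.Ly * (1 + P.negLap k) ^ (-1 : ℝ) * ‖w t k‖ ^ 2) =
        ENNReal.ofReal (P.Lx * P.Ly) * ENNReal.ofReal (P.wt k)⁻¹ * ‖w t k‖ₑ ^ 2 := fun t k => by
      have := P.wt_pos k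
      rw [Real.rpow_neg_one, ENNReal.ofReal_mul (by unfold wt at this; positivity),
        ENNReal.ofReal_mul hA.le, ENNReal.ofReal_pow (norm_nonneg _), ofReal_norm]
      rfl
    simp only [e]
    rw [lintegral_tsum fun k => ((hw.1 k).enorm.pow_const 2).const_mul _, ← ENNReal.tsum_mul_left]
    refine tsum_congr fun k => ?_
    rw [lintegral_const_mul' _ _ (by finiteness), mul_assoc]
  have h2 := hw.2
  rw [← h] at h2
  exact lt_of_mul_lt_mul_left' (a := ENNReal.ofReal (P.Lx * P.Ly)) (by
    rw [ENNReal.mul_top (by simpa using hA)]; exact h2)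

/-- Uniform bounds of the first time derivative. -/
theorem sob_sup_first_lt_top {T : ℝ} (hT : 0 < T) {s : ℕ} {f g v w : ℝ → ℤ × ℤ → ℂ}
    (h : ∀ k, TimeRep T (fun t => f t k) (fun t => g t k) (fun t => v t k) (fun t => w t k))
    (hf : P.sob s (f T - f 0) < ⊤)
    (hv : ∫⁻ t in Ioo 0 T, P.sob s (v t) < ⊤) (τ : ℤ × ℤ → ℝ) (hτ : ∀ k, τ k ∈ Icc 0 T) :
    P.sob s (fun k => g (τ k) k) < ⊤ := by
  have hT2 : ENNReal.ofReal (T ^ 2) ≠ 0 := by simpa using hT.ne'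
  rw [lintegral_sob s (fun k => (h k).cont_v) Subset.rfl] at hv
  refine lt_of_mul_lt_mul_left' (a := ENNReal.ofReal (T ^ 2)) ?_
  rw [ENNReal.mul_top hT2]
  refine lt_of_le_of_lt (b := 2 * (P.sob s (f T - f 0) + ENNReal.ofReal (T ^ 3) *
    ∑' k, ENNReal.ofReal (P.wt k ^ s) * ∫⁻ t in Ioo 0 T, ‖v t k‖ₑ ^ 2)) ?_ (by finiteness)
  rw [sob, sob, ← ENNReal.tsum_mul_left, ← ENNReal.tsum_mul_left, ← ENNReal.tsum_add,
    ← ENNReal.tsum_mul_left]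
  refine ENNReal.tsum_le_tsum fun k => ?_
  have hk := (h k).enorm_g_le hT (hτ k)
  calc _ = ENNReal.ofReal (P.wt k ^ s) * (ENNReal.ofReal (T ^ 2) * ‖g (τ k) k‖ₑ ^ 2) := by ring
    _ ≤ _ := mul_le_mul_right hk _
    _ = _ := by rw [Pi.sub_apply]; ring

/-- Uniform bounds of the second time derivative by interpolation. -/
theorem sob_sup_second_lt_top (hP : P.Admissible) {T : ℝ} (hT : 0 < T) {j : ℕ}
    {f g v w : ℝ → ℤ × ℤ → ℂ}
    (h : ∀ k, TimeRep T (fun t => f t k) (fun t => g t k) (fun t => v t k) (fun t => w t k))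
    (hv : ∫⁻ t in Ioo 0 T, P.sob (2 * j + 1) (v t) < ⊤) (hw : P.MemL2Hs T (-1) w)
    (τ : ℤ × ℤ → ℝ) (hτ : ∀ k, τ k ∈ Icc 0 T) : P.sob j (fun k => v (τ k) k) < ⊤ := by
  have hT2 : ENNReal.ofReal T ≠ 0 := by simpa using hT
  rw [lintegral_sob _ (fun k => (h k).cont_v) Subset.rfl] at hv
  have hw' := tsum_inv_wt_lintegral_lt_top hP hw
  refine lt_of_mul_lt_mul_left' (a := ENNReal.ofReal T) ?_
  rw [ENNReal.mul_top hT2]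
  refine lt_of_le_of_lt (b := 2 * (∑' k, ENNReal.ofReal (P.wt k ^ (2 * j + 1)) *
    ∫⁻ t in Ioo 0 T, ‖v t k‖ₑ ^ 2) + 2 * ENNReal.ofReal (T ^ 2) * (∑' k, ENNReal.ofReal (P.wt k)⁻¹ *
    ∫⁻ t in Ioo 0 T, ‖w t k‖ₑ ^ 2)) ?_ (by finiteness)
  rw [sob, ← ENNReal.tsum_mul_left, ← ENNReal.tsum_mul_left, ← ENNReal.tsum_mul_left,
    ← ENNReal.tsum_add]
  refine ENNReal.tsum_le_tsum fun k => ?_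
  have hk0 := P.wt_pos k
  have hk1 : 1 ≤ P.wt k ^ (j + 1) := one_le_pow₀ (P.one_le_wt k)
  -- The window shrinks with the frequency so as to balance the two norms: after multiplication by
  -- wt^(2j+1) the left side carries wt^j, the v-integral wt^(2j+1) and the w-integral wt⁻¹. This is
  -- interpolation half-way between H^{2j+1} and H⁻¹.
  have hk := (h k).enorm_v_le (hτ k) (δ := T * (P.wt k ^ (j + 1))⁻¹) (by positivity)
    (mul_le_of_le_one_right hT.le (inv_le_one_of_one_le₀ hk1))
  have e1 : ENNReal.ofReal T * ENNReal.ofReal (P.wt k ^ j) =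
      ENNReal.ofReal (P.wt k ^ (2 * j + 1)) * ENNReal.ofReal (T * (P.wt k ^ (j + 1))⁻¹) := by
    rw [← ENNReal.ofReal_mul hT.le, ← ENNReal.ofReal_mul (by positivity)]
    congr 1
    rw [show 2 * j + 1 = j + (j + 1) by ring, pow_add]
    field_simp
  have e2 : ENNReal.ofReal (P.wt k ^ (2 * j + 1)) *
      ENNReal.ofReal ((T * (P.wt k ^ (j + 1))⁻¹) ^ 2) =
      ENNReal.ofReal (T ^ 2) * ENNReal.ofReal (P.wt k)⁻¹ := by
    rw [← ENNReal.ofReal_mul (by positivity), ← ENNReal.ofReal_mul (by positivity)]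
    congr 1
    rw [mul_pow, inv_pow, ← pow_mul, show (j + 1) * 2 = (2 * j + 1) + 1 by ring, pow_succ]
    field_simp
    ring
  calc _ = ENNReal.ofReal (P.wt k ^ (2 * j + 1)) *
        (ENNReal.ofReal (T * (P.wt k ^ (j + 1))⁻¹) * ‖v (τ k) k‖ₑ ^ 2) := by
        rw [← mul_assoc, ← mul_assoc, e1]
    _ ≤ _ := mul_le_mul_right hk _
    _ = 2 * (ENNReal.ofReal (P.wt k ^ (2 * j + 1)) * ∫⁻ t in Ioo 0 T, ‖v t k‖ₑ ^ 2) +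
        2 * (ENNReal.ofReal (P.wt k ^ (2 * j + 1)) *
        ENNReal.ofReal ((T * (P.wt k ^ (j + 1))⁻¹) ^ 2)) * ∫⁻ t in Ioo 0 T, ‖w t k‖ₑ ^ 2 := by ring
    _ = _ := by rw [e2]; ring

/-- A maximizing time is chosen for each mode separately, which places the supremum inside the sum
over frequencies. The resulting sequence dominates the values at all times and, mode by mode, time
integrals. -/
theorem exists_argmax_norm {T : ℝ} (hT : 0 < T) {v : ℝ → ℤ × ℤ → ℂ}
    (hv : ∀ k, ContinuousOn (fun t => v t k) (Icc 0 T)) :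
    ∃ τ : ℤ × ℤ → ℝ, (∀ k, τ k ∈ Icc 0 T) ∧ ∀ k, ∀ t ∈ Icc 0 T, ‖v t k‖ ≤ ‖v (τ k) k‖ := by
  have h : ∀ k, ∃ t₀ ∈ Icc 0 T, ∀ t ∈ Icc 0 T, ‖v t k‖ ≤ ‖v t₀ k‖ := fun k => by
    obtain ⟨t₀, h1, h2⟩ := isCompact_Icc.exists_isMaxOn (nonempty_Icc.2 hT.le) (hv k).norm
    exact ⟨t₀, h1, fun t ht => h2 ht⟩
  choose τ h1 h2 using h
  exact ⟨τ, h1, h2⟩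

theorem sob_sub_le_of_integral {T : ℝ} {s : ℕ} {f g : ℝ → ℤ × ℤ → ℂ} {c : ℤ × ℤ → ℂ}
    (h : ∀ k, ∀ a ∈ Icc 0 T, ∀ b ∈ Icc 0 T, f b k - f a k = ∫ t in a..b, g t k)
    (hc : ∀ k, ∀ t ∈ Icc 0 T, ‖g t k‖ ≤ ‖c k‖) {a b : ℝ} (ha : a ∈ Icc 0 T) (hb : b ∈ Icc 0 T) :
    P.sob s (f b - f a) ≤ ENNReal.ofReal ((b - a) ^ 2) * P.sob s c := by
  rw [← sq_abs]
  refine sob_le_mul_of_norm_le s _ _ fun k => ?_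
  rw [Pi.sub_apply, h k a ha b hb, mul_comm]
  exact intervalIntegral.norm_integral_le_of_norm_le_const fun t ht =>
    hc k t (uIcc_subset_Icc ha hb (uIoc_subset_uIcc ht))

/-! ### Regularity of the exact solution -/

/-- Regularity of an exact solution, with its time derivatives `g`, `v`, `w`. -/
structure Regular (P : PFC) (T : ℝ) (j : ℕ) (φ : ℝ → ℝ × ℝ → ℝ) (g v w : ℝ → ℤ × ℤ → ℂ)
    (B Λ : ℝ≥0∞) : Prop where
  pos : 0 < T
  le_one : j ≤ 1
  bound_ne_top : B ≠ ⊤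
  lip_ne_top : Λ ≠ ⊤
  rep : ∀ k, TimeRep T (fun t => P.coeff (φ t) k) (fun t => g t k) (fun t => v t k)
    (fun t => w t k)
  good : ∀ t ∈ Icc 0 T, P.Good (φ t)
  bound : ∀ t ∈ Icc 0 T, P.sob (2 * j + 5) (P.coeff (φ t)) ≤ B
  eqn : ∀ t ∈ Icc 0 T, ∀ k, g t k = -((P.M * P.negLap k : ℝ) : ℂ) *
    ((P.sym k : ℂ) * P.coeff (φ t) k + P.coeff (fun x => P.dF (φ t x)) k)
  lip : ∀ a ∈ Icc 0 T, ∀ b ∈ Icc 0 T, P.sob (2 * j + 5) (P.coeff (φ b) - P.coeff (φ a)) ≤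
    ENNReal.ofReal ((b - a) ^ 2) * Λ

theorem continuousOn_of_enorm_sq_le {T : ℝ} {f : ℝ → ℂ} {C : ℝ≥0∞} (hC : C ≠ ⊤)
    (h : ∀ a ∈ Icc 0 T, ∀ b ∈ Icc 0 T, ‖f b - f a‖ₑ ^ 2 ≤ ENNReal.ofReal ((b - a) ^ 2) * C) :
    ContinuousOn f (Icc 0 T) := by
  have h' : ∀ a ∈ Icc 0 T, ∀ b ∈ Icc 0 T, dist (f b) (f a) ≤ √C.toReal * dist b a := by
    intro a ha b hb
    have h1 := h a ha b hb
    rw [← ENNReal.ofReal_toReal hC, ← ENNReal.ofReal_mul (sq_nonneg _), ← ofReal_norm,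
      ← ENNReal.ofReal_pow (norm_nonneg _), ENNReal.ofReal_le_ofReal_iff (by positivity)] at h1
    rw [dist_eq_norm, Real.dist_eq]
    refine abs_le_of_sq_le_sq' ?_ (by positivity) |>.2
    rw [mul_pow, Real.sq_sqrt ENNReal.toReal_nonneg, sq_abs, mul_comm]
    exact h1
  have := LipschitzOnWith.of_dist_le_mul (K := ⟨√C.toReal, Real.sqrt_nonneg _⟩) (f := f)
    (s := Icc 0 T) fun x hx y hy => h' y hy x hx
  exact this.continuousOn

theorem coeff_le_sob_zero (c : ℤ × ℤ → ℂ) (k : ℤ × ℤ) : ‖c k‖ₑ ^ 2 ≤ P.sob 0 c := by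
  rw [sob_zero_eq]
  exact ENNReal.le_tsum (f := fun k => ‖c k‖ₑ ^ 2) k

/-- A bootstrap. The L² bound of φ_tt in H^{2j+1} and the bound of φ in H³ give φ_t bounded in
H^{2j+1}; interpolation with φ_ttt gives φ_tt bounded in H^j. So φ and F'(φ) are Lipschitz in
H^{2j+1}, and φ_t is Lipschitz in H^j. The equation expresses φ_t as a sixth-order operator applied
to φ plus a Laplacian of F'(φ), and elliptic regularity lifts everything to H^{2j+5}. The count 2j +
5 ≤ j + 6 is the reason for j ≤ 1. -/
theorem exists_regular (hP : P.Admissible) {T : ℝ} (hT : 0 < T) {j : ℕ} (hj : j ≤ 1)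
    {φ : ℝ → ℝ × ℝ → ℝ} (hφ : P.IsExactSolution T φ)
    (hφ3 : P.MemLinftyHs T (3 : ℕ) (fun t => P.coeff (φ t))) {φtt φttt : ℝ → ℤ × ℤ → ℂ}
    (htt : IsWeakTimeDeriv 2 T (fun t => P.coeff (φ t)) φtt)
    (hs : P.MemL2Hs T (2 * j + 1 : ℕ) φtt)
    (httt : IsWeakTimeDeriv 3 T (fun t => P.coeff (φ t)) φttt)
    (httt1 : P.MemL2Hs T (-1) φttt) :
    ∃ g v B Λ, P.Regular T j φ g v φttt B Λ ∧
      ∀ k, ∀ᵐ t ∂volume.restrict (Ioo 0 T), φtt t k = v t k := by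
  have hA := area_pos hP
  have hA' : ENNReal.ofReal (P.Lx * P.Ly) ≠ 0 := by simpa using hA
  have hrep : ∀ k, ∃ g v : ℝ → ℂ, TimeRep T (fun t => P.coeff (φ t) k) g v (fun t => φttt t k) ∧
      ∀ᵐ t ∂volume.restrict (Ioo 0 T), φtt t k = v t :=
    fun k => exists_timeRep hT (hφ.continuousOn k) (htt k) (httt k)
  choose g' v' hrep' hv' using hrep
  obtain ⟨g, hg⟩ : ∃ g : ℝ → ℤ × ℤ → ℂ, g = fun t k => g' k t := ⟨_, rfl⟩
  obtain ⟨v, hv⟩ : ∃ v : ℝ → ℤ × ℤ → ℂ, v = fun t k => v' k t := ⟨_, rfl⟩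
  have hr : ∀ k, TimeRep T (fun t => P.coeff (φ t) k) (fun t => g t k) (fun t => v t k)
    (fun t => φttt t k) := by rw [hg, hv]; exact hrep'
  have hva : ∀ k, ∀ᵐ t ∂volume.restrict (Ioo 0 T), φtt t k = v t k := by rw [hv]; exact hv'
  -- bounds in `H³`
  obtain ⟨B₃, hB₃, hb3⟩ : ∃ B : ℝ≥0∞, B ≠ ⊤ ∧ ∀ t ∈ Icc 0 T, P.sob 3 (P.coeff (φ t)) ≤ B := by
    refine ⟨(ENNReal.ofReal (P.Lx * P.Ly))⁻¹ * P.linftyHsNormSq T (3 : ℕ) (fun t => P.coeff (φ t)),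
      ENNReal.mul_ne_top (ENNReal.inv_ne_top.2 hA') hφ3.2.ne, fun t ht => ?_⟩
    have h1 := hsNormSq_le_linfty hT hP hφ.continuousOn hφ3.2 t ht
    rw [hsNormSq_natCast P hP] at h1
    rw [← ENNReal.div_eq_inv_mul, ENNReal.le_div_iff_mul_le (Or.inl hA') (Or.inl (by finiteness)),
      mul_comm]
    exact h1
  have hgood : ∀ t ∈ Icc 0 T, P.Good (φ t) := fun t ht =>
    ⟨hφ.memLp t ht, (sob_mono_exp 2 3 (by norm_num) _).trans_lt ((hb3 t ht).trans_lt hB₃.lt_top)⟩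
  have h0 : (0 : ℝ) ∈ Icc 0 T := left_mem_Icc.2 hT.le
  have hTI : T ∈ Icc 0 T := right_mem_Icc.2 hT.le
  have hvL : ∫⁻ t in Ioo 0 T, P.sob (2 * j + 1) (v t) < ⊤ := by
    have h1 := hs.2
    rw [lintegral_hsNormSq_of_ae_eq hP _ hva Subset.rfl] at h1
    exact lt_of_mul_lt_mul_left' (a := ENNReal.ofReal (P.Lx * P.Ly)) (by
      rw [ENNReal.mul_top hA']; exact h1)
  -- Lipschitz continuity
  obtain ⟨σ, hσ, hσ'⟩ := exists_argmax_norm hT fun k => (hr k).cont_g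
  obtain ⟨ρ, hρ, hρ'⟩ := exists_argmax_norm hT fun k => (hr k).cont_v
  obtain ⟨G, hG⟩ : ∃ G, G = P.sob (2 * j + 1) (fun k => g (σ k) k) := ⟨_, rfl⟩
  obtain ⟨V, hV⟩ : ∃ V, V = P.sob j (fun k => v (ρ k) k) := ⟨_, rfl⟩
  have hGt : G ≠ ⊤ := by
    rw [hG]
    refine (sob_sup_first_lt_top hT (f := fun t => P.coeff (φ t)) hr ?_ hvL σ hσ).ne
    refine (sob_mono_exp (2 * j + 1) 3 (by omega) _).trans_lt ((sob_sub_le 3 _ _).trans_lt ?_)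
    have := hb3 0 h0
    have := hb3 T hTI
    refine lt_of_le_of_lt (b := 2 * (B₃ + B₃)) (by gcongr) (by finiteness)
  have hVt : V ≠ ⊤ := by
    rw [hV]
    exact (sob_sup_second_lt_top hP hT (f := fun t => P.coeff (φ t)) hr hvL httt1 ρ hρ).ne
  have hl1 : ∀ a ∈ Icc 0 T, ∀ b ∈ Icc 0 T, P.sob (2 * j + 1) (P.coeff (φ b) - P.coeff (φ a)) ≤
      ENNReal.ofReal ((b - a) ^ 2) * G := fun a ha b hb => by
    rw [hG]
    exact sob_sub_le_of_integral (f := fun t => P.coeff (φ t)) (fun k => (hr k).f_sub) hσ' ha hb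
  have hl2 : ∀ a ∈ Icc 0 T, ∀ b ∈ Icc 0 T, P.sob j (g b - g a) ≤
      ENNReal.ofReal ((b - a) ^ 2) * V := fun a ha b hb => by
    rw [hV]
    exact sob_sub_le_of_integral (fun k => (hr k).g_sub) hρ' ha hb
  obtain ⟨C₁, hC₁, hdF⟩ := exists_sob_dF_sub_le hP (2 * j + 1) 3 (by norm_num) (by omega) hB₃
  obtain ⟨C₂, hC₂, hdF0⟩ := exists_sob_dF_le hP (2 * j + 1) 3 (by norm_num) (by omega) hB₃
  have hl3 : ∀ a ∈ Icc 0 T, ∀ b ∈ Icc 0 T, P.sob (2 * j + 1) (P.coeff (fun x => P.dF (φ b x)) -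
      P.coeff (fun x => P.dF (φ a x))) ≤ ENNReal.ofReal ((b - a) ^ 2) * (C₁ * G) := by
    intro a ha b hb
    have h1 := hdF _ _ (hgood b hb) (hgood a ha) (hb3 b hb) (hb3 a ha)
    rw [coeff_sub ((hgood b hb).dF hP).integrable ((hgood a ha).dF hP).integrable,
      coeff_sub (hgood b hb).integrable (hgood a ha).integrable] at h1
    calc _ ≤ _ := h1
      _ ≤ C₁ * (ENNReal.ofReal ((b - a) ^ 2) * G) := mul_le_mul_right (hl1 a ha b hb) _
      _ = _ := by ring
  have hcF : ∀ k, ContinuousOn (fun t => P.coeff (fun x => P.dF (φ t x)) k) (Icc 0 T) := fun k =>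
    continuousOn_of_enorm_sq_le (C := C₁ * G) (by finiteness) fun a ha b hb =>
      (coeff_le_sob_zero (P := P) (P.coeff (fun x => P.dF (φ b x)) -
        P.coeff (fun x => P.dF (φ a x))) k).trans
        ((sob_mono_exp 0 _ (Nat.zero_le _) _).trans (hl3 a ha b hb))
  -- the equation up to the end points
  have heq : ∀ t ∈ Icc 0 T, ∀ k, g t k = -((P.M * P.negLap k : ℝ) : ℂ) *
      ((P.sym k : ℂ) * P.coeff (φ t) k + P.coeff (fun x => P.dF (φ t x)) k) := by
    intro t ht k
    have hae : ∀ᵐ t ∂volume.restrict (Ioo 0 T), g t k = -((P.M * P.negLap k : ℝ) : ℂ) *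
        ((P.sym k : ℂ) * P.coeff (φ t) k + P.coeff (fun x => P.dF (φ t x)) k) := by
      filter_upwards [ae_restrict_mem measurableSet_Ioo] with t ht
      have htI := Ioo_subset_Icc_self ht
      rw [((hr k).hasDerivAt ht).unique (hφ.equation k t ht), muCoeff]
      have e : (fun x => P.dF (φ t x)) = fun x => (φ t x ^ 3 - P.ε * φ t x) - P.lam * φ t x := by
        ext x; simp only [PFC.dF]; ring
      have hi : Integrable (fun x => φ t x ^ 3 - P.ε * φ t x) (volume.restrict P.Ω) := by
        have := (((hgood t htI).dF hP).add ((hgood t htI).const_mul P.lam)).integrable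
        convert this using 2 with x
        simp only [PFC.dF]; ring
      rw [e, coeff_sub hi ((hgood t htI).const_mul P.lam).integrable, coeff_const_mul]
      simp only [Pi.sub_apply, Pi.smul_apply, smul_eq_mul, sym]
      push_cast
      ring
    exact eqOn_Icc_of_ae_eq hT (hr k).cont_g (continuousOn_const.mul
      ((continuousOn_const.mul (hφ.continuousOn k)).add (hcF k))) hae ht
  -- elliptic regularity
  obtain ⟨C₃, hC₃, hell⟩ := exists_sob_le_of_elliptic hP
  refine ⟨g, v, C₃ * (G + C₂ * B₃ + B₃), C₃ * (V + C₁ * G + G), ⟨hT, hj, by finiteness, by finiteness,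
    hr, hgood, fun t ht => ?_, heq, fun a ha b hb => ?_⟩, hva⟩
  · refine (hell (2 * j + 5) j (2 * j + 1) (by omega) (by omega) _ _ _ (heq t ht)).trans ?_
    have h3 : ∀ s ≤ 3, P.sob s (P.coeff (φ t)) ≤ B₃ := fun s hs =>
      (sob_mono_exp s 3 hs _).trans (hb3 t ht)
    refine mul_le_mul_right (add_le_add (add_le_add ?_ ?_) (h3 j (by omega))) _
    · refine (sob_mono_exp j (2 * j + 1) (by omega) _).trans ?_
      rw [hG]
      exact sob_le_of_norm_le _ _ _ fun k => hσ' k t ht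
    · exact (hdF0 _ (hgood t ht) (hb3 t ht)).trans (mul_le_mul_right (h3 _ (by omega)) _)
  · refine (hell (2 * j + 5) j (2 * j + 1) (by omega) (by omega) (P.coeff (φ b) - P.coeff (φ a))
      (P.coeff (fun x => P.dF (φ b x)) - P.coeff (fun x => P.dF (φ a x))) (g b - g a) fun k => ?_).trans ?_
    · simp only [Pi.sub_apply, heq b hb k, heq a ha k]
      ring
    · calc _ ≤ C₃ * (ENNReal.ofReal ((b - a) ^ 2) * V + ENNReal.ofReal ((b - a) ^ 2) * (C₁ * G) +
            ENNReal.ofReal ((b - a) ^ 2) * G) :=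
            mul_le_mul_right (add_le_add (add_le_add (hl2 a ha b hb) (hl3 a ha b hb))
              ((sob_mono_exp j (2 * j + 1) (by omega) _).trans (hl1 a ha b hb))) _
        _ = _ := by ring

/-! ### Locality of differential operators on Fourier series -/

theorem conj_synth {c : ℤ × ℤ → ℂ} (hc : ∀ k, c (-k) = conj (c k)) (p : ℝ × ℝ) :
    conj (P.synth c p) = P.synth c p := by
  rw [synth, Complex.conj_tsum, ← (Equiv.neg (ℤ × ℤ)).tsum_eq (fun k => c k * P.mode k p)]
  refine tsum_congr fun k => ?_
  rw [Equiv.neg_apply, hc, mode_neg, map_mul]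

/-- The continuous real function with given hermitian coefficients. -/
theorem exists_continuous_of_hermitian (hP : P.Admissible) {c : ℤ × ℤ → ℂ}
    (hc : ∀ k, c (-k) = conj (c k)) (hs : P.sob 2 c < ⊤) :
    ∃ u : ℝ × ℝ → ℝ, Continuous u ∧ P.Good u ∧ P.coeff u = c ∧ ∀ p, (u p : ℂ) = P.synth c p := by
  have hsum := summable_norm_of_sob_two hP hs
  have hu : ∀ p, (((P.synth c p).re : ℝ) : ℂ) = P.synth c p := fun p =>
    Complex.conj_eq_iff_re.1 (conj_synth hc p)
  have hco : P.coeff (fun p => (P.synth c p).re) = c := by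
    rw [coeff_eq_cf]
    simp only [hu]
    exact cf_synth hP hsum
  exact ⟨fun p => (P.synth c p).re, Complex.continuous_re.comp (continuous_synth hsum),
    ⟨(memLp_synth hsum 2).re, by rwa [hco]⟩, hco, hu⟩

theorem abs_ξ_le_wt (k : ℤ × ℤ) : |P.ξ k.1| ≤ P.wt k := by
  rw [abs_le]; unfold wt negLap
  constructor <;> nlinarith [sq_nonneg (P.ξ k.1 - 1), sq_nonneg (P.ξ k.1 + 1), sq_nonneg (P.η k.2)]

theorem abs_η_le_wt (k : ℤ × ℤ) : |P.η k.2| ≤ P.wt k := by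
  rw [abs_le]; unfold wt negLap
  constructor <;> nlinarith [sq_nonneg (P.η k.2 - 1), sq_nonneg (P.η k.2 + 1), sq_nonneg (P.ξ k.1)]

/-- The series may be differentiated term by term, and the derivative of a function vanishing on an
open set vanishes there. This locality, with its counterpart in the second variable, is not visible
from the coefficients. -/
theorem synth_fst_eq_zero {c : ℤ × ℤ → ℂ} (hc : Summable fun k => ‖c k‖)
    (hc' : Summable fun k => |P.ξ k.1| * ‖c k‖) {U : Set (ℝ × ℝ)} (hU : IsOpen U)
    (h : ∀ p ∈ U, P.synth c p = 0) :
    ∀ p ∈ U, P.synth (fun k => Complex.I * P.ξ k.1 * c k) p = 0 := by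
  rintro ⟨x, y⟩ hp
  have hd : HasDerivAt (fun z => P.synth c (z, y))
      (∑' k, c k * (Complex.I * P.ξ k.1 * P.mode k (x, y))) x := by
    refine hasDerivAt_tsum (g := fun k z => c k * P.mode k (z, y))
      (g' := fun k z => c k * (Complex.I * P.ξ k.1 * P.mode k (z, y))) (y₀ := x) hc'
      (fun k z => (hasDerivAt_mode_fst k z y).const_mul _) (fun k z => ?_) ?_ x
    · simp [norm_mode, mul_comm]
    · exact hc.of_norm_bounded fun k => by rw [norm_mul, norm_mode, mul_one]
  have h0 : HasDerivAt (fun z => P.synth c (z, y)) 0 x := by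
    refine (hasDerivAt_const x (0 : ℂ)).congr_of_eventuallyEq ?_
    have hcont : Continuous fun z : ℝ => (z, y) := by fun_prop
    filter_upwards [(hU.preimage hcont).mem_nhds hp] with z hz using h _ hz
  rw [← hd.unique h0, synth]
  exact tsum_congr fun k => by ring

theorem synth_snd_eq_zero {c : ℤ × ℤ → ℂ} (hc : Summable fun k => ‖c k‖)
    (hc' : Summable fun k => |P.η k.2| * ‖c k‖) {U : Set (ℝ × ℝ)} (hU : IsOpen U)
    (h : ∀ p ∈ U, P.synth c p = 0) :
    ∀ p ∈ U, P.synth (fun k => Complex.I * P.η k.2 * c k) p = 0 := by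
  rintro ⟨x, y⟩ hp
  have hd : HasDerivAt (fun z => P.synth c (x, z))
      (∑' k, c k * (Complex.I * P.η k.2 * P.mode k (x, y))) y := by
    refine hasDerivAt_tsum (g := fun k z => c k * P.mode k (x, z))
      (g' := fun k z => c k * (Complex.I * P.η k.2 * P.mode k (x, z))) (y₀ := y) hc'
      (fun k z => (hasDerivAt_mode_snd k x z).const_mul _) (fun k z => ?_) ?_ y
    · simp [norm_mode, mul_comm]
    · exact hc.of_norm_bounded fun k => by rw [norm_mul, norm_mode, mul_one]
  have h0 : HasDerivAt (fun z => P.synth c (x, z)) 0 y := by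
    refine (hasDerivAt_const y (0 : ℂ)).congr_of_eventuallyEq ?_
    have hcont : Continuous fun z : ℝ => (x, z) := by fun_prop
    filter_upwards [(hU.preimage hcont).mem_nhds hp] with z hz using h _ hz
  rw [← hd.unique h0, synth]
  exact tsum_congr fun k => by ring

theorem summable_synth {c : ℤ × ℤ → ℂ} (hc : Summable fun k => ‖c k‖) (p : ℝ × ℝ) :
    Summable fun k => c k * P.mode k p :=
  hc.of_norm_bounded fun k => by rw [norm_mul, norm_mode, mul_one]

theorem synth_add {c d : ℤ × ℤ → ℂ} (hc : Summable fun k => ‖c k‖) (hd : Summable fun k => ‖d k‖)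
    (p : ℝ × ℝ) : P.synth (fun k => c k + d k) p = P.synth c p + P.synth d p := by
  rw [synth, synth, synth, ← (summable_synth hc p).tsum_add (summable_synth hd p)]
  exact tsum_congr fun k => add_mul _ _ _

theorem synth_const_mul (a : ℂ) (c : ℤ × ℤ → ℂ) (p : ℝ × ℝ) :
    P.synth (fun k => a * c k) p = a * P.synth c p := by
  rw [synth, synth, ← tsum_mul_left]
  exact tsum_congr fun k => mul_assoc _ _ _

/-- A Fourier series vanishing on an open set has vanishing Laplacian there. -/
theorem synth_negLap_eq_zero {c : ℤ × ℤ → ℂ} (hc : Summable fun k => P.wt k * ‖c k‖)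
    {U : Set (ℝ × ℝ)} (hU : IsOpen U) (h : ∀ p ∈ U, P.synth c p = 0) :
    ∀ p ∈ U, P.synth (fun k => (P.negLap k : ℂ) * c k) p = 0 := by
  intro p hp
  have h0 : Summable fun k => ‖c k‖ := hc.of_nonneg_of_le (fun k => norm_nonneg _) fun k =>
    le_mul_of_one_le_left (norm_nonneg _) (P.one_le_wt k)
  have hx : Summable fun k => |P.ξ k.1| * ‖c k‖ := hc.of_nonneg_of_le (fun k => by positivity)
    fun k => mul_le_mul_of_nonneg_right (abs_ξ_le_wt k) (norm_nonneg _)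
  have hy : Summable fun k => |P.η k.2| * ‖c k‖ := hc.of_nonneg_of_le (fun k => by positivity)
    fun k => mul_le_mul_of_nonneg_right (abs_η_le_wt k) (norm_nonneg _)
  have nx : ∀ k, ‖Complex.I * P.ξ k.1 * c k‖ = |P.ξ k.1| * ‖c k‖ := fun k => by simp
  have ny : ∀ k, ‖Complex.I * P.η k.2 * c k‖ = |P.η k.2| * ‖c k‖ := fun k => by simp
  have hxx : Summable fun k => |P.ξ k.1| * ‖Complex.I * P.ξ k.1 * c k‖ := by
    refine hc.of_nonneg_of_le (fun k => by positivity) fun k => ?_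
    rw [nx, ← mul_assoc, ← sq, sq_abs]
    refine mul_le_mul_of_nonneg_right ?_ (norm_nonneg _)
    unfold wt negLap; nlinarith [sq_nonneg (P.η k.2)]
  have hyy : Summable fun k => |P.η k.2| * ‖Complex.I * P.η k.2 * c k‖ := by
    refine hc.of_nonneg_of_le (fun k => by positivity) fun k => ?_
    rw [ny, ← mul_assoc, ← sq, sq_abs]
    refine mul_le_mul_of_nonneg_right ?_ (norm_nonneg _)
    unfold wt negLap; nlinarith [sq_nonneg (P.ξ k.1)]
  have h1 := synth_fst_eq_zero (by simpa only [nx] using hx) hxx hU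
    (synth_fst_eq_zero h0 hx hU h) p hp
  have h2 := synth_snd_eq_zero (by simpa only [ny] using hy) hyy hU
    (synth_snd_eq_zero h0 hy hU h) p hp
  have sxx : Summable fun k => ‖Complex.I * P.ξ k.1 * (Complex.I * P.ξ k.1 * c k)‖ := by
    simpa only [norm_mul, Complex.norm_I, one_mul, Complex.norm_real, Real.norm_eq_abs] using hxx
  have syy : Summable fun k => ‖Complex.I * P.η k.2 * (Complex.I * P.η k.2 * c k)‖ := by
    simpa only [norm_mul, Complex.norm_I, one_mul, Complex.norm_real, Real.norm_eq_abs] using hyy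
  have e : (fun k => (P.negLap k : ℂ) * c k) = fun k => (-1 : ℂ) *
      (Complex.I * P.ξ k.1 * (Complex.I * P.ξ k.1 * c k) +
        Complex.I * P.η k.2 * (Complex.I * P.η k.2 * c k)) := by
    ext k
    simp only [negLap]
    push_cast
    linear_combination (P.ξ k.1 ^ 2 + P.η k.2 ^ 2) * c k * Complex.I_sq
  rw [e, synth_const_mul, synth_add sxx syy, h1, h2]
  simp

theorem summable_wt_pow_mul (hP : P.Admissible) {c : ℤ × ℤ → ℂ} {n : ℕ}
    (h : P.sob (2 * n + 2) c < ⊤) : Summable fun k => P.wt k ^ n * ‖c k‖ := by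
  have h1 : P.sob 2 (fun k => ((P.wt k ^ n : ℝ) : ℂ) * c k) < ⊤ := by
    refine lt_of_eq_of_lt (tsum_congr fun k => ?_) h
    have := P.wt_pos k
    rw [enorm_mul, mul_pow, ← ofReal_norm, Complex.norm_real, Real.norm_of_nonneg (by positivity),
      ← ENNReal.ofReal_pow (by positivity), ← mul_assoc, ← ENNReal.ofReal_mul (by positivity)]
    congr 2; ring
  refine (summable_norm_of_sob_two hP h1).congr fun k => ?_
  have := P.wt_pos k
  rw [norm_mul, Complex.norm_real, Real.norm_of_nonneg (by positivity)]

/-- `M Δ ((Δ + β)² + λ) c + M Δ f` vanishes where the Fourier series `c` and `f` vanish. -/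
theorem synth_operator_eq_zero (hP : P.Admissible) {c f : ℤ × ℤ → ℂ} (hc : P.sob 8 c < ⊤)
    (hf : P.sob 4 f < ⊤) {U : Set (ℝ × ℝ)} (hU : IsOpen U) (h : ∀ p ∈ U, P.synth c p = 0)
    (h' : ∀ p ∈ U, P.synth f p = 0) :
    ∀ p ∈ U, P.synth (fun k => -((P.M * P.negLap k : ℝ) : ℂ) * ((P.sym k : ℂ) * c k + f k)) p = 0 := by
  have hw : ∀ {d : ℤ × ℤ → ℂ} {n m : ℕ}, n ≤ m → (Summable fun k => P.wt k ^ m * ‖d k‖) →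
      Summable fun k => P.wt k ^ n * ‖d k‖ := fun hnm hd =>
    hd.of_nonneg_of_le (fun k => by have := P.wt_pos k; positivity) fun k =>
      mul_le_mul_of_nonneg_right (pow_le_pow_right₀ (P.one_le_wt k) hnm) (norm_nonneg _)
  have hlap : ∀ {d : ℤ × ℤ → ℂ} {n : ℕ}, (Summable fun k => P.wt k ^ (n + 1) * ‖d k‖) →
      Summable fun k => P.wt k ^ n * ‖(P.negLap k : ℂ) * d k‖ := fun {d n} hd => by
    refine hd.of_nonneg_of_le (fun k => by have := P.wt_pos k; positivity) fun k => ?_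
    have := P.wt_pos k
    rw [norm_mul, Complex.norm_real, Real.norm_of_nonneg (P.negLap_nonneg k), ← mul_assoc, pow_succ]
    gcongr
    exact P.negLap_le_wt k
  -- Three Laplacians of c and one of f must have absolutely convergent series. Absolute convergence
  -- costs two orders, whence H⁸ and H⁴.
  have c3 := summable_wt_pow_mul hP (n := 3) hc
  have f1 := summable_wt_pow_mul hP (n := 1) hf
  have c2 := hlap c3
  have c1 := hlap c2
  have c0 := hlap c1
  have z1 := synth_negLap_eq_zero (by simpa using hw (by norm_num : 1 ≤ 3) c3) hU h
  have z2 := synth_negLap_eq_zero (by simpa using hw (by norm_num : 1 ≤ 2) c2) hU z1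
  have z3 := synth_negLap_eq_zero (by simpa using c1) hU z2
  have zf := synth_negLap_eq_zero (by simpa using f1) hU h'
  have f0 := hlap f1
  intro p hp
  -- The symbol is expanded as a polynomial in κ, so that the operator becomes a combination of
  -- iterated Laplacians.
  have e : (fun k => -((P.M * P.negLap k : ℝ) : ℂ) * ((P.sym k : ℂ) * c k + f k)) = fun k =>
      ((-P.M * (P.β ^ 2 + P.lam) : ℝ) : ℂ) * ((P.negLap k : ℂ) * c k) +
      (((2 * P.M * P.β : ℝ) : ℂ) * ((P.negLap k : ℂ) * ((P.negLap k : ℂ) * c k)) +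
      (((-P.M : ℝ) : ℂ) * ((P.negLap k : ℂ) * ((P.negLap k : ℂ) * ((P.negLap k : ℂ) * c k))) +
      ((-P.M : ℝ) : ℂ) * ((P.negLap k : ℂ) * f k))) := by
    ext k; simp only [sym]; push_cast; ring
  have sm : ∀ {d : ℤ × ℤ → ℂ} (a : ℂ), (Summable fun k => ‖d k‖) → Summable fun k => ‖a * d k‖ :=
    fun a hd => by simpa only [norm_mul] using hd.mul_left ‖a‖
  have s1 : Summable fun k => ‖(P.negLap k : ℂ) * c k‖ := by simpa using hw (by norm_num : 0 ≤ 2) c2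
  have s2 : Summable fun k => ‖(P.negLap k : ℂ) * ((P.negLap k : ℂ) * c k)‖ := by
    simpa using hw (by norm_num : 0 ≤ 1) c1
  have s3 : Summable fun k => ‖(P.negLap k : ℂ) * ((P.negLap k : ℂ) * ((P.negLap k : ℂ) * c k))‖ := by
    simpa using c0
  have s4 : Summable fun k => ‖(P.negLap k : ℂ) * f k‖ := by simpa using f0
  have sa : ∀ {d d' : ℤ × ℤ → ℂ}, (Summable fun k => ‖d k‖) → (Summable fun k => ‖d' k‖) →
      Summable fun k => ‖d k + d' k‖ := fun hd hd' =>
    (hd.add hd').of_nonneg_of_le (fun k => norm_nonneg _) fun k => norm_add_le _ _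
  rw [e, synth_add (sm _ s1) (sa (sm _ s2) (sa (sm _ s3) (sm _ s4))),
    synth_add (sm _ s2) (sa (sm _ s3) (sm _ s4)), synth_add (sm _ s3) (sm _ s4), synth_const_mul,
    synth_const_mul, synth_const_mul, synth_const_mul, z1 p hp, z2 p hp, z3 p hp, zf p hp]
  simp

/-! ### Stationary solutions -/

section Stationary

variable {T : ℝ} {j : ℕ} {φ : ℝ → ℝ × ℝ → ℝ} {g v w : ℝ → ℤ × ℤ → ℂ} {B Λ : ℝ≥0∞}

theorem Regular.continuousOn_coeff (h : P.Regular T j φ g v w B Λ) (k : ℤ × ℤ) :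
    ContinuousOn (fun t => P.coeff (φ t) k) (Icc 0 T) :=
  continuousOn_of_enorm_sq_le h.lip_ne_top fun a ha b hb =>
    (coeff_le_sob_zero (P.coeff (φ b) - P.coeff (φ a)) k).trans
      ((sob_mono_exp 0 _ (Nat.zero_le _) _).trans (h.lip a ha b hb))

theorem Regular.sob_dF_sub_le (h : P.Regular T j φ g v w B Λ) (hP : P.Admissible) {s : ℕ}
    (hs : s ≤ 2 * j + 5) : ∃ C : ℝ≥0∞, C ≠ ⊤ ∧ ∀ a ∈ Icc 0 T, ∀ b ∈ Icc 0 T,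
      P.sob s (P.coeff (fun x => P.dF (φ b x)) - P.coeff (fun x => P.dF (φ a x))) ≤
        C * P.sob s (P.coeff (φ b) - P.coeff (φ a)) := by
  obtain ⟨C, hC, hdF⟩ := exists_sob_dF_sub_le hP s (2 * j + 5) (by omega) hs h.bound_ne_top
  refine ⟨C, hC, fun a ha b hb => ?_⟩
  have ga := h.good a ha
  have gb := h.good b hb
  have h1 := hdF _ _ gb ga (h.bound b hb) (h.bound a ha)
  rwa [coeff_sub (gb.dF hP).integrable (ga.dF hP).integrable,
    coeff_sub gb.integrable ga.integrable] at h1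

theorem Regular.continuousOn_coeff_dF (h : P.Regular T j φ g v w B Λ) (hP : P.Admissible)
    (k : ℤ × ℤ) : ContinuousOn (fun t => P.coeff (fun x => P.dF (φ t x)) k) (Icc 0 T) := by
  obtain ⟨C, hC, hdF⟩ := h.sob_dF_sub_le hP (Nat.zero_le _)
  have := h.lip_ne_top
  refine continuousOn_of_enorm_sq_le (C := C * Λ) (by finiteness) fun a ha b hb => ?_
  refine (coeff_le_sob_zero (P := P) (P.coeff (fun x => P.dF (φ b x)) -
    P.coeff (fun x => P.dF (φ a x))) k).trans ((hdF a ha b hb).trans ?_)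
  calc _ ≤ C * (ENNReal.ofReal ((b - a) ^ 2) * Λ) :=
        mul_le_mul_right ((sob_mono_exp 0 _ (Nat.zero_le _) _).trans (h.lip a ha b hb)) _
    _ = _ := by ring

/-- The damping Mκ·sym|d|² absorbs d. The forcing stands under a Laplacian, but only the factor
κ/sym remains, which is bounded; hence no derivative of f is lost. -/
theorem two_inner_le_of_damped (hP : P.Admissible) (k : ℤ × ℤ) {d f : ℂ} :
    2 * inner ℝ d (-((P.M * P.negLap k : ℝ) : ℂ) * ((P.sym k : ℂ) * d + f)) ≤
      P.M * P.symLow * ‖f‖ ^ 2 := by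
  have hM := hP.M_pos
  have hκ := P.negLap_nonneg k
  have hs := sym_pos hP k
  have e : inner ℝ d (-((P.M * P.negLap k : ℝ) : ℂ) * ((P.sym k : ℂ) * d + f)) =
      -(P.M * P.negLap k) * (P.sym k * ‖d‖ ^ 2 + inner ℝ d f) := by
    rw [← Complex.real_smul (x := P.sym k), ← Complex.ofReal_neg, ← Complex.real_smul,
      inner_smul_right, inner_add_right, inner_smul_right, real_inner_self_eq_norm_sq]
  have h1 := abs_real_inner_le_norm d f
  have h2 : -inner ℝ d f ≤ ‖d‖ * ‖f‖ := (neg_le_abs _).trans h1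
  have h3 : P.negLap k ≤ P.symLow * P.sym k := by
    refine le_trans ?_ (wt_sq_le_sym hP k)
    nlinarith [P.negLap_le_wt k, P.one_le_wt k]
  have h4 : P.sym k * (2 * (‖d‖ * ‖f‖)) ≤ P.sym k * (2 * (P.sym k * ‖d‖ ^ 2)) + ‖f‖ ^ 2 := by
    nlinarith [sq_nonneg (P.sym k * ‖d‖ - ‖f‖), sq_nonneg (P.sym k * ‖d‖)]
  have h5 : 2 * (‖d‖ * ‖f‖) - 2 * (P.sym k * ‖d‖ ^ 2) ≤ (P.sym k)⁻¹ * ‖f‖ ^ 2 := by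
    refine le_of_mul_le_mul_left ?_ hs
    rw [mul_inv_cancel_left₀ hs.ne']
    linarith
  have h6 : P.negLap k * (P.sym k)⁻¹ ≤ P.symLow := by
    rw [← div_eq_mul_inv, div_le_iff₀ hs]; exact h3
  rw [e]
  calc 2 * (-(P.M * P.negLap k) * (P.sym k * ‖d‖ ^ 2 + inner ℝ d f)) =
        P.M * P.negLap k * (2 * (-inner ℝ d f) - 2 * (P.sym k * ‖d‖ ^ 2)) := by ring
    _ ≤ P.M * P.negLap k * (2 * (‖d‖ * ‖f‖) - 2 * (P.sym k * ‖d‖ ^ 2)) := by gcongr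
    _ ≤ P.M * P.negLap k * ((P.sym k)⁻¹ * ‖f‖ ^ 2) := by gcongr
    _ = P.M * (P.negLap k * (P.sym k)⁻¹) * ‖f‖ ^ 2 := by ring
    _ ≤ _ := by gcongr

theorem norm_sq_le_integral_of_damped {T : ℝ} {d f : ℝ → ℂ} {a : ℝ}
    (hd : ContinuousOn d (Icc 0 T)) (hf : ContinuousOn f (Icc 0 T)) (h0 : d 0 = 0)
    {d' : ℝ → ℂ} (h1 : ∀ t ∈ Ioo 0 T, HasDerivAt d (d' t) t)
    (h2 : ∀ t ∈ Ioo 0 T, 2 * inner ℝ (d t) (d' t) ≤ a * ‖f t‖ ^ 2) {t : ℝ} (ht : t ∈ Icc 0 T) :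
    ‖d t‖ ^ 2 ≤ a * ∫ s in (0 : ℝ)..t, ‖f s‖ ^ 2 := by
  have hT : 0 ≤ T := ht.1.trans ht.2
  have hfc : ContinuousOn (fun s => ‖f s‖ ^ 2) (Icc 0 T) := hf.norm.pow 2
  have hI : ∀ x ∈ Icc 0 T, IntervalIntegrable (fun s => ‖f s‖ ^ 2) volume 0 x := fun x hx =>
    (hfc.mono (uIcc_subset_Icc (left_mem_Icc.2 hT) hx)).intervalIntegrable
  have hder : ∀ x ∈ Ioo 0 T, HasDerivAt (fun t => ‖d t‖ ^ 2 - a * ∫ s in (0 : ℝ)..t, ‖f s‖ ^ 2)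
      (2 * inner ℝ (d x) (d' x) - a * ‖f x‖ ^ 2) x := fun x hx => by
    refine (h1 x hx).norm_sq.sub (HasDerivAt.const_mul a ?_)
    exact intervalIntegral.integral_hasDerivAt_right (hI x (Ioo_subset_Icc_self hx))
      ((hfc.mono Ioo_subset_Icc_self).stronglyMeasurableAtFilter isOpen_Ioo x hx)
      (hfc.continuousAt (Icc_mem_nhds hx.1 hx.2))
  have hcont : ContinuousOn (fun t => ‖d t‖ ^ 2 - a * ∫ s in (0 : ℝ)..t, ‖f s‖ ^ 2) (Icc 0 T) := by
    refine (hd.norm.pow 2).sub (continuousOn_const.mul ?_)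
    have h := intervalIntegral.continuousOn_primitive_interval' (hI T (right_mem_Icc.2 hT))
      left_mem_uIcc
    rwa [uIcc_of_le hT] at h
  have hanti := antitoneOn_of_deriv_nonpos (convex_Icc 0 T) hcont
    (fun x hx => by
      rw [interior_Icc] at hx
      exact (hder x hx).differentiableAt.differentiableWithinAt)
    (fun x hx => by
      rw [interior_Icc] at hx
      rw [(hder x hx).deriv]
      linarith [h2 x hx])
  have := hanti (left_mem_Icc.2 hT) ht ht.1
  simp only [h0, norm_zero, intervalIntegral.integral_same] at this
  linarith

/-- Grönwall's lemma for a homogeneous integral inequality. -/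
theorem eq_zero_of_le_lintegral {T : ℝ} {f : ℝ → ℝ≥0∞} {C K : ℝ} (hC : 0 ≤ C) (hK : 0 ≤ K)
    (hb : ∀ t ∈ Icc 0 T, f t ≤ ENNReal.ofReal K)
    (h : ∀ t ∈ Icc 0 T, f t ≤ ENNReal.ofReal C * ∫⁻ s in Ioo 0 t, f s) :
    ∀ t ∈ Icc 0 T, f t = 0 := by
  -- Iterating the integral inequality from the bound K produces the terms of the exponential
  -- series, which tend to 0. Only monotonicity of the integral is applied to f, so its
  -- measurability plays no role.
  have key : ∀ n : ℕ, ∀ t ∈ Icc 0 T, f t ≤ ENNReal.ofReal (K * ((C * t) ^ n / n.factorial)) := by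
    intro n
    induction n with
    | zero => intro t ht; simpa using hb t ht
    | succ n ih =>
      intro t ht
      refine (h t ht).trans ?_
      have h1 : ∫⁻ s in Ioo 0 t, f s ≤ ∫⁻ s in Ioo 0 t,
          ENNReal.ofReal (K * ((C * s) ^ n / n.factorial)) :=
        setLIntegral_mono' measurableSet_Ioo fun s hs => ih s ⟨hs.1.le, hs.2.le.trans ht.2⟩
      have hcont : Continuous fun s : ℝ => K * ((C * s) ^ n / n.factorial) := by fun_prop
      rw [← ofReal_integral_eq_lintegral_ofReal (hcont.integrableOn_Icc.mono_set
        Ioo_subset_Icc_self) ((ae_restrict_iff' measurableSet_Ioo).2 (Filter.Eventually.of_forall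
        fun s hs => by have := hs.1; positivity)), ← integral_Ioc_eq_integral_Ioo,
        ← intervalIntegral.integral_of_le ht.1] at h1
      refine (mul_le_mul_right h1 _).trans ?_
      rw [← ENNReal.ofReal_mul hC]
      refine ENNReal.ofReal_le_ofReal (le_of_eq ?_)
      simp only [mul_pow]
      rw [intervalIntegral.integral_const_mul, intervalIntegral.integral_div,
        intervalIntegral.integral_const_mul, integral_pow, Nat.factorial_succ]
      have := n.factorial_pos
      push_cast
      field_simp
      simp
      ring
  intro t ht
  have hlim := ENNReal.tendsto_ofReal
    ((FloorSemiring.tendsto_pow_div_factorial_atTop (C * t)).const_mul K)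
  rw [mul_zero, ENNReal.ofReal_zero] at hlim
  exact le_antisymm (ge_of_tendsto' hlim fun n => key n t ht) zero_le

/-- A solution with vanishing initial time derivative is stationary. -/
theorem Regular.stationary (h : P.Regular T j φ g v w B Λ) (hP : P.Admissible) (h0 : g 0 = 0) :
    ∀ t ∈ Icc 0 T, P.coeff (φ t) = P.coeff (φ 0) := by
  obtain ⟨C, hC, hdF⟩ := h.sob_dF_sub_le hP (s := 0) (Nat.zero_le _)
  have hT := h.pos
  have h0I : (0 : ℝ) ∈ Icc 0 T := left_mem_Icc.2 hT.le
  have hM := hP.M_pos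
  have hL := symLow_pos hP
  have hmode : ∀ t ∈ Icc 0 T, ∀ k, ‖(P.coeff (φ t) - P.coeff (φ 0)) k‖ₑ ^ 2 ≤
      ENNReal.ofReal (P.M * P.symLow) * ∫⁻ s in Ioo 0 t, ‖(P.coeff (fun x => P.dF (φ s x)) -
        P.coeff (fun x => P.dF (φ 0 x))) k‖ₑ ^ 2 := by
    intro t ht k
    have hc : ContinuousOn (fun t => P.coeff (fun x => P.dF (φ t x)) k -
        P.coeff (fun x => P.dF (φ 0 x)) k) (Icc 0 T) :=
      (h.continuousOn_coeff_dF hP k).sub continuousOn_const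
    have h1 := norm_sq_le_integral_of_damped (a := P.M * P.symLow)
      (d := fun t => P.coeff (φ t) k - P.coeff (φ 0) k)
      (f := fun t => P.coeff (fun x => P.dF (φ t x)) k - P.coeff (fun x => P.dF (φ 0 x)) k)
      (d' := fun t => g t k) ((h.continuousOn_coeff k).sub continuousOn_const) hc (sub_self _)
      (fun t ht => ((h.rep k).hasDerivAt ht).sub_const _) (fun t ht => by
        -- The vanishing initial velocity makes φ(0) an equilibrium; subtracting its equation leaves
        -- a homogeneous problem for φ(t) - φ(0), forced by F'(φ(t)) - F'(φ(0)).
        have e : g t k = -((P.M * P.negLap k : ℝ) : ℂ) * ((P.sym k : ℂ) *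
            (P.coeff (φ t) k - P.coeff (φ 0) k) + (P.coeff (fun x => P.dF (φ t x)) k -
            P.coeff (fun x => P.dF (φ 0 x)) k)) := by
          have e0 := h.eqn 0 h0I k
          rw [h0, Pi.zero_apply] at e0
          rw [h.eqn t (Ioo_subset_Icc_self ht) k]
          linear_combination -e0
        rw [e]
        exact two_inner_le_of_damped hP k) ht
    rw [intervalIntegral.integral_of_le ht.1, integral_Ioc_eq_integral_Ioo] at h1
    have h2 := ENNReal.ofReal_le_ofReal h1
    have hi : IntegrableOn (fun t => ‖P.coeff (fun x => P.dF (φ t x)) k -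
        P.coeff (fun x => P.dF (φ 0 x)) k‖ ^ 2) (Ioo 0 t) :=
      (hc.norm.pow 2).integrableOn_Icc.mono_set (Ioo_subset_Icc_self.trans
        (Icc_subset_Icc_right ht.2))
    rw [ENNReal.ofReal_mul (by positivity), ofReal_integral_eq_lintegral_ofReal hi (Filter.Eventually.of_forall fun _ => by positivity)] at h2
    simpa only [ENNReal.ofReal_pow (norm_nonneg _), ofReal_norm, Pi.sub_apply] using h2
  have hsum : ∀ t ∈ Icc 0 T, P.sob 0 (P.coeff (φ t) - P.coeff (φ 0)) ≤
      ENNReal.ofReal (P.M * P.symLow * C.toReal) *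
        ∫⁻ s in Ioo 0 t, P.sob 0 (P.coeff (φ s) - P.coeff (φ 0)) := by
    intro t ht
    have hsub : Ioo 0 t ⊆ Ioo 0 T := Ioo_subset_Ioo_right ht.2
    have e := lintegral_sob (P := P) 0 (v := fun s => P.coeff (fun x => P.dF (φ s x)) -
      P.coeff (fun x => P.dF (φ 0 x))) (fun k => (h.continuousOn_coeff_dF hP k).sub
      continuousOn_const) hsub
    simp only [pow_zero, ENNReal.ofReal_one, one_mul] at e
    calc _ ≤ ENNReal.ofReal (P.M * P.symLow) * ∫⁻ s in Ioo 0 t, P.sob 0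
          (P.coeff (fun x => P.dF (φ s x)) - P.coeff (fun x => P.dF (φ 0 x))) := by
          rw [e, sob_zero_eq, ← ENNReal.tsum_mul_left]
          exact ENNReal.tsum_le_tsum fun k => hmode t ht k
      _ ≤ ENNReal.ofReal (P.M * P.symLow) * ∫⁻ s in Ioo 0 t, C *
          P.sob 0 (P.coeff (φ s) - P.coeff (φ 0)) :=
          mul_le_mul_right (setLIntegral_mono' measurableSet_Ioo fun s hs =>
            hdF 0 h0I s ⟨hs.1.le, hs.2.le.trans ht.2⟩) _
      _ = _ := by
        rw [lintegral_const_mul' _ _ hC, ← mul_assoc, ENNReal.ofReal_mul (p := P.M * P.symLow) (by positivity),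
          ENNReal.ofReal_toReal hC]
  obtain ⟨K, hK⟩ : ∃ K, K = ENNReal.ofReal (T ^ 2) * Λ := ⟨_, rfl⟩
  have hKt : K ≠ ⊤ := by have := h.lip_ne_top; rw [hK]; finiteness
  have hz := eq_zero_of_le_lintegral (C := P.M * P.symLow * C.toReal) (K := K.toReal)
    (by positivity) ENNReal.toReal_nonneg (fun t ht => by
      rw [ENNReal.ofReal_toReal hKt, hK]
      refine (sob_mono_exp 0 _ (Nat.zero_le _) _).trans ((h.lip 0 h0I t ht).trans ?_)
      refine mul_le_mul_left (ENNReal.ofReal_le_ofReal ?_) _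
      rw [sub_zero]
      exact pow_le_pow_left₀ ht.1 ht.2 2) hsum
  intro t ht
  have h1 := hz t ht
  rw [sob_zero_eq, ENNReal.tsum_eq_zero] at h1
  ext k
  have := h1 k
  simpa [sub_eq_zero] using this

end Stationary

/-! ### Degenerate initial behaviour -/

/-- Division by t gives X + 3tY = o(t) along times tending to 0. Letting t tend to 0 yields X = 0,
and one more division by t yields Y = 0. -/
theorem eq_zero_of_frequently_small {X Y : ℂ} {C : ℝ} (hC : 0 ≤ C)
    (h : ∀ ε > 0, ∀ δ > 0, ∃ t : ℝ, 0 < t ∧ t < δ ∧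
      ‖(t : ℂ) * X + 3 * (t : ℂ) ^ 2 * Y‖ ^ 2 ≤ C * ((ε + t ^ 2) * t ^ 4)) : X = 0 ∧ Y = 0 := by
  have h1 : ∀ η > 0, ∀ δ > 0, ∃ t : ℝ, 0 < t ∧ t < δ ∧ ‖X + 3 * t * Y‖ ≤ √(2 * C) * η * t := by
    intro η hη δ hδ
    obtain ⟨t, ht, htδ, hb⟩ := h (η ^ 2) (by positivity) (min δ η) (lt_min hδ hη)
    refine ⟨t, ht, htδ.trans_le (min_le_left _ _), ?_⟩
    have htη : t ^ 2 ≤ η ^ 2 := pow_le_pow_left₀ ht.le (htδ.trans_le (min_le_right _ _)).le 2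
    have e : (t : ℂ) * X + 3 * (t : ℂ) ^ 2 * Y = (t : ℂ) * (X + 3 * t * Y) := by ring
    rw [e, norm_mul, Complex.norm_real, Real.norm_of_nonneg ht.le, mul_pow] at hb
    have hb2 : ‖X + 3 * t * Y‖ ^ 2 ≤ (√(2 * C) * η * t) ^ 2 := by
      rw [mul_pow, mul_pow, Real.sq_sqrt (by positivity)]
      refine le_of_mul_le_mul_left (hb.trans ?_) (pow_pos ht 2)
      calc C * ((η ^ 2 + t ^ 2) * t ^ 4) ≤ C * ((η ^ 2 + η ^ 2) * t ^ 4) := by gcongr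
        _ = _ := by ring
    exact abs_le_of_sq_le_sq' hb2 (by positivity) |>.2
  have hX : X = 0 := by
    by_contra hX
    have hpos : 0 < ‖X‖ := norm_pos_iff.2 hX
    obtain ⟨t, ht, htδ, hb⟩ := h1 1 one_pos (‖X‖ / (√(2 * C) + 3 * ‖Y‖ + 1)) (by positivity)
    have h2 : ‖X‖ ≤ ‖X + 3 * t * Y‖ + 3 * t * ‖Y‖ := by
      have e : X = (X + 3 * t * Y) - 3 * t * Y := by ring
      calc ‖X‖ = ‖(X + 3 * t * Y) - 3 * t * Y‖ := by rw [← e]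
        _ ≤ ‖X + 3 * t * Y‖ + ‖3 * t * Y‖ := norm_sub_le _ _
        _ = _ := by simp [abs_of_pos ht]
    rw [lt_div_iff₀ (by positivity)] at htδ
    nlinarith
  subst hX
  refine ⟨rfl, ?_⟩
  by_contra hY
  have hpos : 0 < ‖Y‖ := norm_pos_iff.2 hY
  obtain ⟨t, ht, -, hb⟩ := h1 (‖Y‖ / (√(2 * C) + 1)) (by positivity) 1 one_pos
  rw [zero_add, norm_mul, norm_mul, Complex.norm_real, Real.norm_of_nonneg ht.le,
    Complex.norm_ofNat] at hb
  have h3 : √(2 * C) * (‖Y‖ / (√(2 * C) + 1)) ≤ ‖Y‖ := by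
    rw [mul_div_assoc', div_le_iff₀ (by positivity)]
    nlinarith [Real.sqrt_nonneg (2 * C)]
  have h4 : 3 * t * ‖Y‖ ≤ ‖Y‖ * t := hb.trans (by gcongr)
  nlinarith [mul_pos ht hpos]

/-- If `u₀ u₁²` is constant and `u₁` has mean zero, then `u₀ u₁² = 0`. -/
theorem mul_sq_eq_zero_of_constant (hP : P.Admissible) {u₀ u₁ : ℝ × ℝ → ℝ} (c₀ : Continuous u₀)
    (c₁ : Continuous u₁) (g₀ : P.Good u₀) (g₁ : P.Good u₁) (h0 : P.coeff u₁ 0 = 0)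
    (h : ∀ k ≠ 0, P.coeff (fun x => u₀ x * (u₁ x * u₁ x)) k = 0) :
    ∀ p ∈ P.Ω, u₀ p * (u₁ p * u₁ p) = 0 := by
  have hA := area_pos hP
  have hΩ : IsOpen P.Ω := isOpen_Ioo.prod isOpen_Ioo
  have hg := g₀.mul hP (g₁.mul hP g₁)
  obtain ⟨c, hc⟩ : ∃ c, c = P.coeff (fun x => u₀ x * (u₁ x * u₁ x)) 0 := ⟨_, rfl⟩
  have hs : ∀ p, P.synth (P.coeff (fun x => u₀ x * (u₁ x * u₁ x))) p = c := fun p => by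
    rw [synth, tsum_eq_single 0 fun k hk => by rw [h k hk, zero_mul], mode_zero, mul_one, hc]
  have heq : ∀ p ∈ P.Ω, u₀ p * (u₁ p * u₁ p) = c.re := by
    have hae := hg.ae_eq_synth hP
    have := Measure.eqOn_open_of_ae_eq hae hΩ (Complex.continuous_ofReal.comp
      (c₀.mul (c₁.mul c₁))).continuousOn
      (continuous_synth (summable_norm_of_sob_two hP hg.sob_lt_top)).continuousOn
    intro p hp
    have h1 := congrArg Complex.re (this hp)
    rw [hs] at h1
    simpa using h1
  by_cases hc0 : c.re = 0
  · simpa only [hc0] using heq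
  exfalso
  -- A nonzero constant would forbid zeros of u₁; on the connected cell u₁ would then keep one sign,
  -- against its vanishing mean.
  have hne : ∀ p ∈ P.Ω, u₁ p ≠ 0 := fun p hp hz => hc0 (by rw [← heq p hp, hz]; ring)
  have hint : ∫ p in P.Ω, u₁ p = 0 := by
    rw [coeff] at h0
    have h1 := (mul_eq_zero.1 h0).resolve_left (inv_ne_zero (by exact_mod_cast hA.ne'))
    simp only [Prod.fst_zero, Prod.snd_zero, ξ, η, Int.cast_zero, mul_zero, zero_div, zero_mul,
      add_zero, Complex.ofReal_zero, neg_zero, Complex.exp_zero, mul_one] at h1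
    have h2 := integral_ofReal (𝕜 := ℂ) (f := u₁) (μ := volume.restrict P.Ω)
    exact Complex.ofReal_eq_zero.1 (h2.symm.trans h1)
  have hconn : IsPreconnected P.Ω := ((convex_Ioo 0 P.Lx).prod (convex_Ioo 0 P.Ly)).isPreconnected
  have hpos : ∀ u : ℝ × ℝ → ℝ, Continuous u → P.Good u → (∀ p ∈ P.Ω, 0 < u p) →
      0 < ∫ p in P.Ω, u p := by
    intro u _ hgu hu
    refine (setIntegral_pos_iff_support_of_nonneg_ae ((ae_restrict_iff' hΩ.measurableSet).2
      (Filter.Eventually.of_forall fun p hp => (hu p hp).le)) hgu.integrable).2 ?_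
    have : Function.support u ∩ P.Ω = P.Ω := inter_eq_right.2 fun p hp => (hu p hp).ne'
    rw [this]
    exact hΩ.measure_pos volume ⟨(P.Lx / 2, P.Ly / 2), ⟨by simpa using hP.Lx_pos,
      by linarith [hP.Lx_pos]⟩, by simpa using hP.Ly_pos, by linarith [hP.Ly_pos]⟩
  have hsign : (∀ p ∈ P.Ω, 0 < u₁ p) ∨ (∀ p ∈ P.Ω, 0 < -u₁ p) := by
    by_contra hcon
    push Not at hcon
    obtain ⟨⟨p, hp, hp1⟩, q, hq, hq1⟩ := hcon
    obtain ⟨z, hz, hz0⟩ := hconn.intermediate_value hp hq c₁.continuousOn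
      (⟨hp1, by linarith⟩ : (0 : ℝ) ∈ Icc (u₁ p) (u₁ q))
    exact hne z hz hz0
  rcases hsign with hs | hs
  · exact (hpos u₁ c₁ g₁ hs).ne' hint
  · have h2 := hpos (fun p => -u₁ p) c₁.neg (by simpa using g₁.const_mul (-1)) hs
    rw [integral_neg, hint] at h2
    simp at h2

section Degenerate

variable {T : ℝ} {j : ℕ} {φ : ℝ → ℝ × ℝ → ℝ} {g v w : ℝ → ℤ × ℤ → ℂ} {B Λ : ℝ≥0∞}

/-- The time integral controlling the consistency error. -/
def defect (P : PFC) (j : ℕ) (v w : ℝ → ℤ × ℤ → ℂ) (a b : ℝ) : ℝ≥0∞ :=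
  ∫⁻ s in Ioo a b, (P.negHalfNormSq (w s) + P.sob (2 * j + 1) (v s))

theorem lintegral_sob_le_defect (s : ℕ) (hs : s ≤ 2 * j + 1) (a b : ℝ) :
    ∫⁻ t in Ioo a b, P.sob s (v t) ≤ P.defect j v w a b :=
  lintegral_mono fun _ => (sob_mono_exp s _ hs _).trans le_add_self

theorem lintegral_enorm_le_defect (k : ℤ × ℤ) (a b : ℝ) :
    ∫⁻ t in Ioo a b, ‖v t k‖ₑ ^ 2 ≤ P.defect j v w a b :=
  (lintegral_mono fun t => coeff_le_sob_zero (P := P) (v t) k).trans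
    (lintegral_sob_le_defect 0 (Nat.zero_le _) a b)

theorem lintegral_enorm_third_le_defect (hP : P.Admissible) {k : ℤ × ℤ} (hk : 0 < P.negLap k)
    (a b : ℝ) : ∫⁻ t in Ioo a b, ‖w t k‖ₑ ^ 2 ≤
      ENNReal.ofReal (P.negLap k / (P.Lx * P.Ly)) * P.defect j v w a b := by
  have hA := area_pos hP
  rw [defect, ← lintegral_const_mul' _ _ (by finiteness)]
  refine lintegral_mono fun t => ?_
  have h1 : ENNReal.ofReal (P.Lx * P.Ly * (P.negLap k)⁻¹ * ‖w t k‖ ^ 2) ≤ P.negHalfNormSq (w t) :=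
    ENNReal.le_tsum (f := fun k => ENNReal.ofReal (P.Lx * P.Ly * (P.negLap k)⁻¹ * ‖w t k‖ ^ 2)) k
  calc ‖w t k‖ₑ ^ 2 = ENNReal.ofReal (P.negLap k / (P.Lx * P.Ly)) *
        ENNReal.ofReal (P.Lx * P.Ly * (P.negLap k)⁻¹ * ‖w t k‖ ^ 2) := by
        rw [← ENNReal.ofReal_mul (by positivity), ← ofReal_norm,
          ← ENNReal.ofReal_pow (norm_nonneg _)]
        have hx := hP.Lx_pos.ne'
        have hy := hP.Ly_pos.ne'
        congr 1
        field_simp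
    _ ≤ _ := mul_le_mul_right (h1.trans le_self_add) _

theorem TimeRep.mono {f g v w : ℝ → ℂ} (h : TimeRep T f g v w) {t : ℝ} (ht : t ≤ T) :
    TimeRep t f g v w := by
  have hs : Icc 0 t ⊆ Icc 0 T := Icc_subset_Icc_right ht
  exact ⟨h.cont_g.mono hs, h.cont_v.mono hs, h.int_w.mono_set (Ioo_subset_Ioo_right ht),
    fun a ha b hb => h.f_sub a (hs ha) b (hs hb), fun a ha b hb => h.g_sub a (hs ha) b (hs hb),
    fun a ha b hb => h.v_sub a (hs ha) b (hs hb)⟩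

/-- First order Taylor remainder. -/
theorem enorm_taylor_sq_le {f g v : ℝ → ℂ} (hg : ContinuousOn g (Icc 0 T))
    (hv : IntegrableOn v (Ioo 0 T))
    (h : ∀ a ∈ Icc 0 T, ∀ b ∈ Icc 0 T, f b - f a = ∫ s in a..b, g s)
    (h' : ∀ a ∈ Icc 0 T, ∀ b ∈ Icc 0 T, g b - g a = ∫ s in a..b, v s) {t : ℝ} (ht : t ∈ Icc 0 T) :
    ‖f t - f 0 - t * g 0‖ₑ ^ 2 ≤ ENNReal.ofReal (t ^ 3) * ∫⁻ s in Ioo 0 t, ‖v s‖ₑ ^ 2 := by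
  have h0 : (0 : ℝ) ∈ Icc 0 t := left_mem_Icc.2 ht.1
  have n1 := norm_remainder_le hg h le_rfl ht.2 h0 (right_mem_Icc.2 ht.1) (z := 0)
    fun s hs => norm_sub_le_integral_norm hv h' le_rfl ht.2 h0 hs
  rw [sub_zero, abs_of_nonneg ht.1, mul_comm (∫ s in Ioo 0 t, ‖v s‖)] at n1
  refine (enorm_sq_le_of_norm_le n1).trans ?_
  calc _ ≤ ENNReal.ofReal (t ^ 2) * (ENNReal.ofReal (t - 0) * ∫⁻ s in Ioo 0 t, ‖v s‖ₑ ^ 2) := by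
        gcongr; exact ofReal_integral_norm_sq_le hv le_rfl ht.2
    _ = _ := by
      have := ht.1
      rw [← mul_assoc, ← ENNReal.ofReal_mul (by positivity)]; congr 2; ring

theorem Regular.sob_taylor_le (h : P.Regular T j φ g v w B Λ) {t : ℝ} (ht : t ∈ Icc 0 T) :
    P.sob 0 (P.coeff (φ t) - P.coeff (φ 0) - (t : ℂ) • g 0) ≤
      ENNReal.ofReal (t ^ 3) * P.defect j v w 0 t := by
  refine le_trans ?_ (mul_le_mul_right (lintegral_sob_le_defect 0 (Nat.zero_le _) 0 t) _)
  rw [lintegral_sob 0 (fun k => (h.rep k).cont_v) (Ioo_subset_Ioo_right ht.2), sob_zero_eq,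
    ← ENNReal.tsum_mul_left]
  refine ENNReal.tsum_le_tsum fun k => ?_
  have := h.rep k
  simpa using enorm_taylor_sq_le this.cont_g (integrableOn_Ioo_of_continuousOn this.cont_v)
    this.f_sub this.g_sub ht

/-- The alternative to linear growth of the defect. -/
theorem exists_small_defect (hT : 0 < T)
    (h : ¬∃ c > 0, ∀ t ∈ Ioc 0 T, ENNReal.ofReal (c * t) ≤ P.defect j v w 0 t) :
    ∀ ε > 0, ∀ δ > 0, ∃ t, 0 < t ∧ t < δ ∧ t ≤ T ∧ P.defect j v w 0 t ≤ ENNReal.ofReal (ε * t) := by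
  intro ε hε δ hδ
  obtain ⟨δ', hδ'⟩ : ∃ δ', δ' = min δ T := ⟨_, rfl⟩
  have hd0 : 0 < δ' := by rw [hδ']; exact lt_min hδ hT
  have hd1 : δ' ≤ δ := by rw [hδ']; exact min_le_left _ _
  have hd2 : δ' ≤ T := by rw [hδ']; exact min_le_right _ _
  push Not at h
  -- The constant is small enough that a time t where the linear bound fails can be used even when
  -- it is not small: by monotonicity of the defect it may then be replaced by δ'/2.
  obtain ⟨t, ht, hlt⟩ := h (ε * (δ' / (2 * T))) (by positivity)
  have hle : ε * (δ' / (2 * T)) * t ≤ ε * (δ' / 2) := by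
    have : δ' / (2 * T) * t ≤ δ' / 2 := by
      rw [div_mul_eq_mul_div, div_le_div_iff₀ (by positivity) (by positivity)]
      nlinarith [ht.2]
    rw [mul_assoc]
    gcongr
  by_cases htd : t < δ' / 2
  · refine ⟨t, ht.1, by linarith, ht.2, hlt.le.trans (ENNReal.ofReal_le_ofReal ?_)⟩
    have : δ' / (2 * T) ≤ 1 := by rw [div_le_one (by positivity)]; linarith
    calc _ ≤ ε * 1 * t := by gcongr; exact ht.1.le
      _ = _ := by ring
  · refine ⟨δ' / 2, by positivity, by linarith, by linarith, le_trans ?_ (hlt.le.trans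
      (ENNReal.ofReal_le_ofReal hle))⟩
    exact lintegral_mono_set (Ioo_subset_Ioo_right (not_lt.1 htd))

end Degenerate

theorem sym_neg (k : ℤ × ℤ) : P.sym (-k) = P.sym k := by rw [sym, sym, negLap_neg]

section Initial

variable {T : ℝ} {j : ℕ} {φ : ℝ → ℝ × ℝ → ℝ} {g v w : ℝ → ℤ × ℤ → ℂ} {B Λ : ℝ≥0∞}

theorem Regular.g_neg (h : P.Regular T j φ g v w B Λ) {t : ℝ} (ht : t ∈ Icc 0 T) (k : ℤ × ℤ) :
    g t (-k) = conj (g t k) := by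
  rw [h.eqn t ht, h.eqn t ht, coeff_neg, coeff_neg, negLap_neg, sym_neg]
  simp

/-- The Lipschitz bound holds for the difference quotients at 0 and passes to their limit on finite
sums of modes. The velocity thereby has far more spatial regularity at t = 0 than its construction
gives. -/
theorem Regular.sob_g_zero_le (h : P.Regular T j φ g v w B Λ) : P.sob (2 * j + 5) (g 0) ≤ Λ := by
  have hT := h.pos
  have h0 : (0 : ℝ) ∈ Icc 0 T := left_mem_Icc.2 hT.le
  have hlim : ∀ k, Filter.Tendsto (fun t : ℝ => (P.coeff (φ t) k - P.coeff (φ 0) k) / (t : ℂ))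
      (nhdsWithin 0 (Ioi 0)) (nhds (g 0 k)) := by
    intro k
    have hr := h.rep k
    have hd : HasDerivWithinAt (fun x => P.coeff (φ 0) k + ∫ s in (0 : ℝ)..x, g s k) (g 0 k)
        (Ioi 0) 0 := by
      refine (intervalIntegral.integral_hasDerivWithinAt_right (s := Ici 0) (t := Ioi 0) (by simp)
        ?_ ?_).const_add _ |>.mono Ioi_subset_Ici_self
      · refine ⟨Ioo 0 T, Ioo_mem_nhdsGT hT, ?_⟩
        exact (hr.cont_g.mono Ioo_subset_Icc_self).aestronglyMeasurable measurableSet_Ioo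
      · exact (hr.cont_g 0 h0).mono_of_mem_nhdsWithin
          (Filter.mem_of_superset (Ioo_mem_nhdsGT hT) Ioo_subset_Icc_self)
    rw [hasDerivWithinAt_iff_tendsto_slope' (by simp)] at hd
    refine hd.congr' ?_
    filter_upwards [Ioo_mem_nhdsGT hT] with t ht
    have := hr.f_sub 0 h0 t (Ioo_subset_Icc_self ht)
    rw [slope_def_module]
    simp only [intervalIntegral.integral_same, add_zero, add_sub_cancel_left, sub_zero]
    rw [← this, Complex.real_smul, Complex.ofReal_inv, div_eq_inv_mul]
  rw [sob, ENNReal.tsum_eq_iSup_sum]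
  refine iSup_le fun K => ?_
  have hsum : Filter.Tendsto (fun t : ℝ => ∑ k ∈ K, ENNReal.ofReal (P.wt k ^ (2 * j + 5)) *
      ‖(P.coeff (φ t) k - P.coeff (φ 0) k) / (t : ℂ)‖ₑ ^ 2) (nhdsWithin 0 (Ioi 0))
      (nhds (∑ k ∈ K, ENNReal.ofReal (P.wt k ^ (2 * j + 5)) * ‖g 0 k‖ₑ ^ 2)) :=
    tendsto_finsetSum K fun k _ => ENNReal.Tendsto.const_mul
      (((ENNReal.continuous_pow 2).tendsto _).comp (hlim k).enorm) (Or.inr (by finiteness))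
  refine le_of_tendsto hsum ?_
  filter_upwards [Ioo_mem_nhdsGT hT] with t ht
  have htI := Ioo_subset_Icc_self ht
  have h1 := h.lip 0 h0 t htI
  have ht2 : ENNReal.ofReal (t ^ 2) ≠ 0 := by have := ht.1; simp; positivity
  rw [sub_zero] at h1
  have h2 : P.sob (2 * j + 5) ((t : ℂ)⁻¹ • (P.coeff (φ t) - P.coeff (φ 0))) ≤ Λ := by
    have e : ‖(t : ℂ)⁻¹‖ₑ ^ 2 = (ENNReal.ofReal (t ^ 2))⁻¹ := by
      rw [enorm_inv (by exact_mod_cast ht.1.ne'), ← ENNReal.inv_pow, ← ofReal_norm,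
        Complex.norm_real, Real.norm_of_nonneg ht.1.le, ENNReal.ofReal_pow ht.1.le]
    rw [sob_smul, e]
    calc _ ≤ (ENNReal.ofReal (t ^ 2))⁻¹ * (ENNReal.ofReal (t ^ 2) * Λ) := mul_le_mul_right h1 _
      _ = Λ := by rw [← mul_assoc, ENNReal.inv_mul_cancel ht2 (by finiteness), one_mul]
  refine le_trans ?_ h2
  rw [sob]
  refine le_trans (le_of_eq (Finset.sum_congr rfl fun k _ => ?_)) (ENNReal.sum_le_tsum K)
  rw [Pi.smul_apply, Pi.sub_apply, smul_eq_mul, div_eq_inv_mul]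

/-- The difference of the nonlinearity, expanded to second order in time. -/
theorem Regular.exists_expansion_dF (h : P.Regular T j φ g v w B Λ) (hP : P.Admissible)
    {u₁ : ℝ × ℝ → ℝ} (hu : P.Good u₁) (hu₁ : P.coeff u₁ = g 0) :
    ∃ C : ℝ≥0∞, C ≠ ⊤ ∧ ∀ t ∈ Icc 0 T, ∀ ε, P.defect j v w 0 t ≤ ENNReal.ofReal (ε * t) → 0 ≤ ε →
      P.sob 0 (P.coeff (fun x => P.dF (φ t x)) - P.coeff (fun x => P.dF (φ 0 x)) -
        (t : ℂ) • P.coeff (fun x => 3 * (φ 0 x * (φ 0 x * u₁ x)) - (P.ε + P.lam) * u₁ x) -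
        (3 * (t : ℂ) ^ 2) • P.coeff (fun x => φ 0 x * (u₁ x * u₁ x))) ≤
      C * ENNReal.ofReal ((ε + t ^ 2) * t ^ 4) := by
  have hT := h.pos
  have hBt := h.bound_ne_top
  have hΛt := h.lip_ne_top
  have h0 : (0 : ℝ) ∈ Icc 0 T := left_mem_Icc.2 hT.le
  have g0 := h.good 0 h0
  obtain ⟨m, hm⟩ : ∃ m, m = P.mulConst 0 * P.mulConst 0 := ⟨_, rfl⟩
  have hmt : m ≠ ⊤ := by have := P.mulConst_lt_top hP 0; rw [hm]; finiteness
  obtain ⟨D, hD⟩ : ∃ D, D = 2 * (ENNReal.ofReal (T ^ 2) * Λ + ENNReal.ofReal (T ^ 2) * Λ) :=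
    ⟨_, rfl⟩
  have hDt : D ≠ ⊤ := by rw [hD]; finiteness
  obtain ⟨A, hA⟩ : ∃ A, A = ENNReal.ofReal (3 ^ 2) * (m * (B * B)) +
      ENNReal.ofReal ((P.ε + P.lam) ^ 2) := ⟨_, rfl⟩
  obtain ⟨C, hC⟩ : ∃ C, C = 2 * (2 * (2 * A + ENNReal.ofReal (3 ^ 2) * (m * (B * D))) +
      m * (Λ * Λ * Λ)) := ⟨_, rfl⟩
  refine ⟨C, by rw [hC, hA]; finiteness, fun t ht ε hdef hε => ?_⟩
  have gt := h.good t ht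
  have ht0 := ht.1
  obtain ⟨δ, hδ⟩ : ∃ δ : ℝ × ℝ → ℝ, δ = fun x => φ t x - φ 0 x := ⟨_, rfl⟩
  obtain ⟨e, he⟩ : ∃ e : ℝ × ℝ → ℝ, e = fun x => φ t x - φ 0 x - t * u₁ x := ⟨_, rfl⟩
  obtain ⟨s, hs⟩ : ∃ s : ℝ × ℝ → ℝ, s = fun x => δ x + t * u₁ x := ⟨_, rfl⟩
  have gδ : P.Good δ := by rw [hδ]; exact gt.sub g0
  have ge : P.Good e := by rw [he]; exact (gt.sub g0).sub (hu.const_mul t)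
  have gs : P.Good s := by rw [hs]; exact gδ.add (hu.const_mul t)
  have cδ : P.coeff δ = P.coeff (φ t) - P.coeff (φ 0) := by
    rw [hδ]; exact coeff_sub gt.integrable g0.integrable
  have ce : P.coeff e = P.coeff (φ t) - P.coeff (φ 0) - (t : ℂ) • g 0 := by
    rw [he, coeff_sub (gt.sub g0).integrable (hu.const_mul t).integrable,
      coeff_sub gt.integrable g0.integrable, coeff_const_mul, hu₁]
  have n0 : P.sob 2 (P.coeff (φ 0)) ≤ B := (sob_mono_exp 2 _ (by omega) _).trans (h.bound 0 h0)
  have nδ : P.sob 2 (P.coeff δ) ≤ ENNReal.ofReal (t ^ 2) * Λ := by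
    rw [cδ]; simpa using (sob_mono_exp 2 _ (by omega) _).trans (h.lip 0 h0 t ht)
  have n1 : P.sob 2 (P.coeff u₁) ≤ Λ := by
    rw [hu₁]; exact (sob_mono_exp 2 _ (by omega) _).trans h.sob_g_zero_le
  have hts : ENNReal.ofReal (t ^ 2) ≤ ENNReal.ofReal (T ^ 2) :=
    ENNReal.ofReal_le_ofReal (pow_le_pow_left₀ ht0 ht.2 2)
  have ns : P.sob 2 (P.coeff s) ≤ D := by
    rw [hs, hD]
    refine (sob_coeff_add_le 2 gδ (hu.const_mul t)).trans ?_
    rw [sob_coeff_const_mul]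
    gcongr
    exact nδ.trans (by gcongr)
  obtain ⟨E, hE⟩ : ∃ E, E = ENNReal.ofReal (ε * t ^ 4) := ⟨_, rfl⟩
  have ne : P.sob 0 (P.coeff e) ≤ E := by
    rw [ce]
    refine (h.sob_taylor_le ht).trans ((mul_le_mul_right hdef _).trans (le_of_eq ?_))
    rw [hE, ← ENNReal.ofReal_mul (by positivity)]
    congr 1; ring
  -- the remainder
  have gR1 := (g0.mul hP (g0.mul hP ge)).const_mul 3
  have gR2 := ge.const_mul (P.ε + P.lam)
  have gR3 := (g0.mul hP (gs.mul hP ge)).const_mul 3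
  have gR4 := gδ.mul hP (gδ.mul hP gδ)
  have gA := ((g0.mul hP (g0.mul hP hu)).const_mul 3).sub (hu.const_mul (P.ε + P.lam))
  have gY := g0.mul hP (hu.mul hP hu)
  have gT := h.good t ht
  -- Taylor expansion of the cubic in δ = φ(t) - φ(0) = tu₁ + e. The quadratic term is rearranged by
  -- δ² - t²u₁² = (δ + tu₁)e, so that, apart from δ³, every remainder contains the Taylor error e.
  have eq1 : P.coeff (fun x => P.dF (φ t x)) - P.coeff (fun x => P.dF (φ 0 x)) -
        (t : ℂ) • P.coeff (fun x => 3 * (φ 0 x * (φ 0 x * u₁ x)) - (P.ε + P.lam) * u₁ x) -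
        (3 * (t : ℂ) ^ 2) • P.coeff (fun x => φ 0 x * (u₁ x * u₁ x)) =
      P.coeff (fun x => (3 * (φ 0 x * (φ 0 x * e x)) - (P.ε + P.lam) * e x +
        3 * (φ 0 x * (s x * e x))) + δ x * (δ x * δ x)) := by
    have c3 : (3 * (t : ℂ) ^ 2) = ((3 * t ^ 2 : ℝ) : ℂ) := by push_cast; ring
    rw [c3, ← coeff_const_mul, ← coeff_const_mul, ← coeff_sub (gT.dF hP).integrable
      (g0.dF hP).integrable, ← coeff_sub ((gT.dF hP).sub (g0.dF hP)).integrable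
      (gA.const_mul t).integrable, ← coeff_sub (((gT.dF hP).sub (g0.dF hP)).sub
      (gA.const_mul t)).integrable (gY.const_mul _).integrable]
    congr 1
    funext x
    simp only [hs, he, hδ, dF]
    ring
  rw [eq1]
  have hE1 : E ≤ ENNReal.ofReal ((ε + t ^ 2) * t ^ 4) := by
    rw [hE]; refine ENNReal.ofReal_le_ofReal ?_
    have : 0 ≤ t ^ 4 := by positivity
    nlinarith [sq_nonneg t]
  have hE2 : ENNReal.ofReal (t ^ 2) * ENNReal.ofReal (t ^ 2) * ENNReal.ofReal (t ^ 2) ≤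
      ENNReal.ofReal ((ε + t ^ 2) * t ^ 4) := by
    rw [← ENNReal.ofReal_mul (by positivity), ← ENNReal.ofReal_mul (by positivity)]
    refine ENNReal.ofReal_le_ofReal ?_
    have : 0 ≤ ε * t ^ 4 := by positivity
    nlinarith
  have b1 : P.sob 0 (P.coeff fun x => 3 * (φ 0 x * (φ 0 x * e x)) - (P.ε + P.lam) * e x) ≤
      2 * (A * E) := by
    refine (sob_coeff_sub_le 0 gR1 gR2).trans ?_
    rw [sob_coeff_const_mul, sob_coeff_const_mul, hA, add_mul, mul_assoc (ENNReal.ofReal (3 ^ 2))]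
    gcongr
    refine (sob_coeff_mul_mul_le hP g0 g0 ge.memLp 0 2 le_rfl (Nat.zero_le _)).trans ?_
    rw [← hm, mul_assoc m]
    gcongr
  have b2 : P.sob 0 (P.coeff fun x => 3 * (φ 0 x * (s x * e x))) ≤
      ENNReal.ofReal (3 ^ 2) * (m * (B * D)) * E := by
    rw [sob_coeff_const_mul, mul_assoc (ENNReal.ofReal (3 ^ 2))]
    gcongr
    refine (sob_coeff_mul_mul_le hP g0 gs ge.memLp 0 2 le_rfl (Nat.zero_le _)).trans ?_
    rw [← hm, mul_assoc m]
    gcongr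
  have b3 : P.sob 0 (P.coeff fun x => δ x * (δ x * δ x)) ≤ m * (Λ * Λ * Λ) *
      ENNReal.ofReal ((ε + t ^ 2) * t ^ 4) := by
    refine (sob_coeff_mul_mul_le hP gδ gδ gδ.memLp 0 2 le_rfl (Nat.zero_le _)).trans ?_
    rw [← hm, mul_assoc m]
    refine mul_le_mul_right ?_ m
    have n00 : P.sob 0 (P.coeff δ) ≤ ENNReal.ofReal (t ^ 2) * Λ :=
      (sob_mono_exp 0 2 (Nat.zero_le _) _).trans nδ
    calc _ ≤ ENNReal.ofReal (t ^ 2) * Λ * (ENNReal.ofReal (t ^ 2) * Λ) *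
          (ENNReal.ofReal (t ^ 2) * Λ) := by gcongr
      _ = Λ * Λ * Λ * (ENNReal.ofReal (t ^ 2) * ENNReal.ofReal (t ^ 2) *
          ENNReal.ofReal (t ^ 2)) := by ring
      _ ≤ _ := mul_le_mul_right hE2 _
  refine (sob_coeff_add_le 0 ((gR1.sub gR2).add gR3) gR4).trans ?_
  calc _ ≤ 2 * (2 * (2 * (A * E) + ENNReal.ofReal (3 ^ 2) * (m * (B * D)) * E) +
        m * (Λ * Λ * Λ) * ENNReal.ofReal ((ε + t ^ 2) * t ^ 4)) := by
        gcongr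
        exact (sob_coeff_add_le 0 (gR1.sub gR2) gR3).trans (by gcongr)
    _ ≤ 2 * (2 * (2 * (A * ENNReal.ofReal ((ε + t ^ 2) * t ^ 4)) + ENNReal.ofReal (3 ^ 2) *
        (m * (B * D)) * ENNReal.ofReal ((ε + t ^ 2) * t ^ 4)) +
        m * (Λ * Λ * Λ) * ENNReal.ofReal ((ε + t ^ 2) * t ^ 4)) := by gcongr
    _ = _ := by rw [hC]; ring

end Initial

theorem norm_add_add_sq_le (a b c : ℂ) : ‖a + b + c‖ ^ 2 ≤ 3 * (‖a‖ ^ 2 + ‖b‖ ^ 2 + ‖c‖ ^ 2) := by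
  have h : ‖a + b + c‖ ≤ ‖a‖ + ‖b‖ + ‖c‖ := norm_add₃_le
  calc ‖a + b + c‖ ^ 2 ≤ (‖a‖ + ‖b‖ + ‖c‖) ^ 2 := pow_le_pow_left₀ (norm_nonneg _) h 2
    _ ≤ _ := by nlinarith [sq_nonneg (‖a‖ - ‖b‖), sq_nonneg (‖a‖ - ‖c‖), sq_nonneg (‖b‖ - ‖c‖)]

theorem norm_sq_le_of_enorm_sq_le {z : ℂ} {c : ℝ} (hc : 0 ≤ c) (h : ‖z‖ₑ ^ 2 ≤ ENNReal.ofReal c) :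
    ‖z‖ ^ 2 ≤ c := by
  rwa [← ofReal_norm, ← ENNReal.ofReal_pow (norm_nonneg _), ENNReal.ofReal_le_ofReal_iff hc] at h

theorem negLap_pos (hP : P.Admissible) {k : ℤ × ℤ} (hk : k ≠ 0) : 0 < P.negLap k := by
  have hx := hP.Lx_pos
  have hy := hP.Ly_pos
  have hpi := Real.pi_pos
  by_cases h1 : k.1 = 0
  · have h2 : k.2 ≠ 0 := fun h2 => hk (Prod.ext h1 h2)
    have h3 : (k.2 : ℝ) ≠ 0 := by exact_mod_cast h2
    have : P.η k.2 ≠ 0 := by unfold η; positivity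
    unfold negLap; positivity
  · have h3 : (k.1 : ℝ) ≠ 0 := by exact_mod_cast h1
    have : P.ξ k.1 ≠ 0 := by unfold ξ; positivity
    unfold negLap; positivity

section Initial

variable {T : ℝ} {j : ℕ} {φ : ℝ → ℝ × ℝ → ℝ} {g v w : ℝ → ℤ × ℤ → ℂ} {B Λ : ℝ≥0∞}

/-- The value v(0) is bounded by averages of v and w over the window (0,t). Their integrals are at
most a small multiple of t, and the choice ε = |v(0)|²/(2K) contradicts v(0) ≠ 0. The mode 0 is
excluded because the dual norm in the defect does not see it. -/
theorem Regular.second_eq_zero (h : P.Regular T j φ g v w B Λ) (hP : P.Admissible)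
    (hd : ∀ ε > 0, ∀ δ > 0, ∃ t, 0 < t ∧ t < δ ∧ t ≤ T ∧
      P.defect j v w 0 t ≤ ENNReal.ofReal (ε * t)) {k : ℤ × ℤ} (hk : k ≠ 0) : v 0 k = 0 := by
  have hκ := negLap_pos hP hk
  have hA := area_pos hP
  have hT := h.pos
  obtain ⟨c, hc⟩ : ∃ c, c = P.negLap k / (P.Lx * P.Ly) := ⟨_, rfl⟩
  have hc0 : 0 < c := by rw [hc]; positivity
  by_contra hv
  have hpos : 0 < ‖v 0 k‖ ^ 2 := by have := norm_pos_iff.2 hv; positivity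
  obtain ⟨K, hK⟩ : ∃ K, K = 2 + 2 * T ^ 2 * c := ⟨_, rfl⟩
  have hK0 : 0 < K := by rw [hK]; positivity
  obtain ⟨t, ht, -, htT, hdef⟩ := hd (‖v 0 k‖ ^ 2 / (2 * K)) (by positivity) 1 one_pos
  have h1 := ((h.rep k).mono htT).enorm_v_le (t := 0) (δ := t) (left_mem_Icc.2 ht.le) ht le_rfl
  have h2 : ENNReal.ofReal t * ‖v 0 k‖ₑ ^ 2 ≤
      2 * ENNReal.ofReal (‖v 0 k‖ ^ 2 / (2 * K) * t) + 2 * ENNReal.ofReal (t ^ 2) *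
        (ENNReal.ofReal c * ENNReal.ofReal (‖v 0 k‖ ^ 2 / (2 * K) * t)) := by
    refine h1.trans ?_
    gcongr
    · exact (lintegral_enorm_le_defect k 0 t).trans hdef
    · rw [hc]
      exact (lintegral_enorm_third_le_defect hP hκ 0 t).trans (mul_le_mul_right hdef _)
  have two : (2 : ℝ≥0∞) = ENNReal.ofReal 2 := by simp
  rw [← ofReal_norm, ← ENNReal.ofReal_pow (norm_nonneg _), two, ← ENNReal.ofReal_mul ht.le,
    ← ENNReal.ofReal_mul hc0.le, ← ENNReal.ofReal_mul (by norm_num), ← ENNReal.ofReal_mul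
    (by norm_num), ← ENNReal.ofReal_mul (by positivity), ← ENNReal.ofReal_add (by positivity)
    (by positivity), ENNReal.ofReal_le_ofReal_iff (by positivity)] at h2
  have h3 : t * ‖v 0 k‖ ^ 2 ≤ ‖v 0 k‖ ^ 2 / (2 * K) * t * K := by
    refine h2.trans ?_
    have e : 2 * (‖v 0 k‖ ^ 2 / (2 * K) * t) + 2 * t ^ 2 * (c * (‖v 0 k‖ ^ 2 / (2 * K) * t)) =
        ‖v 0 k‖ ^ 2 / (2 * K) * t * (2 + 2 * t ^ 2 * c) := by ring
    rw [e, hK]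
    gcongr
  have h4 : ‖v 0 k‖ ^ 2 / (2 * K) * t * K = t * ‖v 0 k‖ ^ 2 / 2 := by field_simp
  rw [h4] at h3
  nlinarith [mul_pos ht hpos]

/-- With v(0) = 0 the velocity has a vanishing linear term at t = 0, and the remainder is controlled
by the integral of w, hence by the defect: it is o(t²). -/
theorem Regular.norm_g_sub_sq_le (h : P.Regular T j φ g v w B Λ) (hP : P.Admissible)
    {k : ℤ × ℤ} (hk : k ≠ 0) (hv : v 0 k = 0) {t ε : ℝ} (ht : t ∈ Icc 0 T) (hε : 0 ≤ ε)
    (hdef : P.defect j v w 0 t ≤ ENNReal.ofReal (ε * t)) :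
    ‖g t k - g 0 k‖ ^ 2 ≤ P.negLap k / (P.Lx * P.Ly) * (ε * t ^ 4) := by
  have hκ := negLap_pos hP hk
  have hA := area_pos hP
  have hr := h.rep k
  have ht0 := ht.1
  have h1 := enorm_taylor_sq_le hr.cont_v hr.int_w hr.g_sub hr.v_sub ht
  rw [hv, mul_zero, sub_zero] at h1
  refine norm_sq_le_of_enorm_sq_le (by positivity) (h1.trans ?_)
  calc _ ≤ ENNReal.ofReal (t ^ 3) * (ENNReal.ofReal (P.negLap k / (P.Lx * P.Ly)) *
        ENNReal.ofReal (ε * t)) := mul_le_mul_right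
          ((lintegral_enorm_third_le_defect hP hκ 0 t).trans (mul_le_mul_right hdef _)) _
    _ = _ := by
      rw [← ENNReal.ofReal_mul (by positivity), ← ENNReal.ofReal_mul (by positivity)]
      congr 1; ring

/-- The increment of the equation from 0 to t is divided by Mκ and expanded. Both φ(t) - φ(0) -
tφ_t(0) and φ_t(t) - φ_t(0) are o(t²) along the sequence, so the coefficient of t² coming from the
cubic, three times the product in question, must vanish. -/
theorem Regular.coeff_mul_sq_eq_zero (h : P.Regular T j φ g v w B Λ) (hP : P.Admissible)
    (hd : ∀ ε > 0, ∀ δ > 0, ∃ t, 0 < t ∧ t < δ ∧ t ≤ T ∧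
      P.defect j v w 0 t ≤ ENNReal.ofReal (ε * t)) {u₁ : ℝ × ℝ → ℝ} (hu : P.Good u₁)
    (hu₁ : P.coeff u₁ = g 0) {k : ℤ × ℤ} (hk : k ≠ 0) :
    P.coeff (fun x => φ 0 x * (u₁ x * u₁ x)) k = 0 := by
  have hκ := negLap_pos hP hk
  have hA := area_pos hP
  have hM := hP.M_pos
  have hl := sym_pos hP k
  have h0 : (0 : ℝ) ∈ Icc 0 T := left_mem_Icc.2 h.pos.le
  obtain ⟨C, hC, hexp⟩ := h.exists_expansion_dF hP hu hu₁
  obtain ⟨Y, hY⟩ : ∃ Y, Y = P.coeff (fun x => φ 0 x * (u₁ x * u₁ x)) k := ⟨_, rfl⟩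
  obtain ⟨A, hAk⟩ : ∃ A, A = P.coeff (fun x => 3 * (φ 0 x * (φ 0 x * u₁ x)) -
    (P.ε + P.lam) * u₁ x) k := ⟨_, rfl⟩
  rw [← hY]
  refine (eq_zero_of_frequently_small (X := (P.sym k : ℂ) * g 0 k + A) (Y := Y)
    (C := 3 * ((P.M * P.negLap k)⁻¹ ^ 2 * (P.negLap k / (P.Lx * P.Ly)) + P.sym k ^ 2 +
      C.toReal)) (by positivity) ?_).2
  intro ε hε δ hδ
  obtain ⟨t, ht, htδ, htT, hdef⟩ := hd ε hε δ hδ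
  refine ⟨t, ht, htδ, ?_⟩
  have htI : t ∈ Icc 0 T := ⟨ht.le, htT⟩
  obtain ⟨e, he⟩ : ∃ e, e = P.coeff (φ t) k - P.coeff (φ 0) k - t * g 0 k := ⟨_, rfl⟩
  obtain ⟨R, hR⟩ : ∃ R, R = P.coeff (fun x => P.dF (φ t x)) k - P.coeff (fun x => P.dF (φ 0 x)) k
    - t * A - (3 * (t : ℂ) ^ 2) * Y := ⟨_, rfl⟩
  have n1 := h.norm_g_sub_sq_le hP hk (h.second_eq_zero hP hd hk) htI hε.le hdef
  have n2 : ‖e‖ ^ 2 ≤ ε * t ^ 4 := by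
    refine norm_sq_le_of_enorm_sq_le (by positivity) ?_
    have h1 := (coeff_le_sob_zero (P := P) (P.coeff (φ t) - P.coeff (φ 0) - (t : ℂ) • g 0) k).trans
      ((h.sob_taylor_le htI).trans (mul_le_mul_right hdef _))
    rw [← ENNReal.ofReal_mul (by positivity)] at h1
    rw [he]
    refine h1.trans (ENNReal.ofReal_le_ofReal (le_of_eq (by ring)))
  have n3 : ‖R‖ ^ 2 ≤ C.toReal * ((ε + t ^ 2) * t ^ 4) := by
    refine norm_sq_le_of_enorm_sq_le (by positivity) ?_
    rw [ENNReal.ofReal_mul ENNReal.toReal_nonneg, ENNReal.ofReal_toReal hC, hR, hAk, hY]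
    exact (coeff_le_sob_zero (P := P) _ k).trans (hexp t htI ε hdef hε.le)
  have hMκ : ((P.M * P.negLap k : ℝ) : ℂ) ≠ 0 := by exact_mod_cast (mul_pos hM hκ).ne'
  have key : (t : ℂ) * ((P.sym k : ℂ) * g 0 k + A) + 3 * (t : ℂ) ^ 2 * Y =
      (-(((P.M * P.negLap k)⁻¹ : ℝ) : ℂ) * (g t k - g 0 k)) + (-((P.sym k : ℂ) * e)) + -R := by
    have hz : -(((P.M * P.negLap k)⁻¹ : ℝ) : ℂ) * (g t k - g 0 k) =
        (P.sym k : ℂ) * (P.coeff (φ t) k - P.coeff (φ 0) k) +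
        (P.coeff (fun x => P.dF (φ t x)) k - P.coeff (fun x => P.dF (φ 0 x)) k) := by
      rw [h.eqn t htI k, h.eqn 0 h0 k, ← mul_sub, Complex.ofReal_inv, neg_mul, neg_mul, mul_neg,
        neg_neg, ← mul_assoc, inv_mul_cancel₀ hMκ]
      ring
    rw [hz, hR, he]
    ring
  rw [key]
  refine (norm_add_add_sq_le _ _ _).trans ?_
  have hinv : 0 < (P.M * P.negLap k)⁻¹ := by positivity
  rw [norm_neg, norm_neg, norm_mul, norm_mul, norm_neg, Complex.norm_real, Complex.norm_real,
    Real.norm_of_nonneg hinv.le, Real.norm_of_nonneg hl.le, mul_pow, mul_pow]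
  have hεt : ε * t ^ 4 ≤ (ε + t ^ 2) * t ^ 4 := by
    have : 0 ≤ t ^ 4 := by positivity
    nlinarith [sq_nonneg t]
  rw [mul_assoc 3, add_mul, add_mul]
  refine mul_le_mul_of_nonneg_left (add_le_add (add_le_add ?_ ?_) n3) (by norm_num)
  · rw [mul_assoc]
    refine mul_le_mul_of_nonneg_left (n1.trans ?_) (by positivity)
    gcongr
  · exact mul_le_mul_of_nonneg_left (n2.trans hεt) (by positivity)

/-- Sublinear growth of the defect at the initial time forces the solution to be stationary. -/
theorem Regular.initial_velocity_eq_zero (h : P.Regular T j φ g v w B Λ) (hP : P.Admissible)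
    (hd : ∀ ε > 0, ∀ δ > 0, ∃ t, 0 < t ∧ t < δ ∧ t ≤ T ∧
      P.defect j v w 0 t ≤ ENNReal.ofReal (ε * t)) : g 0 = 0 := by
  have h0 : (0 : ℝ) ∈ Icc 0 T := left_mem_Icc.2 h.pos.le
  have hΩ : IsOpen P.Ω := isOpen_Ioo.prod isOpen_Ioo
  have g0 := h.good 0 h0
  have hB := h.bound_ne_top
  have hΛ := h.lip_ne_top
  have hg5 : P.sob 5 (g 0) ≤ Λ := (sob_mono_exp 5 _ (by omega) _).trans h.sob_g_zero_le
  have hg2 : P.sob 2 (g 0) < ⊤ := (sob_mono_exp 2 5 (by norm_num) _).trans_lt (hg5.trans_lt hΛ.lt_top)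
  obtain ⟨u₁, c₁, hu, hu₁, hs₁⟩ := exists_continuous_of_hermitian hP (h.g_neg h0) hg2
  obtain ⟨u₀, c₀, hu0, hu₀, hs₀⟩ := exists_continuous_of_hermitian hP (coeff_neg P (φ 0))
    g0.sob_lt_top
  have hae : φ 0 =ᵐ[volume.restrict P.Ω] u₀ := by
    filter_upwards [g0.ae_eq_synth hP] with p hp
    rw [← hs₀ p] at hp
    exact_mod_cast hp
  have hmean : P.coeff u₁ 0 = 0 := by rw [hu₁, h.eqn 0 h0, negLap_zero]; simp
  have hzero := mul_sq_eq_zero_of_constant hP c₀ c₁ hu0 hu hmean fun k hk => by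
    rw [← h.coeff_mul_sq_eq_zero hP hd hu hu₁ hk]
    refine congrFun (coeff_congr_ae ?_) k
    filter_upwards [hae] with p hp
    rw [hp]
  -- regularity of the initial value
  obtain ⟨C₁, hC₁, hdF⟩ := exists_sob_dF_le hP 5 (2 * j + 5) (by omega) (by omega) hB
  have hf5 : P.sob 5 (P.coeff fun x => P.dF (φ 0 x)) < ⊤ := by
    refine (hdF _ g0 (h.bound 0 h0)).trans_lt ?_
    have : P.sob 5 (P.coeff (φ 0)) ≤ B := (sob_mono_exp 5 _ (by omega) _).trans (h.bound 0 h0)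
    have : P.sob 5 (P.coeff (φ 0)) ≠ ⊤ := ne_top_of_le_ne_top hB this
    finiteness
  obtain ⟨C₂, hC₂, hell⟩ := exists_sob_le_of_elliptic hP
  -- The locality argument needs φ(0) in H⁸; since the velocity at 0 is now known in H³ and F'(φ(0))
  -- in H⁵, one more elliptic step suffices.
  have hc9 : P.sob 9 (P.coeff (φ 0)) < ⊤ := by
    refine (hell 9 3 5 (by norm_num) (by norm_num) _ _ _ (h.eqn 0 h0)).trans_lt ?_
    have e1 : P.sob 3 (g 0) ≠ ⊤ :=
      ne_top_of_le_ne_top hΛ ((sob_mono_exp 3 5 (by norm_num) _).trans hg5)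
    have e2 : P.sob 3 (P.coeff (φ 0)) ≠ ⊤ :=
      ne_top_of_le_ne_top hB ((sob_mono_exp 3 _ (by omega) _).trans (h.bound 0 h0))
    finiteness
  -- On U the product u₀u₁² = 0 forces u₀ = 0, hence F'(u₀) = 0, and by locality of the equation the
  -- velocity u₁ vanishes on U as well. So U is empty.
  obtain ⟨U, hU⟩ : ∃ U, U = P.Ω ∩ {p | u₁ p ≠ 0} := ⟨_, rfl⟩
  have hUo : IsOpen U := by rw [hU]; exact hΩ.inter (isOpen_ne_fun c₁ continuous_const)
  have hU0 : ∀ p ∈ U, u₀ p = 0 := fun p hp => by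
    rw [hU] at hp
    have h1 := hzero p hp.1
    have h2 : u₁ p ≠ 0 := hp.2
    simpa [h2] using h1
  have hUc : ∀ p ∈ U, P.synth (P.coeff (φ 0)) p = 0 := fun p hp => by rw [← hs₀, hU0 p hp]; simp
  have hUf : ∀ p ∈ U, P.synth (P.coeff fun x => P.dF (φ 0 x)) p = 0 := by
    have hF : (fun p => ((P.dF (u₀ p) : ℝ) : ℂ)) =ᵐ[volume.restrict P.Ω]
        P.synth (P.coeff fun x => P.dF (φ 0 x)) := by
      filter_upwards [(g0.dF hP).ae_eq_synth hP, hae] with p hp hp'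
      rw [← hp, hp']
    have := Measure.eqOn_open_of_ae_eq hF hΩ (Complex.continuous_ofReal.comp
      ((continuous_iff_continuousAt.2 fun z => (by unfold dF; fun_prop : Continuous P.dF).continuousAt
        (x := z)).comp c₀)).continuousOn
      (continuous_synth (summable_norm_of_sob_two hP (g0.dF hP).sob_lt_top)).continuousOn
    intro p hp
    rw [← this (by rw [hU] at hp; exact hp.1)]
    simp [hU0 p hp, dF]
  have hUg := synth_operator_eq_zero hP ((sob_mono_exp 8 9 (by norm_num) _).trans_lt hc9)
    ((sob_mono_exp 4 5 (by norm_num) _).trans_lt hf5) hUo hUc hUf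
  have hu0' : ∀ p ∈ P.Ω, u₁ p = 0 := by
    intro p hp
    by_contra hne
    have h1 := hUg p (by rw [hU]; exact ⟨hp, hne⟩)
    rw [← funext (h.eqn 0 h0), ← hs₁] at h1
    exact hne (by exact_mod_cast h1)
  rw [← hu₁, ← coeff_zero_fun P]
  exact coeff_congr_ae ((ae_restrict_iff' hΩ.measurableSet).2 (Filter.Eventually.of_forall hu0'))

/-- One may choose the Lipschitz constant so that it is controlled by the defect. -/
theorem Regular.exists_lip_le_defect (h : P.Regular T j φ g v w B Λ) (hP : P.Admissible) :
    ∃ Λ', P.Regular T j φ g v w B Λ' ∧ ∃ C : ℝ≥0∞, C ≠ ⊤ ∧ ∀ t ∈ Icc 0 T,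
      Λ' * ENNReal.ofReal t ≤ C * P.defect j v w 0 t := by
  have hT := h.pos
  have hΛ := h.lip_ne_top
  -- If the defect grows at least linearly, Λ itself is admissible, with constant Λ/c. Otherwise the
  -- solution is stationary and 0 is a Lipschitz constant.
  by_cases hc : ∃ c > 0, ∀ t ∈ Ioc 0 T, ENNReal.ofReal (c * t) ≤ P.defect j v w 0 t
  · obtain ⟨c, hc, hct⟩ := hc
    refine ⟨Λ, h, Λ * ENNReal.ofReal c⁻¹, by finiteness, fun t ht => ?_⟩
    rcases ht.1.eq_or_lt with rfl | ht0
    · simp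
    calc Λ * ENNReal.ofReal t = Λ * ENNReal.ofReal c⁻¹ * ENNReal.ofReal (c * t) := by
          rw [mul_assoc, ← ENNReal.ofReal_mul (by positivity)]; congr 2; field_simp
      _ ≤ _ := mul_le_mul_right (hct t ⟨ht0, ht.2⟩) _
  · have hst := h.stationary hP (h.initial_velocity_eq_zero hP (exists_small_defect hT hc))
    refine ⟨0, { h with lip_ne_top := by simp, lip := fun a ha b hb => ?_ }, 0, by simp, by simp⟩
    rw [hst a ha, hst b hb, sub_self, sob_zero]
    exact zero_le

end Initial

/-! ### Spectral truncation -/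

/-- The modes retained by the discretization. -/
def lowPart (N : ℕ) (c : ℤ × ℤ → ℂ) (k : ℤ × ℤ) : ℂ := if k ∈ modes N then c k else 0

/-- The modes discarded by the discretization. -/
def highPart (N : ℕ) (c : ℤ × ℤ → ℂ) (k : ℤ × ℤ) : ℂ := if k ∈ modes N then 0 else c k

theorem lowPart_of_mem {N : ℕ} {k : ℤ × ℤ} (hk : k ∈ modes N) (c : ℤ × ℤ → ℂ) :
    lowPart N c k = c k := if_pos hk

theorem lowPart_of_notMem {N : ℕ} {k : ℤ × ℤ} (hk : k ∉ modes N) (c : ℤ × ℤ → ℂ) :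
    lowPart N c k = 0 := if_neg hk

theorem highPart_of_mem {N : ℕ} {k : ℤ × ℤ} (hk : k ∈ modes N) (c : ℤ × ℤ → ℂ) :
    highPart N c k = 0 := if_pos hk

theorem highPart_of_notMem {N : ℕ} {k : ℤ × ℤ} (hk : k ∉ modes N) (c : ℤ × ℤ → ℂ) :
    highPart N c k = c k := if_neg hk

theorem lowPart_add (N : ℕ) (c d : ℤ × ℤ → ℂ) : lowPart N (c + d) = lowPart N c + lowPart N d := by
  funext k; unfold lowPart; by_cases hk : k ∈ modes N <;> simp [hk]

theorem lowPart_sub (N : ℕ) (c d : ℤ × ℤ → ℂ) : lowPart N (c - d) = lowPart N c - lowPart N d := by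
  funext k; unfold lowPart; by_cases hk : k ∈ modes N <;> simp [hk]

theorem lowPart_smul (N : ℕ) (a : ℂ) (c : ℤ × ℤ → ℂ) : lowPart N (a • c) = a • lowPart N c := by
  funext k; unfold lowPart; by_cases hk : k ∈ modes N <;> simp [hk]

theorem highPart_add (N : ℕ) (c d : ℤ × ℤ → ℂ) :
    highPart N (c + d) = highPart N c + highPart N d := by
  funext k; unfold highPart; by_cases hk : k ∈ modes N <;> simp [hk]

theorem lowPart_add_highPart (N : ℕ) (c : ℤ × ℤ → ℂ) : lowPart N c + highPart N c = c := by
  funext k; unfold lowPart highPart; by_cases hk : k ∈ modes N <;> simp [hk]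

theorem sob_lowPart_le (s N : ℕ) (c : ℤ × ℤ → ℂ) : P.sob s (lowPart N c) ≤ P.sob s c :=
  sob_le_of_norm_le s _ _ fun k => by unfold lowPart; split_ifs <;> simp

theorem sob_highPart_le_self (s N : ℕ) (c : ℤ × ℤ → ℂ) : P.sob s (highPart N c) ≤ P.sob s c :=
  sob_le_of_norm_le s _ _ fun k => by unfold highPart; split_ifs <;> simp

theorem exists_negLap_ge (hP : P.Admissible) : ∃ c > 0, c ≤ 1 ∧ ∀ k : ℤ × ℤ,
    c * (k.1 : ℝ) ^ 2 ≤ P.negLap k ∧ c * (k.2 : ℝ) ^ 2 ≤ P.negLap k := by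
  have hx := hP.Lx_pos
  have hy := hP.Ly_pos
  have hpi := Real.pi_pos
  refine ⟨min 1 (min ((2 * Real.pi / P.Lx) ^ 2) ((2 * Real.pi / P.Ly) ^ 2)), by positivity,
    min_le_left _ _, fun k => ⟨?_, ?_⟩⟩
  · have h1 : (2 * Real.pi / P.Lx) ^ 2 * (k.1 : ℝ) ^ 2 ≤ P.negLap k := by
      have e : P.negLap k = (2 * Real.pi / P.Lx) ^ 2 * (k.1 : ℝ) ^ 2 + P.η k.2 ^ 2 := by
        unfold negLap ξ; ring
      rw [e]; linarith [sq_nonneg (P.η k.2)]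
    refine le_trans (mul_le_mul_of_nonneg_right ?_ (sq_nonneg _)) h1
    exact (min_le_right _ _).trans (min_le_left _ _)
  · have h1 : (2 * Real.pi / P.Ly) ^ 2 * (k.2 : ℝ) ^ 2 ≤ P.negLap k := by
      have e : P.negLap k = P.ξ k.1 ^ 2 + (2 * Real.pi / P.Ly) ^ 2 * (k.2 : ℝ) ^ 2 := by
        unfold negLap η; ring
      rw [e]; linarith [sq_nonneg (P.ξ k.1)]
    refine le_trans (mul_le_mul_of_nonneg_right ?_ (sq_nonneg _)) h1
    exact (min_le_right _ _).trans (min_le_right _ _)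

theorem exists_le_negLap (hP : P.Admissible) : ∃ c > 0, c ≤ 1 ∧ ∀ k : ℤ × ℤ, k ≠ 0 →
    c ≤ P.negLap k := by
  obtain ⟨c, hc, hc1, h⟩ := exists_negLap_ge hP
  refine ⟨c, hc, hc1, fun k hk => ?_⟩
  have hz : ∀ z : ℤ, z ≠ 0 → (1 : ℝ) ≤ (z : ℝ) ^ 2 := fun z hz => by
    have : (1 : ℤ) ≤ z ^ 2 := by have := sq_pos_of_ne_zero hz; omega
    exact_mod_cast this
  by_cases h1 : k.1 = 0
  · have h2 : k.2 ≠ 0 := fun h2 => hk (Prod.ext h1 h2)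
    exact (le_mul_of_one_le_right hc.le (hz _ h2)).trans (h k).2
  · exact (le_mul_of_one_le_right hc.le (hz _ h1)).trans (h k).1

/-- For N ≥ 4 a discarded frequency has a component of size at least N/4: if both components were
smaller, k and -k would both lie in the range, because N/4 ≤ N/2 - 1. -/
theorem exists_le_wt_of_notMem_modes (hP : P.Admissible) : ∃ c > 0, c ≤ 1 ∧ ∀ (N : ℕ) (k : ℤ × ℤ),
    k ∉ modes N → c * (N : ℝ) ^ 2 ≤ P.wt k := by
  obtain ⟨c, hc, hc1, h⟩ := exists_negLap_ge hP
  refine ⟨c / 16, by positivity, by linarith, fun N k hk => ?_⟩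
  -- For small N the set `modes N` may even be empty, but then N² ≤ 16 and wt ≥ 1 suffice.
  by_cases hN : (N : ℝ) < 4
  · have h1 := P.one_le_wt k
    have h2 : (N : ℝ) ^ 2 ≤ 16 := by nlinarith [(Nat.cast_nonneg N : (0 : ℝ) ≤ N)]
    nlinarith
  push Not at hN
  have hbig : ∀ x : ℝ, (N : ℝ) / 4 ≤ |x| → c / 16 * (N : ℝ) ^ 2 ≤ c * x ^ 2 := fun x hx => by
    have : ((N : ℝ) / 4) ^ 2 ≤ x ^ 2 := by rw [← sq_abs x]; exact pow_le_pow_left₀ (by linarith) hx 2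
    nlinarith
  have hor : (N : ℝ) / 4 ≤ |(k.1 : ℝ)| ∨ (N : ℝ) / 4 ≤ |(k.2 : ℝ)| := by
    by_contra hcon
    push Not at hcon
    obtain ⟨h1, h2⟩ := hcon
    rw [abs_lt] at h1 h2
    refine hk (mem_modes.2 ⟨⟨?_, ?_, ?_, ?_⟩, ⟨?_, ?_, ?_, ?_⟩⟩) <;>
      push_cast [Prod.fst_neg, Prod.snd_neg] <;> linarith
  have hw := P.negLap_le_wt k
  rcases hor with h1 | h1
  · exact (hbig _ h1).trans ((h k).1.trans hw)
  · exact (hbig _ h1).trans ((h k).2.trans hw)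

/-- The spectral approximation property of the truncation. -/
theorem exists_sob_highPart_le (hP : P.Admissible) (s n : ℕ) : ∃ C : ℝ≥0∞, C ≠ ⊤ ∧
    ∀ (N : ℕ) (c : ℤ × ℤ → ℂ), 0 < N → P.sob s (highPart N c) ≤
      C * (ENNReal.ofReal ((N : ℝ) ^ (2 * n))⁻¹ * P.sob (n + s) c) := by
  obtain ⟨c, hc, -, hw⟩ := exists_le_wt_of_notMem_modes hP
  refine ⟨ENNReal.ofReal (c ^ n)⁻¹, by finiteness, fun N z hN => ?_⟩
  have hN' : (0 : ℝ) < N := by exact_mod_cast hN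
  rw [sob, sob, ← ENNReal.tsum_mul_left, ← ENNReal.tsum_mul_left]
  refine ENNReal.tsum_le_tsum fun k => ?_
  by_cases hk : k ∈ modes N
  · simp [highPart_of_mem hk]
  have hwp := P.wt_pos k
  rw [highPart_of_notMem hk, ← mul_assoc, ← mul_assoc, ← ENNReal.ofReal_mul (by positivity),
    ← ENNReal.ofReal_mul (by positivity)]
  refine mul_le_mul_left (ENNReal.ofReal_le_ofReal ?_) _
  have h1 : (c * (N : ℝ) ^ 2) ^ n ≤ P.wt k ^ n := pow_le_pow_left₀ (by positivity) (hw N k hk) n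
  rw [mul_pow, ← pow_mul] at h1
  rw [pow_add, ← mul_inv, ← mul_assoc]
  refine le_mul_of_one_le_left (by positivity) ?_
  rw [inv_mul_eq_div, one_le_div (by positivity)]
  exact h1

/-! ### Consistency of the discrete nonlinear terms -/

/-- The truncated sum is the inner product of v with the projection of u, so the discrepancy
involves only the discarded modes of u. -/
theorem ofReal_ip_sub_sum_sq_le (hP : P.Admissible) (N : ℕ) {u v : ℝ × ℝ → ℝ} (hu : P.Good u)
    (hv : P.Good v) :
    ENNReal.ofReal ((P.ip u v - P.Lx * P.Ly *
      ∑ k ∈ modes N, (conj (P.coeff u k) * P.coeff v k).re) ^ 2) ≤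
    ENNReal.ofReal ((P.Lx * P.Ly) ^ 2) *
      (P.sob 0 (highPart N (P.coeff u)) * P.sob 0 (P.coeff v)) := by
  obtain ⟨z, hz, hzc⟩ := exists_mem_SN_of_hermitian hP N (coeff_neg P u)
  have gz := good_of_mem_SN hP hz
  have h1 : P.Lx * P.Ly * ∑ k ∈ modes N, (conj (P.coeff u k) * P.coeff v k).re = P.ip z v := by
    have e : P.ip z v = P.ip v z := by unfold ip; simp only [mul_comm]
    rw [e, ip_eq_sum_modes hP hv.memLp hz]
    congr 1
    refine Finset.sum_congr rfl fun k hk => ?_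
    rw [hzc k hk, ← Complex.conj_re, map_mul, Complex.conj_conj, mul_comm]
  have h2 : P.ip u v - P.ip z v = P.ip (fun x => u x - z x) v := by
    unfold ip
    rw [← integral_sub (hu.mul hP hv).integrable (gz.mul hP hv).integrable]
    simp only [sub_mul]
  have h3 : P.coeff (fun x => u x - z x) = highPart N (P.coeff u) := by
    rw [coeff_sub hu.integrable gz.integrable]
    funext k
    rw [Pi.sub_apply]
    by_cases hk : k ∈ modes N
    · rw [highPart_of_mem hk, hzc k hk, sub_self]
    · rw [highPart_of_notMem hk, coeff_eq_zero_of_mem_SN hP hz hk, sub_zero]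
  rw [h1, h2, ← h3]
  exact ofReal_ip_sq_le hP (hu.sub gz).memLp hv.memLp

/-- The squared spectral accuracy `ρ N^{-2m}`. -/
def spectralError (m : ℕ) (ρ : ℝ≥0∞) (N : ℕ) : ℝ≥0∞ := ENNReal.ofReal ((N : ℝ) ^ (2 * m))⁻¹ * ρ

section Consistency

variable {T : ℝ} {j : ℕ} {φ : ℝ → ℝ × ℝ → ℝ} {g v w : ℝ → ℤ × ℤ → ℂ} {B Λ : ℝ≥0∞}

theorem sob_half_smul_le (s : ℕ) (c : ℤ × ℤ → ℂ) : P.sob s (((1 / 2 : ℝ) : ℂ) • c) ≤ P.sob s c := by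
  refine sob_le_of_norm_le s _ _ fun k => ?_
  rw [Pi.smul_apply, norm_smul, Complex.norm_real]
  exact mul_le_of_le_one_left (norm_nonneg _) (by norm_num)

/-- The consistency errors of the nonlinear potential and of the scalar auxiliary variable. -/
theorem Regular.exists_consistency_bound (h : P.Regular T j φ g v w B Λ) (hP : P.Admissible)
    {m : ℕ} {ρ : ℝ≥0∞} (hρt : ρ ≠ ⊤) (hρ : ∀ t ∈ Icc 0 T, P.sob (m + 1) (P.coeff (φ t)) ≤ ρ)
    {B' : ℝ≥0∞} (hB' : B' ≠ ⊤) :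
    ∃ C : ℝ≥0∞, C ≠ ⊤ ∧ ∀ N : ℕ, 0 < N → ∀ a ∈ Icc 0 T, ∀ b ∈ Icc 0 T, ∀ u ∈ P.SN N,
      P.sob 2 (P.coeff u) ≤ B' →
      P.sob 1 (P.coeff fun x => (√(P.E1 (φ a)) + √(P.E1 (φ b))) / 2 / √(P.E1 u) * P.dF (u x) -
        (P.dF (φ a x) + P.dF (φ b x)) / 2) ≤
        C * (P.sob 1 (lowPart N (P.coeff u -
          ((1 / 2 : ℝ) : ℂ) • (P.coeff (φ a) + P.coeff (φ b)))) +
          ENNReal.ofReal ((b - a) ^ 4) * Λ + spectralError m ρ N) ∧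
      ENNReal.ofReal ((1 / 2 * (P.Lx * P.Ly * ∑ k ∈ modes N,
        (conj (((√(P.E1 u))⁻¹ : ℝ) * P.coeff (fun x => P.dF (u x)) k) *
          (P.coeff (φ b) k - P.coeff (φ a) k)).re) - (√(P.E1 (φ b)) - √(P.E1 (φ a)))) ^ 2) ≤
        C * (ENNReal.ofReal ((b - a) ^ 2) * (P.sob 1 (lowPart N (P.coeff u -
          ((1 / 2 : ℝ) : ℂ) • (P.coeff (φ a) + P.coeff (φ b)))) +
          ENNReal.ofReal ((b - a) ^ 4) * Λ + spectralError m ρ N)) := by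
  have hB := h.bound_ne_top
  have hΛ := h.lip_ne_top
  have hlow := e1Low_pos hP
  obtain ⟨BB, hBB⟩ : ∃ BB, BB = 4 * B + 4 * ρ + B' := ⟨_, rfl⟩
  have hBBt : BB ≠ ⊤ := by rw [hBB]; finiteness
  obtain ⟨C₁, hC₁, h₁⟩ := exists_sob_potential_sub_le hP hBBt
  obtain ⟨C₂, hC₂, h₂⟩ := exists_sav_increment_sub_le hP hBBt
  obtain ⟨C₃, hC₃, h₃⟩ := exists_sob_highPart_le hP 1 m
  obtain ⟨C₄, hC₄, h₄⟩ := exists_sob_highPart_le hP 0 m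
  obtain ⟨C₅, hC₅, h₅⟩ := exists_sob_dF_sub_le hP 0 2 le_rfl (Nat.zero_le _) hBBt
  obtain ⟨C₆, hC₆, h₆⟩ := exists_sob_dF_le hP (m + 1) (max (m + 1) 2) (le_max_right _ _)
    (le_max_left _ _) hBBt
  obtain ⟨D, hD⟩ : ∃ D, D = 2 + 2 * (C₃ * 4) + Λ := ⟨_, rfl⟩
  have hDt : D ≠ ⊤ := by rw [hD]; finiteness
  obtain ⟨E, hE⟩ : ∃ E, E = 2 * (C₅ * D + C₄ * (C₆ * 4)) := ⟨_, rfl⟩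
  have hEt : E ≠ ⊤ := by rw [hE]; finiteness
  obtain ⟨G, hG⟩ : ∃ G, G = 2 * (C₂ * (Λ * D) + ENNReal.ofReal ((√P.e1Low)⁻¹ ^ 2) *
    (ENNReal.ofReal ((P.Lx * P.Ly) ^ 2) * (E * Λ))) := ⟨_, rfl⟩
  refine ⟨C₁ * D + G, by rw [hG]; finiteness, fun N hN a ha b hb u hu hub => ?_⟩
  obtain ⟨Y, hY⟩ : ∃ Y, Y = P.sob 1 (lowPart N (P.coeff u -
      ((1 / 2 : ℝ) : ℂ) • (P.coeff (φ a) + P.coeff (φ b)))) := ⟨_, rfl⟩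
  obtain ⟨Q, hQ⟩ : ∃ Q, Q = Y + ENNReal.ofReal ((b - a) ^ 4) * Λ + spectralError m ρ N := ⟨_, rfl⟩
  rw [← hY, ← hQ]
  have ga := h.good a ha
  have gb := h.good b hb
  have gu := good_of_mem_SN hP hu
  -- Midpoint and half increment: φ(a) = z - d and φ(b) = z + d, the form required by the estimates
  -- for symmetric differences.
  obtain ⟨z, hz⟩ : ∃ z : ℝ × ℝ → ℝ, z = fun x => 1 / 2 * (φ a x + φ b x) := ⟨_, rfl⟩
  obtain ⟨d, hd⟩ : ∃ d : ℝ × ℝ → ℝ, d = fun x => 1 / 2 * (φ b x - φ a x) := ⟨_, rfl⟩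
  have gz : P.Good z := by rw [hz]; exact (ga.add gb).const_mul _
  have gd : P.Good d := by rw [hd]; exact (gb.sub ga).const_mul _
  have cz : P.coeff z = ((1 / 2 : ℝ) : ℂ) • (P.coeff (φ a) + P.coeff (φ b)) := by
    rw [hz, coeff_const_mul, coeff_add ga.integrable gb.integrable]
  have cd : P.coeff d = ((1 / 2 : ℝ) : ℂ) • (P.coeff (φ b) - P.coeff (φ a)) := by
    rw [hd, coeff_const_mul, coeff_sub gb.integrable ga.integrable]
  have em : (fun x => z x - d x) = φ a := by funext x; rw [hz, hd]; ring
  have ep : (fun x => z x + d x) = φ b := by funext x; rw [hz, hd]; ring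
  have nz : ∀ s R, P.sob s (P.coeff (φ a)) ≤ R → P.sob s (P.coeff (φ b)) ≤ R →
      P.sob s (P.coeff z) ≤ 4 * R := fun s R h1 h2 => by
    rw [cz]
    refine (sob_half_smul_le s _).trans ((sob_add_le s _ _).trans ?_)
    calc _ ≤ 2 * (R + R) := by gcongr
      _ = 4 * R := by ring
  have n2 : ∀ t ∈ Icc 0 T, P.sob 2 (P.coeff (φ t)) ≤ B := fun t ht =>
    (sob_mono_exp 2 _ (by omega) _).trans (h.bound t ht)
  have nz2 : P.sob 2 (P.coeff z) ≤ BB := (nz 2 B (n2 a ha) (n2 b hb)).trans (by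
    rw [hBB, add_assoc]; exact le_self_add)
  have nzm : P.sob (m + 1) (P.coeff z) ≤ 4 * ρ := nz _ ρ (hρ a ha) (hρ b hb)
  have nzp : P.sob (max (m + 1) 2) (P.coeff z) ≤ BB := by
    rcases max_choice (m + 1) 2 with h1 | h1 <;> rw [h1]
    · exact nzm.trans (by rw [hBB, add_right_comm]; exact le_add_self)
    · exact nz2
  have nu2 : P.sob 2 (P.coeff u) ≤ BB := hub.trans (by rw [hBB]; exact le_add_self)
  have nd5 : P.sob (2 * j + 5) (P.coeff d) ≤ ENNReal.ofReal ((b - a) ^ 2) * Λ := by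
    rw [cd]; exact (sob_half_smul_le _ _).trans (h.lip a ha b hb)
  have nd : ∀ s, s ≤ 5 → P.sob s (P.coeff d) ≤ ENNReal.ofReal ((b - a) ^ 2) * Λ := fun s hs =>
    (sob_mono_exp s _ (by omega) _).trans nd5
  have nd2 : P.sob 2 (P.coeff d) ≤ BB := by
    rw [cd]
    refine (sob_half_smul_le _ _).trans ((sob_sub_le 2 _ _).trans ?_)
    calc _ ≤ 2 * (B + B) := by gcongr; exacts [n2 b hb, n2 a ha]
      _ = 4 * B := by ring
      _ ≤ BB := by rw [hBB, add_assoc]; exact le_self_add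
  -- One factor Λ goes into the constant; the other must stay visible, since it is traded for the
  -- defect at the end.
  have ndsq : P.sob 2 (P.coeff d) ^ 2 ≤ Λ * (ENNReal.ofReal ((b - a) ^ 4) * Λ) := by
    calc _ ≤ (ENNReal.ofReal ((b - a) ^ 2) * Λ) ^ 2 := by gcongr; exact nd 2 (by norm_num)
      _ = _ := by
        have e : (b - a) ^ 4 = (b - a) ^ 2 * (b - a) ^ 2 := by ring
        rw [e, ENNReal.ofReal_mul (sq_nonneg _)]; ring
  -- the extrapolation error
  have cy : P.coeff (fun x => u x - z x) = P.coeff u - P.coeff z :=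
    coeff_sub gu.integrable gz.integrable
  have ny : P.sob 1 (P.coeff fun x => u x - z x) ≤
      2 * (Y + C₃ * 4 * spectralError m ρ N) := by
    rw [cy, ← lowPart_add_highPart N (P.coeff u - P.coeff z)]
    refine (sob_add_le 1 _ _).trans ?_
    rw [← cz] at hY
    rw [← hY]
    gcongr
    have e : P.sob 1 (highPart N (P.coeff u - P.coeff z)) ≤ P.sob 1 (highPart N (P.coeff z)) := by
      refine sob_le_of_norm_le 1 _ _ fun k => ?_
      by_cases hk : k ∈ modes N
      · rw [highPart_of_mem hk, highPart_of_mem hk]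
      · rw [highPart_of_notMem hk, highPart_of_notMem hk, Pi.sub_apply,
          coeff_eq_zero_of_mem_SN hP hu hk, zero_sub, norm_neg]
    refine e.trans ((h₃ N _ hN).trans ?_)
    calc _ ≤ C₃ * (ENNReal.ofReal ((N : ℝ) ^ (2 * m))⁻¹ * (4 * ρ)) := by gcongr
      _ = _ := by rw [spectralError]; ring
  have nQ : P.sob 1 (P.coeff fun x => u x - z x) + P.sob 2 (P.coeff d) ^ 2 ≤ D * Q := by
    calc _ ≤ 2 * (Y + C₃ * 4 * spectralError m ρ N) +
          Λ * (ENNReal.ofReal ((b - a) ^ 4) * Λ) := add_le_add ny ndsq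
      _ = 2 * Y + 2 * (C₃ * 4) * spectralError m ρ N + Λ * (ENNReal.ofReal ((b - a) ^ 4) * Λ) := by
          ring
      _ ≤ 2 * Q + 2 * (C₃ * 4) * Q + Λ * Q := by
          gcongr
          · rw [hQ, add_assoc]; exact le_self_add
          · rw [hQ]; exact le_add_self
          · rw [hQ, add_right_comm]; exact le_add_self
      _ = D * Q := by rw [hD]; ring
  have nQ0 : P.sob 0 (P.coeff fun x => u x - z x) ≤ D * Q :=
    (sob_mono_exp 0 1 (Nat.zero_le _) _).trans (le_self_add.trans nQ)
  constructor
  · have h1 := h₁ z d u gz gd gu nz2 nd2 nu2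
    rw [em, ep] at h1
    have e : (fun x => (√(P.E1 (φ a)) + √(P.E1 (φ b))) / 2 / √(P.E1 u) * P.dF (u x) -
        (P.dF (z x - d x) + P.dF (z x + d x)) / 2) = fun x =>
        (√(P.E1 (φ a)) + √(P.E1 (φ b))) / 2 / √(P.E1 u) * P.dF (u x) -
        (P.dF (φ a x) + P.dF (φ b x)) / 2 := by
      funext x; rw [congrFun em x, congrFun ep x]
    rw [e] at h1
    refine h1.trans ?_
    calc _ ≤ C₁ * (D * Q) := mul_le_mul_right nQ _
      _ = C₁ * D * Q := by ring
      _ ≤ _ := mul_le_mul_left le_self_add _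
  · have gf := gu.dF hP
    have gfz := gz.dF hP
    have h1 := h₂ z d u gz gd gu nz2 nd2 nu2
    rw [em, ep] at h1
    have h2 := ofReal_ip_sub_sum_sq_le hP N gf gd
    -- the discarded modes of the nonlinearity
    have nf : P.sob 0 (highPart N (P.coeff fun x => P.dF (u x))) ≤ E * Q := by
      have e : P.coeff (fun x => P.dF (u x)) =
          P.coeff (fun x => P.dF (u x) - P.dF (z x)) + P.coeff (fun x => P.dF (z x)) := by
        rw [coeff_sub gf.integrable gfz.integrable, sub_add_cancel]
      rw [e, highPart_add]
      refine (sob_add_le 0 _ _).trans ?_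
      have i1 : P.sob 0 (highPart N (P.coeff fun x => P.dF (u x) - P.dF (z x))) ≤ C₅ * (D * Q) :=
        (sob_highPart_le_self 0 N _).trans ((h₅ u z gu gz nu2 nz2).trans (mul_le_mul_right nQ0 _))
      have i2 : P.sob 0 (highPart N (P.coeff fun x => P.dF (z x))) ≤
          C₄ * (C₆ * 4) * spectralError m ρ N := by
        refine (h₄ N _ hN).trans ?_
        have : P.sob (m + 0) (P.coeff fun x => P.dF (z x)) ≤ C₆ * (4 * ρ) :=
          (sob_mono_exp _ (m + 1) (by omega) _).trans ((h₆ z gz nzp).trans (mul_le_mul_right nzm _))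
        calc _ ≤ C₄ * (ENNReal.ofReal ((N : ℝ) ^ (2 * m))⁻¹ * (C₆ * (4 * ρ))) := by gcongr
          _ = _ := by rw [spectralError]; ring
      calc _ ≤ 2 * (C₅ * (D * Q) + C₄ * (C₆ * 4) * spectralError m ρ N) := by gcongr
        _ ≤ 2 * (C₅ * (D * Q) + C₄ * (C₆ * 4) * Q) := by
            gcongr; rw [hQ]; exact le_add_self
        _ = E * Q := by rw [hE]; ring
    obtain ⟨S, hS⟩ : ∃ S, S = P.Lx * P.Ly * ∑ k ∈ modes N,
      (conj (P.coeff (fun x => P.dF (u x)) k) * P.coeff d k).re := ⟨_, rfl⟩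
    rw [← hS] at h2
    have eS : 1 / 2 * (P.Lx * P.Ly * ∑ k ∈ modes N,
        (conj (((√(P.E1 u))⁻¹ : ℝ) * P.coeff (fun x => P.dF (u x)) k) *
          (P.coeff (φ b) k - P.coeff (φ a) k)).re) = (√(P.E1 u))⁻¹ * S := by
      rw [hS, mul_left_comm (1 / 2 : ℝ), mul_left_comm (√(P.E1 u))⁻¹, Finset.mul_sum _ _ (1 / 2 : ℝ),
        Finset.mul_sum _ _ (√(P.E1 u))⁻¹]
      congr 1
      refine Finset.sum_congr rfl fun k _ => ?_
      rw [cd, Pi.smul_apply, Pi.sub_apply, map_mul, Complex.conj_ofReal, smul_eq_mul,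
        mul_left_comm, mul_assoc, Complex.re_ofReal_mul, Complex.re_ofReal_mul]
      ring
    have eq : (√(P.E1 u))⁻¹ * S - (√(P.E1 (φ b)) - √(P.E1 (φ a))) =
        (P.ip (fun x => P.dF (u x)) d / √(P.E1 u) - (√(P.E1 (φ b)) - √(P.E1 (φ a)))) +
        (-(√(P.E1 u))⁻¹) * (P.ip (fun x => P.dF (u x)) d - S) := by ring
    rw [eS, eq]
    refine (ofReal_add_sq_le _ _).trans ?_
    rw [ofReal_mul_sq, neg_sq]
    have hinv : ENNReal.ofReal ((√(P.E1 u))⁻¹ ^ 2) ≤ ENNReal.ofReal ((√P.e1Low)⁻¹ ^ 2) := by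
      have h3 := sqrt_e1Low_le hP u
      have h4 : 0 < √P.e1Low := Real.sqrt_pos.2 hlow
      refine ENNReal.ofReal_le_ofReal ?_
      gcongr
    obtain ⟨t, ht⟩ : ∃ t, t = ENNReal.ofReal ((b - a) ^ 2) := ⟨_, rfl⟩
    have nd0 := nd 0 (by norm_num)
    rw [← ht] at nd0 ⊢
    calc _ ≤ 2 * (C₂ * (t * Λ * (D * Q)) + ENNReal.ofReal ((√P.e1Low)⁻¹ ^ 2) *
          (ENNReal.ofReal ((P.Lx * P.Ly) ^ 2) * (E * Q * (t * Λ)))) := by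
          gcongr
          · refine h1.trans ?_
            gcongr
            exact le_trans (by gcongr; exact sob_mono_exp 0 1 (Nat.zero_le _) _) nQ
          · exact h2.trans (by gcongr)
      _ = G * (t * Q) := by rw [hG]; ring
      _ ≤ _ := mul_le_mul_left le_add_self _

end Consistency

/-! ### The error of the first-order step -/

theorem ofReal_sum_modes_sq_le (hP : P.Admissible) (N : ℕ) {u v : ℝ × ℝ → ℝ} (hu : P.Good u)
    (hv : P.Good v) :
    ENNReal.ofReal ((P.Lx * P.Ly *
      ∑ k ∈ modes N, (conj (P.coeff u k) * P.coeff v k).re) ^ 2) ≤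
    4 * ENNReal.ofReal ((P.Lx * P.Ly) ^ 2) * (P.sob 0 (P.coeff u) * P.sob 0 (P.coeff v)) := by
  have h1 := ofReal_ip_sub_sum_sq_le hP N hu hv
  have h2 := ofReal_ip_sq_le hP hu.memLp hv.memLp
  obtain ⟨S, hS⟩ : ∃ S, S = P.Lx * P.Ly *
    ∑ k ∈ modes N, (conj (P.coeff u k) * P.coeff v k).re := ⟨_, rfl⟩
  rw [← hS] at h1 ⊢
  have e : S = P.ip u v + -(P.ip u v - S) := by ring
  rw [e]
  refine (ofReal_add_sq_le _ _).trans ?_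
  rw [neg_sq]
  calc _ ≤ 2 * (ENNReal.ofReal ((P.Lx * P.Ly) ^ 2) * (P.sob 0 (P.coeff u) * P.sob 0 (P.coeff v)) +
        ENNReal.ofReal ((P.Lx * P.Ly) ^ 2) * (P.sob 0 (P.coeff u) * P.sob 0 (P.coeff v))) := by
        gcongr
        exact h1.trans (by gcongr; exact sob_highPart_le_self 0 N _)
    _ = _ := by ring

theorem sob_le_of_norm_le_negLap (s : ℕ) {C : ℝ} {c d : ℤ × ℤ → ℂ}
    (h : ∀ k, ‖d k‖ ≤ C * (P.negLap k * ‖c k‖)) :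
    P.sob s d ≤ ENNReal.ofReal (C ^ 2) * P.sob (s + 2) c := by
  refine (sob_le_mul_of_norm_le s d (fun k => ((P.negLap k * ‖c k‖ : ℝ) : ℂ)) (C := C)
    fun k => ?_).trans (mul_le_mul_right (ENNReal.tsum_le_tsum fun k => ?_) _)
  · rw [Complex.norm_real, Real.norm_of_nonneg (mul_nonneg (P.negLap_nonneg k) (norm_nonneg _))]
    exact h k
  · have hw := P.wt_pos k
    have hκ := P.negLap_nonneg k
    rw [← ofReal_norm, Complex.norm_real, Real.norm_of_nonneg (by positivity), ← ofReal_norm,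
      ← ENNReal.ofReal_pow (by positivity), ← ENNReal.ofReal_pow (by positivity),
      ← ENNReal.ofReal_mul (by positivity), ← ENNReal.ofReal_mul (by positivity)]
    refine ENNReal.ofReal_le_ofReal ?_
    rw [mul_pow, pow_add, mul_assoc]
    gcongr
    exact P.negLap_le_wt k

/-- The implicit factor 1 + a(ℓ + s) is inverted. On f it is simply dropped, which keeps the small
factor a; on p it is used in full, through aℓ/(1 + aℓ) ≤ 1, which exchanges the factor a for the
smoothing 1/ℓ. The latter suits the projection error, which is not small in the time step. -/
theorem norm_le_of_damped {a ℓ s h : ℝ} (ha : 0 ≤ a) (hℓ : 0 < ℓ) (hs : 0 ≤ s) (hh : 0 ≤ h)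
    {e f p t : ℂ} (h1 : e = -(a : ℂ) * (((ℓ + s : ℝ) : ℂ) * e + f + p) + (h : ℂ) * t) :
    ‖e‖ ≤ a * ‖f‖ + h * ‖t‖ + ‖p‖ / ℓ := by
  have h2 : ((1 + a * (ℓ + s) : ℝ) : ℂ) * e = -(a : ℂ) * f + (h : ℂ) * t + -(a : ℂ) * p := by
    have e1 : ((1 + a * (ℓ + s) : ℝ) : ℂ) * e = e + (a : ℂ) * ((ℓ + s : ℝ) : ℂ) * e := by
      push_cast; ring
    rw [e1]
    nth_rewrite 1 [h1]
    ring
  have h3 := congrArg norm h2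
  rw [norm_mul, Complex.norm_real, Real.norm_of_nonneg (by positivity)] at h3
  have h4 : (1 + a * (ℓ + s)) * ‖e‖ ≤ a * ‖f‖ + h * ‖t‖ + a * ‖p‖ := by
    rw [h3]
    refine norm_add₃_le.trans (le_of_eq ?_)
    simp [abs_of_nonneg ha, abs_of_nonneg hh]
  have h5 : a * ‖p‖ = a * ℓ * (‖p‖ / ℓ) := by field_simp
  have h6 : 0 ≤ ‖p‖ / ℓ := by positivity
  have h7 : 0 ≤ a * ‖f‖ + h * ‖t‖ := by positivity
  by_contra hcon
  push Not at hcon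
  have h8 : (1 + a * (ℓ + s)) * (a * ‖f‖ + h * ‖t‖ + ‖p‖ / ℓ) < (1 + a * (ℓ + s)) * ‖e‖ := by
    gcongr
  have h9 : 0 ≤ a * (ℓ + s) * (a * ‖f‖ + h * ‖t‖) := by positivity
  have h10 : 0 ≤ a * s * (‖p‖ / ℓ) := by positivity
  nlinarith

/-- Division by a symbol of order four gains four derivatives. -/
theorem sob_div_sym_le (hP : P.Admissible) {s : ℕ} (hs : s ≤ 4) {c d : ℤ × ℤ → ℂ}
    (h : ∀ k, ‖d k‖ ≤ ‖c k‖ / P.sym k) :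
    P.sob s d ≤ ENNReal.ofReal (P.symLow ^ 2) * P.sob 0 c := by
  rw [sob, sob, ← ENNReal.tsum_mul_left]
  refine ENNReal.tsum_le_tsum fun k => ?_
  have hw := P.wt_pos k
  have hℓ := sym_pos hP k
  rw [← ofReal_norm, ← ofReal_norm, ← ENNReal.ofReal_pow (norm_nonneg _),
    ← ENNReal.ofReal_pow (norm_nonneg _), ← ENNReal.ofReal_mul (by positivity), pow_zero,
    ENNReal.ofReal_one, one_mul, ← ENNReal.ofReal_mul (by positivity)]
  refine ENNReal.ofReal_le_ofReal ?_
  have h1 : P.wt k ^ s ≤ (P.symLow * P.sym k) ^ 2 :=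
    calc P.wt k ^ s ≤ P.wt k ^ 4 := pow_le_pow_right₀ (P.one_le_wt k) hs
      _ = (P.wt k ^ 2) ^ 2 := by ring
      _ ≤ _ := pow_le_pow_left₀ (by positivity) (wt_sq_le_sym hP k) 2
  calc P.wt k ^ s * ‖d k‖ ^ 2 ≤ (P.symLow * P.sym k) ^ 2 * (‖c k‖ / P.sym k) ^ 2 := by
        gcongr; exact h k
    _ = _ := by field_simp

section FirstStep

variable {T : ℝ} {j : ℕ} {φ : ℝ → ℝ × ℝ → ℝ} {g v w : ℝ → ℤ × ℤ → ℂ} {B Λ : ℝ≥0∞}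

theorem Regular.sob_backward_le (h : P.Regular T j φ g v w B Λ) (s : ℕ) {a b : ℝ} (ha : 0 ≤ a)
    (hab : a < b) (hb : b ≤ T) :
    P.sob s (fun k => g b k - (P.coeff (φ b) k - P.coeff (φ a) k) / ((b - a : ℝ) : ℂ)) ≤
      ENNReal.ofReal (b - a) * ∫⁻ t in Ioo a b, P.sob s (v t) := by
  rw [lintegral_sob s (fun k => (h.rep k).cont_v)
    (fun t ht => ⟨ha.trans_lt ht.1, ht.2.trans_le hb⟩), sob, ← ENNReal.tsum_mul_left]
  refine ENNReal.tsum_le_tsum fun k => ?_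
  rw [mul_left_comm]
  exact mul_le_mul_right ((h.rep k).backward ha hab hb) _

/-- The error equations of the first-order step. -/
theorem Regular.first_step_error_eq (h : P.Regular T j φ g v w B Λ) (hP : P.Admissible) {N : ℕ}
    {η : ℝ} (hη : η ∈ Ioc 0 T) {u μ u' : ℝ × ℝ → ℝ} {R R' : ℝ} (hproj : P.IsProj N (φ 0) u)
    (hstep : P.FirstOrderStep N η u R μ u' R') {k : ℤ × ℤ} (hk : k ∈ modes N) :
    P.coeff u' k - P.coeff (φ η) k = -((P.M * η * P.negLap k : ℝ) : ℂ) *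
        (P.coeff μ k - ((P.sym k : ℂ) * P.coeff (φ η) k + P.coeff (fun x => P.dF (φ η x)) k)) +
      (η : ℂ) * (g η k - (P.coeff (φ η) k - P.coeff (φ 0) k) / ((η - 0 : ℝ) : ℂ)) ∧
    P.coeff μ k - ((P.sym k : ℂ) * P.coeff (φ η) k + P.coeff (fun x => P.dF (φ η x)) k) =
      ((P.sym k + P.S * P.negLap k : ℝ) : ℂ) * (P.coeff u' k - P.coeff (φ η) k) +
      ((R' - √(P.E1 u) : ℝ) : ℂ) * (((√(P.E1 u))⁻¹ : ℝ) * P.coeff (fun x => P.dF (u x)) k) +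
      ((P.coeff (fun x => P.dF (u x)) k - P.coeff (fun x => P.dF (φ 0 x)) k) +
        ((P.coeff (fun x => P.dF (φ 0 x)) k - P.coeff (fun x => P.dF (φ η x)) k) +
        ((P.S * P.negLap k : ℝ) : ℂ) * (P.coeff (φ η) k - P.coeff (φ 0) k))) := by
  have h0 : (0 : ℝ) ∈ Icc 0 T := left_mem_Icc.2 h.pos.le
  obtain ⟨f1, f2, -⟩ := hstep.modes_eq hP hproj.1
  have f1 := f1 k hk
  have f2 := f2 k hk
  have f0 := hproj.coeff_eq hP (h.good 0 h0).memLp k hk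
  have hg := h.eqn η ⟨hη.1.le, hη.2⟩ k
  have hη0 : (η : ℂ) ≠ 0 := by exact_mod_cast hη.1.ne'
  have hE : ((√(P.E1 u) : ℝ) : ℂ) ≠ 0 := by exact_mod_cast (sqrt_E1_pos hP u).ne'
  rw [f0] at f1 f2
  constructor
  · rw [sub_zero, hg, mul_sub (η : ℂ), mul_div_cancel₀ _ hη0]
    have e : P.coeff u' k = P.coeff (φ 0) k + -((P.M * η * P.negLap k : ℝ) : ℂ) * P.coeff μ k := by
      rw [← f1]; ring
    rw [e]
    push_cast
    ring
  · rw [f2]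
    have e : ((R' / √(P.E1 u) : ℝ) : ℂ) = ((R' - √(P.E1 u) : ℝ) : ℂ) * ((√(P.E1 u))⁻¹ : ℝ) + 1 := by
      push_cast; field_simp; ring
    rw [e]
    push_cast
    ring

end FirstStep

section FirstStep

variable {T : ℝ} {j : ℕ} {φ : ℝ → ℝ × ℝ → ℝ} {g v w : ℝ → ℤ × ℤ → ℂ} {B Λ : ℝ≥0∞}

theorem IsProj.coeff_sub_eq (hP : P.Admissible) {N : ℕ} {f u : ℝ × ℝ → ℝ}
    (hf : MemLp f 2 (volume.restrict P.Ω)) (h : P.IsProj N f u) :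
    P.coeff u - P.coeff f = -highPart N (P.coeff f) := by
  funext k
  rw [Pi.sub_apply, Pi.neg_apply]
  by_cases hk : k ∈ modes N
  · rw [highPart_of_mem hk, h.coeff_eq hP hf k hk, sub_self, neg_zero]
  · rw [highPart_of_notMem hk, coeff_eq_zero_of_mem_SN hP h.1 hk, zero_sub]

theorem IsProj.sob_le (hP : P.Admissible) {N : ℕ} {f u : ℝ × ℝ → ℝ}
    (hf : MemLp f 2 (volume.restrict P.Ω)) (h : P.IsProj N f u) (s : ℕ) :
    P.sob s (P.coeff u) ≤ P.sob s (P.coeff f) := by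
  refine sob_le_of_norm_le s _ _ fun k => ?_
  by_cases hk : k ∈ modes N
  · rw [h.coeff_eq hP hf k hk]
  · rw [coeff_eq_zero_of_mem_SN hP h.1 hk, norm_zero]; exact norm_nonneg _

/-- Bounds for the data in the error equations of the first-order step. -/
theorem Regular.exists_first_step_data_bound (h : P.Regular T j φ g v w B Λ) (hP : P.Admissible)
    {m : ℕ} {ρ : ℝ≥0∞} (hρ : ∀ t ∈ Icc 0 T, P.sob (m + 1) (P.coeff (φ t)) ≤ ρ) :
    ∃ C : ℝ≥0∞, C ≠ ⊤ ∧ ∀ N : ℕ, 0 < N → ∀ η ∈ Icc 0 T, ∀ u, P.IsProj N (φ 0) u →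
      P.sob 1 (P.coeff (fun x => P.dF (u x)) - P.coeff (fun x => P.dF (φ 0 x))) ≤
        C * spectralError m ρ N ∧
      P.sob (2 * j + 3) (P.coeff (fun x => P.dF (φ 0 x)) - P.coeff (fun x => P.dF (φ η x)) +
        fun k => ((P.S * P.negLap k : ℝ) : ℂ) * (P.coeff (φ η) k - P.coeff (φ 0) k)) ≤
        C * (ENNReal.ofReal (η ^ 2) * Λ) ∧
      P.sob (2 * j + 3) (fun k => ((√(P.E1 u))⁻¹ : ℝ) * P.coeff (fun x => P.dF (u x)) k) ≤ C ∧
      ENNReal.ofReal ((√(P.E1 (φ 0)) - √(P.E1 u)) ^ 2) ≤ C * spectralError m ρ N ∧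
      ENNReal.ofReal ((1 / 2 * (P.Lx * P.Ly * ∑ k ∈ modes N,
        (conj (((√(P.E1 u))⁻¹ : ℝ) * P.coeff (fun x => P.dF (u x)) k) *
          (P.coeff (φ η) k - P.coeff (φ 0) k)).re)) ^ 2) ≤ C * (ENNReal.ofReal (η ^ 2) * Λ) := by
  have hB := h.bound_ne_top
  have hΛ := h.lip_ne_top
  have hlow := e1Low_pos hP
  have h0 : (0 : ℝ) ∈ Icc 0 T := left_mem_Icc.2 h.pos.le
  have g0 := h.good 0 h0
  obtain ⟨C₁, hC₁, h₁⟩ := exists_sob_highPart_le hP 1 m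
  obtain ⟨C₂, hC₂, h₂⟩ := exists_sob_dF_sub_le hP 1 2 le_rfl (by norm_num) hB
  obtain ⟨C₃, hC₃, h₃⟩ := h.sob_dF_sub_le hP (s := 2 * j + 3) (by omega)
  obtain ⟨C₄, hC₄, h₄⟩ := exists_sob_dF_le hP (2 * j + 3) (2 * j + 5) (by omega) (by omega) hB
  obtain ⟨C₅, hC₅, h₅⟩ := exists_sqrt_E1_sub_le hP hB
  obtain ⟨i, hi⟩ : ∃ i, i = ENNReal.ofReal ((√P.e1Low)⁻¹ ^ 2) := ⟨_, rfl⟩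
  have hit : i ≠ ⊤ := by rw [hi]; finiteness
  obtain ⟨D, hD⟩ : ∃ D, D = i * (C₄ * B) := ⟨_, rfl⟩
  have hDt : D ≠ ⊤ := by rw [hD]; finiteness
  obtain ⟨c₁, hc₁⟩ : ∃ c, c = C₂ * C₁ := ⟨_, rfl⟩
  obtain ⟨c₂, hc₂⟩ : ∃ c, c = 2 * (C₃ + ENNReal.ofReal (P.S ^ 2)) := ⟨_, rfl⟩
  obtain ⟨c₄, hc₄⟩ : ∃ c, c = C₅ * C₁ := ⟨_, rfl⟩
  obtain ⟨c₅, hc₅⟩ : ∃ c, c = i * (4 * ENNReal.ofReal ((P.Lx * P.Ly) ^ 2) * (C₄ * B)) := ⟨_, rfl⟩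
  refine ⟨c₁ + c₂ + D + c₄ + c₅, by rw [hc₁, hc₂, hc₄, hc₅]; finiteness,
    fun N hN η hη u hu => ?_⟩
  have gη := h.good η hη
  have gu := good_of_mem_SN hP hu.1
  have n0 : ∀ s, s ≤ 2 * j + 5 → P.sob s (P.coeff (φ 0)) ≤ B := fun s hs =>
    (sob_mono_exp s _ hs _).trans (h.bound 0 h0)
  have nu : ∀ s, s ≤ 2 * j + 5 → P.sob s (P.coeff u) ≤ B := fun s hs =>
    (hu.sob_le hP g0.memLp s).trans (n0 s hs)
  have nδ : P.sob (2 * j + 5) (P.coeff (φ η) - P.coeff (φ 0)) ≤ ENNReal.ofReal (η ^ 2) * Λ := by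
    simpa using h.lip 0 h0 η hη
  have ndiff : P.sob 1 (P.coeff fun x => u x - φ 0 x) ≤ C₁ * spectralError m ρ N := by
    rw [coeff_sub gu.integrable g0.integrable, hu.coeff_sub_eq hP g0.memLp, sob_neg]
    exact (h₁ N _ hN).trans (by rw [spectralError]; gcongr; exact hρ 0 h0)
  have hinv : ENNReal.ofReal ((√(P.E1 u))⁻¹ ^ 2) ≤ i := by
    have h3 := sqrt_e1Low_le hP u
    have h4 : 0 < √P.e1Low := Real.sqrt_pos.2 hlow
    rw [hi]
    refine ENNReal.ofReal_le_ofReal ?_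
    gcongr
  have nf : P.sob (2 * j + 3) (P.coeff fun x => P.dF (u x)) ≤ C₄ * B :=
    (h₄ u gu (nu _ le_rfl)).trans (mul_le_mul_right (nu _ (by omega)) _)
  refine ⟨?_, ?_, ?_, ?_, ?_⟩
  · rw [← coeff_sub (gu.dF hP).integrable (g0.dF hP).integrable]
    refine (h₂ u (φ 0) gu g0 (nu 2 (by omega)) (n0 2 (by omega))).trans ?_
    calc _ ≤ C₂ * (C₁ * spectralError m ρ N) := mul_le_mul_right ndiff _
      _ = c₁ * spectralError m ρ N := by rw [hc₁]; ring
      _ ≤ _ := by gcongr; simp only [add_assoc]; exact le_self_add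
  · refine (sob_add_le _ _ _).trans ?_
    have i1 := (h₃ η hη 0 h0).trans (mul_le_mul_right
      ((sob_mono_exp (2 * j + 3) (2 * j + 5) (by omega) _).trans (sob_sub_comm (P := P) (2 * j + 5)
        (P.coeff (φ 0)) (P.coeff (φ η)) ▸ nδ)) C₃)
    have i2 : P.sob (2 * j + 3) (fun k => ((P.S * P.negLap k : ℝ) : ℂ) *
        (P.coeff (φ η) k - P.coeff (φ 0) k)) ≤
        ENNReal.ofReal (P.S ^ 2) * (ENNReal.ofReal (η ^ 2) * Λ) := by
      refine (sob_le_of_norm_le_negLap (2 * j + 3) (C := P.S)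
        (c := P.coeff (φ η) - P.coeff (φ 0)) fun k => le_of_eq ?_).trans (mul_le_mul_right nδ _)
      rw [norm_mul, Complex.norm_real, Real.norm_of_nonneg
        (mul_nonneg hP.S_nonneg (P.negLap_nonneg k)), mul_assoc, Pi.sub_apply]
    calc _ ≤ 2 * (C₃ * (ENNReal.ofReal (η ^ 2) * Λ) +
          ENNReal.ofReal (P.S ^ 2) * (ENNReal.ofReal (η ^ 2) * Λ)) := by gcongr
      _ = c₂ * (ENNReal.ofReal (η ^ 2) * Λ) := by rw [hc₂]; ring
      _ ≤ _ := by
        gcongr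
        rw [add_comm c₁]; simp only [add_assoc]; exact le_self_add
  · have e : (fun k => (((√(P.E1 u))⁻¹ : ℝ) : ℂ) * P.coeff (fun x => P.dF (u x)) k) =
        P.coeff (fun x => (√(P.E1 u))⁻¹ * P.dF (u x)) := by
      rw [coeff_const_mul]; rfl
    rw [e, sob_coeff_const_mul]
    calc _ ≤ i * (C₄ * B) := by gcongr
      _ = D := hD.symm
      _ ≤ _ := by rw [add_assoc, add_right_comm]; exact le_add_self
  · rw [← neg_sq, neg_sub]
    refine (h₅ u (φ 0) gu g0 (nu 2 (by omega)) (n0 2 (by omega))).trans ?_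
    calc _ ≤ C₅ * (C₁ * spectralError m ρ N) :=
          mul_le_mul_right ((sob_mono_exp 0 1 (by norm_num) _).trans ndiff) _
      _ = c₄ * spectralError m ρ N := by rw [hc₄]; ring
      _ ≤ _ := by gcongr; rw [add_right_comm]; exact le_add_self
  · have gd := gη.sub g0
    have i1 := ofReal_sum_modes_sq_le hP N (gu.dF hP) gd
    rw [coeff_sub gη.integrable g0.integrable] at i1
    obtain ⟨S, hS⟩ : ∃ S, S = P.Lx * P.Ly * ∑ k ∈ modes N,
      (conj (P.coeff (fun x => P.dF (u x)) k) * (P.coeff (φ η) - P.coeff (φ 0)) k).re := ⟨_, rfl⟩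
    rw [← hS] at i1
    have eS : P.Lx * P.Ly * ∑ k ∈ modes N,
        (conj (((√(P.E1 u))⁻¹ : ℝ) * P.coeff (fun x => P.dF (u x)) k) *
          (P.coeff (φ η) k - P.coeff (φ 0) k)).re = (√(P.E1 u))⁻¹ * S := by
      rw [hS, mul_left_comm (√(P.E1 u))⁻¹, Finset.mul_sum _ _ (√(P.E1 u))⁻¹]
      congr 1
      refine Finset.sum_congr rfl fun k _ => ?_
      rw [Pi.sub_apply, map_mul, Complex.conj_ofReal, mul_assoc, Complex.re_ofReal_mul]
    rw [eS]
    have i2 : ENNReal.ofReal ((1 / 2 * ((√(P.E1 u))⁻¹ * S)) ^ 2) ≤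
        ENNReal.ofReal ((√(P.E1 u))⁻¹ ^ 2) * ENNReal.ofReal (S ^ 2) := by
      rw [← ENNReal.ofReal_mul (sq_nonneg _)]
      refine ENNReal.ofReal_le_ofReal ?_
      nlinarith [sq_nonneg ((√(P.E1 u))⁻¹ * S)]
    refine i2.trans ?_
    calc _ ≤ i * (4 * ENNReal.ofReal ((P.Lx * P.Ly) ^ 2) *
          (C₄ * B * (ENNReal.ofReal (η ^ 2) * Λ))) := by
          gcongr
          refine i1.trans ?_
          gcongr
          · exact (sob_mono_exp 0 _ (Nat.zero_le _) _).trans nf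
          · exact (sob_mono_exp 0 _ (Nat.zero_le _) _).trans nδ
      _ = c₅ * (ENNReal.ofReal (η ^ 2) * Λ) := by rw [hc₅]; ring
      _ ≤ _ := by gcongr; exact le_add_self

end FirstStep

theorem exists_sum_inv_le_sob_zero (hP : P.Admissible) : ∃ C : ℝ≥0∞, C ≠ ⊤ ∧
    ∀ (K : Finset (ℤ × ℤ)) (c : ℤ × ℤ → ℂ),
      ENNReal.ofReal (P.Lx * P.Ly * ∑ k ∈ K, (P.negLap k)⁻¹ * ‖c k‖ ^ 2) ≤ C * P.sob 0 c := by
  have hA := area_pos hP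
  obtain ⟨c₀, hc, -, hκ⟩ := exists_le_negLap hP
  refine ⟨ENNReal.ofReal (P.Lx * P.Ly * c₀⁻¹), by finiteness, fun K c => ?_⟩
  refine le_trans ?_ (mul_le_mul_right (ofReal_sum_le_sob 0 K c) _)
  rw [← ENNReal.ofReal_mul (by positivity), mul_assoc (P.Lx * P.Ly)]
  refine ENNReal.ofReal_le_ofReal (mul_le_mul_of_nonneg_left ?_ hA.le)
  rw [Finset.mul_sum]
  refine Finset.sum_le_sum fun k _ => ?_
  rw [pow_zero, one_mul]
  by_cases hk : k = 0
  · rw [hk, negLap_zero, inv_zero, zero_mul]; positivity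
  · have := hκ k hk
    gcongr

theorem ofReal_sum_negLap_le (hP : P.Admissible) (K : Finset (ℤ × ℤ)) (c : ℤ × ℤ → ℂ) :
    ENNReal.ofReal (P.Lx * P.Ly * ∑ k ∈ K, P.negLap k * ‖c k‖ ^ 2) ≤
      ENNReal.ofReal (P.Lx * P.Ly) * P.sob 1 c := by
  rw [ENNReal.ofReal_mul (area_pos hP).le]
  exact mul_le_mul_right (ofReal_sum_negLap_le_sob K c) _

theorem half_inv_mul_sum (K : Finset (ℤ × ℤ)) (s A : ℝ) (f d : ℤ × ℤ → ℂ) :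
    1 / (2 * s) * (A * ∑ k ∈ K, (conj (f k) * d k).re) =
      1 / 2 * (A * ∑ k ∈ K, (conj (((s⁻¹ : ℝ) : ℂ) * f k) * d k).re) := by
  simp only [map_mul, Complex.conj_ofReal, mul_assoc, Complex.re_ofReal_mul, ← Finset.mul_sum]
  rw [one_div, mul_inv]
  ring

section FirstStep

variable {T : ℝ} {j : ℕ} {φ : ℝ → ℝ × ℝ → ℝ} {g v w : ℝ → ℤ × ℤ → ℂ} {B Λ : ℝ≥0∞}

theorem Regular.g_eq_zero (h : P.Regular T j φ g v w B Λ) {k : ℤ × ℤ} (hk : P.negLap k = 0) {t : ℝ}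
    (ht : t ∈ Icc 0 T) : g t k = 0 := by rw [h.eqn t ht, hk]; simp

/-- Conservation of mass. It makes the time defects vanish wherever the weight κ⁻¹ would be
singular. -/
theorem Regular.coeff_eq_of_negLap_eq_zero (h : P.Regular T j φ g v w B Λ) {k : ℤ × ℤ}
    (hk : P.negLap k = 0) {a b : ℝ} (ha : a ∈ Icc 0 T) (hb : b ∈ Icc 0 T) :
    P.coeff (φ b) k = P.coeff (φ a) k := by
  rw [← sub_eq_zero, (h.rep k).f_sub a ha b hb]
  have e : ∫ s in a..b, g s k = ∫ s in a..b, (0 : ℂ) :=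
    intervalIntegral.integral_congr fun s hs => h.g_eq_zero hk (uIcc_subset_Icc ha hb hs)
  rw [e, intervalIntegral.integral_zero]

/-- The energy inequality for the first-order step with the exact solution at time η as reference.
The bound is only of first order in η; this suffices, because the scalar error acts on the function
with a further factor η. The quantity compared is √E₁(u), which stands in the denominator of the
scheme, so the initial mismatch and the motion of φ enter as a scalar defect. -/
theorem Regular.exists_first_step_sav_bound (h : P.Regular T j φ g v w B Λ) (hP : P.Admissible)
    {m : ℕ} {ρ : ℝ≥0∞} (hρ : ∀ t ∈ Icc 0 T, P.sob (m + 1) (P.coeff (φ t)) ≤ ρ) :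
    ∃ C : ℝ≥0∞, C ≠ ⊤ ∧ ∀ N : ℕ, 0 < N → ∀ η ∈ Ioc 0 T, ∀ (u μ u' : ℝ × ℝ → ℝ) (R R' : ℝ),
      P.IsProj N (φ 0) u → R = √(P.E1 (φ 0)) → P.FirstOrderStep N η u R μ u' R' →
      ENNReal.ofReal ((R' - √(P.E1 u)) ^ 2) ≤ C * (spectralError m ρ N +
        ENNReal.ofReal (η ^ 2) * Λ + ENNReal.ofReal (η ^ 2) *
          ∫⁻ s in Ioo 0 η, P.sob (2 * j + 1) (v s)) := by
  have hA := area_pos hP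
  have hM := hP.M_pos
  obtain ⟨C₁, hC₁, h₁⟩ := h.exists_first_step_data_bound hP hρ
  obtain ⟨C₂, hC₂, h₂⟩ := exists_sum_inv_le_sob_zero hP
  obtain ⟨X, hX⟩ : ∃ X, X = ENNReal.ofReal T := ⟨_, rfl⟩
  have hXt : X ≠ ⊤ := by rw [hX]; finiteness
  obtain ⟨c₁, hc₁⟩ : ∃ c, c = ENNReal.ofReal (2 / P.M + 1) * C₂ := ⟨_, rfl⟩
  obtain ⟨c₂, hc₂⟩ : ∃ c, c = ENNReal.ofReal (P.M + 1) * ENNReal.ofReal (P.Lx * P.Ly) *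
    (2 * C₁) := ⟨_, rfl⟩
  refine ⟨2 * C₁ + X * c₂ + c₁, by rw [hc₁, hc₂]; finiteness, fun N hN η hη u μ u' R R' hu hR
    hstep => ?_⟩
  have h0 : (0 : ℝ) ∈ Icc 0 T := left_mem_Icc.2 h.pos.le
  have hηI : η ∈ Icc 0 T := Ioc_subset_Icc_self hη
  obtain ⟨np, nq, -, nE, nS⟩ := h₁ N hN η hηI u hu
  have herr := fun k hk => h.first_step_error_eq hP hη hu hstep (k := k) hk
  obtain ⟨-, -, f3⟩ := hstep.modes_eq hP hu.1
  obtain ⟨b, hb⟩ : ∃ b : ℤ × ℤ → ℂ, b = fun k => ((√(P.E1 u))⁻¹ : ℝ) *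
    P.coeff (fun x => P.dF (u x)) k := ⟨_, rfl⟩
  obtain ⟨p, hp⟩ : ∃ p, p = P.coeff (fun x => P.dF (u x)) - P.coeff (fun x => P.dF (φ 0 x)) :=
    ⟨_, rfl⟩
  obtain ⟨q, hq⟩ : ∃ q, q = P.coeff (fun x => P.dF (φ 0 x)) - P.coeff (fun x => P.dF (φ η x)) +
    fun k => ((P.S * P.negLap k : ℝ) : ℂ) * (P.coeff (φ η) k - P.coeff (φ 0) k) := ⟨_, rfl⟩
  obtain ⟨t, ht⟩ : ∃ t : ℤ × ℤ → ℂ, t = fun k => g η k - (P.coeff (φ η) k - P.coeff (φ 0) k) /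
    ((η - 0 : ℝ) : ℂ) := ⟨_, rfl⟩
  obtain ⟨θ₁, hθ₁⟩ : ∃ θ₁, θ₁ = √(P.E1 (φ 0)) - √(P.E1 u) := ⟨_, rfl⟩
  obtain ⟨θ₂, hθ₂⟩ : ∃ θ₂, θ₂ = 1 / 2 * (P.Lx * P.Ly * ∑ k ∈ modes N,
    (conj (b k) * (P.coeff (φ η) k - P.coeff (φ 0) k)).re) := ⟨_, rfl⟩
  have eθ₂ : θ₂ = 1 / 2 * (P.Lx * P.Ly * ∑ k ∈ modes N,
        (conj (((√(P.E1 u))⁻¹ : ℝ) * P.coeff (fun x => P.dF (u x)) k) *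
          (P.coeff (φ η) k - P.coeff (φ 0) k)).re) := by rw [hθ₂, hb]
  rw [← hp] at np
  rw [← hq] at nq
  rw [← hθ₁] at nE
  rw [← eθ₂] at nS
  have ht0 : ∀ k, P.negLap k = 0 → t k = 0 := fun k hk => by
    rw [ht]; beta_reduce
    rw [h.g_eq_zero hk hηI, h.coeff_eq_of_negLap_eq_zero hk h0 hηI]; simp
  -- The old error is 0 on the retained modes, so e = v = 0 and half of the symbol is again put into
  -- the stabilization.
  have key := energy_step_le hP (modes N) hη.1.le
    (s := fun k => P.sym k / 2 + P.S * P.negLap k)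
    (fun k => by have := sym_pos hP k; have := P.negLap_nonneg k; have := hP.S_nonneg; positivity)
    (e := 0) (e' := fun k => P.coeff u' k - P.coeff (φ η) k) (v := 0)
    (w := fun k => P.coeff μ k -
      ((P.sym k : ℂ) * P.coeff (φ η) k + P.coeff (fun x => P.dF (φ η x)) k))
    (b := b) (g := p + q) (t := t) (r := 0) (r' := R' - √(P.E1 u)) (σ := R' - √(P.E1 u))
    (t₂ := θ₁ + θ₂) ht0
    (fun k hk => by rw [Pi.zero_apply, sub_zero, (herr k hk).1, ht])
    (fun k hk => by
      rw [(herr k hk).2, hb, hp, hq]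
      simp only [Pi.zero_apply, Pi.add_apply, Pi.sub_apply]
      push_cast
      ring)
    (by
      have e1 : R' - √(P.E1 u) - 0 = (R' - R) + θ₁ := by rw [hR, hθ₁]; ring
      rw [e1, f3, half_inv_mul_sum, hθ₂, add_comm θ₁, ← add_assoc, ← mul_add, ← mul_add,
        ← Finset.sum_add_distrib]
      congr 3
      refine Finset.sum_congr rfl fun k hk => ?_
      rw [← Complex.add_re, ← mul_add, hb, Pi.zero_apply,
        hu.coeff_eq hP (h.good 0 h0).memLp k hk]
      congr 2
      ring)
  have hσ : (R' - √(P.E1 u)) ^ 2 ≤ (θ₁ + θ₂) ^ 2 + η * ((2 / P.M + 1) *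
      (P.Lx * P.Ly * ∑ k ∈ modes N, (P.negLap k)⁻¹ * ‖t k‖ ^ 2) +
      (P.M + 1) * (P.Lx * P.Ly * ∑ k ∈ modes N, P.negLap k * ‖(p + q) k‖ ^ 2)) := by
    have i1 : 0 ≤ P.Lx * P.Ly * (∑ k ∈ modes N, P.sym k / 2 * ‖P.coeff u' k - P.coeff (φ η) k‖ ^ 2) :=
      mul_nonneg hA.le (Finset.sum_nonneg fun k _ => by have := sym_pos hP k; positivity)
    have i2 : 0 ≤ P.Lx * P.Ly * (∑ k ∈ modes N, (P.sym k / 2 + P.S * P.negLap k) / 2 *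
        ‖P.coeff u' k - P.coeff (φ η) k‖ ^ 2) :=
      mul_nonneg hA.le (Finset.sum_nonneg fun k _ => by
        have := sym_pos hP k; have := P.negLap_nonneg k; have := hP.S_nonneg; positivity)
    simp only [Pi.zero_apply, sub_zero, norm_zero, ne_eq, OfNat.ofNat_ne_zero, not_false_eq_true,
      zero_pow, mul_zero, Finset.sum_const_zero, add_zero, zero_add] at key
    -- With σ the new scalar error and θ = θ₁ + θ₂, the identity 2σ(σ - θ) = σ² - θ² + (σ - θ)²
    -- extracts σ².
    nlinarith [sq_nonneg (R' - √(P.E1 u) - (θ₁ + θ₂))]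
  obtain ⟨V, hV⟩ : ∃ V, V = ∫⁻ s in Ioo 0 η, P.sob (2 * j + 1) (v s) := ⟨_, rfl⟩
  obtain ⟨x, hx⟩ : ∃ x, x = ENNReal.ofReal η := ⟨_, rfl⟩
  have hx2 : ENNReal.ofReal (η ^ 2) = x ^ 2 := by rw [hx, ENNReal.ofReal_pow hη.1.le]
  have hxX : x ≤ X := by rw [hx, hX]; exact ENNReal.ofReal_le_ofReal hη.2
  have nt : P.sob 0 t ≤ x * V := by
    have := h.sob_backward_le (2 * j + 1) le_rfl hη.1 hη.2
    rw [← ht, sub_zero, ← hV, ← hx] at this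
    exact (sob_mono_exp 0 _ (Nat.zero_le _) _).trans this
  rw [hx2] at nq nS ⊢
  rw [← hV]
  refine (ENNReal.ofReal_le_ofReal hσ).trans (ENNReal.ofReal_add_le.trans ?_)
  rw [ENNReal.ofReal_mul hη.1.le, ← hx]
  have j1 : ENNReal.ofReal ((2 / P.M + 1) *
      (P.Lx * P.Ly * ∑ k ∈ modes N, (P.negLap k)⁻¹ * ‖t k‖ ^ 2)) ≤ c₁ * (x * V) := by
    rw [ENNReal.ofReal_mul (by positivity), hc₁, mul_assoc (ENNReal.ofReal (2 / P.M + 1))]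
    exact mul_le_mul_right ((h₂ _ _).trans (mul_le_mul_right nt _)) _
  have j2 : ENNReal.ofReal ((P.M + 1) *
      (P.Lx * P.Ly * ∑ k ∈ modes N, P.negLap k * ‖(p + q) k‖ ^ 2)) ≤
      c₂ * (spectralError m ρ N + x ^ 2 * Λ) := by
    rw [ENNReal.ofReal_mul (by positivity)]
    have := (sob_mono_exp 1 (2 * j + 3) (by omega) q).trans nq
    calc _ ≤ ENNReal.ofReal (P.M + 1) * (ENNReal.ofReal (P.Lx * P.Ly) *
          (2 * (C₁ * spectralError m ρ N + C₁ * (x ^ 2 * Λ)))) := by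
          refine mul_le_mul_right ((ofReal_sum_negLap_le hP _ _).trans (mul_le_mul_right ?_ _)) _
          exact (sob_add_le 1 p q).trans (by gcongr)
      _ = _ := by rw [hc₂]; ring
  calc _ ≤ 2 * (C₁ * spectralError m ρ N + C₁ * (x ^ 2 * Λ)) +
        x * (c₁ * (x * V) + c₂ * (spectralError m ρ N + x ^ 2 * Λ)) := by
        refine add_le_add ((ofReal_add_sq_le _ _).trans (by gcongr)) (mul_le_mul_right ?_ _)
        exact ENNReal.ofReal_add_le.trans (add_le_add j1 j2)
    _ = 2 * C₁ * (spectralError m ρ N + x ^ 2 * Λ) + c₁ * (x ^ 2 * V) +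
        x * c₂ * (spectralError m ρ N + x ^ 2 * Λ) := by ring
    _ ≤ 2 * C₁ * (spectralError m ρ N + x ^ 2 * Λ + x ^ 2 * V) +
        c₁ * (spectralError m ρ N + x ^ 2 * Λ + x ^ 2 * V) +
        X * c₂ * (spectralError m ρ N + x ^ 2 * Λ + x ^ 2 * V) := by
        refine add_le_add (add_le_add (mul_le_mul_right le_self_add _)
          (mul_le_mul_right le_add_self _)) (mul_le_mul' (mul_le_mul_left hxX _) le_self_add)
    _ = _ := by ring

end FirstStep

section FirstStep

variable {T : ℝ} {j : ℕ} {φ : ℝ → ℝ × ℝ → ℝ} {g v w : ℝ → ℤ × ℤ → ℂ} {B Λ : ℝ≥0∞}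

/-- The error of the intermediate value computed by the first-order scheme. -/
theorem Regular.exists_first_step_bound (h : P.Regular T j φ g v w B Λ) (hP : P.Admissible)
    {m : ℕ} {ρ : ℝ≥0∞} (hρ : ∀ t ∈ Icc 0 T, P.sob (m + 1) (P.coeff (φ t)) ≤ ρ) :
    ∃ C : ℝ≥0∞, C ≠ ⊤ ∧ ∀ N : ℕ, 0 < N → ∀ η ∈ Ioc 0 T, ∀ (u μ u' : ℝ × ℝ → ℝ) (R R' : ℝ),
      P.IsProj N (φ 0) u → R = √(P.E1 (φ 0)) → P.FirstOrderStep N η u R μ u' R' →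
      P.sob (2 * j + 1) (lowPart N (P.coeff u' - P.coeff (φ η))) ≤ C * (spectralError m ρ N +
        ENNReal.ofReal (η ^ 4) * Λ + ENNReal.ofReal (η ^ 3) *
          ∫⁻ s in Ioo 0 η, P.sob (2 * j + 1) (v s)) := by
  have hM := hP.M_pos
  have hj := h.le_one
  obtain ⟨C₁, hC₁, h₁⟩ := h.exists_first_step_data_bound hP hρ
  obtain ⟨C₂, hC₂, h₂⟩ := h.exists_first_step_sav_bound hP hρ
  obtain ⟨X, hX⟩ : ∃ X, X = ENNReal.ofReal T := ⟨_, rfl⟩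
  have hXt : X ≠ ⊤ := by rw [hX]; finiteness
  obtain ⟨D, hD⟩ : ∃ D, D = ENNReal.ofReal (P.M ^ 2) * C₁ * C₂ * (X ^ 2 + 1 + X) := ⟨_, rfl⟩
  have hDt : D ≠ ⊤ := by rw [hD]; finiteness
  refine ⟨4 * (D + ENNReal.ofReal (P.M ^ 2) * C₁ + 1 + ENNReal.ofReal (P.symLow ^ 2) * C₁),
    by finiteness, fun N hN η hη u μ u' R R' hu hR hstep => ?_⟩
  have hηI : η ∈ Icc 0 T := Ioc_subset_Icc_self hη
  have hη0 := hη.1.le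
  obtain ⟨np, nq, nb, -, -⟩ := h₁ N hN η hηI u hu
  have nσ := h₂ N hN η hη u μ u' R R' hu hR hstep
  have herr := fun k hk => h.first_step_error_eq hP hη hu hstep (k := k) hk
  obtain ⟨b, hb⟩ : ∃ b : ℤ × ℤ → ℂ, b = fun k => ((√(P.E1 u))⁻¹ : ℝ) *
    P.coeff (fun x => P.dF (u x)) k := ⟨_, rfl⟩
  obtain ⟨p, hp⟩ : ∃ p, p = P.coeff (fun x => P.dF (u x)) - P.coeff (fun x => P.dF (φ 0 x)) :=
    ⟨_, rfl⟩
  obtain ⟨q, hq⟩ : ∃ q, q = P.coeff (fun x => P.dF (φ 0 x)) - P.coeff (fun x => P.dF (φ η x)) +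
    fun k => ((P.S * P.negLap k : ℝ) : ℂ) * (P.coeff (φ η) k - P.coeff (φ 0) k) := ⟨_, rfl⟩
  obtain ⟨t, ht⟩ : ∃ t : ℤ × ℤ → ℂ, t = fun k => g η k - (P.coeff (φ η) k - P.coeff (φ 0) k) /
    ((η - 0 : ℝ) : ℂ) := ⟨_, rfl⟩
  obtain ⟨σ, hσ⟩ : ∃ σ, σ = R' - √(P.E1 u) := ⟨_, rfl⟩
  obtain ⟨V, hV⟩ : ∃ V, V = ∫⁻ s in Ioo 0 η, P.sob (2 * j + 1) (v s) := ⟨_, rfl⟩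
  obtain ⟨x, hx⟩ : ∃ x, x = ENNReal.ofReal η := ⟨_, rfl⟩
  have hxn : ∀ n : ℕ, ENNReal.ofReal (η ^ n) = x ^ n := fun n => by
    rw [hx, ENNReal.ofReal_pow hη0]
  have hxX : x ≤ X := by rw [hx, hX]; exact ENNReal.ofReal_le_ofReal hη.2
  have nt : P.sob (2 * j + 1) t ≤ x * V := by
    have := h.sob_backward_le (2 * j + 1) le_rfl hη.1 hη.2
    rwa [← ht, sub_zero, ← hV, ← hx] at this
  rw [← hp] at np
  rw [← hq] at nq
  rw [← hb] at nb
  rw [← hσ, ← hV] at nσ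
  rw [← hV]
  simp only [hxn] at nq nσ ⊢
  -- the error, mode by mode
  have hmode : ∀ k ∈ modes N, ‖P.coeff u' k - P.coeff (φ η) k‖ ≤
      P.M * η * |σ| * (P.negLap k * ‖b k‖) + P.M * η * (P.negLap k * ‖q k‖) +
        (η * ‖t k‖ + ‖p k‖ / P.sym k) := by
    intro k hk
    have hκ := P.negLap_nonneg k
    obtain ⟨e1, e2⟩ := herr k hk
    rw [e2] at e1
    have h3 := norm_le_of_damped (a := P.M * η * P.negLap k) (ℓ := P.sym k) (s := P.S * P.negLap k)
      (h := η) (f := (σ : ℂ) * b k + q k) (p := p k) (t := t k) (by positivity) (sym_pos hP k)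
      (mul_nonneg hP.S_nonneg hκ) hη0 (e := P.coeff u' k - P.coeff (φ η) k) (by
        rw [hb, hp, hq, ht, hσ]
        refine e1.trans ?_
        simp only [Pi.sub_apply, Pi.add_apply]
        ring)
    have h4 : ‖(σ : ℂ) * b k + q k‖ ≤ |σ| * ‖b k‖ + ‖q k‖ := by
      refine (norm_add_le _ _).trans (le_of_eq ?_)
      rw [norm_mul, Complex.norm_real, Real.norm_eq_abs]
    have h5 : P.M * η * P.negLap k * ‖(σ : ℂ) * b k + q k‖ ≤
      P.M * η * P.negLap k * (|σ| * ‖b k‖ + ‖q k‖) := by gcongr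
    linarith
  -- Four contributions: the scalar error, the change of the data from 0 to η together with the
  -- stabilization, the truncation error in time, and the initial projection. The first two carry an
  -- explicit factor η and two derivatives, for which the data were bounded in H^{2j+3}; the
  -- projection term is smoothed by the symbol.
  obtain ⟨X₁, hX₁⟩ : ∃ X₁ : ℤ × ℤ → ℂ, X₁ = fun k =>
    ((P.M * η * |σ| * (P.negLap k * ‖b k‖) : ℝ) : ℂ) := ⟨_, rfl⟩
  obtain ⟨X₂, hX₂⟩ : ∃ X₂ : ℤ × ℤ → ℂ, X₂ = fun k =>
    ((P.M * η * (P.negLap k * ‖q k‖) : ℝ) : ℂ) := ⟨_, rfl⟩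
  obtain ⟨X₃, hX₃⟩ : ∃ X₃ : ℤ × ℤ → ℂ, X₃ = fun k => ((η * ‖t k‖ : ℝ) : ℂ) := ⟨_, rfl⟩
  obtain ⟨X₄, hX₄⟩ : ∃ X₄ : ℤ × ℤ → ℂ, X₄ = fun k => ((‖p k‖ / P.sym k : ℝ) : ℂ) := ⟨_, rfl⟩
  have i1 : P.sob (2 * j + 1) X₁ ≤ D * (spectralError m ρ N + x ^ 4 * Λ + x ^ 3 * V) := by
    have := sob_le_of_norm_le_negLap (P := P) (2 * j + 1) (C := P.M * η * |σ|) (c := b) (d := X₁)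
      fun k => le_of_eq (by
        have := P.negLap_nonneg k
        rw [hX₁, Complex.norm_real, Real.norm_of_nonneg (by positivity)])
    refine this.trans ?_
    rw [mul_pow, mul_pow, sq_abs, ENNReal.ofReal_mul (by positivity),
      ENNReal.ofReal_mul (by positivity), hxn]
    calc _ ≤ ENNReal.ofReal (P.M ^ 2) * x ^ 2 *
          (C₂ * (spectralError m ρ N + x ^ 2 * Λ + x ^ 2 * V)) * C₁ := by gcongr
      _ = ENNReal.ofReal (P.M ^ 2) * C₁ * C₂ *
          (x ^ 2 * spectralError m ρ N + x ^ 4 * Λ + x * (x ^ 3 * V)) := by ring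
      _ ≤ ENNReal.ofReal (P.M ^ 2) * C₁ * C₂ *
          (X ^ 2 * spectralError m ρ N + x ^ 4 * Λ + X * (x ^ 3 * V)) := by gcongr
      _ ≤ ENNReal.ofReal (P.M ^ 2) * C₁ * C₂ *
          (X ^ 2 * (spectralError m ρ N + x ^ 4 * Λ + x ^ 3 * V) +
          (spectralError m ρ N + x ^ 4 * Λ + x ^ 3 * V) +
          X * (spectralError m ρ N + x ^ 4 * Λ + x ^ 3 * V)) := by
          refine mul_le_mul_right (add_le_add (add_le_add (mul_le_mul_right ?_ _) ?_)
            (mul_le_mul_right le_add_self _)) _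
          · rw [add_assoc]; exact le_self_add
          · rw [add_right_comm]; exact le_add_self
      _ = _ := by rw [hD]; ring
  have i2 : P.sob (2 * j + 1) X₂ ≤ ENNReal.ofReal (P.M ^ 2) * C₁ *
      (spectralError m ρ N + x ^ 4 * Λ + x ^ 3 * V) := by
    have := sob_le_of_norm_le_negLap (P := P) (2 * j + 1) (C := P.M * η) (c := q) (d := X₂)
      fun k => le_of_eq (by
        have := P.negLap_nonneg k
        rw [hX₂, Complex.norm_real, Real.norm_of_nonneg (by positivity)])
    refine this.trans ?_
    rw [mul_pow, ENNReal.ofReal_mul (by positivity), hxn]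
    calc _ ≤ ENNReal.ofReal (P.M ^ 2) * x ^ 2 * (C₁ * (x ^ 2 * Λ)) := by gcongr
      _ = ENNReal.ofReal (P.M ^ 2) * C₁ * (x ^ 4 * Λ) := by ring
      _ ≤ _ := mul_le_mul_right (by rw [add_right_comm]; exact le_add_self) _
  have i3 : P.sob (2 * j + 1) X₃ ≤ 1 * (spectralError m ρ N + x ^ 4 * Λ + x ^ 3 * V) := by
    have := sob_le_mul_of_norm_le (P := P) (2 * j + 1) (C := η) X₃ t
      fun k => le_of_eq (by
        rw [hX₃, Complex.norm_real, Real.norm_of_nonneg (by positivity)])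
    refine this.trans ?_
    rw [hxn]
    calc _ ≤ x ^ 2 * (x * V) := by gcongr
      _ = x ^ 3 * V := by ring
      _ ≤ _ := by rw [one_mul]; exact le_add_self
  have i4 : P.sob (2 * j + 1) X₄ ≤ ENNReal.ofReal (P.symLow ^ 2) * C₁ *
      (spectralError m ρ N + x ^ 4 * Λ + x ^ 3 * V) := by
    have := sob_div_sym_le hP (s := 2 * j + 1) (by omega) (c := p) (d := X₄)
      fun k => le_of_eq (by
        have := sym_pos hP k
        rw [hX₄, Complex.norm_real, Real.norm_of_nonneg (by positivity)])
    refine this.trans ?_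
    calc _ ≤ ENNReal.ofReal (P.symLow ^ 2) * (C₁ * spectralError m ρ N) :=
          mul_le_mul_right ((sob_mono_exp 0 1 (by norm_num) _).trans np) _
      _ = ENNReal.ofReal (P.symLow ^ 2) * C₁ * spectralError m ρ N := by ring
      _ ≤ _ := mul_le_mul_right (by rw [add_assoc]; exact le_self_add) _
  have hle : P.sob (2 * j + 1) (lowPart N (P.coeff u' - P.coeff (φ η))) ≤
      P.sob (2 * j + 1) ((X₁ + X₂) + (X₃ + X₄)) := by
    refine sob_le_of_norm_le _ _ _ fun k => ?_
    have hκ := P.negLap_nonneg k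
    have hℓ := sym_pos hP k
    have e : ((X₁ + X₂) + (X₃ + X₄)) k = ((P.M * η * |σ| * (P.negLap k * ‖b k‖) +
        P.M * η * (P.negLap k * ‖q k‖) + (η * ‖t k‖ + ‖p k‖ / P.sym k) : ℝ) : ℂ) := by
      rw [hX₁, hX₂, hX₃, hX₄]; simp only [Pi.add_apply]; push_cast; ring
    rw [e, Complex.norm_real, Real.norm_of_nonneg (by positivity)]
    by_cases hk : k ∈ modes N
    · rw [lowPart_of_mem hk]; exact hmode k hk
    · rw [lowPart_of_notMem hk, norm_zero]; positivity
  refine hle.trans ((sob_add_le _ _ _).trans ?_)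
  obtain ⟨Q, hQ⟩ : ∃ Q, Q = spectralError m ρ N + x ^ 4 * Λ + x ^ 3 * V := ⟨_, rfl⟩
  rw [← hQ] at i1 i2 i3 i4 ⊢
  calc _ ≤ 2 * (2 * (D * Q + ENNReal.ofReal (P.M ^ 2) * C₁ * Q) +
        2 * (1 * Q + ENNReal.ofReal (P.symLow ^ 2) * C₁ * Q)) := by
        gcongr
        · exact (sob_add_le _ _ _).trans (by gcongr)
        · exact (sob_add_le _ _ _).trans (by gcongr)
    _ = _ := by ring

end FirstStep

/-! ### The error recursion -/

/-- The energy of the error. -/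
def errorEnergy (P : PFC) (N : ℕ) (e e' : ℤ × ℤ → ℂ) (s : ℝ) : ℝ :=
  P.Lx * P.Ly * (∑ k ∈ modes N, P.sym k / 2 * ‖e k‖ ^ 2) +
    P.Lx * P.Ly * (∑ k ∈ modes N, P.S * P.negLap k / 2 * ‖e k - e' k‖ ^ 2) + s ^ 2

section Recursion

variable {T : ℝ} {j : ℕ} {φ : ℝ → ℝ × ℝ → ℝ} {g v w : ℝ → ℤ × ℤ → ℂ} {B Λ : ℝ≥0∞}

theorem Regular.sum_inv_trapezoid_le (h : P.Regular T j φ g v w B Λ) (hP : P.Admissible)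
    (K : Finset (ℤ × ℤ)) {a b : ℝ} (ha : 0 ≤ a) (hab : a < b) (hb : b ≤ T) :
    ENNReal.ofReal (P.Lx * P.Ly * ∑ k ∈ K, (P.negLap k)⁻¹ *
      ‖(g a k + g b k) / 2 - (P.coeff (φ b) k - P.coeff (φ a) k) / ((b - a : ℝ) : ℂ)‖ ^ 2) ≤
    ENNReal.ofReal (4 * (b - a) ^ 3) * ∫⁻ s in Ioo a b, P.negHalfNormSq (w s) := by
  have hA := area_pos hP
  have hba : 0 < b - a := sub_pos.2 hab
  have hsub : Ioo a b ⊆ Ioo 0 T := fun t ht => ⟨ha.trans_lt ht.1, ht.2.trans_le hb⟩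
  have hκ : ∀ k, 0 ≤ P.Lx * P.Ly * (P.negLap k)⁻¹ := fun k => by
    have := P.negLap_nonneg k; positivity
  have hterm : ∀ (k : ℤ × ℤ) (z : ℂ), ENNReal.ofReal (P.Lx * P.Ly * (P.negLap k)⁻¹ * ‖z‖ ^ 2) =
      ENNReal.ofReal (P.Lx * P.Ly * (P.negLap k)⁻¹) * ‖z‖ₑ ^ 2 := fun k z => by
    rw [ENNReal.ofReal_mul (hκ k), ENNReal.ofReal_pow (norm_nonneg _), ofReal_norm]
  rw [Finset.mul_sum, ENNReal.ofReal_sum_of_nonneg fun k _ => by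
    rw [← mul_assoc]; exact mul_nonneg (hκ k) (sq_nonneg _)]
  calc _ ≤ ∑ k ∈ K, ENNReal.ofReal (4 * (b - a) ^ 3) * ∫⁻ s in Ioo a b,
        ENNReal.ofReal (P.Lx * P.Ly * (P.negLap k)⁻¹) * ‖w s k‖ₑ ^ 2 := by
        refine Finset.sum_le_sum fun k _ => ?_
        rw [← mul_assoc, hterm, lintegral_const_mul' _ _ (by finiteness), mul_left_comm]
        exact mul_le_mul_right ((h.rep k).trapezoid ha hab hb) _
    _ = ENNReal.ofReal (4 * (b - a) ^ 3) * ∫⁻ s in Ioo a b, ∑ k ∈ K,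
        ENNReal.ofReal (P.Lx * P.Ly * (P.negLap k)⁻¹) * ‖w s k‖ₑ ^ 2 := by
        rw [← Finset.mul_sum, lintegral_finsetSum' K fun k _ =>
          (((h.rep k).int_w.mono_set hsub).aestronglyMeasurable.enorm.pow_const 2).const_mul _]
    _ ≤ _ := by
        refine mul_le_mul_right (lintegral_mono fun s => ?_) _
        refine le_trans (le_of_eq (Finset.sum_congr rfl fun k _ => ?_)) (ENNReal.sum_le_tsum K)
        rw [hterm]

/-- The stabilization costs two derivatives beyond H¹. If S = 0 the term is absent; otherwise j = 1
and H^{2j+1} is H³. This is the purpose of the index j. -/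
theorem sob_one_stabilization_le (hP : P.Admissible) (hj : P.S = 0 ∨ j = 1) (N : ℕ)
    (z : ℤ × ℤ → ℂ) :
    P.sob 1 (lowPart N fun k => ((P.S * P.negLap k : ℝ) : ℂ) * z k) ≤
      ENNReal.ofReal (P.S ^ 2) * P.sob (2 * j + 1) (lowPart N z) := by
  have h1 := sob_le_of_norm_le_negLap (P := P) 1 (C := P.S) (c := lowPart N z)
    (d := lowPart N fun k => ((P.S * P.negLap k : ℝ) : ℂ) * z k) fun k => by
      by_cases hk : k ∈ modes N
      · rw [lowPart_of_mem hk, lowPart_of_mem hk, norm_mul, Complex.norm_real,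
          Real.norm_of_nonneg (mul_nonneg hP.S_nonneg (P.negLap_nonneg k)), mul_assoc]
      · rw [lowPart_of_notMem hk, lowPart_of_notMem hk]; simp
  refine h1.trans ?_
  rcases hj with h0 | h0
  · simp [h0]
  · rw [h0]

/-- One step of the error recursion. -/
theorem Regular.exists_step_bound (h : P.Regular T j φ g v w B Λ) (hP : P.Admissible)
    (hj : P.S = 0 ∨ j = 1) {m : ℕ} {ρ : ℝ≥0∞} (hρt : ρ ≠ ⊤)
    (hρ : ∀ t ∈ Icc 0 T, P.sob (m + 1) (P.coeff (φ t)) ≤ ρ) {B' : ℝ≥0∞} (hB' : B' ≠ ⊤) :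
    ∃ C : ℝ≥0∞, C ≠ ⊤ ∧ ∀ N : ℕ, 0 < N → ∀ a b : ℝ, 0 ≤ a → a < b → b ≤ T →
      ∀ (uo u μ u' : ℝ × ℝ → ℝ) (R R' : ℝ) (z eo : ℤ × ℤ → ℂ), uo ∈ P.SN N → u ∈ P.SN N →
      P.SecondOrderStep N (b - a) uo u R μ u' R' → P.sob 2 (P.coeff (extrap uo u)) ≤ B' →
      (∀ k ∈ modes N, P.coeff u' k - 2 * P.coeff u k + P.coeff uo k =
        ((P.coeff u' - P.coeff (φ b)) k - 2 * (P.coeff u - P.coeff (φ a)) k + eo k) + z k) →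
      ∃ x : ℝ, P.errorEnergy N (P.coeff u' - P.coeff (φ b)) (P.coeff u - P.coeff (φ a))
          (R' - √(P.E1 (φ b))) ≤
        P.errorEnergy N (P.coeff u - P.coeff (φ a)) eo (R - √(P.E1 (φ a))) +
        (b - a) / (4 * T) * ((R - √(P.E1 (φ a))) ^ 2 + (R' - √(P.E1 (φ b))) ^ 2) + x ∧
      ENNReal.ofReal x ≤ ENNReal.ofReal (b - a) * (C * (
        P.sob 1 (lowPart N (P.coeff (extrap uo u) -
          ((1 / 2 : ℝ) : ℂ) • (P.coeff (φ a) + P.coeff (φ b)))) +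
        P.sob (2 * j + 1) (lowPart N z) + ENNReal.ofReal ((b - a) ^ 4) * Λ +
        spectralError m ρ N +
        ENNReal.ofReal ((b - a) ^ 3) * ∫⁻ s in Ioo a b, P.negHalfNormSq (w s))) := by
  have hA := area_pos hP
  have hM := hP.M_pos
  have hT := h.pos
  obtain ⟨C₁, hC₁, h₁⟩ := h.exists_consistency_bound hP hρt hρ hB'
  obtain ⟨c₁, hc₁⟩ : ∃ c, c = ENNReal.ofReal (2 * T) * C₁ := ⟨_, rfl⟩
  obtain ⟨c₂, hc₂⟩ : ∃ c, c = ENNReal.ofReal (2 / P.M + 1) * ENNReal.ofReal 4 := ⟨_, rfl⟩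
  obtain ⟨c₃, hc₃⟩ : ∃ c, c = ENNReal.ofReal (P.M + 1) * (ENNReal.ofReal (P.Lx * P.Ly) *
    (2 * (ENNReal.ofReal (P.S ^ 2) + C₁))) := ⟨_, rfl⟩
  refine ⟨c₁ + c₂ + c₃, by rw [hc₁, hc₂, hc₃]; finiteness, ?_⟩
  intro N hN a b ha hab hb uo u μ u' R R' z eo huo hu hstep hext hz
  have hτ : 0 < b - a := sub_pos.2 hab
  have haI : a ∈ Icc 0 T := ⟨ha, hab.le.trans hb⟩
  have hbI : b ∈ Icc 0 T := ⟨ha.trans hab.le, hb⟩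
  have hue := extrap_mem_SN hP huo hu
  obtain ⟨ue, hue'⟩ : ∃ ue, ue = extrap uo u := ⟨_, rfl⟩
  obtain ⟨f1, f2, f3⟩ := hstep.modes_eq hP huo hu
  rw [← hue'] at f2 f3 hext hue ⊢
  obtain ⟨n1, n2⟩ := h₁ N hN a haI b hbI ue hue hext
  have ga := h.good a haI
  have gb := h.good b hbI
  have ge := good_of_mem_SN hP hue
  obtain ⟨pot, hpot⟩ : ∃ pot, pot = P.coeff fun x => (√(P.E1 (φ a)) + √(P.E1 (φ b))) / 2 /
    √(P.E1 ue) * P.dF (ue x) - (P.dF (φ a x) + P.dF (φ b x)) / 2 := ⟨_, rfl⟩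
  have cpot : ∀ k, pot k = (((√(P.E1 (φ a)) + √(P.E1 (φ b))) / 2 / √(P.E1 ue) : ℝ) : ℂ) *
      P.coeff (fun x => P.dF (ue x)) k - (P.coeff (fun x => P.dF (φ a x)) k +
        P.coeff (fun x => P.dF (φ b x)) k) / 2 := by
    intro k
    have e : (fun x => (√(P.E1 (φ a)) + √(P.E1 (φ b))) / 2 / √(P.E1 ue) * P.dF (ue x) -
        (P.dF (φ a x) + P.dF (φ b x)) / 2) = fun x => (√(P.E1 (φ a)) + √(P.E1 (φ b))) / 2 /
        √(P.E1 ue) * P.dF (ue x) - 1 / 2 * (P.dF (φ a x) + P.dF (φ b x)) := by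
      funext x; ring
    rw [hpot, e, coeff_sub ((ge.dF hP).const_mul _).integrable
      (((ga.dF hP).add (gb.dF hP)).const_mul _).integrable, coeff_const_mul, coeff_const_mul,
      coeff_add (ga.dF hP).integrable (gb.dF hP).integrable]
    simp only [Pi.sub_apply, Pi.smul_apply, Pi.add_apply, smul_eq_mul]
    push_cast
    ring
  obtain ⟨bb, hbb⟩ : ∃ bb : ℤ × ℤ → ℂ, bb = fun k => ((√(P.E1 ue))⁻¹ : ℝ) *
    P.coeff (fun x => P.dF (ue x)) k := ⟨_, rfl⟩
  obtain ⟨t, ht⟩ : ∃ t : ℤ × ℤ → ℂ, t = fun k => (g a k + g b k) / 2 -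
    (P.coeff (φ b) k - P.coeff (φ a) k) / ((b - a : ℝ) : ℂ) := ⟨_, rfl⟩
  obtain ⟨G, hG⟩ : ∃ G : ℤ × ℤ → ℂ, G = (fun k => ((P.S * P.negLap k : ℝ) : ℂ) * z k) + pot :=
    ⟨_, rfl⟩
  obtain ⟨t₂, ht₂⟩ : ∃ t₂, t₂ = 1 / 2 * (P.Lx * P.Ly * ∑ k ∈ modes N,
        (conj (bb k) * (P.coeff (φ b) k - P.coeff (φ a) k)).re) -
        (√(P.E1 (φ b)) - √(P.E1 (φ a))) := ⟨_, rfl⟩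
  have et₂ : t₂ = 1 / 2 * (P.Lx * P.Ly * ∑ k ∈ modes N,
        (conj (((√(P.E1 ue))⁻¹ : ℝ) * P.coeff (fun x => P.dF (ue x)) k) *
          (P.coeff (φ b) k - P.coeff (φ a) k)).re) - (√(P.E1 (φ b)) - √(P.E1 (φ a))) := by
    rw [ht₂, hbb]
  rw [← hpot] at n1
  rw [← et₂] at n2
  have ht0 : ∀ k, P.negLap k = 0 → t k = 0 := fun k hk => by
    rw [ht]
    simp only [h.g_eq_zero hk haI, h.g_eq_zero hk hbI, h.coeff_eq_of_negLap_eq_zero hk haI hbI]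
    simp
  have hτc : ((b - a : ℝ) : ℂ) ≠ 0 := by exact_mod_cast hτ.ne'
  -- The exact equations at a and b are averaged and subtracted. The defect t is the trapezoidal
  -- error, G combines the potential defect with the stabilization of z, t₂ is the defect of the
  -- scalar increment, and σ is the average of the two scalar errors.
  have key := energy_step_le hP (modes N) hτ.le
    (s := fun k => P.S * P.negLap k)
    (fun k => mul_nonneg hP.S_nonneg (P.negLap_nonneg k))
    (e := P.coeff u - P.coeff (φ a)) (e' := P.coeff u' - P.coeff (φ b)) (v := eo)
    (w := fun k => P.coeff μ k - ((P.sym k : ℂ) * ((P.coeff (φ a) k + P.coeff (φ b) k) / 2) +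
      (P.coeff (fun x => P.dF (φ a x)) k + P.coeff (fun x => P.dF (φ b x)) k) / 2))
    (b := bb) (g := G) (t := t) (r := R - √(P.E1 (φ a))) (r' := R' - √(P.E1 (φ b)))
    (σ := ((R - √(P.E1 (φ a))) + (R' - √(P.E1 (φ b)))) / 2) (t₂ := t₂) ht0
    (fun k hk => by
      have e1 : P.coeff u' k = P.coeff u k + -((P.M * (b - a) * P.negLap k : ℝ) : ℂ) *
        P.coeff μ k := by rw [← f1 k hk]; ring
      rw [ht, Pi.sub_apply, Pi.sub_apply, e1, mul_sub ((b - a : ℝ) : ℂ), mul_div_cancel₀ _ hτc,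
        h.eqn a haI k, h.eqn b hbI k]
      push_cast
      ring)
    (fun k hk => by
      rw [f2 k hk, hz k hk, hG, hbb, Pi.add_apply, cpot]
      simp only [Pi.sub_apply]
      push_cast
      ring)
    (by
      rw [half_inv_mul_sum] at f3
      have e1 : (R' - √(P.E1 (φ b))) - (R - √(P.E1 (φ a))) =
        (R' - R) - (√(P.E1 (φ b)) - √(P.E1 (φ a))) := by ring
      rw [e1, f3, ht₂, ← add_sub_assoc, ← mul_add, ← mul_add, ← Finset.sum_add_distrib]
      congr 3
      refine Finset.sum_congr rfl fun k _ => ?_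
      rw [← Complex.add_re, ← mul_add, hbb]
      congr 2
      simp only [Pi.sub_apply]
      ring)
  obtain ⟨s, hs⟩ : ∃ s, s = R - √(P.E1 (φ a)) := ⟨_, rfl⟩
  obtain ⟨s', hs'⟩ : ∃ s', s' = R' - √(P.E1 (φ b)) := ⟨_, rfl⟩
  obtain ⟨I₁, hI₁⟩ : ∃ I, I = P.Lx * P.Ly * ∑ k ∈ modes N, (P.negLap k)⁻¹ * ‖t k‖ ^ 2 := ⟨_, rfl⟩
  obtain ⟨I₂, hI₂⟩ : ∃ I, I = P.Lx * P.Ly * ∑ k ∈ modes N, P.negLap k * ‖G k‖ ^ 2 := ⟨_, rfl⟩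
  rw [← hs, ← hs', ← hI₁, ← hI₂] at key
  rw [← hs, ← hs']
  -- Young's inequality for (s + s')t₂ with weight (b - a)/(4T): the weight is at most 1/4, so the
  -- new scalar error can be absorbed later. Since t₂² is of order (b - a)², division by b - a still
  -- leaves one factor b - a.
  refine ⟨2 * T / (b - a) * t₂ ^ 2 + (b - a) * ((2 / P.M + 1) * I₁ + (P.M + 1) * I₂), ?_, ?_⟩
  · have hyoung : (s + s') * t₂ ≤ (b - a) / (4 * T) * (s ^ 2 + s' ^ 2) +
        2 * T / (b - a) * t₂ ^ 2 := by
      obtain ⟨c, hc⟩ : ∃ c, c = (b - a) / (4 * T) := ⟨_, rfl⟩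
      have hc0 : 0 < c := by rw [hc]; positivity
      have e : 2 * T / (b - a) = 1 / (2 * c) := by rw [hc]; field_simp; ring
      rw [e, ← hc, ← sub_nonneg]
      have e2 : c * (s ^ 2 + s' ^ 2) + 1 / (2 * c) * t₂ ^ 2 - (s + s') * t₂ =
          c / 2 * (s - s') ^ 2 + 1 / (2 * c) * (c * (s + s') - t₂) ^ 2 := by
        field_simp; ring
      rw [e2]; positivity
    unfold errorEnergy
    simp only [Pi.sub_apply] at key ⊢
    nlinarith
  · obtain ⟨Y, hY⟩ : ∃ Y, Y = P.sob 1 (lowPart N (P.coeff ue -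
      ((1 / 2 : ℝ) : ℂ) • (P.coeff (φ a) + P.coeff (φ b)))) := ⟨_, rfl⟩
    obtain ⟨W, hW⟩ : ∃ W, W = ∫⁻ s in Ioo a b, P.negHalfNormSq (w s) := ⟨_, rfl⟩
    obtain ⟨x, hx⟩ : ∃ x, x = ENNReal.ofReal (b - a) := ⟨_, rfl⟩
    have hxn : ∀ n : ℕ, ENNReal.ofReal ((b - a) ^ n) = x ^ n := fun n => by
      rw [hx, ENNReal.ofReal_pow hτ.le]
    rw [← hY] at n1 n2 ⊢
    rw [← hW, ← hx]
    simp only [hxn] at n1 n2 ⊢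
    obtain ⟨Q, hQ⟩ : ∃ Q, Q = Y + P.sob (2 * j + 1) (lowPart N z) + x ^ 4 * Λ +
      spectralError m ρ N + x ^ 3 * W := ⟨_, rfl⟩
    have hQ1 : Y + x ^ 4 * Λ + spectralError m ρ N ≤ Q := by
      rw [hQ]
      refine le_trans ?_ le_self_add
      gcongr
      exact le_self_add
    have hQ2 : P.sob (2 * j + 1) (lowPart N z) ≤ Q := by
      rw [hQ, add_assoc, add_assoc, add_right_comm]; exact le_add_self
    have hQ3 : x ^ 3 * W ≤ Q := by rw [hQ]; exact le_add_self
    rw [← hQ]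
    have k1 : ENNReal.ofReal (2 * T / (b - a) * t₂ ^ 2) ≤ x * (c₁ * Q) := by
      rw [ENNReal.ofReal_mul (by positivity)]
      calc _ ≤ ENNReal.ofReal (2 * T / (b - a)) * (C₁ * (x ^ 2 * Q)) := by
            refine mul_le_mul_right (n2.trans ?_) _
            gcongr
        _ = (ENNReal.ofReal (2 * T / (b - a)) * x) * (x * (C₁ * Q)) := by ring
        _ = ENNReal.ofReal (2 * T) * (x * (C₁ * Q)) := by
            congr 1
            rw [hx, ← ENNReal.ofReal_mul (by positivity), div_mul_cancel₀ _ hτ.ne']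
        _ = _ := by rw [hc₁]; ring
    have k2 : ENNReal.ofReal ((2 / P.M + 1) * I₁) ≤ c₂ * Q := by
      have := h.sum_inv_trapezoid_le hP (modes N) ha hab hb
      rw [ENNReal.ofReal_mul (p := (4 : ℝ)) (by norm_num), hxn, ← hW] at this
      rw [ENNReal.ofReal_mul (by positivity), hc₂, mul_assoc (ENNReal.ofReal (2 / P.M + 1)), hI₁, ht]
      refine mul_le_mul_right (this.trans ?_) _
      rw [mul_assoc]
      gcongr
    have k3 : ENNReal.ofReal ((P.M + 1) * I₂) ≤ c₃ * Q := by
      have e : I₂ = P.Lx * P.Ly * ∑ k ∈ modes N, P.negLap k * ‖lowPart N G k‖ ^ 2 := by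
        rw [hI₂]
        congr 1
        exact Finset.sum_congr rfl fun k hk => by rw [lowPart_of_mem hk]
      rw [ENNReal.ofReal_mul (by positivity), hc₃, mul_assoc (ENNReal.ofReal (P.M + 1)), e,
        mul_assoc (ENNReal.ofReal (P.Lx * P.Ly))]
      refine mul_le_mul_right ((ofReal_sum_negLap_le hP _ _).trans (mul_le_mul_right ?_ _)) _
      rw [hG, lowPart_add]
      refine (sob_add_le 1 _ _).trans ?_
      calc _ ≤ 2 * (ENNReal.ofReal (P.S ^ 2) * Q + C₁ * Q) := by
            gcongr
            · exact (sob_one_stabilization_le hP hj N z).trans (mul_le_mul_right hQ2 _)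
            · exact (sob_lowPart_le 1 N pot).trans (n1.trans (mul_le_mul_right hQ1 _))
        _ = _ := by ring
    refine ENNReal.ofReal_add_le.trans ?_
    rw [ENNReal.ofReal_mul (p := b - a) hτ.le, ← hx]
    calc _ ≤ x * (c₁ * Q) + x * (c₂ * Q + c₃ * Q) :=
          add_le_add k1 (mul_le_mul_right (ENNReal.ofReal_add_le.trans (add_le_add k2 k3)) _)
      _ = _ := by ring

end Recursion

/-! ### Discrete Gronwall inequality -/

/-- The majorant is monotone in n, so the delayed term a (n - 1) is bounded by the majorant at n as
well. At n = 0 truncated subtraction gives a (0 - 1) = a 0, which is 0. -/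
theorem le_of_discrete_recursion {a D : ℕ → ℝ≥0∞} {c : ℝ≥0∞} {n₀ : ℕ} (h0 : a 0 = 0)
    (h : ∀ n < n₀, a (n + 1) ≤ a n + c * (a n + a (n - 1) + D n)) :
    ∀ n ≤ n₀, a n ≤ (1 + 2 * c) ^ n * ∑ i ∈ Finset.range n, c * D i := by
  obtain ⟨S, hS⟩ : ∃ S : ℕ → ℝ≥0∞, S = fun n => (1 + 2 * c) ^ n * ∑ i ∈ Finset.range n, c * D i :=
    ⟨_, rfl⟩
  have h1 : (1 : ℝ≥0∞) ≤ 1 + 2 * c := le_self_add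
  have hmono : Monotone S := monotone_nat_of_le_succ fun n => by
    rw [hS]
    beta_reduce
    rw [Finset.sum_range_succ]
    exact mul_le_mul' (pow_le_pow_right₀ h1 n.le_succ) le_self_add
  have key : ∀ n, n ≤ n₀ → ∀ i ≤ n, a i ≤ S i := by
    intro n
    induction n with
    | zero => intro _ i hi; rw [Nat.le_zero.1 hi, h0]; exact zero_le
    | succ n ih =>
      intro hn i hi
      rcases Nat.le_succ_iff.1 hi with hi' | rfl
      · exact ih (by omega) i hi'
      have e1 := ih (by omega) n le_rfl
      have e2 := (ih (by omega) (n - 1) (by omega)).trans (hmono (Nat.sub_le n 1))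
      calc a (n + 1) ≤ a n + c * (a n + a (n - 1) + D n) := h n (by omega)
        _ ≤ S n + c * (S n + S n + D n) := by gcongr
        _ = (1 + 2 * c) * S n + 1 * (c * D n) := by ring
        _ ≤ (1 + 2 * c) * S n + (1 + 2 * c) ^ (n + 1) * (c * D n) := by
            gcongr
            exact one_le_pow_of_one_le' h1 _
        _ = S (n + 1) := by rw [hS]; beta_reduce; rw [Finset.sum_range_succ]; ring
  intro n hn
  have := key n hn n le_rfl
  rwa [hS] at this

theorem one_add_pow_le_exp {C : ℝ≥0∞} (hC : C ≠ ⊤) {τ T : ℝ} (hτ : 0 ≤ τ) {n : ℕ}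
    (hn : n * τ ≤ T) :
    (1 + 2 * (ENNReal.ofReal τ * C)) ^ n ≤ ENNReal.ofReal (Real.exp (2 * T * C.toReal)) := by
  have hc := ENNReal.toReal_nonneg (a := C)
  have e : 1 + 2 * (ENNReal.ofReal τ * C) = ENNReal.ofReal (1 + 2 * (τ * C.toReal)) := by
    rw [ENNReal.ofReal_add zero_le_one (by positivity), ENNReal.ofReal_one,
      ENNReal.ofReal_mul (p := (2 : ℝ)) zero_le_two, ENNReal.ofReal_mul (p := τ) hτ,
      ENNReal.ofReal_toReal hC, ENNReal.ofReal_ofNat]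
  rw [e, ← ENNReal.ofReal_pow (by positivity)]
  refine ENNReal.ofReal_le_ofReal ?_
  calc (1 + 2 * (τ * C.toReal)) ^ n ≤ Real.exp (2 * (τ * C.toReal)) ^ n := by
        gcongr
        rw [add_comm]; exact Real.add_one_le_exp _
    _ = Real.exp (2 * (n * τ) * C.toReal) := by rw [← Real.exp_nat_mul]; ring_nf
    _ ≤ _ := by gcongr

/-- The new scalar error is absorbed on the left. For θ ≤ 1/4 one has 1 + θ ≤ (1 - θ)(1 + 3θ) and 1
≤ 2(1 - θ). A negative x is replaced by 0, in agreement with `ENNReal.ofReal`. -/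
theorem ofReal_le_of_implicit_recursion {E E' s s' x θ : ℝ} (hθ : 0 ≤ θ) (hθ' : θ ≤ 1 / 4)
    (hs : s ^ 2 ≤ E) (hs' : s' ^ 2 ≤ E') (h : E' ≤ E + θ * (s ^ 2 + s' ^ 2) + x) :
    ENNReal.ofReal E' ≤ ENNReal.ofReal E + ENNReal.ofReal (3 * θ) * ENNReal.ofReal E +
      2 * ENNReal.ofReal x := by
  have hE : 0 ≤ E := (sq_nonneg s).trans hs
  have hx : x ≤ max x 0 := le_max_left _ _
  have hx0 : 0 ≤ max x 0 := le_max_right _ _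
  have e : ENNReal.ofReal x = ENNReal.ofReal (max x 0) := by
    rw [ENNReal.ofReal_max, ENNReal.ofReal_zero, max_eq_left (zero_le)]
  obtain ⟨X, hX⟩ : ∃ X, X = max x 0 := ⟨_, rfl⟩
  rw [← hX] at hx hx0 e
  rw [e, ← ENNReal.ofReal_mul (by positivity), ← ENNReal.ofReal_ofNat 2,
    ← ENNReal.ofReal_mul (p := OfNat.ofNat 2) zero_le_two, ← ENNReal.ofReal_add hE (by positivity),
    ← ENNReal.ofReal_add (by positivity) (by positivity)]
  refine ENNReal.ofReal_le_ofReal ?_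
  have h1 : (1 - θ) * E' ≤ (1 + θ) * E + X := by nlinarith
  have h2 : (1 + θ) * E + X ≤ (1 - θ) * (E + 3 * θ * E + 2 * X) := by
    nlinarith [mul_nonneg hθ hE, mul_nonneg (mul_nonneg hθ hE) (sub_nonneg.2 hθ'),
      mul_nonneg hx0 (sub_nonneg.2 hθ')]
  exact le_of_mul_le_mul_left (h1.trans h2) (by linarith)

/-! ### Sums of local defects -/

section Defect

variable {j : ℕ} {v w : ℝ → ℤ × ℤ → ℂ}

theorem defect_mono {a b a' b' : ℝ} (ha : a' ≤ a) (hb : b ≤ b') :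
    P.defect j v w a b ≤ P.defect j v w a' b' :=
  lintegral_mono_set (Ioo_subset_Ioo ha hb)

theorem defect_add_le {a b c : ℝ} (hab : a ≤ b) (hbc : b ≤ c) :
    P.defect j v w a b + P.defect j v w b c ≤ P.defect j v w a c := by
  have hd : Disjoint (Ioo a b) (Ioo b c) :=
    Set.disjoint_left.2 fun x hx hx' => (hx.2.trans hx'.1).false
  rw [defect, defect, defect, ← lintegral_union measurableSet_Ioo hd]
  exact lintegral_mono_set (union_subset (Ioo_subset_Ioo le_rfl hbc) (Ioo_subset_Ioo hab le_rfl))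

/-- Each window spans two time steps and consecutive windows overlap, so every time is counted at
most twice. The window for i = 0 is (0,τ), since 0 - 1 = 0 in ℕ. -/
theorem sum_defect_le {τ : ℝ} (hτ : 0 ≤ τ) (k : ℕ) :
    ∑ i ∈ Finset.range k, P.defect j v w ((i - 1 : ℕ) * τ) ((i + 1 : ℕ) * τ) ≤
      2 * P.defect j v w 0 (k * τ) := by
  have key : ∑ i ∈ Finset.range k, P.defect j v w ((i - 1 : ℕ) * τ) ((i + 1 : ℕ) * τ) ≤
      P.defect j v w 0 (k * τ) + P.defect j v w 0 ((k - 1 : ℕ) * τ) := by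
    induction k with
    | zero => simp
    | succ k ih =>
      rw [Finset.sum_range_succ, Nat.add_sub_cancel]
      refine (add_le_add_left ih _).trans ?_
      rw [add_assoc, add_comm (P.defect j v w 0 ((k + 1 : ℕ) * τ))]
      refine add_le_add le_rfl (defect_add_le (by positivity) ?_)
      gcongr
      omega
  refine key.trans ?_
  rw [two_mul]
  refine add_le_add le_rfl (defect_mono le_rfl ?_)
  gcongr
  omega

theorem Regular.sob_second_difference_le {T : ℝ} {φ : ℝ → ℝ × ℝ → ℝ} {g : ℝ → ℤ × ℤ → ℂ}
    {B Λ : ℝ≥0∞} (h : P.Regular T j φ g v w B Λ) {t δ : ℝ} (hδ : 0 ≤ δ) (h0 : 0 ≤ t - δ)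
    (hT : t + δ ≤ T) (s : ℕ) :
    P.sob s (P.coeff (φ (t + δ)) - (2 : ℂ) • P.coeff (φ t) + P.coeff (φ (t - δ))) ≤
      ENNReal.ofReal (8 * δ ^ 3) * ∫⁻ r in Ioo (t - δ) (t + δ), P.sob s (v r) := by
  have hsub : Ioo (t - δ) (t + δ) ⊆ Ioo 0 T :=
    fun r hr => ⟨h0.trans_lt hr.1, hr.2.trans_le hT⟩
  rw [lintegral_sob s (fun k => (h.rep k).cont_v) hsub, ← ENNReal.tsum_mul_left]
  refine ENNReal.tsum_le_tsum fun k => ?_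
  rw [mul_left_comm]
  refine mul_le_mul_right ?_ _
  simpa using (h.rep k).second_difference hδ h0 hT

end Defect

/-! ### Local errors along the scheme -/

theorem coeff_extrap (hP : P.Admissible) {N : ℕ} {w u : ℝ × ℝ → ℝ} (hw : w ∈ P.SN N)
    (hu : u ∈ P.SN N) :
    P.coeff (extrap w u) = (3 / 2 : ℂ) • P.coeff u - (1 / 2 : ℂ) • P.coeff w := by
  have e : extrap w u = fun p => 3 / 2 * u p - 1 / 2 * w p := by
    funext p; simp only [extrap]; ring
  rw [e, coeff_sub ((good_of_mem_SN hP hu).const_mul _).integrable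
    ((good_of_mem_SN hP hw).const_mul _).integrable, coeff_const_mul, coeff_const_mul]
  norm_num

theorem extrap_prevIterate_zero (h : ℝ × ℝ → ℝ) (φN : ℕ → ℝ × ℝ → ℝ) :
    extrap (prevIterate h φN 0) (φN 0) = h := by
  funext p
  simp only [extrap, prevIterate, Pi.sub_apply, Pi.smul_apply, smul_eq_mul]
  ring

theorem sq_le_errorEnergy (hP : P.Admissible) (N : ℕ) (e e' : ℤ × ℤ → ℂ) (s : ℝ) :
    s ^ 2 ≤ P.errorEnergy N e e' s := by
  have hA := area_pos hP
  have hS := hP.S_nonneg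
  have h1 : 0 ≤ P.Lx * P.Ly * ∑ k ∈ modes N, P.sym k / 2 * ‖e k‖ ^ 2 :=
    mul_nonneg hA.le (Finset.sum_nonneg fun k _ => by have := sym_pos hP k; positivity)
  have h2 : 0 ≤ P.Lx * P.Ly * ∑ k ∈ modes N, P.S * P.negLap k / 2 * ‖e k - e' k‖ ^ 2 :=
    mul_nonneg hA.le (Finset.sum_nonneg fun k _ => by have := P.negLap_nonneg k; positivity)
  unfold errorEnergy
  linarith

theorem sob_two_lowPart_le_errorEnergy (hP : P.Admissible) (N : ℕ) (e e' : ℤ × ℤ → ℂ) (s : ℝ) :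
    P.sob 2 (lowPart N e) ≤ ENNReal.ofReal (2 * P.symLow / (P.Lx * P.Ly)) *
      ENNReal.ofReal (P.errorEnergy N e e' s) := by
  have hA := area_pos hP
  have hS := hP.S_nonneg
  have hL := symLow_pos hP
  rw [← ENNReal.ofReal_mul (by positivity)]
  refine (sob_two_le_energy hP (modes N) _ fun k hk => lowPart_of_notMem hk _).trans
    (ENNReal.ofReal_le_ofReal (mul_le_mul_of_nonneg_left ?_ (by positivity)))
  have h1 : ∑ k ∈ modes N, P.sym k / 2 * ‖lowPart N e k‖ ^ 2 =
      ∑ k ∈ modes N, P.sym k / 2 * ‖e k‖ ^ 2 :=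
    Finset.sum_congr rfl fun k hk => by rw [lowPart_of_mem hk]
  have h2 : 0 ≤ P.Lx * P.Ly * ∑ k ∈ modes N, P.S * P.negLap k / 2 * ‖e k - e' k‖ ^ 2 :=
    mul_nonneg hA.le (Finset.sum_nonneg fun k _ => by have := P.negLap_nonneg k; positivity)
  rw [h1]
  unfold errorEnergy
  nlinarith [sq_nonneg s]

theorem sob_smul_ofReal (s : ℕ) (r : ℝ) (c : ℤ × ℤ → ℂ) :
    P.sob s ((r : ℂ) • c) = ENNReal.ofReal (r ^ 2) * P.sob s c := by
  rw [sob_smul, ← ofReal_norm, ← ENNReal.ofReal_pow (norm_nonneg _), Complex.norm_real,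
    Real.norm_eq_abs, sq_abs]

theorem sob_two_smul (s : ℕ) (c : ℤ × ℤ → ℂ) : P.sob s ((2 : ℂ) • c) = 4 * P.sob s c := by
  have h := sob_smul_ofReal (P := P) s 2 c
  rw [show (2 : ℝ) ^ 2 = 4 by norm_num, ENNReal.ofReal_ofNat] at h
  exact_mod_cast h

section Local

variable {T : ℝ} {j : ℕ} {φ : ℝ → ℝ × ℝ → ℝ} {g v w : ℝ → ℤ × ℤ → ℂ} {B Λ : ℝ≥0∞}

theorem Regular.sob_second_difference_le_defect (h : P.Regular T j φ g v w B Λ) {a b c δ : ℝ}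
    (hδ : 0 ≤ δ) (ha : 0 ≤ a) (hab : a + δ = b) (hbc : b + δ = c) (hc : c ≤ T) :
    P.sob (2 * j + 1) (P.coeff (φ c) - (2 : ℂ) • P.coeff (φ b) + P.coeff (φ a)) ≤
      8 * (ENNReal.ofReal (δ ^ 3) * P.defect j v w a c) := by
  have e : a = b - δ := by linarith
  subst hbc
  have h1 := h.sob_second_difference_le hδ (e ▸ ha) hc (2 * j + 1)
  rw [← e] at h1
  refine h1.trans ?_
  rw [ENNReal.ofReal_mul (p := (8 : ℝ)) (by norm_num), ENNReal.ofReal_ofNat, mul_assoc]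
  gcongr
  exact lintegral_sob_le_defect _ le_rfl _ _

/-- For the exact solution, extrapolation from a and b minus the average over b and c is minus half
of the second difference; the errors of the iterates enter with the weights 3/2 and 1/2. -/
theorem Regular.sob_extrap_error_le (h : P.Regular T j φ g v w B Λ) (hP : P.Admissible) {N : ℕ}
    {a b c τ : ℝ} (hτ : 0 ≤ τ) (ha : 0 ≤ a) (hab : a + τ = b) (hbc : b + τ = c) (hc : c ≤ T)
    {uo u : ℝ × ℝ → ℝ} (huo : uo ∈ P.SN N) (hu : u ∈ P.SN N) :
    P.sob 1 (lowPart N (P.coeff (extrap uo u) -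
        ((1 / 2 : ℝ) : ℂ) • (P.coeff (φ b) + P.coeff (φ c)))) ≤
      10 * (P.sob 2 (lowPart N (P.coeff u - P.coeff (φ b))) +
        P.sob 2 (lowPart N (P.coeff uo - P.coeff (φ a)))) +
      16 * (ENNReal.ofReal (τ ^ 3) * P.defect j v w a c) := by
  have e : P.coeff (extrap uo u) - ((1 / 2 : ℝ) : ℂ) • (P.coeff (φ b) + P.coeff (φ c)) =
      (((3 / 2 : ℝ) : ℂ) • (P.coeff u - P.coeff (φ b)) -
        ((1 / 2 : ℝ) : ℂ) • (P.coeff uo - P.coeff (φ a))) -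
      ((1 / 2 : ℝ) : ℂ) • (P.coeff (φ c) - (2 : ℂ) • P.coeff (φ b) + P.coeff (φ a)) := by
    rw [coeff_extrap hP huo hu]
    funext k
    simp only [Pi.sub_apply, Pi.add_apply, Pi.smul_apply, smul_eq_mul]
    push_cast
    ring
  have hd := h.sob_second_difference_le_defect hτ ha hab hbc hc
  obtain ⟨d, hd'⟩ : ∃ d, d = P.coeff (φ c) - (2 : ℂ) • P.coeff (φ b) + P.coeff (φ a) := ⟨_, rfl⟩
  obtain ⟨x, hx⟩ : ∃ x, x = P.coeff u - P.coeff (φ b) := ⟨_, rfl⟩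
  obtain ⟨y, hy⟩ : ∃ y, y = P.coeff uo - P.coeff (φ a) := ⟨_, rfl⟩
  rw [e, ← hd', ← hx, ← hy, lowPart_sub, lowPart_sub, lowPart_smul, lowPart_smul, lowPart_smul]
  rw [← hd'] at hd
  have h94 : ENNReal.ofReal ((3 / 2 : ℝ) ^ 2) ≤ 5 / 2 := by
    rw [show (5 / 2 : ℝ≥0∞) = ENNReal.ofReal (5 / 2) by
      rw [ENNReal.ofReal_div_of_pos (by norm_num)]; norm_num]
    exact ENNReal.ofReal_le_ofReal (by norm_num)
  refine (sob_sub_le 1 _ _).trans ?_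
  calc _ ≤ 2 * (2 * (5 / 2 * P.sob 2 (lowPart N x) + P.sob 2 (lowPart N y)) +
        8 * (ENNReal.ofReal (τ ^ 3) * P.defect j v w a c)) := by
        refine mul_le_mul_right (add_le_add ((sob_sub_le 1 _ _).trans
          (mul_le_mul_right (add_le_add ?_ ?_) _)) ?_) _
        · rw [sob_smul_ofReal]
          exact mul_le_mul' h94 (sob_mono_exp 1 2 one_le_two _)
        · exact (sob_half_smul_le 1 _).trans (sob_mono_exp 1 2 one_le_two _)
        · exact (sob_half_smul_le 1 _).trans ((sob_lowPart_le 1 N d).trans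
            ((sob_mono_exp 1 _ (by omega) _).trans hd))
    _ = 2 * 2 * (5 / 2) * P.sob 2 (lowPart N x) + 4 * P.sob 2 (lowPart N y) +
        16 * (ENNReal.ofReal (τ ^ 3) * P.defect j v w a c) := by ring
    _ ≤ _ := by
        rw [show (2 * 2 * (5 / 2) : ℝ≥0∞) = 10 by
          rw [mul_assoc, ENNReal.mul_div_cancel (by norm_num) (by norm_num)]; norm_num, mul_add]
        gcongr
        norm_num

/-- Local errors of the first step. -/
theorem Regular.exists_initial_local_bound (h : P.Regular T j φ g v w B Λ) (hP : P.Admissible)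
    {m : ℕ} {ρ : ℝ≥0∞} (hρ : ∀ t ∈ Icc 0 T, P.sob (m + 1) (P.coeff (φ t)) ≤ ρ) :
    ∃ C : ℝ≥0∞, C ≠ ⊤ ∧ ∀ N : ℕ, 0 < N → ∀ τ ∈ Ioc 0 T, ∀ (u h μ : ℝ × ℝ → ℝ) (R R' : ℝ),
      P.IsProj N (φ 0) u → R = √(P.E1 (φ 0)) → P.FirstOrderStep N (τ / 2) u R μ h R' →
      P.sob 1 (lowPart N (P.coeff h - ((1 / 2 : ℝ) : ℂ) • (P.coeff (φ 0) + P.coeff (φ τ)))) +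
      P.sob (2 * j + 1) (lowPart N
        ((P.coeff (φ τ) - (2 : ℂ) • P.coeff (φ (τ / 2)) + P.coeff (φ 0)) -
          (2 : ℂ) • (P.coeff h - P.coeff (φ (τ / 2))))) ≤
      C * (ENNReal.ofReal (τ ^ 3) * P.defect j v w 0 τ + ENNReal.ofReal (τ ^ 4) * Λ +
        spectralError m ρ N) := by
  obtain ⟨C₁, hC₁, h₁⟩ := h.exists_first_step_bound hP hρ
  refine ⟨32 + 10 * C₁, by finiteness, ?_⟩
  intro N hN τ hτ u ht μ R R' hproj hR hstep
  have hτ0 : 0 < τ := hτ.1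
  have hτ2 : 0 < τ / 2 := by linarith
  have b1 := h₁ N hN (τ / 2) ⟨hτ2, by linarith [hτ.2]⟩ u μ ht R R' hproj hR hstep
  have b2 := h.sob_second_difference_le_defect (a := 0) (b := τ / 2) (c := τ) hτ2.le le_rfl
    (by ring) (by ring) hτ.2
  obtain ⟨d, hd⟩ : ∃ d, d = P.coeff (φ τ) - (2 : ℂ) • P.coeff (φ (τ / 2)) + P.coeff (φ 0) :=
    ⟨_, rfl⟩
  obtain ⟨x, hx⟩ : ∃ x, x = P.coeff ht - P.coeff (φ (τ / 2)) := ⟨_, rfl⟩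
  obtain ⟨Q, hQ⟩ : ∃ Q, Q = ENNReal.ofReal (τ ^ 3) * P.defect j v w 0 τ +
    ENNReal.ofReal (τ ^ 4) * Λ + spectralError m ρ N := ⟨_, rfl⟩
  -- In the first step the extrapolated value is the half-step value itself, so its error is the
  -- error x of the first-order scheme minus half of a second difference with spacing τ/2.
  have e : P.coeff ht - ((1 / 2 : ℝ) : ℂ) • (P.coeff (φ 0) + P.coeff (φ τ)) =
      x - ((1 / 2 : ℝ) : ℂ) • d := by
    rw [hx, hd]
    funext k
    simp only [Pi.sub_apply, Pi.add_apply, Pi.smul_apply, smul_eq_mul]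
    push_cast
    ring
  rw [e, ← hd, ← hx, ← hQ]
  rw [← hd] at b2
  rw [← hx] at b1
  have hpow : ∀ n : ℕ, ENNReal.ofReal ((τ / 2) ^ n) ≤ ENNReal.ofReal (τ ^ n) := fun n =>
    ENNReal.ofReal_le_ofReal (pow_le_pow_left₀ hτ2.le (by linarith) n)
  have c2 : P.sob (2 * j + 1) (lowPart N d) ≤ 8 * Q := by
    refine (sob_lowPart_le _ N d).trans (b2.trans (mul_le_mul_right ?_ _))
    rw [hQ, add_assoc]
    exact (mul_le_mul_left (hpow 3) _).trans le_self_add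
  have c1 : P.sob (2 * j + 1) (lowPart N x) ≤ C₁ * Q := by
    refine b1.trans (mul_le_mul_right ?_ _)
    rw [hQ]
    refine le_trans ?_ (b := spectralError m ρ N + ENNReal.ofReal (τ ^ 4) * Λ +
      ENNReal.ofReal (τ ^ 3) * P.defect j v w 0 τ) (le_of_eq (by ring))
    refine add_le_add (add_le_add le_rfl (mul_le_mul_left (hpow 4) _)) (mul_le_mul' (hpow 3) ?_)
    exact (lintegral_sob_le_defect _ le_rfl 0 (τ / 2)).trans (defect_mono le_rfl (by linarith))
  rw [lowPart_sub, lowPart_sub, lowPart_smul, lowPart_smul]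
  calc _ ≤ 2 * (C₁ * Q + 8 * Q) + 2 * (8 * Q + 4 * (C₁ * Q)) := by
        refine add_le_add ((sob_sub_le 1 _ _).trans (mul_le_mul_right (add_le_add ?_ ?_) _))
          ((sob_sub_le _ _ _).trans (mul_le_mul_right (add_le_add c2 ?_) _))
        · exact (sob_mono_exp 1 _ (by omega) _).trans c1
        · exact (sob_half_smul_le 1 _).trans ((sob_mono_exp 1 _ (by omega) _).trans c2)
        · rw [sob_two_smul]; exact mul_le_mul_right c1 _
    _ = _ := by ring

end Local

/-! ### The error estimate for the discrete solution -/

section Estimate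

variable {T : ℝ} {j : ℕ} {φ : ℝ → ℝ × ℝ → ℝ} {g v w : ℝ → ℤ × ℤ → ℂ} {B Λ : ℝ≥0∞}

/-- The local truncation error over the two steps around `n * τ`. -/
def localError (P : PFC) (j m : ℕ) (v w : ℝ → ℤ × ℤ → ℂ) (Λ ρ : ℝ≥0∞) (τ : ℝ) (N n : ℕ) : ℝ≥0∞ :=
  ENNReal.ofReal (τ ^ 3) * P.defect j v w ((n - 1 : ℕ) * τ) ((n + 1 : ℕ) * τ) +
    ENNReal.ofReal (τ ^ 4) * Λ + spectralError m ρ N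

/-- The error energy of the `n`-th iterate. -/
def schemeError (P : PFC) (N : ℕ) (φ φN : ℕ → ℝ × ℝ → ℝ) (R : ℕ → ℝ) (n : ℕ) : ℝ≥0∞ :=
  ENNReal.ofReal (P.errorEnergy N (P.coeff (φN n) - P.coeff (φ n))
    (P.coeff (φN (n - 1)) - P.coeff (φ (n - 1))) (R n - √(P.E1 (φ n))))

/-- The terms with Λ add up to τ⁴ Λ kτ, which `hC` converts into a multiple of the defect on (0,kτ).
The spectral terms are simply summed over the whole time interval. -/
theorem sum_localError_le {m N k NT : ℕ} {ρ : ℝ≥0∞} {τ : ℝ} (hτ : 0 ≤ τ) (hk : k ≤ NT)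
    {C : ℝ≥0∞} (hC : Λ * ENNReal.ofReal (k * τ) ≤ C * P.defect j v w 0 (k * τ)) :
    ∑ i ∈ Finset.range k, ENNReal.ofReal τ * P.localError j m v w Λ ρ τ N i ≤
      (2 + C) * (ENNReal.ofReal (τ ^ 4) * P.defect j v w 0 (k * τ)) +
        ENNReal.ofReal (NT * τ) * spectralError m ρ N := by
  have hpow : ∀ n : ℕ, ENNReal.ofReal (τ ^ n) = ENNReal.ofReal τ ^ n := fun n =>
    ENNReal.ofReal_pow hτ n
  have hmul : ∀ n : ℕ, ENNReal.ofReal (n * τ) = n * ENNReal.ofReal τ := fun n => by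
    rw [ENNReal.ofReal_mul (Nat.cast_nonneg n), ENNReal.ofReal_natCast]
  obtain ⟨x, hx⟩ : ∃ x, x = ENNReal.ofReal τ := ⟨_, rfl⟩
  rw [hmul, ← hx] at hC
  simp only [localError, hpow, hmul, ← hx]
  rw [← Finset.mul_sum, Finset.sum_add_distrib, Finset.sum_add_distrib, ← Finset.mul_sum,
    Finset.sum_const, Finset.sum_const, Finset.card_range, nsmul_eq_mul, nsmul_eq_mul]
  calc _ ≤ x * (x ^ 3 * (2 * P.defect j v w 0 (k * τ)) + k * (x ^ 4 * Λ) +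
        NT * spectralError m ρ N) := by
        refine mul_le_mul_right (add_le_add (add_le_add
          (mul_le_mul_right (sum_defect_le hτ k) _) le_rfl) ?_) _
        gcongr
    _ = x ^ 4 * (2 * P.defect j v w 0 (k * τ)) + x ^ 4 * (Λ * (k * x)) +
        NT * x * spectralError m ρ N := by ring
    _ ≤ x ^ 4 * (2 * P.defect j v w 0 (k * τ)) + x ^ 4 * (C * P.defect j v w 0 (k * τ)) +
        NT * x * spectralError m ρ N := by
        gcongr
    _ = _ := by ring

/-- The bound for a single step is closed: the error of the extrapolation is expressed by the error
energies of the two preceding iterates and the local error, and the stability bound makes all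
constants uniform in N and τ. -/
theorem Regular.exists_recursion (h : P.Regular T j φ g v w B Λ) (hP : P.Admissible)
    (hj : P.S = 0 ∨ j = 1) {m : ℕ} {ρ : ℝ≥0∞} (hρt : ρ ≠ ⊤)
    (hρ : ∀ t ∈ Icc 0 T, P.sob (m + 1) (P.coeff (φ t)) ≤ ρ) :
    ∃ C : ℝ≥0∞, C ≠ ⊤ ∧ ∀ N NT : ℕ, 0 < N → ∀ τ : ℝ, 0 < τ → NT * τ = T →
      ∀ (φN : ℕ → ℝ × ℝ → ℝ) (R : ℕ → ℝ), P.IsDiscreteSolution N τ NT (φ 0) φN R →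
      ∀ n < NT, P.schemeError N (fun n => φ (n * τ)) φN R (n + 1) ≤
        P.schemeError N (fun n => φ (n * τ)) φN R n + ENNReal.ofReal τ * C *
          (P.schemeError N (fun n => φ (n * τ)) φN R n +
            P.schemeError N (fun n => φ (n * τ)) φN R (n - 1) +
            P.localError j m v w Λ ρ τ N n) := by
  have hT := h.pos
  have hA := area_pos hP
  have hL := symLow_pos hP
  have h0I : (0 : ℝ) ∈ Icc 0 T := ⟨le_rfl, hT.le⟩
  obtain ⟨B₀, hB₀, hstab⟩ := exists_stability_bound hP (h.good 0 h0I)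
  -- The factor 20 generously covers the squared norm of the extrapolation with weights 3/2 and 1/2
  -- of two iterates bounded by B₀.
  obtain ⟨C₁, hC₁, h₁⟩ := h.exists_step_bound hP hj hρt hρ (B' := 20 * B₀) (by finiteness)
  obtain ⟨C₂, hC₂, h₂⟩ := h.exists_initial_local_bound hP hρ
  obtain ⟨κ, hκ⟩ : ∃ κ, κ = ENNReal.ofReal (2 * P.symLow / (P.Lx * P.Ly)) := ⟨_, rfl⟩
  have hκt : κ ≠ ⊤ := by rw [hκ]; finiteness
  obtain ⟨C₃, hC₃⟩ : ∃ C, C = C₂ + 10 * κ + 24 := ⟨_, rfl⟩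
  have hC₃t : C₃ ≠ ⊤ := by rw [hC₃]; finiteness
  refine ⟨ENNReal.ofReal (3 / (4 * T)) + 2 * (C₁ * (C₃ + 1)), by finiteness, ?_⟩
  intro N NT hN τ hτ hNT φN R ⟨hproj, hR0, ht, μh, Rh, μ, hfirst, hstep⟩ n hn
  obtain ⟨st0, st⟩ := hstab N τ NT φN R ht μh Rh μ hτ.le hproj hR0 hfirst hstep
  have hmem := prevIterate_mem_SN hP hproj.1 hfirst.mem (fun n hn => (hstep n hn).mem)
  obtain ⟨a, ha⟩ : ∃ a : ℕ → ℝ≥0∞, a = P.schemeError N (fun n => φ (n * τ)) φN R := ⟨_, rfl⟩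
  obtain ⟨D, hD⟩ : ∃ D, D = P.localError j m v w Λ ρ τ N n := ⟨_, rfl⟩
  have ha2 : ∀ i, P.sob 2 (lowPart N (P.coeff (φN i) - P.coeff (φ (i * τ)))) ≤ κ * a i := fun i => by
    rw [ha, hκ]
    exact sob_two_lowPart_le_errorEnergy hP N _ _ _
  rw [← ha, ← hD]
  have htime : ∀ i : ℕ, i ≤ NT → (i : ℝ) * τ ≤ T := fun i hi => by
    rw [← hNT]; gcongr
  have hba : ((n + 1 : ℕ) : ℝ) * τ - n * τ = τ := by push_cast; ring
  have hτT : τ ≤ T := by simpa using htime 1 (by omega)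
  -- local errors
  have hlocal : P.sob 2 (P.coeff (extrap (prevIterate ht φN n) (φN n))) ≤ 20 * B₀ ∧
      ∃ z, (∀ k ∈ modes N, P.coeff (φN (n + 1)) k - 2 * P.coeff (φN n) k +
        P.coeff (prevIterate ht φN n) k =
        ((P.coeff (φN (n + 1)) - P.coeff (φ ((n + 1 : ℕ) * τ))) k -
          2 * (P.coeff (φN n) - P.coeff (φ (n * τ))) k +
          (P.coeff (φN (n - 1)) - P.coeff (φ ((n - 1 : ℕ) * τ))) k) + z k) ∧
      P.sob 1 (lowPart N (P.coeff (extrap (prevIterate ht φN n) (φN n)) -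
          ((1 / 2 : ℝ) : ℂ) • (P.coeff (φ (n * τ)) + P.coeff (φ ((n + 1 : ℕ) * τ))))) +
        P.sob (2 * j + 1) (lowPart N z) ≤ C₃ * (a n + a (n - 1) + D) := by
    -- For n = 0 the previous iterate is fictitious and the half-step value is used directly. The
    -- previous error is there, by n - 1 = 0, the error of the projection, which vanishes on the
    -- retained modes.
    rcases n with _ | n
    · rw [extrap_prevIterate_zero]
      -- From φ⁻¹ = 3φ⁰ - 2h the second difference in the stabilization is φ¹ + φ⁰ - 2h; hence the
      -- second difference of φ with spacing τ/2, corrected by twice the error of h.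
      refine ⟨st0.trans ?_, (P.coeff (φ τ) - (2 : ℂ) • P.coeff (φ (τ / 2)) + P.coeff (φ 0)) -
          (2 : ℂ) • (P.coeff ht - P.coeff (φ (τ / 2))), ?_, ?_⟩
      · calc B₀ = 1 * B₀ := (one_mul _).symm
          _ ≤ 20 * B₀ := by gcongr; norm_num
      · intro k hk
        rw [coeff_prevIterate_zero hP hproj.1 hfirst.mem]
        simp only [Nat.cast_zero, zero_mul, zero_add, Nat.cast_one, one_mul, Nat.zero_sub,
          Pi.sub_apply, Pi.add_apply, Pi.smul_apply, smul_eq_mul,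
          hproj.coeff_eq hP (h.good 0 h0I).memLp k hk]
        ring
      · have := h₂ N hN τ ⟨hτ, hτT⟩ (φN 0) ht μh (R 0) Rh hproj hR0 hfirst
        simp only [Nat.cast_zero, zero_mul, zero_add, Nat.cast_one, one_mul]
        refine this.trans (mul_le_mul' ?_ ?_)
        · rw [hC₃, add_assoc]; exact le_self_add
        · rw [hD]
          simp only [localError, Nat.zero_sub, Nat.cast_zero, zero_mul, zero_add, Nat.cast_one,
            one_mul]
          exact le_add_self
    · have t1 : ((n : ℕ) : ℝ) * τ + τ = (n + 1 : ℕ) * τ := by push_cast; ring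
      have t2 : ((n + 1 : ℕ) : ℝ) * τ + τ = (n + 1 + 1 : ℕ) * τ := by push_cast; ring
      have t0 : 0 ≤ (n : ℝ) * τ := by positivity
      have t3 := htime (n + 1 + 1) hn
      have m1 := (hmem (n + 1) hn.le).1
      have m0 := (hmem n (by omega)).1
      have ep : prevIterate ht φN (n + 1) = φN n := rfl
      have y1 := h.sob_extrap_error_le hP hτ.le t0 t1 t2 t3 m0 m1
      have z1 := h.sob_second_difference_le_defect hτ.le t0 t1 t2 t3
      rw [ep, Nat.add_sub_cancel]
      refine ⟨?_, P.coeff (φ ((n + 1 + 1 : ℕ) * τ)) - (2 : ℂ) • P.coeff (φ ((n + 1 : ℕ) * τ)) +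
        P.coeff (φ (n * τ)), ?_, ?_⟩
      · have e : P.coeff (extrap (φN n) (φN (n + 1))) = ((3 / 2 : ℝ) : ℂ) • P.coeff (φN (n + 1)) -
            ((1 / 2 : ℝ) : ℂ) • P.coeff (φN n) := by
          rw [coeff_extrap hP m0 m1]; push_cast; rfl
        rw [e]
        refine (sob_sub_le 2 _ _).trans ?_
        rw [sob_smul_ofReal]
        calc _ ≤ 2 * (9 * B₀ + B₀) := by
              refine mul_le_mul_right (add_le_add (mul_le_mul' ?_ (st _ hn.le))
                ((sob_half_smul_le 2 _).trans (st n (by omega)))) _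
              rw [show (9 : ℝ≥0∞) = ENNReal.ofReal 9 by norm_num]
              exact ENNReal.ofReal_le_ofReal (by norm_num)
          _ = _ := by ring
      · intro k _
        simp only [Pi.sub_apply, Pi.add_apply, Pi.smul_apply, smul_eq_mul]
        ring
      · obtain ⟨Q, hQ⟩ : ∃ Q, Q = ENNReal.ofReal (τ ^ 3) *
          P.defect j v w (n * τ) ((n + 1 + 1 : ℕ) * τ) := ⟨_, rfl⟩
        have hQD : Q ≤ D := by
          rw [hD, localError, Nat.add_sub_cancel, ← hQ, add_assoc]
          exact le_self_add
        rw [← hQ] at y1 z1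
        calc _ ≤ 10 * (κ * a (n + 1) + κ * a n) + 16 * D + 8 * D := by
              refine add_le_add (y1.trans (add_le_add (mul_le_mul_right
                (add_le_add (ha2 _) (ha2 _)) _) (mul_le_mul_right hQD _)))
                ((sob_lowPart_le _ N _).trans (z1.trans (mul_le_mul_right hQD _)))
          _ = 10 * κ * (a (n + 1) + a n) + 24 * D := by ring
          _ ≤ C₃ * (a (n + 1) + a n) + C₃ * D := by
              refine add_le_add (mul_le_mul_left ?_ _) (mul_le_mul_left ?_ _)
              · rw [hC₃, add_right_comm]; exact le_add_self
              · rw [hC₃]; exact le_add_self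
          _ = _ := by ring
  obtain ⟨hext, z, hz, hyz⟩ := hlocal
  obtain ⟨x, hx1, hx2⟩ := h₁ N hN (n * τ) ((n + 1 : ℕ) * τ) (by positivity)
    (by rw [← sub_pos, hba]; exact hτ) (htime _ hn) (prevIterate ht φN n) (φN n) (μ n) (φN (n + 1))
    (R n) (R (n + 1)) z (P.coeff (φN (n - 1)) - P.coeff (φ ((n - 1 : ℕ) * τ)))
    (hmem n hn.le).2 (hmem n hn.le).1 (by rw [hba]; exact hstep n hn) hext hz
  rw [hba] at hx1 hx2
  have hx3 : ENNReal.ofReal x ≤ ENNReal.ofReal τ * (C₁ * (C₃ + 1)) * (a n + a (n - 1) + D) := by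
    refine hx2.trans ?_
    rw [mul_assoc (ENNReal.ofReal τ), mul_assoc C₁]
    refine mul_le_mul_right (mul_le_mul_right ?_ _) _
    calc _ ≤ C₃ * (a n + a (n - 1) + D) + ENNReal.ofReal (τ ^ 4) * Λ + spectralError m ρ N +
          ENNReal.ofReal (τ ^ 3) *
            P.defect j v w ((n - 1 : ℕ) * τ) ((n + 1 : ℕ) * τ) := by
          refine add_le_add (add_le_add (add_le_add hyz le_rfl) le_rfl) (mul_le_mul_right ?_ _)
          refine le_trans (lintegral_mono fun s => le_self_add) (defect_mono ?_ le_rfl)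
          gcongr
          omega
      _ = C₃ * (a n + a (n - 1) + D) + D := by
          rw [hD]; unfold localError; ring
      _ ≤ C₃ * (a n + a (n - 1) + D) + (a n + a (n - 1) + D) := add_le_add le_rfl le_add_self
      _ = _ := by ring
  have hrec := ofReal_le_of_implicit_recursion (θ := τ / (4 * T)) (by positivity)
    (by rw [div_le_iff₀ (by positivity)]; linarith)
    (sq_le_errorEnergy hP N _ _ _) (sq_le_errorEnergy hP N _ _ _) hx1
  have e3 : ENNReal.ofReal (3 * (τ / (4 * T))) =
      ENNReal.ofReal τ * ENNReal.ofReal (3 / (4 * T)) := by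
    rw [← ENNReal.ofReal_mul hτ.le]; congr 1; ring
  have ea : a (n + 1) ≤ a n + ENNReal.ofReal τ * ENNReal.ofReal (3 / (4 * T)) * a n +
      2 * ENNReal.ofReal x := by
    rw [← e3, ha]; exact hrec
  calc a (n + 1) ≤ a n + ENNReal.ofReal τ * ENNReal.ofReal (3 / (4 * T)) * a n +
      2 * ENNReal.ofReal x := ea
    _ ≤ a n + ENNReal.ofReal τ * ENNReal.ofReal (3 / (4 * T)) * (a n + a (n - 1) + D) +
        2 * (ENNReal.ofReal τ * (C₁ * (C₃ + 1)) * (a n + a (n - 1) + D)) := by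
        refine add_le_add (add_le_add le_rfl (mul_le_mul_right ?_ _)) (mul_le_mul_right hx3 _)
        rw [add_assoc]; exact le_self_add
    _ = _ := by ring

/-- Gronwall's inequality is applied after Λ has been exchanged for a Lipschitz constant controlled
by the defect. Without this exchange the time integral could not be restricted to (0,kτ). -/
theorem Regular.exists_error_bound (h : P.Regular T j φ g v w B Λ) (hP : P.Admissible)
    (hj : P.S = 0 ∨ j = 1) {m : ℕ} {ρ : ℝ≥0∞} (hρt : ρ ≠ ⊤)
    (hρ : ∀ t ∈ Icc 0 T, P.sob (m + 1) (P.coeff (φ t)) ≤ ρ) :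
    ∃ C : ℝ≥0∞, C ≠ ⊤ ∧ ∀ N NT : ℕ, 0 < N → ∀ τ : ℝ, 0 < τ → NT * τ = T →
      ∀ (φN : ℕ → ℝ × ℝ → ℝ) (R : ℕ → ℝ), P.IsDiscreteSolution N τ NT (φ 0) φN R →
      ∀ k ≤ NT, P.schemeError N (fun n => φ (n * τ)) φN R k ≤
        C * (ENNReal.ofReal (τ ^ 4) * P.defect j v w 0 (k * τ) + spectralError m ρ N) := by
  obtain ⟨Λ', h', C₀, hC₀, hΛ⟩ := h.exists_lip_le_defect hP
  obtain ⟨C, hC, hrec⟩ := h'.exists_recursion hP hj hρt hρ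
  obtain ⟨G, hG⟩ : ∃ G, G = ENNReal.ofReal (Real.exp (2 * T * C.toReal)) := ⟨_, rfl⟩
  have hGt : G ≠ ⊤ := by rw [hG]; finiteness
  refine ⟨G * (C * (2 + C₀ + ENNReal.ofReal T)), by finiteness, ?_⟩
  intro N NT hN τ hτ hNT φN R hsol k hk
  have hkT : k * τ ≤ T := by rw [← hNT]; gcongr
  -- The iteration starts from the exact retained modes and the exact scalar; the stabilization part
  -- also vanishes, because the index 0 - 1 is again 0.
  have h0 : P.schemeError N (fun n => φ (n * τ)) φN R 0 = 0 := by
    have e : ∀ k ∈ modes N, P.coeff (φN 0) k - P.coeff (φ 0) k = 0 := fun k hk => by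
      rw [hsol.1.coeff_eq hP (h.good 0 ⟨le_rfl, h.pos.le⟩).memLp k hk, sub_self]
    have e1 : ∑ k ∈ modes N, P.sym k / 2 * ‖P.coeff (φN 0) k - P.coeff (φ 0) k‖ ^ 2 = 0 :=
      Finset.sum_eq_zero fun k hk => by rw [e k hk]; simp
    simp [schemeError, errorEnergy, hsol.2.1, e1]
  refine (le_of_discrete_recursion h0 (hrec N NT hN τ hτ hNT φN R hsol) k hk).trans ?_
  have hs := sum_localError_le (P := P) (m := m) (N := N) (ρ := ρ) hτ.le hk
    (hΛ (k * τ) ⟨by positivity, hkT⟩)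
  obtain ⟨X, hX⟩ : ∃ X, X = ENNReal.ofReal (τ ^ 4) * P.defect j v w 0 (k * τ) := ⟨_, rfl⟩
  rw [hNT, ← hX] at hs
  rw [← hX, mul_assoc G]
  refine mul_le_mul' (hG ▸ one_add_pow_le_exp hC hτ.le hkT) ?_
  calc _ = C * ∑ i ∈ Finset.range k, ENNReal.ofReal τ * P.localError j m v w Λ' ρ τ N i := by
        rw [Finset.mul_sum]
        exact Finset.sum_congr rfl fun i _ => by ring
    _ ≤ C * ((2 + C₀) * X + ENNReal.ofReal T * spectralError m ρ N) := mul_le_mul_right hs _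
    _ ≤ C * ((2 + C₀ + ENNReal.ofReal T) * X + (2 + C₀ + ENNReal.ofReal T) *
        spectralError m ρ N) := by
        refine mul_le_mul_right (add_le_add (mul_le_mul_left le_self_add _)
          (mul_le_mul_left le_add_self _)) _
    _ = _ := by ring

end Estimate

/-! ### Norms of the error and of the data -/

theorem exists_negHalfNormSq_le (hP : P.Admissible) : ∃ C : ℝ≥0∞, C ≠ ⊤ ∧ ∀ c : ℤ × ℤ → ℂ,
    P.negHalfNormSq c ≤ C * P.hsNormSq (-1) c := by
  obtain ⟨c₀, hc₀, -, h⟩ := exists_le_negLap hP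
  have hA := area_pos hP
  refine ⟨ENNReal.ofReal (1 + c₀⁻¹), by finiteness, fun c => ?_⟩
  rw [negHalfNormSq, hsNormSq, ← ENNReal.tsum_mul_left]
  refine ENNReal.tsum_le_tsum fun k => ?_
  rw [← ENNReal.ofReal_mul (by positivity)]
  refine ENNReal.ofReal_le_ofReal ?_
  have hn := P.negLap_nonneg k
  have key : (P.negLap k)⁻¹ ≤ (1 + c₀⁻¹) * (1 + P.negLap k) ^ (-1 : ℝ) := by
    rw [Real.rpow_neg_one]
    by_cases hk : k = 0
    · rw [hk, negLap_zero, inv_zero]; positivity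
    · have h1 := h k hk
      have h2 : 0 < P.negLap k := hc₀.trans_le h1
      rw [inv_le_iff_one_le_mul₀ h2, mul_assoc, ← div_eq_inv_mul, ← mul_div_assoc,
        le_div_iff₀ (by positivity), one_mul, add_mul, one_mul, add_comm]
      gcongr
      rw [← div_eq_inv_mul, le_div_iff₀ hc₀, one_mul]
      exact h1
  calc _ ≤ P.Lx * P.Ly * ((1 + c₀⁻¹) * (1 + P.negLap k) ^ (-1 : ℝ)) * ‖c k‖ ^ 2 := by gcongr
    _ = _ := by ring

section Data

variable {T : ℝ} {j : ℕ} {φ : ℝ → ℝ × ℝ → ℝ} {v w φtt : ℝ → ℤ × ℤ → ℂ}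

theorem defect_le_lintegral (hP : P.Admissible)
    (hv : ∀ k, ∀ᵐ t ∂volume.restrict (Ioo 0 T), φtt t k = v t k) {t : ℝ} (ht : t ≤ T)
    {f : ℝ → ℝ≥0∞} (hf : ∀ s, P.negHalfNormSq (w s) + P.hsNormSq (2 * j + 1 : ℕ) (φtt s) ≤ f s) :
    P.defect j v w 0 t ≤ (1 + (ENNReal.ofReal (P.Lx * P.Ly))⁻¹) * ∫⁻ s in Ioo 0 t, f s := by
  have hA : ENNReal.ofReal (P.Lx * P.Ly) ≠ 0 := by simpa using area_pos hP
  have hAi : (ENNReal.ofReal (P.Lx * P.Ly))⁻¹ ≠ ⊤ := ENNReal.inv_ne_top.2 hA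
  rw [defect, ← lintegral_const_mul' _ _ (by finiteness)]
  refine lintegral_mono_ae ?_
  filter_upwards [ae_mono (Measure.restrict_mono (Ioo_subset_Ioo_right ht) le_rfl)
    (ae_all_iff.2 hv)] with s hs
  have e : φtt s = v s := funext hs
  refine le_trans ?_ (mul_le_mul_right (hf s) _)
  rw [hsNormSq_natCast P hP, e, add_mul, mul_add (_ : ℝ≥0∞)⁻¹, ← mul_assoc,
    ENNReal.inv_mul_cancel hA (by finiteness), one_mul, one_mul, add_assoc]
  exact add_le_add le_rfl (le_add_self.trans le_add_self)

theorem defect_lt_top (hP : P.Admissible)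
    (hv : ∀ k, ∀ᵐ t ∂volume.restrict (Ioo 0 T), φtt t k = v t k)
    (htt : P.MemL2Hs T (2 * j + 1 : ℕ) φtt) (httt : P.MemL2Hs T (-1) w) :
    P.defect j v w 0 T < ⊤ := by
  have hA : ENNReal.ofReal (P.Lx * P.Ly) ≠ 0 := by simpa using area_pos hP
  obtain ⟨C, hC, hle⟩ := exists_negHalfNormSq_le hP
  have hmeas : AEMeasurable (fun t => P.hsNormSq (-1) (w t)) (volume.restrict (Ioo 0 T)) :=
    AEMeasurable.tsum fun k => (((httt.1 k).norm.aemeasurable.pow_const 2).const_mul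
      _).ennreal_ofReal
  have h1 := defect_le_lintegral (w := w) (j := j) hP hv le_rfl
    (f := fun s => C * P.hsNormSq (-1) (w s) + P.hsNormSq (2 * j + 1 : ℕ) (φtt s))
    fun s => add_le_add (hle _) le_rfl
  refine h1.trans_lt ?_
  rw [lintegral_add_left' (hmeas.const_mul _), lintegral_const_mul' _ _ hC]
  have h2 := httt.2.ne
  have h3 := htt.2.ne
  have hAi : (ENNReal.ofReal (P.Lx * P.Ly))⁻¹ ≠ ⊤ := ENNReal.inv_ne_top.2 hA
  finiteness

end Data

section Norms

variable {T : ℝ} {j : ℕ} {φ : ℝ → ℝ × ℝ → ℝ} {g v w : ℝ → ℤ × ℤ → ℂ} {B Λ : ℝ≥0∞}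

/-- The retained modes and the scalar are controlled by the error energy. The discarded modes of the
error are those of φ up to sign, and they are small by the spatial regularity. -/
theorem Regular.exists_norm_error_bound (h : P.Regular T j φ g v w B Λ) (hP : P.Admissible)
    (hj : P.S = 0 ∨ j = 1) {m : ℕ} {ρ : ℝ≥0∞} (hρt : ρ ≠ ⊤)
    (hρ : ∀ t ∈ Icc 0 T, P.sob (m + 1) (P.coeff (φ t)) ≤ ρ) :
    ∃ C : ℝ≥0∞, C ≠ ⊤ ∧ ∀ N NT : ℕ, 0 < N → ∀ τ : ℝ, 0 < τ → NT * τ = T →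
      ∀ (φN : ℕ → ℝ × ℝ → ℝ) (R : ℕ → ℝ), P.IsDiscreteSolution N τ NT (φ 0) φN R →
      ∀ k ≤ NT, ENNReal.ofReal ((∫ p in P.Ω, (φN k p - φ (k * τ) p) ^ 2) +
          (R k - P.sav φ (k * τ)) ^ 2) ≤
        C * (ENNReal.ofReal (τ ^ 4) * P.defect j v w 0 (k * τ) + spectralError m ρ N) := by
  obtain ⟨C₁, hC₁, h₁⟩ := h.exists_error_bound hP hj hρt hρ
  obtain ⟨C₂, hC₂, h₂⟩ := exists_sob_highPart_le hP 0 m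
  obtain ⟨A, hA⟩ : ∃ A, A = ENNReal.ofReal (P.Lx * P.Ly) := ⟨_, rfl⟩
  obtain ⟨κ, hκ⟩ : ∃ κ, κ = ENNReal.ofReal (2 * P.symLow / (P.Lx * P.Ly)) := ⟨_, rfl⟩
  have hAt : A ≠ ⊤ := by rw [hA]; finiteness
  have hκt : κ ≠ ⊤ := by rw [hκ]; finiteness
  refine ⟨A * (2 * (κ * C₁ + C₂)) + C₁, by finiteness, ?_⟩
  intro N NT hN τ hτ hNT φN R hsol k hk
  have hkT : k * τ ≤ T := by rw [← hNT]; gcongr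
  have hkI : k * τ ∈ Icc 0 T := ⟨by positivity, hkT⟩
  have hE := h₁ N NT hN τ hτ hNT φN R hsol k hk
  have hmem : φN k ∈ P.SN N := by
    obtain ⟨hproj, -, ht, μh, Rh, μ, hfirst, hstep⟩ := hsol
    exact (prevIterate_mem_SN hP hproj.1 hfirst.mem (fun n hn => (hstep n hn).mem) k hk).1
  obtain ⟨X, hX⟩ : ∃ X, X = ENNReal.ofReal (τ ^ 4) * P.defect j v w 0 (k * τ) := ⟨_, rfl⟩
  obtain ⟨e, he⟩ : ∃ e, e = P.coeff (φN k) - P.coeff (φ (k * τ)) := ⟨_, rfl⟩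
  have gN := good_of_mem_SN hP hmem
  have gφ := h.good _ hkI
  have hip : (∫ p in P.Ω, (φN k p - φ (k * τ) p) ^ 2) =
      P.ip (φN k - φ (k * τ)) (φN k - φ (k * τ)) := by
    simp only [ip, Pi.sub_apply, sq]
  have hcoeff : P.coeff (φN k - φ (k * τ)) = e := by
    rw [he]; exact coeff_sub gN.integrable gφ.integrable
  have hhigh : highPart N e = -highPart N (P.coeff (φ (k * τ))) := by
    funext i
    by_cases hi : i ∈ modes N
    · rw [Pi.neg_apply, highPart_of_mem hi, highPart_of_mem hi, neg_zero]
    · rw [Pi.neg_apply, highPart_of_notMem hi, highPart_of_notMem hi, he, Pi.sub_apply,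
        coeff_eq_zero_of_mem_SN hP hmem hi, zero_sub]
  have hlow : P.sob 0 (lowPart N e) ≤ κ * (C₁ * (X + spectralError m ρ N)) := by
    rw [he]
    refine (sob_mono_exp 0 2 zero_le_two _).trans
      ((sob_two_lowPart_le_errorEnergy hP N _ (P.coeff (φN (k - 1)) -
        P.coeff (φ ((k - 1 : ℕ) * τ))) (R k - √(P.E1 (φ (k * τ))))).trans ?_)
    rw [← hκ, hX]
    exact mul_le_mul_right hE _
  have hhigh' : P.sob 0 (highPart N e) ≤ C₂ * spectralError m ρ N := by
    rw [hhigh, sob_neg]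
    refine (h₂ N _ hN).trans (mul_le_mul_right (mul_le_mul_right ?_ _) _)
    exact (sob_mono_exp _ _ (by omega) _).trans (hρ _ hkI)
  have hs : ENNReal.ofReal ((R k - P.sav φ (k * τ)) ^ 2) ≤ C₁ * (X + spectralError m ρ N) := by
    refine le_trans (ENNReal.ofReal_le_ofReal (sq_le_errorEnergy hP N _ _ _)) (hX ▸ hE)
  refine ENNReal.ofReal_add_le.trans ?_
  rw [hip, ofReal_ip_self hP (gN.memLp.sub gφ.memLp), hcoeff, ← hA, ← hX, add_mul]
  refine add_le_add ?_ hs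
  rw [mul_assoc A]
  refine mul_le_mul_right ?_ _
  calc P.sob 0 e = P.sob 0 (lowPart N e + highPart N e) := by rw [lowPart_add_highPart]
    _ ≤ 2 * (κ * (C₁ * (X + spectralError m ρ N)) + C₂ * spectralError m ρ N) :=
        (sob_add_le 0 _ _).trans (mul_le_mul_right (add_le_add hlow hhigh') _)
    _ ≤ 2 * (κ * (C₁ * (X + spectralError m ρ N)) + C₂ * (X + spectralError m ρ N)) := by
        gcongr
        exact le_add_self
    _ = _ := by ring

end Norms

theorem sqrt_add_abs_le {x y K p q : ℝ} (hx : 0 ≤ x) (hp : 0 ≤ p) (hq : 0 ≤ q) (hK : 0 ≤ K)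
    (h : x + y ^ 2 ≤ K * (p ^ 2 + q ^ 2)) : √x + |y| ≤ √(2 * K) * (p + q) := by
  refine abs_le_of_sq_le_sq' ?_ (by positivity) |>.2
  have h1 := Real.sq_sqrt hx
  have h2 := sq_abs y
  rw [mul_pow, Real.sq_sqrt (by positivity)]
  nlinarith [sq_nonneg (√x - |y|), mul_nonneg hK (mul_nonneg hp hq)]

end PFC

end

/-! ### The two forms of the error estimate. -/

theorem theorem5p1 (P : PFC) (hP : P.Admissible) (T : ℝ) (hT : 0 < T) (m : ℕ)
    (φ : ℝ → ℝ × ℝ → ℝ) (hφ : P.IsExactSolution T φ)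
    (hφ3 : P.MemLinftyHs T 3 (fun t => P.coeff (φ t)))
    (hφm : P.MemLinftyHs T ((m : ℝ) + 1) (fun t => P.coeff (φ t)))
    (r₃ : ℝ → ℝ) (hr : PFC.IsH3WithThirdDeriv T (P.sav φ) r₃)
    (φtt φttt : ℝ → ℤ × ℤ → ℂ)
    (htt : PFC.IsWeakTimeDeriv 2 T (fun t => P.coeff (φ t)) φtt)
    (htt1 : P.MemL2Hs T 1 φtt)
    (httt : PFC.IsWeakTimeDeriv 3 T (fun t => P.coeff (φ t)) φttt)
    (httt1 : P.MemL2Hs T (-1) φttt)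
    (htt3 : 0 < P.S → P.MemL2Hs T 3 φtt) :
    ∃ C : ℝ, 0 < C ∧ ∀ N NT : ℕ, 0 < N → 0 < NT →
      ∀ (φN : ℕ → ℝ × ℝ → ℝ) (R : ℕ → ℝ),
        P.IsDiscreteSolution N (T / NT) NT (φ 0) φN R →
        ∀ k ≤ NT,
          ENNReal.ofReal ((∫ p in P.Ω, (φN k p - φ (k * (T / NT)) p) ^ 2)
              + (R k - P.sav φ (k * (T / NT))) ^ 2)
            ≤ ENNReal.ofReal (C * (T / NT) ^ 4) *
                (∫⁻ s in Ioo 0 (k * (T / NT)),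
                  (P.negHalfNormSq (φttt s) + P.hsNormSq 1 (φtt s)
                    + (if 0 < P.S then P.hsNormSq 3 (φtt s) else 0)
                    + ENNReal.ofReal (r₃ s ^ 2)))
              + ENNReal.ofReal C * P.linftyHsNormSq T ((m : ℝ) + 1) (fun t => P.coeff (φ t))
                * ENNReal.ofReal (((N : ℝ) ^ (2 * m))⁻¹)
          ∧ √(∫ p in P.Ω, (φN k p - φ (k * (T / NT)) p) ^ 2)
              + |R k - P.sav φ (k * (T / NT))|
            ≤ C * ((T / NT) ^ 2 + ((N : ℝ) ^ m)⁻¹) := by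
  have hA : ENNReal.ofReal (P.Lx * P.Ly) ≠ 0 := by simpa using PFC.area_pos hP
  obtain ⟨A, hAe⟩ : ∃ A, A = ENNReal.ofReal (P.Lx * P.Ly) := ⟨_, rfl⟩
  rw [← hAe] at hA
  have hAt : A ≠ ⊤ := by rw [hAe]; finiteness
  have hAi : A⁻¹ ≠ ⊤ := ENNReal.inv_ne_top.2 hA
  obtain ⟨I, hI⟩ : ∃ I : ℝ → ℝ≥0∞, I = fun s => P.negHalfNormSq (φttt s) + P.hsNormSq 1 (φtt s)
      + (if 0 < P.S then P.hsNormSq 3 (φtt s) else 0) + ENNReal.ofReal (r₃ s ^ 2) := ⟨_, rfl⟩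
  -- The two cases of the theorem: without stabilization φ_tt is measured in H¹ (j = 0), with
  -- stabilization in H³ (j = 1).
  obtain ⟨j, hj1, hjS, hs, hjI⟩ : ∃ j ≤ 1, (P.S = 0 ∨ j = 1) ∧
      P.MemL2Hs T (2 * j + 1 : ℕ) φtt ∧
      ∀ s, P.negHalfNormSq (φttt s) + P.hsNormSq (2 * j + 1 : ℕ) (φtt s) ≤ I s := by
    rcases hP.S_nonneg.eq_or_lt with h0 | hpos
    · have e1 : ((2 * 0 + 1 : ℕ) : ℝ) = 1 := by norm_num
      refine ⟨0, zero_le_one, Or.inl h0.symm, by rw [e1]; exact htt1, fun s => ?_⟩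
      rw [hI, e1]
      exact le_self_add.trans le_self_add
    · have e3 : ((2 * 1 + 1 : ℕ) : ℝ) = 3 := by norm_num
      refine ⟨1, le_rfl, Or.inr rfl, by rw [e3]; exact htt3 hpos, fun s => ?_⟩
      rw [hI, e3]
      simp only [if_pos hpos]
      exact (add_le_add le_self_add le_rfl).trans le_self_add
  obtain ⟨g, v, B, Λ, h, hv⟩ := PFC.exists_regular hP hT hj1 hφ (by exact_mod_cast hφ3) htt hs
    httt httt1
  obtain ⟨L, hL⟩ : ∃ L, L = P.linftyHsNormSq T ((m : ℝ) + 1) (fun t => P.coeff (φ t)) := ⟨_, rfl⟩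
  have hLt : L ≠ ⊤ := by rw [hL]; exact hφm.2.ne
  have hρ : ∀ t ∈ Icc 0 T, P.sob (m + 1) (P.coeff (φ t)) ≤ A⁻¹ * L := fun t ht => by
    have h1 := PFC.hsNormSq_le_linfty hT hP hφ.continuousOn hφm.2 t ht
    have h2 := PFC.hsNormSq_natCast P hP (m + 1) (P.coeff (φ t))
    push_cast at h2
    rw [h2, ← hAe, ← hL] at h1
    calc _ = A⁻¹ * (A * P.sob (m + 1) (P.coeff (φ t))) := by
          rw [← mul_assoc, ENNReal.inv_mul_cancel hA hAt, one_mul]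
      _ ≤ _ := mul_le_mul_right h1 _
  obtain ⟨C₁, hC₁, hmain⟩ := h.exists_norm_error_bound hP hjS (by finiteness) hρ
  have hdef : P.defect j v φttt 0 T ≠ ⊤ := (PFC.defect_lt_top hP hv hs httt1).ne
  obtain ⟨D, hD⟩ : ∃ D, D = P.defect j v φttt 0 T := ⟨_, rfl⟩
  rw [← hD] at hdef
  obtain ⟨K₁, hK₁⟩ : ∃ K, K = (C₁ * (1 + A⁻¹)).toReal := ⟨_, rfl⟩
  -- K₁ serves the estimate that keeps the integral over (0,t^k). K₂ contains the finite total
  -- defect on (0,T) and the spatial norm, and gives the plain rate.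
  obtain ⟨K₂, hK₂⟩ : ∃ K, K = (C₁ * (D + A⁻¹ * L)).toReal := ⟨_, rfl⟩
  have hK₁0 : 0 ≤ K₁ := by rw [hK₁]; exact ENNReal.toReal_nonneg
  have hK₂0 : 0 ≤ K₂ := by rw [hK₂]; exact ENNReal.toReal_nonneg
  have hK₁e : C₁ * (1 + A⁻¹) = ENNReal.ofReal K₁ := by
    rw [hK₁, ENNReal.ofReal_toReal (by finiteness)]
  have hK₂e : C₁ * (D + A⁻¹ * L) = ENNReal.ofReal K₂ := by
    rw [hK₂, ENNReal.ofReal_toReal (by finiteness)]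
  refine ⟨K₁ + √(2 * K₂) + 1, by positivity, ?_⟩
  intro N NT hN hNT φN R hsol k hk
  have hNT' : (0 : ℝ) < NT := by exact_mod_cast hNT
  obtain ⟨τ, hτe⟩ : ∃ τ, τ = T / NT := ⟨_, rfl⟩
  rw [← hτe] at hsol ⊢
  have hτ : 0 < τ := by rw [hτe]; positivity
  have hτT : NT * τ = T := by rw [hτe]; field_simp
  have hkT : k * τ ≤ T := by rw [← hτT]; gcongr
  have hest := hmain N NT hN τ hτ hτT φN R hsol k hk
  rw [PFC.spectralError] at hest
  have hN0 : (0 : ℝ) ≤ ((N : ℝ) ^ (2 * m))⁻¹ := by positivity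
  refine ⟨hest.trans ?_, ?_⟩
  · have h1 := PFC.defect_le_lintegral hP hv hkT hjI
    rw [← hAe] at h1
    have hK : ENNReal.ofReal K₁ ≤ ENNReal.ofReal (K₁ + √(2 * K₂) + 1) :=
      ENNReal.ofReal_le_ofReal (by linarith [Real.sqrt_nonneg (2 * K₂)])
    rw [← hL, ENNReal.ofReal_mul (by positivity), ← hI]
    calc _ ≤ C₁ * (ENNReal.ofReal (τ ^ 4) * ((1 + A⁻¹) * ∫⁻ s in Ioo 0 (k * τ), I s) +
          ENNReal.ofReal ((N : ℝ) ^ (2 * m))⁻¹ * ((1 + A⁻¹) * L)) := by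
          refine mul_le_mul_right (add_le_add (mul_le_mul_right h1 _)
            (mul_le_mul_right (mul_le_mul_left le_add_self _) _)) _
      _ = C₁ * (1 + A⁻¹) * ENNReal.ofReal (τ ^ 4) * (∫⁻ s in Ioo 0 (k * τ), I s) +
          C₁ * (1 + A⁻¹) * L * ENNReal.ofReal ((N : ℝ) ^ (2 * m))⁻¹ := by ring
      _ ≤ _ := by
          rw [hK₁e]
          gcongr
  · have h1 : C₁ * (ENNReal.ofReal (τ ^ 4) * P.defect j v φttt 0 (k * τ) +
        ENNReal.ofReal ((N : ℝ) ^ (2 * m))⁻¹ * (A⁻¹ * L)) ≤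
        ENNReal.ofReal (K₂ * ((τ ^ 2) ^ 2 + (((N : ℝ) ^ m)⁻¹) ^ 2)) := by
      have e : (τ ^ 2) ^ 2 + (((N : ℝ) ^ m)⁻¹) ^ 2 = τ ^ 4 + ((N : ℝ) ^ (2 * m))⁻¹ := by
        rw [inv_pow, ← pow_mul, ← pow_mul, mul_comm m]
      rw [e, ENNReal.ofReal_mul hK₂0, ENNReal.ofReal_add (by positivity) hN0, ← hK₂e, mul_assoc C₁]
      refine mul_le_mul_right ?_ _
      rw [mul_add (D + A⁻¹ * L), mul_comm (D + A⁻¹ * L), mul_comm (D + A⁻¹ * L)]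
      exact add_le_add (mul_le_mul_right ((PFC.defect_mono le_rfl hkT).trans (hD ▸ le_self_add)) _)
        (mul_le_mul_right le_add_self _)
    have h2 := (ENNReal.ofReal_le_ofReal_iff (by positivity)).1 (hest.trans h1)
    have h3 : 0 ≤ ∫ p in P.Ω, (φN k p - φ (k * τ) p) ^ 2 :=
      integral_nonneg fun p => sq_nonneg _
    refine (PFC.sqrt_add_abs_le h3 (sq_nonneg τ) (by positivity) hK₂0 h2).trans ?_
    gcongr
    linarith
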